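/- **Setting.** Let $q\ge 3$ be a fixed real number, $\sigma(z)=(\max\{0,z\})^q$, and $v=(1,0,\dots,0)\in\mathbb R^d$. *Data.* A data point $(x,y)\sim\mathcal D$ has a label $y\in\{-1,1\}$ and an input $x=(x_1,x_2)\in\mathbb R^d\times\mathbb R^d$; one of the two patches is the feature patch $y\,v$ and the other is the noise patch $\xi=g\odot b-\alpha y v$. Here $g\sim N(0,\sigma_p^2 I_d)$, and $b\in\{0,1\}^d$ is the indicator of a uniformly random set of $s$ coordinates other than the first. The pair (label, position of the feature patch), $b$ and $g$ are independent; the joint law of label and position is arbitrary, except that both labels have probability at least a constant $p_0>0$. *Model and objective.* For weights $W=(w_{j,r})_{j\in\{\pm1\},\,r\le m}$, $w_{j,r}\in\mathbb R^d$, let $F_j(W,x)=\sum_{r=1}^m[\sigma(\langle w_{j,r},x_1\rangle)+\sigma(\langle w_{j,r},x_2\rangle)]$. Given $n$ i.i.d. data points $(x_i,y_i)\sim\mathcal D$, let $$L(W)=-\frac1n\sum_{i=1}^n\log\frac{e^{F_{y_i}(W,x_i)}}{\sum_{j\in\{-1,1\}}e^{F_j(W,x_i)}}+\frac\lambda2\|W\|_F^2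 .$$ *Algorithms.* The entries of $W^{(0)}$ are i.i.d. $N(0,\sigma_0^2)$, independent of the data. Gradient descent is $W^{(t+1)}=W^{(t)}-\eta\nabla L(W^{(t)})$. Adam, started from $W^{(0)}$ with zero averages, is (entrywise) $\mathbf m^{(t)}=\beta_1\mathbf m^{(t-1)}+(1-\beta_1)\nabla L(W^{(t)})$, $\mathbf v^{(t)}=\beta_2\mathbf v^{(t-1)}+(1-\beta_2)[\nabla L(W^{(t)})]^2$, $W^{(t+1)}=W^{(t)}-\eta\,\mathbf m^{(t)}/\sqrt{\mathbf v^{(t)}}$, where $\mathbf m^{(-1)}=\mathbf v^{(-1)}=0$, $0/0=0$, and $\beta_1\in[0,1)$, $\beta_2\in(\beta_1^2,1)$ are constants. *Parameters.* $d=\mathrm{poly}(n)$, $m=\mathrm{polylog}(n)$, $s=\Theta(d^{1/2}/n^2)$, $\sigma_p^2=\Theta\big(\frac1{s\,\mathrm{polylog}(n)}\big)$, $\alpha=\Theta(\sigma_p\,\mathrm{polylog}(n))$ with $\alpha<1$, $\sigma_0=\Theta(d^{-1/4})$, and $\lambda\in(0,\lambda_0)$ with $\lambda_0=\Theta\big(\frac1{d^{(q-1)/4}\,n\,\mathrm{polylog}(n)}\big)$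 and $\lambda\ge 1/\mathrm{poly}(n)$. The polynomials (respectively polylogarithms) in these formulas lie between $n^{\kappa}$ and $n^{K}$ (respectively $(\log n)^{\kappa}$ and $(\log n)^{K}$), where $\kappa$ is a sufficiently large constant depending only on $q$ and $K$ is an arbitrary constant; the bound $\lambda\ge 1/\mathrm{poly}(n)$ means $\lambda\ge n^{-K}$. The constants in $\Theta(\cdot)$ are arbitrary. The step size and the number $T$ of iterations satisfy $\eta=1/\mathrm{poly}(n)$ and $T=\mathrm{poly}(n)/\eta$: $n^{a_0}\le T\eta\le n^{A}$ and $n^{b_0}\le 1/\eta\le n^{B}$, where $a_0$ is sufficiently large given $q$ and all the constants above, $A$ is arbitrary, $b_0$ is sufficiently large given in addition $A$, and $B$ is arbitrary. **Theorem (nonconvex setting).** The following holds for all sufficiently large $n$; the $o(1)$ terms tend to $0$ as $n\to\infty$, uniformly over the parameters above with the constants fixed. 1. Run Adam for $T$ iterations, and let $W^*_{\rm Adam}$ be an iterate among $W^{(1)},\dots,W^{(T)}$ with the smallest $\|\nabla L(W^{(t)})\|_1$ (entrywise $\ell_1$ norm). With probability at least $1-n^{-1}$ over the training data and the initialization, $\|\nabla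 L(W^*_{\rm Adam})\|_1\le\frac1{T\eta}$, the training error $\frac1n\sum_{i=1}^n\mathbf 1[F_{y_i}(W^*_{\rm Adam},x_i)\le F_{-y_i}(W^*_{\rm Adam},x_i)]$ is $0$, and the test error satisfies $\mathbb P_{(x,y)\sim\mathcal D}[F_y(W^*_{\rm Adam},x)\le F_{-y}(W^*_{\rm Adam},x)]\ge\frac12-o(1)$. 2. Run gradient descent from the same initialization for $T$ iterations, and let $W^*_{\rm GD}$ be an iterate among $W^{(1)},\dots,W^{(T)}$ with the smallest $\|\nabla L(W^{(t)})\|_F$. With probability at least $1-n^{-1}$, $\|\nabla L(W^*_{\rm GD})\|_F^2\le\frac1{T\eta}$, the training error of $W^*_{\rm GD}$ is $0$, and its test error is $o(1)$. -/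

import Mathlib

open MeasureTheory ProbabilityTheory

noncomputable section

namespace AdamGD

/-- Labels and output indices are the elements of `{-1, 1}`, realised as `ℤˣ`;
this is the corresponding real number. -/
def sgn (y : ℤˣ) : ℝ := ((y : ℤ) : ℝ)

/-! ### The data distribution -/

/-- The input of a data point: two patches in `ℝ^d`. -/
abbrev Patches (d : ℕ) : Type := Fin 2 → Fin d → ℝ

/-- A labelled data point. -/
abbrev DataPoint (d : ℕ) : Type := Patches d × ℤˣ

/-- The feature vector `v = (1, 0, …, 0)`. -/
def feature (d : ℕ) : Fin d → ℝ := fun k => if (k : ℕ) = 0 then 1 else 0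

/-- The masks in `{0,1}^d` that select exactly `s` coordinates, none of them the first. -/
def masks (d s : ℕ) : Set (Fin d → Bool) :=
  {b | (∀ k : Fin d, (k : ℕ) = 0 → b k = false) ∧
    (Finset.univ.filter fun k => b k = true).card = s}

/-- The noise vector `g ⊙ b - α y v`. -/
def noiseVec (d : ℕ) (α : ℝ) (y : ℤˣ) (b : Fin d → Bool) (g : Fin d → ℝ) : Fin d → ℝ :=
  fun k => (if b k = true then g k else 0) - α * sgn y * feature d k

/-- The data point with label `ω.1.1`, feature patch in position `ω.1.2`, mask `ω.2.1` and
Gaussian vector `ω.2.2`. -/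
def mkData (d : ℕ) (α : ℝ) (ω : (ℤˣ × Fin 2) × ((Fin d → Bool) × (Fin d → ℝ))) : DataPoint d :=
  (fun p => if p = ω.1.2 then fun k => sgn ω.1.1 * feature d k
    else noiseVec d α ω.1.1 ω.2.1 ω.2.2, ω.1.1)

/-- The centred Gaussian law with covariance `σ² I`. -/
def gaussianVec (ι : Type) [Fintype ι] (σ : ℝ) : Measure (ι → ℝ) :=
  Measure.pi fun _ => gaussianReal 0 (Real.toNNReal (σ ^ 2))

/-- The data distribution. `ρ` is the joint law of the label and of the position of the feature
patch; the mask is uniform and the Gaussian vector has law `N(0, σp² I)`; the three are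
independent. -/
def dataLaw (d s : ℕ) (σp α : ℝ) (ρ : Measure (ℤˣ × Fin 2)) : Measure (DataPoint d) :=
  (ρ.prod ((uniformOn (masks d s)).prod (gaussianVec (Fin d) σp))).map (mkData d α)

/-! ### The network and the training objective -/

/-- The index set of the weights: `(j, r, k)` is the `k`-th entry of `w_{j,r}`. -/
abbrev Idx (m d : ℕ) : Type := ℤˣ × Fin m × Fin d

/-- The collection of all weights; its norm is the Frobenius norm. -/
abbrev Weights (m d : ℕ) : Type := EuclideanSpace ℝ (Idx m d)

/-- The activation function `max(0, z)^q`. -/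
def act (q z : ℝ) : ℝ := (max 0 z) ^ q

/-- The `j`-th output of the two-layer CNN. -/
def output (q : ℝ) {m d : ℕ} (W : Weights m d) (j : ℤˣ) (x : Patches d) : ℝ :=
  ∑ r : Fin m, ∑ p : Fin 2, act q (∑ k : Fin d, W (j, r, k) * x p k)

/-- The cross-entropy loss at one data point. -/
def sampleLoss (q : ℝ) {m d : ℕ} (z : DataPoint d) (W : Weights m d) : ℝ :=
  -Real.log (Real.exp (output q W z.2 z.1) / ∑ j : ℤˣ, Real.exp (output q W j z.1))

/-- The empirical loss with weight decay. -/
def loss (q lam : ℝ) {n m d : ℕ} (S : Fin n → DataPoint d) (W : Weights m d) : ℝ :=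
  (1 / (n : ℝ)) * ∑ i, sampleLoss q (S i) W + lam / 2 * ‖W‖ ^ 2

/-- The entrywise `ℓ¹` norm. -/
def norm1 {m d : ℕ} (G : Weights m d) : ℝ := ∑ k, |G k|

/-- The fraction of misclassified training points. -/
def trainError (q : ℝ) {n m d : ℕ} (S : Fin n → DataPoint d) (W : Weights m d) : ℝ :=
  (1 / (n : ℝ)) * ∑ i, if output q W (S i).2 (S i).1 ≤ output q W (-(S i).2) (S i).1 then 1 else 0

/-- The misclassification probability on a fresh data point with law `D`. -/
def testError (q : ℝ) {m d : ℕ} (D : Measure (DataPoint d)) (W : Weights m d) : ℝ :=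
  D.real {z | output q W z.2 z.1 ≤ output q W (-z.2) z.1}

/-! ### The training algorithms (full batch) -/

/-- The iterates of gradient descent on `L` with step size `η`. -/
def gdIter {m d : ℕ} (L : Weights m d → ℝ) (η : ℝ) (W₀ : Weights m d) : ℕ → Weights m d
  | 0 => W₀
  | t + 1 => gdIter L η W₀ t - η • gradient L (gdIter L η W₀ t)

/-- The state of Adam: weights, first-moment and second-moment averages. -/
structure AdamState (m d : ℕ) where
  W : Weights m d
  mom : Weights m d
  sq : Weights m d

/-- One step of Adam on `L`: both averages are updated with the gradient at the current weights,
and then the weights move by `-η mom / √sq`, entrywise. -/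
def adamStep {m d : ℕ} (L : Weights m d → ℝ) (β₁ β₂ η : ℝ) (st : AdamState m d) :
    AdamState m d :=
  let g : Weights m d := gradient L st.W
  let mom : Weights m d := β₁ • st.mom + (1 - β₁) • g
  let sq : Weights m d := WithLp.toLp 2 fun k => β₂ * st.sq k + (1 - β₂) * g k ^ 2
  ⟨WithLp.toLp 2 fun k => st.W k - η * (mom k / √(sq k)), mom, sq⟩

/-- The states of Adam, started with both averages equal to zero. -/
def adamState {m d : ℕ} (L : Weights m d → ℝ) (β₁ β₂ η : ℝ) (W₀ : Weights m d) :
    ℕ → AdamState m d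
  | 0 => ⟨W₀, 0, 0⟩
  | t + 1 => adamStep L β₁ β₂ η (adamState L β₁ β₂ η W₀ t)

/-- The iterates of Adam on `L`. -/
def adamIter {m d : ℕ} (L : Weights m d → ℝ) (β₁ β₂ η : ℝ) (W₀ : Weights m d) (t : ℕ) :
    Weights m d :=
  (adamState L β₁ β₂ η W₀ t).W

/-- `t ∈ {1, …, T}` minimises `f` over `{1, …, T}`. -/
def IsBestIter (T : ℕ) (f : ℕ → ℝ) (t : ℕ) : Prop :=
  t ∈ Finset.Icc 1 T ∧ ∀ t' ∈ Finset.Icc 1 T, f t ≤ f t'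

/-! ### The parameter regime -/

/-- The problem parameters other than the sample size and the activation exponent:
dimension, noise sparsity, width, noise level, feature-noise strength, initialisation scale,
weight decay, joint law of label and feature position. -/
structure Params where
  d : ℕ
  s : ℕ
  m : ℕ
  σp : ℝ
  α : ℝ
  σ₀ : ℝ
  lam : ℝ
  ρ : Measure (ℤˣ × Fin 2)

/-- `x = Θ(y)` with constant `c`. -/
def Theta (c x y : ℝ) : Prop := y / c ≤ x ∧ x ≤ c * y

/-- `x = polylog(n)`, with degree between `κ` and `K`. -/
def IsPolylog (κ K n : ℕ) (x : ℝ) : Prop := Real.log n ^ κ ≤ x ∧ x ≤ Real.log n ^ K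

/-- `x = poly(n)`, with degree between `κ` and `K`. -/
def IsPoly (κ K n : ℕ) (x : ℝ) : Prop := (n : ℝ) ^ κ ≤ x ∧ x ≤ (n : ℝ) ^ K

/-- The parameter regime at sample size `n`. The degrees of all the polynomials and polylogarithms
are at least `κ` and at most `K`, the constants in `Θ(·)` are at most `c`, and both labels have
probability at least `p₀`. -/
structure Params.Admissible (P : Params) (q : ℝ) (κ K : ℕ) (c p₀ : ℝ) (n : ℕ) : Prop where
  prob : IsProbabilityMeasure P.ρ
  labels : ∀ y : ℤˣ, p₀ ≤ P.ρ.real {z | z.1 = y}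
  dim : IsPoly κ K n P.d
  width : IsPolylog κ K n P.m
  sparsity : Theta c P.s (√(P.d : ℝ) / (n : ℝ) ^ 2)
  noise_pos : 0 < P.σp
  noise : ∃ l, IsPolylog κ K n l ∧ Theta c (P.σp ^ 2) (1 / (P.s * l))
  strength_lt : P.α < 1
  strength : ∃ l, IsPolylog κ K n l ∧ Theta c P.α (P.σp * l)
  init : Theta c P.σ₀ ((P.d : ℝ) ^ (-(1 / 4) : ℝ))
  decay_lt : ∃ lam₀ l, IsPolylog κ K n l ∧
    Theta c lam₀ (1 / ((P.d : ℝ) ^ ((q - 1) / 4) * n * l)) ∧ P.lam < lam₀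
  decay_ge : 1 / (n : ℝ) ^ K ≤ P.lam

namespace Params

/-- The data distribution. -/
def law (P : Params) : Measure (DataPoint P.d) := dataLaw P.d P.s P.σp P.α P.ρ

/-- The joint law of the `n` independent training points and of the independent Gaussian
initialisation. -/
def trainLaw (P : Params) (n : ℕ) :
    Measure ((Fin n → DataPoint P.d) × (Idx P.m P.d → ℝ)) :=
  (Measure.pi fun _ => P.law).prod (gaussianVec (Idx P.m P.d) P.σ₀)

end Params

/-! ### The data distribution is a probability measure -/

lemma masks_nonempty {d s : ℕ} (h : s < d) : (masks d s).Nonempty := by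
  obtain ⟨e, rfl⟩ : ∃ e, d = e + 1 := ⟨d - 1, by omega⟩
  obtain ⟨A, hA, hc⟩ := Finset.exists_subset_card_eq
    (s := (Finset.univ : Finset (Fin (e + 1))).erase 0) (n := s) (by simp; omega)
  refine ⟨fun k => decide (k ∈ A), fun k hk => ?_, ?_⟩
  · have : k = 0 := Fin.ext hk
    subst this
    simp only [decide_eq_false_iff_not]
    intro h0
    simpa using hA h0
  · simpa using hc

instance : MeasurableSingletonClass ℤˣ := by
  refine ⟨fun y => ⟨{(y : ℤ)}, MeasurableSet.singleton _, ?_⟩⟩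
  ext z
  simp [Units.ext_iff]

instance (ι : Type) [Fintype ι] (σ : ℝ) : IsProbabilityMeasure (gaussianVec ι σ) := by
  unfold gaussianVec; infer_instance

lemma measurable_mkData (d : ℕ) (α : ℝ) : Measurable (mkData d α) := by
  have h : ∀ (a : ℤˣ × Fin 2) (b : Fin d → Bool),
      Measurable fun g : Fin d → ℝ => mkData d α (a, b, g) := by
    intro a b
    refine Measurable.prodMk (measurable_pi_iff.2 fun p => measurable_pi_iff.2 fun k => ?_)
      (measurable_const (a := a.1))
    by_cases hp : p = a.2
    · simp only [hp, if_true]; exact measurable_const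
    · simp only [hp, if_false, noiseVec]
      by_cases hb : b k = true
      · simp only [hb, if_true]; exact (measurable_pi_apply k).sub_const _
      · simp only [if_neg hb]; exact measurable_const
  exact measurable_from_prod_countable_right fun a =>
    measurable_from_prod_countable_right fun b => h a b

lemma isProbabilityMeasure_dataLaw {d s : ℕ} (h : s < d) (σp α : ℝ) (ρ : Measure (ℤˣ × Fin 2))
    [IsProbabilityMeasure ρ] : IsProbabilityMeasure (dataLaw d s σp α ρ) := by
  have : IsProbabilityMeasure (uniformOn (masks d s)) :=
    isProbabilityMeasure_uniformOn (Set.toFinite _) (masks_nonempty h)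
  exact Measure.isProbabilityMeasure_map (measurable_mkData d α).aemeasurable

lemma Params.isProbabilityMeasure_trainLaw (P : Params) (h : P.s < P.d)
    [IsProbabilityMeasure P.ρ] (n : ℕ) : IsProbabilityMeasure (P.trainLaw n) := by
  have : IsProbabilityMeasure P.law := isProbabilityMeasure_dataLaw h _ _ _
  unfold Params.trainLaw
  infer_instance

end AdamGD

end

open AdamGD

namespace AdamGD

/-! ### The activation function -/

/-! The network is seen through two families of numbers: the alignment `featU` of each neuron with
the feature of its own class, and its response `noiseDot` to the Gaussian part of each training
noise. With high probability the noise supports are pairwise disjoint, and then these observables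
form a closed system (`lossGrad_first`, `sum_mul_lossGrad`). A sample raises the alignment through
its feature patch (force `Obs.D`) and lowers it, with the factor `α`, through its noise patch (force
`Obs.C`). It also moves its own noise response by `Obs.C` times the squared norm of its noise,
upwards for neurons of its class and downwards for the others. Weight decay is linear and the forces
have degree `q - 1 > 1`, so the theorem is decided by which family of observables becomes large
first.

Gradient descent. The squared noise norms are at most 1/8 and `α` is tiny, so the noise moves more
slowly than the feature. The accumulated noise force stays below a fraction of the accumulated
feature force along the whole trajectory (`IsGDObs.invariant`), and the best alignment of each class
never falls below its initial scale (`IsGDObs.exists_U_ge`). At a nearly stationary point an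
alignment cannot lie strictly between that scale and `n ^ (-2)`, because an unfitted sample pushes
harder than the weight decay pulls. Hence some neuron of each class is well aligned, while negative
alignments and responses to the noise of the opposite class are negligible
(`Obs.NearStat.gd_outcome`). This classifies training points and fresh points correctly.

Adam. When a gradient entry is large compared with its change in one step, the momentum ratio is
close to its sign (`adam_ratio_ge`), so Adam is sign descent up to a small dead zone
(`adam_isSignDescent`). Every entry moves at the same speed, so a noise response grows at a speed
proportional to the `ℓ¹` norm of the noise, about `d ^ (1/4) / n` times faster than an alignment can
move. Once the responses are that large, `α` times the noise force beats the feature force and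
drives all alignments to nonpositive values (`SignStart.U_nonpos`). Later a barrier keeps them at
most tiny (`SignRun.U_le`), and every sample stays memorised by some neuron (`SignRun.exists_X_ge`).
The gradient is too large during the initial phase for the best iterate to lie there
(`SignStart.exists_grad_ge`). At a nearly stationary point after that phase the samples are fitted
through their noise, and the balance in the first coordinate leaves in each class a neuron with
alignment at most `-α / (8 m)` (`Obs.NearStat.sign_outcome`). A fresh noise does not meet the
training noises, and on coordinates where no data force acts stationarity makes the weights
negligible (`GoodSample.noiseDot_fresh_le`). The wrongly signed features therefore decide, and
almost every fresh point is misclassified.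

Almost stationarity of the best iterate comes from descent inequalities on a box
(`gd_best_iter_grad_le`, `signDescent_best_iter_le`). The random input is one event, `GoodSample`,
shared by both algorithms and bounded in probability by `trainLaw_real_ge`. The numerical conditions
are checked by taking logarithms, where they become linear in `log n`, `log d` and an error of order
`log log n` (`Scales`). -/

/-- The derivative of the activation function. -/
noncomputable def dact (q z : ℝ) : ℝ := q * (max 0 z) ^ (q - 1)

section Activation

variable {q : ℝ}

lemma act_nonneg (z : ℝ) : 0 ≤ act q z := Real.rpow_nonneg (le_max_left _ _) _

lemma dact_nonneg (hq : 0 ≤ q) (z : ℝ) : 0 ≤ dact q z :=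
  mul_nonneg hq (Real.rpow_nonneg (le_max_left _ _) _)

lemma act_of_nonpos (hq : q ≠ 0) {z : ℝ} (hz : z ≤ 0) : act q z = 0 := by
  simp [act, max_eq_left hz, Real.zero_rpow hq]

lemma dact_of_nonpos (hq : q ≠ 1) {z : ℝ} (hz : z ≤ 0) : dact q z = 0 := by
  simp [dact, max_eq_left hz, Real.zero_rpow (sub_ne_zero.2 hq)]

lemma act_of_nonneg {z : ℝ} (hz : 0 ≤ z) : act q z = z ^ q := by
  simp [act, max_eq_right hz]

lemma dact_of_nonneg {z : ℝ} (hz : 0 ≤ z) : dact q z = q * z ^ (q - 1) := by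
  simp [dact, max_eq_right hz]

lemma act_mono (hq : 0 ≤ q) {a b : ℝ} (h : a ≤ b) : act q a ≤ act q b :=
  Real.rpow_le_rpow (le_max_left _ _) (max_le_max le_rfl h) hq

lemma dact_mono (hq : 1 ≤ q) {a b : ℝ} (h : a ≤ b) : dact q a ≤ dact q b :=
  mul_le_mul_of_nonneg_left
    (Real.rpow_le_rpow (le_max_left _ _) (max_le_max le_rfl h) (by linarith)) (by linarith)

/-- At the origin the two one-sided derivatives are glued: the left one is that of a constant, the
right one vanishes because `q > 1`. -/
lemma hasDerivAt_act (hq : 1 < q) (z : ℝ) : HasDerivAt (act q) (dact q z) z := by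
  rcases lt_trichotomy z 0 with hz | hz | hz
  · rw [dact_of_nonpos hq.ne' hz.le]
    refine (hasDerivAt_const z (0 : ℝ)).congr_of_eventuallyEq ?_
    filter_upwards [gt_mem_nhds hz] with w hw
    exact act_of_nonpos (by linarith) (le_of_lt hw)
  · subst hz
    rw [dact_of_nonpos hq.ne' le_rfl]
    have h1 : HasDerivWithinAt (act q) 0 (Set.Ici 0) 0 := by
      have := (Real.hasDerivAt_rpow_const (x := 0) (p := q) (Or.inr hq.le)).hasDerivWithinAt
        (s := Set.Ici 0)
      rw [Real.zero_rpow (by linarith), mul_zero] at this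
      exact this.congr (fun x hx => act_of_nonneg hx) (act_of_nonneg le_rfl)
    have h2 : HasDerivWithinAt (act q) 0 (Set.Iic 0) 0 :=
      (hasDerivAt_const (0 : ℝ) (0 : ℝ)).hasDerivWithinAt.congr
        (fun x hx => act_of_nonpos (by linarith) hx) (act_of_nonpos (by linarith) le_rfl)
    have := h1.union h2
    rw [Set.Ici_union_Iic] at this
    exact this.hasDerivAt Filter.univ_mem
  · rw [dact_of_nonneg hz.le]
    refine (Real.hasDerivAt_rpow_const (x := z) (p := q) (Or.inr hq.le)).congr_of_eventuallyEq ?_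
    filter_upwards [lt_mem_nhds hz] with w hw
    exact act_of_nonneg (le_of_lt hw)

lemma abs_act_sub_le (hq : 1 < q) {R a b : ℝ} (ha : |a| ≤ R) (hb : |b| ≤ R) :
    |act q a - act q b| ≤ q * R ^ (q - 1) * |a - b| := by
  have := Convex.norm_image_sub_le_of_norm_hasDerivWithin_le (f := act q) (f' := dact q)
    (C := q * R ^ (q - 1)) (s := Set.Icc (-R) R) (x := b) (y := a)
    (fun x _ => (hasDerivAt_act hq x).hasDerivWithinAt) (fun x hx => ?_) (convex_Icc _ _)
    (abs_le.1 hb) (abs_le.1 ha)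
  · simpa using this
  · rw [Real.norm_of_nonneg (dact_nonneg (by linarith) x)]
    have hR : 0 ≤ R := (abs_nonneg _).trans ha
    exact mul_le_mul_of_nonneg_left
      (Real.rpow_le_rpow (le_max_left _ _) (max_le hR hx.2) (by linarith)) (by linarith)

/-- The derivative is `q` times the activation with exponent `q - 1`, so `abs_act_sub_le` applies
one degree lower. -/
lemma abs_dact_sub_le (hq : 2 < q) {R a b : ℝ} (ha : |a| ≤ R) (hb : |b| ≤ R) :
    |dact q a - dact q b| ≤ q * (q - 1) * R ^ (q - 2) * |a - b| := by
  have h := abs_act_sub_le (q := q - 1) (by linarith) ha hb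
  have : dact q a - dact q b = q * (act (q - 1) a - act (q - 1) b) := by
    simp only [dact, act]; ring
  rw [this, abs_mul, abs_of_pos (by linarith : 0 < q)]
  calc q * |act (q - 1) a - act (q - 1) b| ≤ q * ((q - 1) * R ^ (q - 1 - 1) * |a - b|) :=
        mul_le_mul_of_nonneg_left h (by linarith)
    _ = _ := by rw [show q - 1 - 1 = q - 2 by ring]; ring

lemma dact_le (hq : 1 ≤ q) {R a : ℝ} (hR : 0 ≤ R) (ha : a ≤ R) : dact q a ≤ q * R ^ (q - 1) := by
  rw [← dact_of_nonneg hR]; exact dact_mono hq ha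

lemma act_le (hq : 0 ≤ q) {R a : ℝ} (hR : 0 ≤ R) (ha : a ≤ R) : act q a ≤ R ^ q := by
  rw [← act_of_nonneg hR]; exact act_mono hq ha

end Activation

/-! ### The logistic weight -/

/-- The logistic function at `-z`. -/
noncomputable def logi (z : ℝ) : ℝ := 1 / (1 + Real.exp z)

lemma logi_pos (z : ℝ) : 0 < logi z := by unfold logi; positivity

lemma logi_le_one (z : ℝ) : logi z ≤ 1 := by
  unfold logi
  rw [div_le_one (by positivity)]
  linarith [Real.exp_pos z]

lemma logi_anti {a b : ℝ} (h : a ≤ b) : logi b ≤ logi a := by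
  unfold logi
  have := Real.exp_le_exp.2 h
  exact one_div_le_one_div_of_le (by positivity) (by linarith)

/-- Used for samples that are not yet fitted: their logistic weight has not saturated, so their pull
on the weights is of full order. -/
lemma quarter_le_logi {z : ℝ} (hz : z ≤ 1) : 1 / 4 ≤ logi z := by
  refine le_trans ?_ (logi_anti hz)
  unfold logi
  exact one_div_le_one_div_of_le (by positivity) (by linarith [Real.exp_one_lt_three])

lemma logi_le_exp_neg (z : ℝ) : logi z ≤ Real.exp (-z) := by
  unfold logi
  rw [Real.exp_neg, one_div]
  exact inv_anti₀ (Real.exp_pos z) (by linarith)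

lemma hasDerivAt_log_one_add_exp_neg (z : ℝ) :
    HasDerivAt (fun z => Real.log (1 + Real.exp (-z))) (-logi z) z := by
  have h : HasDerivAt (fun z : ℝ => 1 + Real.exp (-z)) (Real.exp (-z) * (-1)) z :=
    ((hasDerivAt_neg z).exp).const_add 1
  convert h.log (by positivity) using 1
  unfold logi
  rw [Real.exp_neg]
  field_simp
  ring

lemma abs_logi_sub_le (a b : ℝ) : |logi a - logi b| ≤ |a - b| := by
  have hd : ∀ z, HasDerivAt logi (-(Real.exp z) / (1 + Real.exp z) ^ 2) z := fun z => by
    have h : HasDerivAt (fun z : ℝ => 1 + Real.exp z) (Real.exp z) z :=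
      (Real.hasDerivAt_exp z).const_add 1
    have := h.inv (by positivity)
    have e : logi = (fun z : ℝ => 1 + Real.exp z)⁻¹ := by
      ext z; simp [logi]
    rw [e]; exact this
  have := Convex.norm_image_sub_le_of_norm_hasDerivWithin_le (f := logi)
    (f' := fun z => -(Real.exp z) / (1 + Real.exp z) ^ 2)
    (C := 1) (s := Set.univ) (x := b) (y := a)
    (fun x _ => (hd x).hasDerivWithinAt) (fun x _ => ?_) convex_univ trivial trivial
  · simpa using this
  · rw [Real.norm_eq_abs, abs_div, abs_neg, abs_of_pos (Real.exp_pos x),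
      abs_of_pos (by positivity), div_le_one (by positivity)]
    nlinarith [Real.exp_pos x]

/-! ### Labels -/

lemma sgn_mul_self (y : ℤˣ) : sgn y * sgn y = 1 := by
  rcases Int.units_eq_one_or y with h | h <;> simp [h, sgn]

lemma sgn_neg (y : ℤˣ) : sgn (-y) = -sgn y := by simp [sgn]

lemma abs_sgn (y : ℤˣ) : |sgn y| = 1 := by
  rcases Int.units_eq_one_or y with h | h <;> simp [h, sgn]

lemma units_eq_or_eq_neg (y j : ℤˣ) : y = j ∨ y = -j := by
  rcases Int.units_eq_one_or y with h | h <;> rcases Int.units_eq_one_or j with h' | h' <;>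
    simp [h, h']

lemma ne_neg_units (y : ℤˣ) : y ≠ -y := by
  rcases Int.units_eq_one_or y with h | h <;> subst h <;> decide

lemma sgn_mul_sgn_neg (y : ℤˣ) : sgn y * sgn (-y) = -1 := by
  rw [sgn_neg, mul_neg, sgn_mul_self]

lemma sum_units {M : Type*} [AddCommMonoid M] (f : ℤˣ → M) (y : ℤˣ) :
    ∑ j, f j = f y + f (-y) := by
  have h : (Finset.univ : Finset ℤˣ) = {y, -y} := by
    ext z; simp only [Finset.mem_univ, Finset.mem_insert, Finset.mem_singleton, true_iff]
    exact units_eq_or_eq_neg z y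
  rw [h, Finset.sum_pair (ne_neg_units y)]

/-! ### The gradient of the training objective -/

section Gradient

variable {q lam : ℝ} {n m d : ℕ}

/-- The inner product of a neuron with a patch. -/
noncomputable def neuronDot (W : Weights m d) (j : ℤˣ) (r : Fin m) (x : Fin d → ℝ) : ℝ :=
  ∑ k, W (j, r, k) * x k

/-- The classification margin at a labelled point. -/
noncomputable def margin (q : ℝ) (W : Weights m d) (z : DataPoint d) : ℝ :=
  output q W z.2 z.1 - output q W (-z.2) z.1

lemma sampleLoss_eq (z : DataPoint d) (W : Weights m d) :
    sampleLoss q z W = Real.log (1 + Real.exp (-margin q W z)) := by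
  unfold sampleLoss margin
  rw [sum_units _ z.2, ← Real.log_inv]
  congr 1
  rw [neg_sub, Real.exp_sub]
  field_simp

/-- The explicit gradient of the training objective. -/
noncomputable def lossGrad (q lam : ℝ) (S : Fin n → DataPoint d) (W : Weights m d) : Weights m d :=
  WithLp.toLp 2 fun a => lam * W a - (1 / (n : ℝ)) * ∑ i, logi (margin q W (S i)) *
    (sgn (S i).2 * sgn a.1 *
      ∑ p, dact q (neuronDot W a.1 a.2.1 ((S i).1 p)) * (S i).1 p a.2.2)

lemma lossGrad_apply (S : Fin n → DataPoint d) (W : Weights m d) (j : ℤˣ) (r : Fin m) (k : Fin d) :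
    lossGrad q lam S W (j, r, k) = lam * W (j, r, k) - (1 / (n : ℝ)) *
      ∑ i, logi (margin q W (S i)) * (sgn (S i).2 * sgn j *
        ∑ p, dact q (neuronDot W j r ((S i).1 p)) * (S i).1 p k) := rfl

/-- The neuron functional as a continuous linear map. -/
noncomputable def neuronCLM (j : ℤˣ) (r : Fin m) (x : Fin d → ℝ) : Weights m d →L[ℝ] ℝ :=
  ∑ k, x k • (EuclideanSpace.proj (𝕜 := ℝ) (j, r, k) : Weights m d →L[ℝ] ℝ)

lemma neuronCLM_apply (j : ℤˣ) (r : Fin m) (x : Fin d → ℝ) (W : Weights m d) :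
    neuronCLM j r x W = neuronDot W j r x := by
  simp [neuronCLM, neuronDot, mul_comm]

lemma output_eq (W : Weights m d) (j : ℤˣ) (x : Patches d) :
    output q W j x = ∑ r, ∑ p, act q (neuronDot W j r (x p)) := rfl

lemma hasFDerivAt_output (hq : 1 < q) (W : Weights m d) (j : ℤˣ) (x : Patches d) :
    HasFDerivAt (fun W : Weights m d => output q W j x)
      (∑ r, ∑ p, dact q (neuronDot W j r (x p)) • neuronCLM j r (x p)) W := by
  simp only [output_eq]
  refine HasFDerivAt.fun_sum fun r _ => HasFDerivAt.fun_sum fun p _ => ?_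
  have h : HasFDerivAt (fun W : Weights m d => neuronDot W j r (x p)) (neuronCLM j r (x p)) W := by
    have := (neuronCLM j r (x p)).hasFDerivAt (x := W)
    convert this using 1
    ext W'
    exact (neuronCLM_apply j r (x p) W').symm
  exact (hasDerivAt_act hq _).comp_hasFDerivAt W h

lemma hasFDerivAt_sampleLoss (hq : 1 < q) (W : Weights m d) (z : DataPoint d) :
    HasFDerivAt (sampleLoss q z)
      ((-logi (margin q W z)) • ((∑ r, ∑ p, dact q (neuronDot W z.2 r (z.1 p)) •
          neuronCLM z.2 r (z.1 p)) -
        ∑ r, ∑ p, dact q (neuronDot W (-z.2) r (z.1 p)) • neuronCLM (-z.2) r (z.1 p))) W := by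
  have e : (sampleLoss q z : Weights m d → ℝ) =
      (fun z => Real.log (1 + Real.exp (-z))) ∘ (fun W => margin q W z) := by
    ext W'; exact sampleLoss_eq z W'
  rw [e]
  exact (hasDerivAt_log_one_add_exp_neg _).comp_hasFDerivAt W
    ((hasFDerivAt_output hq W z.2 z.1).fun_sub (hasFDerivAt_output hq W (-z.2) z.1))

lemma sum_neuronDot (c : Fin m → Fin 2 → ℝ) (V : Weights m d) (j : ℤˣ) (x : Patches d) :
    ∑ r, ∑ p, c r p * neuronDot V j r (x p) = ∑ r, ∑ k, (∑ p, c r p * x p k) * V (j, r, k) := by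
  refine Finset.sum_congr rfl fun r _ => ?_
  simp only [neuronDot, Finset.mul_sum, Finset.sum_mul]
  rw [Finset.sum_comm]
  exact Finset.sum_congr rfl fun k _ => Finset.sum_congr rfl fun p _ => by ring

lemma hasFDerivAt_loss (hq : 1 < q) (S : Fin n → DataPoint d) (W : Weights m d) :
    HasFDerivAt (loss q lam S) (innerSL ℝ (lossGrad q lam S W)) W := by
  have h1 := (HasFDerivAt.fun_sum (u := Finset.univ) fun (i : Fin n) _ =>
    hasFDerivAt_sampleLoss hq W (S i)).const_mul (1 / (n : ℝ))
  have h2 : HasFDerivAt (fun W : Weights m d => lam / 2 * ‖W‖ ^ 2) ((lam / 2) • (2 • innerSL ℝ W)) W :=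
    ((hasStrictFDerivAt_norm_sq W).hasFDerivAt).const_mul (lam / 2)
  refine HasFDerivAt.congr_fderiv (h1.fun_add h2 : HasFDerivAt (loss q lam S) _ W) ?_
  ext V
  simp only [innerSL_apply_apply, _root_.add_apply, _root_.smul_apply,
    _root_.sum_apply, _root_.sub_apply, neuronCLM_apply, smul_eq_mul,
    sum_neuronDot, PiLp.inner_apply, RCLike.inner_apply, conj_trivial, nsmul_eq_mul,
    Fintype.sum_prod_type]
  -- The sign `y j` turns the difference between the output of the label and the output of its
  -- negative into one sum over all output indices.
  have key : ∀ i, -logi (margin q W (S i)) *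
      (∑ r, ∑ k, (∑ p, dact q (neuronDot W (S i).2 r ((S i).1 p)) * (S i).1 p k) *
          V ((S i).2, r, k) -
        ∑ r, ∑ k, (∑ p, dact q (neuronDot W (-(S i).2) r ((S i).1 p)) * (S i).1 p k) *
          V (-(S i).2, r, k)) =
      ∑ j : ℤˣ, ∑ r, ∑ k, V (j, r, k) * -(logi (margin q W (S i)) * (sgn (S i).2 * sgn j *
        ∑ p, dact q (neuronDot W j r ((S i).1 p)) * (S i).1 p k)) := by
    intro i
    rw [sum_units _ (S i).2, sgn_mul_self, sgn_mul_sgn_neg, mul_sub, Finset.mul_sum,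
      Finset.mul_sum, sub_eq_add_neg, ← Finset.sum_neg_distrib]
    congr 1
    · refine Finset.sum_congr rfl fun r _ => ?_
      rw [Finset.mul_sum]
      exact Finset.sum_congr rfl fun k _ => by ring
    · refine Finset.sum_congr rfl fun r _ => ?_
      rw [Finset.mul_sum, ← Finset.sum_neg_distrib]
      exact Finset.sum_congr rfl fun k _ => by ring
  rw [Finset.sum_congr rfl fun i _ => key i]
  rw [Finset.sum_comm, Finset.mul_sum, Finset.mul_sum, Finset.mul_sum, ← Finset.sum_add_distrib]
  refine Finset.sum_congr rfl fun j _ => ?_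
  rw [Finset.sum_comm, Finset.mul_sum, Finset.mul_sum, Finset.mul_sum, ← Finset.sum_add_distrib]
  refine Finset.sum_congr rfl fun r _ => ?_
  rw [Finset.sum_comm, Finset.mul_sum, Finset.mul_sum, Finset.mul_sum, ← Finset.sum_add_distrib]
  refine Finset.sum_congr rfl fun k _ => ?_
  rw [lossGrad_apply, ← Finset.mul_sum, Finset.sum_neg_distrib]
  push_cast
  ring

lemma gradient_loss (hq : 1 < q) (S : Fin n → DataPoint d) (W : Weights m d) :
    gradient (loss q lam S) W = lossGrad q lam S W := by
  refine HasGradientAt.gradient ?_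
  rw [hasGradientAt_iff_hasFDerivAt]
  exact hasFDerivAt_loss hq S W

end Gradient

end AdamGD


namespace AdamGD

/-! ### Lipschitz bounds for the gradient on a box -/

section Lipschitz

variable {q lam : ℝ} {n m d : ℕ}

lemma abs_avg_le {c : ℝ} (hc : 0 ≤ c) {a : Fin n → ℝ} (h : ∀ i, |a i| ≤ c) :
    |(1 / (n : ℝ)) * ∑ i, a i| ≤ c := by
  rcases Nat.eq_zero_or_pos n with hn | hn
  · subst hn; simpa using hc
  have hn' : (0 : ℝ) < n := by exact_mod_cast hn
  rw [abs_mul, abs_of_pos (by positivity), one_div, inv_mul_le_iff₀ hn']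
  calc |∑ i, a i| ≤ ∑ i, |a i| := Finset.abs_sum_le_sum_abs _ _
    _ ≤ ∑ _i : Fin n, c := Finset.sum_le_sum fun i _ => h i
    _ = n * c := by simp

/-- Weights are measured in the sup norm and patches in `ℓ¹`. This pairing suits Adam, whose entries
each move by at most a fixed multiple of the step size. -/
lemma abs_neuronDot_sub_le {W W' : Weights m d} {ε B : ℝ} (hW : ∀ a, |W a - W' a| ≤ ε)
    {x : Fin d → ℝ} (hx : ∑ k, |x k| ≤ B) (hε : 0 ≤ ε) (j : ℤˣ) (r : Fin m) :
    |neuronDot W j r x - neuronDot W' j r x| ≤ ε * B := by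
  unfold neuronDot
  rw [← Finset.sum_sub_distrib]
  calc |∑ k, (W (j, r, k) * x k - W' (j, r, k) * x k)|
      ≤ ∑ k, |W (j, r, k) * x k - W' (j, r, k) * x k| := Finset.abs_sum_le_sum_abs _ _
    _ ≤ ∑ k, ε * |x k| := Finset.sum_le_sum fun k _ => by
        rw [← sub_mul, abs_mul]; exact mul_le_mul_of_nonneg_right (hW _) (abs_nonneg _)
    _ = ε * ∑ k, |x k| := by rw [Finset.mul_sum]
    _ ≤ ε * B := mul_le_mul_of_nonneg_left hx hε

lemma abs_neuronDot_le {W : Weights m d} {R B : ℝ} (hW : ∀ a, |W a| ≤ R)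
    {x : Fin d → ℝ} (hx : ∑ k, |x k| ≤ B) (hR : 0 ≤ R) (j : ℤˣ) (r : Fin m) :
    |neuronDot W j r x| ≤ R * B := by
  have := abs_neuronDot_sub_le (W := W) (W' := 0) (ε := R) (by simpa using hW) hx hR j r
  simpa [neuronDot] using this

variable {R B ε : ℝ} {W W' : Weights m d}

lemma abs_output_sub_le (hq : 1 < q) (hR : 0 ≤ R) (hε : 0 ≤ ε) (hW : ∀ a, |W a| ≤ R)
    (hW' : ∀ a, |W' a| ≤ R) (hWW : ∀ a, |W a - W' a| ≤ ε) {x : Patches d}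
    (hx : ∀ p, ∑ k, |x p k| ≤ B) (j : ℤˣ) :
    |output q W j x - output q W' j x| ≤ m * (2 * (q * (R * B) ^ (q - 1) * (ε * B))) := by
  have hB : 0 ≤ B := (Finset.sum_nonneg fun _ _ => abs_nonneg _).trans (hx 0)
  rw [output_eq, output_eq, ← Finset.sum_sub_distrib]
  calc |∑ r, (∑ p, act q (neuronDot W j r (x p)) - ∑ p, act q (neuronDot W' j r (x p)))|
      ≤ ∑ r : Fin m, ∑ p : Fin 2, q * (R * B) ^ (q - 1) * (ε * B) := by
        refine (Finset.abs_sum_le_sum_abs _ _).trans (Finset.sum_le_sum fun r _ => ?_)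
        rw [← Finset.sum_sub_distrib]
        refine (Finset.abs_sum_le_sum_abs _ _).trans (Finset.sum_le_sum fun p _ => ?_)
        refine (abs_act_sub_le hq (abs_neuronDot_le hW (hx p) hR j r)
          (abs_neuronDot_le hW' (hx p) hR j r)).trans ?_
        exact mul_le_mul_of_nonneg_left (abs_neuronDot_sub_le hWW (hx p) hε j r) (by positivity)
    _ = _ := by simp

lemma abs_margin_sub_le (hq : 1 < q) (hR : 0 ≤ R) (hε : 0 ≤ ε) (hW : ∀ a, |W a| ≤ R)
    (hW' : ∀ a, |W' a| ≤ R) (hWW : ∀ a, |W a - W' a| ≤ ε) {z : DataPoint d}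
    (hx : ∀ p, ∑ k, |z.1 p k| ≤ B) :
    |margin q W z - margin q W' z| ≤ 4 * m * (q * (R * B) ^ (q - 1) * B) * ε := by
  have h1 := abs_output_sub_le hq hR hε hW hW' hWW hx z.2
  have h2 := abs_output_sub_le hq hR hε hW hW' hWW hx (-z.2)
  unfold margin
  rw [abs_le] at *
  constructor <;> linarith [h1.1, h1.2, h2.1, h2.2]

lemma abs_patch_le {x : Fin d → ℝ} (hx : ∑ k, |x k| ≤ B) (k : Fin d) : |x k| ≤ B :=
  (Finset.single_le_sum (f := fun k => |x k|) (fun _ _ => abs_nonneg _) (Finset.mem_univ k)).trans hx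

/-- The bound for the data part of the gradient on a box. -/
noncomputable def gradBound (q R B : ℝ) : ℝ := 2 * (q * (R * B) ^ (q - 1) * B)

lemma abs_sum_dact_le (hq : 1 < q) (hR : 0 ≤ R) (hW : ∀ a, |W a| ≤ R) {x : Patches d}
    (hx : ∀ p, ∑ k, |x p k| ≤ B) (j : ℤˣ) (r : Fin m) (k : Fin d) :
    |∑ p, dact q (neuronDot W j r (x p)) * x p k| ≤ gradBound q R B := by
  have hB : 0 ≤ B := (Finset.sum_nonneg fun _ _ => abs_nonneg _).trans (hx 0)
  have : ∀ p, |dact q (neuronDot W j r (x p)) * x p k| ≤ q * (R * B) ^ (q - 1) * B := by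
    intro p
    rw [abs_mul, abs_of_nonneg (dact_nonneg (by linarith) _)]
    exact mul_le_mul (dact_le hq.le (by positivity)
      ((le_abs_self _).trans (abs_neuronDot_le hW (hx p) hR j r))) (abs_patch_le (hx p) k)
      (abs_nonneg _) (by positivity)
  rw [Fin.sum_univ_two]
  have := (abs_add_le _ _).trans (add_le_add (this 0) (this 1))
  unfold gradBound
  linarith

lemma abs_sum_dact_sub_le (hq : 2 < q) (hR : 0 ≤ R) (hε : 0 ≤ ε) (hW : ∀ a, |W a| ≤ R)
    (hW' : ∀ a, |W' a| ≤ R) (hWW : ∀ a, |W a - W' a| ≤ ε) {x : Patches d}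
    (hx : ∀ p, ∑ k, |x p k| ≤ B) (j : ℤˣ) (r : Fin m) (k : Fin d) :
    |∑ p, dact q (neuronDot W j r (x p)) * x p k - ∑ p, dact q (neuronDot W' j r (x p)) * x p k|
      ≤ 2 * (q * (q - 1) * (R * B) ^ (q - 2) * B ^ 2) * ε := by
  have hB : 0 ≤ B := (Finset.sum_nonneg fun _ _ => abs_nonneg _).trans (hx 0)
  have hc : 0 ≤ q * (q - 1) * (R * B) ^ (q - 2) :=
    mul_nonneg (mul_nonneg (by linarith) (by linarith)) (by positivity)
  have : ∀ p, |dact q (neuronDot W j r (x p)) * x p k - dact q (neuronDot W' j r (x p)) * x p k|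
      ≤ q * (q - 1) * (R * B) ^ (q - 2) * (ε * B) * B := by
    intro p
    rw [← sub_mul, abs_mul]
    refine mul_le_mul ?_ (abs_patch_le (hx p) k) (abs_nonneg _) (by positivity)
    refine (abs_dact_sub_le hq (abs_neuronDot_le hW (hx p) hR j r)
      (abs_neuronDot_le hW' (hx p) hR j r)).trans ?_
    exact mul_le_mul_of_nonneg_left (abs_neuronDot_sub_le hWW (hx p) hε j r) hc
  rw [Fin.sum_univ_two, Fin.sum_univ_two]
  have h := (abs_add_le _ _).trans (add_le_add (this 0) (this 1))
  calc _ = |(dact q (neuronDot W j r (x 0)) * x 0 k - dact q (neuronDot W' j r (x 0)) * x 0 k) +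
        (dact q (neuronDot W j r (x 1)) * x 1 k - dact q (neuronDot W' j r (x 1)) * x 1 k)| := by
        congr 1; ring
    _ ≤ _ := h
    _ = _ := by ring

variable {S : Fin n → DataPoint d}

lemma abs_lossGrad_le (hq : 1 < q) (hl : 0 ≤ lam) (hR : 0 ≤ R) (hB : 0 ≤ B) (hW : ∀ a, |W a| ≤ R)
    (hS : ∀ i p, ∑ k, |(S i).1 p k| ≤ B) (a : Idx m d) :
    |lossGrad q lam S W a| ≤ lam * R + gradBound q R B := by
  obtain ⟨j, r, k⟩ := a
  rw [lossGrad_apply]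
  refine (abs_sub _ _).trans (add_le_add ?_ ?_)
  · rw [abs_mul, abs_of_nonneg hl]; exact mul_le_mul_of_nonneg_left (hW _) hl
  · refine abs_avg_le (by unfold gradBound; positivity) fun i => ?_
    rw [abs_mul, abs_mul, abs_mul, abs_sgn, abs_sgn, abs_of_pos (logi_pos _), one_mul, one_mul]
    calc _ ≤ 1 * gradBound q R B := mul_le_mul (logi_le_one _)
          (abs_sum_dact_le hq hR hW (hS i) j r k) (abs_nonneg _) zero_le_one
      _ = _ := one_mul _

/-- A Lipschitz constant for the gradient on a box. -/
noncomputable def lipBound (q lam : ℝ) (m : ℕ) (R B : ℝ) : ℝ :=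
  lam + (4 * m * (q * (R * B) ^ (q - 1) * B) * gradBound q R B +
    2 * (q * (q - 1) * (R * B) ^ (q - 2) * B ^ 2))

/-- The data part is a product of a logistic weight and an activation derivative. Changing one
factor at a time gives the two summands of `lipBound` after the weight decay. -/
lemma abs_lossGrad_sub_le (hq : 2 < q) (hl : 0 ≤ lam) (hR : 0 ≤ R) (hB : 0 ≤ B) (hε : 0 ≤ ε)
    (hW : ∀ a, |W a| ≤ R) (hW' : ∀ a, |W' a| ≤ R) (hWW : ∀ a, |W a - W' a| ≤ ε)
    (hS : ∀ i p, ∑ k, |(S i).1 p k| ≤ B) (a : Idx m d) :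
    |lossGrad q lam S W a - lossGrad q lam S W' a| ≤ lipBound q lam m R B * ε := by
  obtain ⟨j, r, k⟩ := a
  have hg : 0 ≤ gradBound q R B := by unfold gradBound; positivity
  have hc : 0 ≤ 2 * (q * (q - 1) * (R * B) ^ (q - 2) * B ^ 2) :=
    mul_nonneg zero_le_two (mul_nonneg (mul_nonneg (mul_nonneg (by linarith) (by linarith))
      (by positivity)) (by positivity))
  have hb : 0 ≤ 4 * m * (q * (R * B) ^ (q - 1) * B) :=
    mul_nonneg (by positivity) (mul_nonneg (mul_nonneg (by linarith) (by positivity)) hB)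
  rw [lossGrad_apply, lossGrad_apply]
  have e : ∀ a b x y c : ℝ, a - c * x - (b - c * y) = (a - b) - c * (x - y) := by intros; ring
  rw [e, ← mul_sub, ← Finset.sum_sub_distrib, lipBound, add_mul]
  refine (abs_sub _ _).trans (add_le_add ?_ ?_)
  · rw [abs_mul, abs_of_nonneg hl]; exact mul_le_mul_of_nonneg_left (hWW _) hl
  · refine abs_avg_le (mul_nonneg (add_nonneg (mul_nonneg hb hg) hc) hε) fun i => ?_
    set l := logi (margin q W (S i)) with hldef
    set l' := logi (margin q W' (S i))
    set a := ∑ p, dact q (neuronDot W j r ((S i).1 p)) * (S i).1 p k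
    set a' := ∑ p, dact q (neuronDot W' j r ((S i).1 p)) * (S i).1 p k
    have e2 : l * (sgn (S i).2 * sgn j * a) - l' * (sgn (S i).2 * sgn j * a') =
        (sgn (S i).2 * sgn j) * ((l - l') * a + l' * (a - a')) := by ring
    rw [e2, abs_mul, abs_mul, abs_sgn, abs_sgn, one_mul, one_mul, add_mul]
    refine (abs_add_le _ _).trans (add_le_add ?_ ?_)
    · rw [abs_mul]
      calc |l - l'| * |a| ≤ (4 * m * (q * (R * B) ^ (q - 1) * B) * ε) * gradBound q R B := by
            refine mul_le_mul ((abs_logi_sub_le _ _).trans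
              (abs_margin_sub_le (by linarith) hR hε hW hW' hWW (hS i)))
              (abs_sum_dact_le (by linarith) hR hW (hS i) j r k) (abs_nonneg _)
              (mul_nonneg hb hε)
        _ = _ := by ring
    · rw [abs_mul, abs_of_pos (logi_pos _)]
      calc l' * |a - a'| ≤ 1 * |a - a'| :=
            mul_le_mul_of_nonneg_right (logi_le_one _) (abs_nonneg _)
        _ ≤ _ := by
            rw [one_mul]; exact abs_sum_dact_sub_le hq hR hε hW hW' hWW (hS i) j r k

lemma hasDerivAt_loss_line (hq : 1 < q) (W D : Weights m d) (t : ℝ) :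
    HasDerivAt (fun t : ℝ => loss q lam S (W + t • D))
      (∑ a, lossGrad q lam S (W + t • D) a * D a) t := by
  have h1 : HasDerivAt (fun t : ℝ => W + t • D) D t := by
    simpa using ((hasDerivAt_id t).smul_const D).const_add W
  have h := (hasFDerivAt_loss (lam := lam) hq S (W + t • D)).comp_hasDerivAt t h1
  refine h.congr_deriv ?_
  simp [innerSL_apply_apply, PiLp.inner_apply, mul_comm]

/-- The descent inequality on a box. -/
lemma loss_add_le (hq : 2 < q) (hl : 0 ≤ lam) (hR : 0 ≤ R) (hB : 0 ≤ B)
    (hW : ∀ a, |W a| ≤ R) {D : Weights m d} (hW' : ∀ a, |(W + D) a| ≤ R)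
    (hε : 0 ≤ ε) (hD : ∀ a, |D a| ≤ ε) (hS : ∀ i p, ∑ k, |(S i).1 p k| ≤ B) :
    loss q lam S (W + D) ≤ loss q lam S W + ∑ a, lossGrad q lam S W a * D a +
      lipBound q lam m R B * ε * ∑ a, |D a| := by
  -- Mean value theorem along the segment. The gradient there differs from the one at `W` by at most
  -- `lipBound * ε` in each entry, which is paired with the `ℓ¹` norm of the step.
  obtain ⟨t, ht, h⟩ := exists_hasDerivAt_eq_slope (fun t : ℝ => loss q lam S (W + t • D))
    (fun t => ∑ a, lossGrad q lam S (W + t • D) a * D a) (zero_lt_one)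
    (fun t _ => (hasDerivAt_loss_line (by linarith) W D t).continuousAt.continuousWithinAt)
    (fun t _ => hasDerivAt_loss_line (by linarith) W D t)
  simp only [one_smul, zero_smul, add_zero, sub_zero, div_one] at h
  have hb : ∀ a, |(W + t • D) a| ≤ R := by
    intro a
    have e : (W + t • D) a = (1 - t) * W a + t * (W + D) a := by
      simp only [PiLp.add_apply, PiLp.smul_apply, smul_eq_mul]; ring
    rw [e]
    refine (abs_add_le _ _).trans ?_
    rw [abs_mul, abs_mul, abs_of_pos ht.1, abs_of_pos (by linarith [ht.2] : 0 < 1 - t)]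
    nlinarith [hW a, hW' a, ht.1, ht.2]
  have hd : ∀ a, |(W + t • D) a - W a| ≤ ε := by
    intro a
    simp only [PiLp.add_apply, PiLp.smul_apply, smul_eq_mul, add_sub_cancel_left]
    rw [abs_mul, abs_of_pos ht.1]
    nlinarith [hD a, ht.1, ht.2, abs_nonneg (D a)]
  have key : ∑ a, lossGrad q lam S (W + t • D) a * D a ≤ ∑ a, lossGrad q lam S W a * D a +
      lipBound q lam m R B * ε * ∑ a, |D a| := by
    rw [Finset.mul_sum, ← Finset.sum_add_distrib]
    refine Finset.sum_le_sum fun a _ => ?_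
    have h1 := abs_lossGrad_sub_le hq hl hR hB hε hb hW hd hS a
    have h2 : (lossGrad q lam S (W + t • D) a - lossGrad q lam S W a) * D a ≤
        lipBound q lam m R B * ε * |D a| := by
      refine (le_abs_self _).trans ?_
      rw [abs_mul]
      exact mul_le_mul_of_nonneg_right h1 (abs_nonneg _)
    linarith
  linarith

lemma loss_nonneg_part (S : Fin n → DataPoint d) (W : Weights m d) :
    lam / 2 * ‖W‖ ^ 2 ≤ loss q lam S W := by
  unfold loss
  refine le_add_of_nonneg_left (mul_nonneg (by positivity) (Finset.sum_nonneg fun i _ => ?_))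
  rw [sampleLoss_eq]
  exact Real.log_nonneg (by linarith [Real.exp_pos (-margin q W (S i))])

lemma loss_nonneg (hl : 0 ≤ lam) (S : Fin n → DataPoint d) (W : Weights m d) :
    0 ≤ loss q lam S W :=
  (mul_nonneg (by linarith) (by positivity)).trans (loss_nonneg_part S W)

end Lipschitz

end AdamGD


namespace AdamGD

/-! ### Convergence of gradient descent -/

section GradientDescent

variable {q lam η R B : ℝ} {n m d : ℕ} {S : Fin n → DataPoint d} {W₀ : Weights m d}

lemma gdIter_succ (hq : 1 < q) (t : ℕ) :
    gdIter (loss q lam S) η W₀ (t + 1) = gdIter (loss q lam S) η W₀ t +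
      -(η • lossGrad q lam S (gdIter (loss q lam S) η W₀ t)) := by
  rw [← gradient_loss hq, ← sub_eq_add_neg]
  rfl

lemma abs_apply_le_norm (W : Weights m d) (a : Idx m d) : |W a| ≤ ‖W‖ :=
  PiLp.norm_apply_le W a

/-- Weight decay alone confines the sublevel sets of the loss. The unit of slack in `R - 1` leaves
room for one more step inside the box. -/
lemma abs_le_of_loss_le_one (hl : 0 < lam) (hR : 1 ≤ R) (hRl : 2 / lam ≤ (R - 1) ^ 2)
    {W : Weights m d} (h : loss q lam S W ≤ 1) (a : Idx m d) : |W a| ≤ R - 1 := by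
  refine (abs_apply_le_norm W a).trans (abs_le_of_sq_le_sq' ?_ (by linarith)).2
  have h1 := (loss_nonneg_part (q := q) S W).trans h
  refine le_trans ?_ hRl
  rw [le_div_iff₀ hl]
  linarith

lemma sum_abs_le_card_mul_norm (G : Weights m d) :
    ∑ a, |G a| ≤ Fintype.card (Idx m d) * ‖G‖ := by
  calc ∑ a, |G a| ≤ ∑ _a : Idx m d, ‖G‖ := Finset.sum_le_sum fun a _ => abs_apply_le_norm G a
    _ = _ := by simp

/-- The box maintains itself: the decrease of the loss so far bounds the current weights by `R - 1`,
hence the next step stays in the box, where the descent inequality holds. The second-order term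
costs at most a tenth of the decrease. -/
lemma gd_descent (hq : 2 < q) (hl : 0 < lam) (hη : 0 < η) (hR : 1 ≤ R) (hB : 0 ≤ B)
    (hRl : 2 / lam ≤ (R - 1) ^ 2) (hS : ∀ i p, ∑ k, |(S i).1 p k| ≤ B)
    (hstep : η * (lam * R + gradBound q R B) ≤ 1)
    (hlip : η * (lipBound q lam m R B * Fintype.card (Idx m d)) ≤ 1 / 10)
    (h0 : loss q lam S W₀ ≤ 1) (t : ℕ) :
    loss q lam S (gdIter (loss q lam S) η W₀ t) ≤ loss q lam S W₀ -
      9 / 10 * η * ∑ s ∈ Finset.range t, ‖lossGrad q lam S (gdIter (loss q lam S) η W₀ s)‖ ^ 2 := by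
  induction t with
  | zero => simp [gdIter]
  | succ t ih =>
    set W := gdIter (loss q lam S) η W₀ t with hW
    set G := lossGrad q lam S W with hG
    have hbox : ∀ a, |W a| ≤ R - 1 := by
      refine abs_le_of_loss_le_one (q := q) (S := S) hl hR hRl (ih.trans ?_)
      have : 0 ≤ 9 / 10 * η * ∑ s ∈ Finset.range t,
          ‖lossGrad q lam S (gdIter (loss q lam S) η W₀ s)‖ ^ 2 := by positivity
      linarith
    have hbox' : ∀ a, |W a| ≤ R := fun a => (hbox a).trans (by linarith)
    have hD : ∀ a, |(-(η • G)) a| = η * |G a| := fun a => by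
      simp [abs_mul, abs_of_pos hη]
    have hstep' : ∀ a, |(W + -(η • G)) a| ≤ R := by
      intro a
      rw [PiLp.add_apply]
      refine (abs_add_le _ _).trans ?_
      rw [hD]
      have := mul_le_mul_of_nonneg_left
        (abs_lossGrad_le (by linarith : 1 < q) hl.le (by linarith) hB hbox' hS a) hη.le
      linarith [hbox a]
    have key := loss_add_le (W := W) (D := -(η • G)) (ε := η * ‖G‖) hq hl.le (by linarith) hB hbox'
      hstep' (by positivity) (fun a => by
        rw [hD]; exact mul_le_mul_of_nonneg_left (abs_apply_le_norm G a) hη.le) hS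
    have e1 : ∑ a, lossGrad q lam S W a * (-(η • G)) a = -(η * ‖G‖ ^ 2) := by
      rw [EuclideanSpace.real_norm_sq_eq, Finset.mul_sum, ← Finset.sum_neg_distrib]
      refine Finset.sum_congr rfl fun a _ => ?_
      simp only [PiLp.neg_apply, PiLp.smul_apply, smul_eq_mul, ← hG]
      ring
    have e2 : ∑ a, |(-(η • G)) a| ≤ η * (Fintype.card (Idx m d) * ‖G‖) := by
      simp only [hD, ← Finset.mul_sum]
      exact mul_le_mul_of_nonneg_left (sum_abs_le_card_mul_norm G) hη.le
    have hL : 0 ≤ lipBound q lam m R B := by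
      have : 0 ≤ gradBound q R B := by unfold gradBound; positivity
      have h1 : 0 ≤ q - 1 := by linarith
      unfold lipBound
      positivity
    have e3 : lipBound q lam m R B * (η * ‖G‖) * ∑ a, |(-(η • G)) a| ≤ 1 / 10 * η * ‖G‖ ^ 2 := by
      calc _ ≤ lipBound q lam m R B * (η * ‖G‖) * (η * (Fintype.card (Idx m d) * ‖G‖)) :=
            mul_le_mul_of_nonneg_left e2 (by positivity)
        _ = η * (lipBound q lam m R B * Fintype.card (Idx m d)) * (η * ‖G‖ ^ 2) := by ring
        _ ≤ 1 / 10 * (η * ‖G‖ ^ 2) := mul_le_mul_of_nonneg_right hlip (by positivity)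
        _ = _ := by ring
    rw [gdIter_succ (by linarith), Finset.sum_range_succ, mul_add]
    rw [e1] at key
    linarith

/-- The initial loss is near `log 2`, so at most 9/10. This cancels the factor 9/10 of the descent
inequality and gives the bound with constant exactly 1. -/
lemma gd_best_iter_grad_le (hq : 2 < q) (hl : 0 < lam) (hη : 0 < η) (hR : 1 ≤ R) (hB : 0 ≤ B)
    (hRl : 2 / lam ≤ (R - 1) ^ 2) (hS : ∀ i p, ∑ k, |(S i).1 p k| ≤ B)
    (hstep : η * (lam * R + gradBound q R B) ≤ 1)
    (hlip : η * (lipBound q lam m R B * Fintype.card (Idx m d)) ≤ 1 / 10)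
    (h0 : loss q lam S W₀ ≤ 9 / 10) {T t : ℕ}
    (ht : IsBestIter T (fun t => ‖gradient (loss q lam S) (gdIter (loss q lam S) η W₀ t)‖) t) :
    ‖gradient (loss q lam S) (gdIter (loss q lam S) η W₀ t)‖ ^ 2 ≤ 1 / (T * η) := by
  obtain ⟨htm, hmin⟩ := ht
  simp only [gradient_loss (by linarith : 1 < q)] at hmin ⊢
  have hT : 0 < (T : ℝ) := by
    have := Finset.mem_Icc.1 htm
    exact_mod_cast (by omega : 0 < T)
  set x := ‖lossGrad q lam S (gdIter (loss q lam S) η W₀ t)‖ with hx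
  have h := gd_descent hq hl hη hR hB hRl hS hstep hlip (h0.trans (by norm_num)) (T + 1)
  -- The best iterate is taken over times 1 to `T`, so `T + 1` steps are summed and the term at time
  -- 0 is discarded.
  have hs : (T : ℝ) * x ^ 2 ≤ ∑ s ∈ Finset.range (T + 1),
      ‖lossGrad q lam S (gdIter (loss q lam S) η W₀ s)‖ ^ 2 := by
    rw [Finset.sum_range_succ']
    refine le_add_of_le_of_nonneg ?_ (by positivity)
    calc (T : ℝ) * x ^ 2 = ∑ s ∈ Finset.range T, x ^ 2 := by simp
      _ ≤ _ := Finset.sum_le_sum fun s hs => by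
        have hs' := Finset.mem_range.1 hs
        exact pow_le_pow_left₀ (norm_nonneg _)
          (hmin (s + 1) (Finset.mem_Icc.2 ⟨by omega, by omega⟩)) 2
  have hn := loss_nonneg (q := q) hl.le S (gdIter (loss q lam S) η W₀ (T + 1))
  rw [le_div_iff₀ (by positivity)]
  have := mul_le_mul_of_nonneg_left hs (by positivity : 0 ≤ 9 / 10 * η)
  nlinarith

end GradientDescent

/-! ### Adam as approximate sign descent -/

section AdamScalar

variable {β₁ β₂ : ℝ} {g mom sq : ℕ → ℝ}

/-- Young's inequality with parameter `δ = β₂ - β₁ ^ 2` splits the square of the new momentum. Since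
`(1 + δ) β₁ ^ 2 ≤ β₂`, the old part contracts at least as fast as the second-moment average. -/
lemma adam_mom_sq_le (h1 : β₁ < 1) (h0 : 0 ≤ β₁) (h12 : β₁ ^ 2 < β₂) (h2 : β₂ < 1)
    (hm0 : mom 0 = (1 - β₁) * g 0) (hs0 : sq 0 = (1 - β₂) * g 0 ^ 2)
    (hm : ∀ t, mom (t + 1) = β₁ * mom t + (1 - β₁) * g (t + 1))
    (hs : ∀ t, sq (t + 1) = β₂ * sq t + (1 - β₂) * g (t + 1) ^ 2) (t : ℕ) :
    mom t ^ 2 ≤ (1 + 1 / (β₂ - β₁ ^ 2)) / (1 - β₂) * sq t := by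
  have hδ : 0 < β₂ - β₁ ^ 2 := by linarith
  have hβ : 0 < 1 - β₂ := by linarith
  set δ := β₂ - β₁ ^ 2 with hδdef
  have hA : (1 - β₁) ^ 2 ≤ 1 := by nlinarith
  induction t with
  | zero =>
    rw [hm0, hs0]
    have : (1 + 1 / δ) / (1 - β₂) * ((1 - β₂) * g 0 ^ 2) = (1 + 1 / δ) * g 0 ^ 2 := by
      field_simp
    rw [this, mul_pow]
    refine mul_le_mul_of_nonneg_right (hA.trans ?_) (sq_nonneg _)
    have : 0 < 1 / δ := by positivity
    linarith
  | succ t ih =>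
    rw [hm, hs]
    set a := mom t
    set b := g (t + 1)
    have e1 : (1 + 1 / δ) / (1 - β₂) * (β₂ * sq t + (1 - β₂) * b ^ 2) =
        β₂ * ((1 + 1 / δ) / (1 - β₂) * sq t) + (1 + 1 / δ) * b ^ 2 := by field_simp
    rw [e1]
    have hβ2 : 0 ≤ β₂ := by nlinarith
    have e2 : 2 * (β₁ * a) * ((1 - β₁) * b) ≤ δ * (β₁ * a) ^ 2 + 1 / δ * ((1 - β₁) * b) ^ 2 := by
      have h := sq_nonneg (δ * (β₁ * a) - (1 - β₁) * b)
      have : δ * (β₁ * a) ^ 2 + 1 / δ * ((1 - β₁) * b) ^ 2 - 2 * (β₁ * a) * ((1 - β₁) * b) =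
          1 / δ * (δ * (β₁ * a) - (1 - β₁) * b) ^ 2 := by field_simp; ring
      have h' : 0 ≤ 1 / δ * (δ * (β₁ * a) - (1 - β₁) * b) ^ 2 := by positivity
      linarith
    have e3 : β₁ ^ 2 * a ^ 2 + δ * (β₁ ^ 2 * a ^ 2) ≤ β₂ * a ^ 2 := by
      have hb1 : β₁ ^ 2 ≤ 1 := by nlinarith
      have : δ * (β₁ ^ 2 * a ^ 2) ≤ δ * (1 * a ^ 2) := by gcongr
      have e : β₂ * a ^ 2 = β₁ ^ 2 * a ^ 2 + δ * (1 * a ^ 2) := by rw [hδdef]; ring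
      linarith
    have e4 : (1 + 1 / δ) * ((1 - β₁) * b) ^ 2 ≤ (1 + 1 / δ) * b ^ 2 := by
      have : ((1 - β₁) * b) ^ 2 ≤ b ^ 2 := by
        rw [mul_pow]; nlinarith [sq_nonneg b]
      have h' : 0 < 1 + 1 / δ := by positivity
      exact mul_le_mul_of_nonneg_left this h'.le
    have e5 := mul_le_mul_of_nonneg_left ih hβ2
    nlinarith [e2, e3, e4, e5]

lemma adam_ratio_le (h1 : β₁ < 1) (h0 : 0 ≤ β₁) (h12 : β₁ ^ 2 < β₂) (h2 : β₂ < 1)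
    (hm0 : mom 0 = (1 - β₁) * g 0) (hs0 : sq 0 = (1 - β₂) * g 0 ^ 2)
    (hm : ∀ t, mom (t + 1) = β₁ * mom t + (1 - β₁) * g (t + 1))
    (hs : ∀ t, sq (t + 1) = β₂ * sq t + (1 - β₂) * g (t + 1) ^ 2) (t : ℕ) :
    |mom t / √(sq t)| ≤ √((1 + 1 / (β₂ - β₁ ^ 2)) / (1 - β₂)) := by
  have h := adam_mom_sq_le h1 h0 h12 h2 hm0 hs0 hm hs t
  have hC : 0 ≤ (1 + 1 / (β₂ - β₁ ^ 2)) / (1 - β₂) := by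
    have h1 : 0 < β₂ - β₁ ^ 2 := by linarith
    have h2 : 0 < 1 - β₂ := by linarith
    positivity
  rw [abs_div, abs_of_nonneg (Real.sqrt_nonneg _)]
  -- This form also covers a vanishing denominator, where the quotient is zero by convention.
  refine div_le_of_le_mul₀ (Real.sqrt_nonneg _) (Real.sqrt_nonneg _) ?_
  rw [← Real.sqrt_mul hC]
  exact Real.abs_le_sqrt h

/-- The momentum is a weighted average of past gradients with total weight `1 - β₁ ^ (t + 1)`. Its
error obeys `err ↦ β₁ (err + ρ)`, a map that preserves the bound `ρ / (1 - β₁)`. -/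
lemma adam_mom_close (h1 : β₁ < 1) (h0 : 0 ≤ β₁) (hm0 : mom 0 = (1 - β₁) * g 0)
    (hm : ∀ t, mom (t + 1) = β₁ * mom t + (1 - β₁) * g (t + 1)) {ρ : ℝ} (hρ : 0 ≤ ρ) {T : ℕ}
    (hg : ∀ t < T, |g (t + 1) - g t| ≤ ρ) (t : ℕ) (ht : t ≤ T) :
    |mom t - (1 - β₁ ^ (t + 1)) * g t| ≤ ρ / (1 - β₁) := by
  have hβ : 0 < 1 - β₁ := by linarith
  induction t with
  | zero => simp only [hm0, zero_add, pow_one, sub_self, abs_zero]; positivity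
  | succ t ih =>
    have ih := ih (by omega)
    have e : mom (t + 1) - (1 - β₁ ^ (t + 1 + 1)) * g (t + 1) =
        β₁ * ((mom t - (1 - β₁ ^ (t + 1)) * g t) - (1 - β₁ ^ (t + 1)) * (g (t + 1) - g t)) := by
      rw [hm]; ring
    have hp : 0 ≤ 1 - β₁ ^ (t + 1) := by linarith [pow_le_one₀ h0 h1.le (n := t + 1)]
    have hp' : 1 - β₁ ^ (t + 1) ≤ 1 := by linarith [pow_nonneg h0 (t + 1)]
    rw [e, abs_mul, abs_of_nonneg h0]
    have h3 : |(1 - β₁ ^ (t + 1)) * (g (t + 1) - g t)| ≤ ρ := by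
      rw [abs_mul, abs_of_nonneg hp]
      have := hg t (by omega)
      nlinarith [abs_nonneg (g (t + 1) - g t)]
    have h4 := (abs_sub (mom t - (1 - β₁ ^ (t + 1)) * g t)
      ((1 - β₁ ^ (t + 1)) * (g (t + 1) - g t))).trans (add_le_add ih h3)
    calc _ ≤ β₁ * (ρ / (1 - β₁) + ρ) := mul_le_mul_of_nonneg_left h4 h0
      _ = ρ / (1 - β₁) - ρ * (1 - β₁) := by field_simp; ring
      _ ≤ ρ / (1 - β₁) := by
        have : 0 ≤ ρ * (1 - β₁) := by positivity
        linarith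

/-- Adding the same nonnegative number under both roots is a contraction. This lets the recursion
for the second moment be run at the level of square roots. -/
lemma abs_sqrt_add_sub_sqrt_add_le {a b c : ℝ} (ha : 0 ≤ a) (hb : 0 ≤ b) (hc : 0 ≤ c) :
    |√(a + c) - √(b + c)| ≤ |√a - √b| := by
  wlog h : b ≤ a generalizing a b
  · rw [abs_sub_comm, abs_sub_comm (√a)]
    exact this hb ha (by linarith)
  have h1 : √b ≤ √a := Real.sqrt_le_sqrt h
  have h2 : √(b + c) ≤ √(a + c) := Real.sqrt_le_sqrt (by linarith)
  rw [abs_of_nonneg (by linarith), abs_of_nonneg (by linarith)]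
  have h3 : √b ≤ √(b + c) := Real.sqrt_le_sqrt (by linarith)
  suffices √(a + c) ≤ √(b + c) + (√a - √b) by linarith
  apply Real.sqrt_le_iff.2 ⟨by linarith [Real.sqrt_nonneg (b + c)], ?_⟩
  have e1 := Real.sq_sqrt ha
  have e2 := Real.sq_sqrt hb
  have e3 := Real.sq_sqrt (add_nonneg hb hc)
  nlinarith [mul_le_mul_of_nonneg_right h3 (sub_nonneg.2 h1)]

lemma adam_sq_nonneg (h0 : 0 ≤ β₂) (h2 : β₂ < 1) (hs0 : sq 0 = (1 - β₂) * g 0 ^ 2)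
    (hs : ∀ t, sq (t + 1) = β₂ * sq t + (1 - β₂) * g (t + 1) ^ 2) (t : ℕ) : 0 ≤ sq t := by
  have hβ : 0 ≤ 1 - β₂ := by linarith
  induction t with
  | zero => rw [hs0]; positivity
  | succ t ih => rw [hs]; positivity

/-- The same recursion as for the momentum, now for square roots and with contraction factor `√β₂`.
Working with roots makes the error linear in the variation of the gradient. -/
lemma adam_sqrt_close (h0 : 0 ≤ β₂) (h2 : β₂ < 1) (hs0 : sq 0 = (1 - β₂) * g 0 ^ 2)
    (hs : ∀ t, sq (t + 1) = β₂ * sq t + (1 - β₂) * g (t + 1) ^ 2) {ρ : ℝ} (hρ : 0 ≤ ρ) {T : ℕ}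
    (hg : ∀ t < T, |g (t + 1) - g t| ≤ ρ) (t : ℕ) (ht : t ≤ T) :
    |√(sq t) - √((1 - β₂ ^ (t + 1)) * g t ^ 2)| ≤ ρ / (1 - √β₂) := by
  have hβ : 0 ≤ 1 - β₂ := by linarith
  have hr : √β₂ < 1 := by rw [Real.sqrt_lt' one_pos]; simpa using h2
  have hr' : 0 < 1 - √β₂ := by linarith
  induction t with
  | zero => simp only [hs0, zero_add, pow_one, sub_self, abs_zero]; positivity
  | succ t ih =>
    have ih := ih (by omega)
    have hp : 0 ≤ 1 - β₂ ^ (t + 1) := by linarith [pow_le_one₀ h0 h2.le (n := t + 1)]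
    have hp' : 1 - β₂ ^ (t + 1) ≤ 1 := by linarith [pow_nonneg h0 (t + 1)]
    have e : (1 - β₂ ^ (t + 1 + 1)) * g (t + 1) ^ 2 =
        β₂ * ((1 - β₂ ^ (t + 1)) * g (t + 1) ^ 2) + (1 - β₂) * g (t + 1) ^ 2 := by ring
    rw [hs, e]
    refine (abs_sqrt_add_sub_sqrt_add_le (mul_nonneg h0 (adam_sq_nonneg h0 h2 hs0 hs t))
      (by positivity) (by positivity)).trans ?_
    rw [Real.sqrt_mul h0, Real.sqrt_mul h0, ← mul_sub, abs_mul, abs_of_nonneg (Real.sqrt_nonneg _)]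
    have h3 : |√((1 - β₂ ^ (t + 1)) * g t ^ 2) - √((1 - β₂ ^ (t + 1)) * g (t + 1) ^ 2)| ≤ ρ := by
      rw [Real.sqrt_mul hp, Real.sqrt_mul hp, Real.sqrt_sq_eq_abs, Real.sqrt_sq_eq_abs, ← mul_sub,
        abs_mul, abs_of_nonneg (Real.sqrt_nonneg _)]
      have h4 : √(1 - β₂ ^ (t + 1)) ≤ 1 := Real.sqrt_le_one.2 hp'
      have h5 : |(|g t| - |g (t + 1)|)| ≤ ρ := by
        refine (abs_abs_sub_abs_le _ _).trans ?_
        rw [abs_sub_comm]; exact hg t (by omega)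
      nlinarith [abs_nonneg (|g t| - |g (t + 1)|), Real.sqrt_nonneg (1 - β₂ ^ (t + 1))]
    have h4 := (abs_sub_le (√(sq t)) (√((1 - β₂ ^ (t + 1)) * g t ^ 2))
      (√((1 - β₂ ^ (t + 1)) * g (t + 1) ^ 2))).trans (add_le_add ih h3)
    calc _ ≤ √β₂ * (ρ / (1 - √β₂) + ρ) := mul_le_mul_of_nonneg_left h4 (Real.sqrt_nonneg _)
      _ = ρ / (1 - √β₂) - ρ * (1 - √β₂) := by field_simp; ring
      _ ≤ ρ / (1 - √β₂) := by
        have : 0 ≤ ρ * (1 - √β₂) := by positivity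
        linarith

/-- When the gradient entry is positive and large compared with its variation in one step, Adam
moves at speed close to that of sign descent. -/
lemma adam_ratio_ge (h1 : β₁ < 1) (h0 : 0 ≤ β₁) (h02 : 0 ≤ β₂) (h2 : β₂ < 1)
    (hm0 : mom 0 = (1 - β₁) * g 0) (hs0 : sq 0 = (1 - β₂) * g 0 ^ 2)
    (hm : ∀ t, mom (t + 1) = β₁ * mom t + (1 - β₁) * g (t + 1))
    (hs : ∀ t, sq (t + 1) = β₂ * sq t + (1 - β₂) * g (t + 1) ^ 2) {ρ : ℝ} (hρ : 0 < ρ) {T : ℕ}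
    (hg : ∀ t < T, |g (t + 1) - g t| ≤ ρ) {H t : ℕ} (hH1 : β₁ ^ H ≤ 1 / 100)
    (hH2 : β₂ ^ H ≤ 1 / 100) (hHt : H ≤ t) (ht : t ≤ T)
    (hgt : 100 * (1 / (1 - β₁) + 1 / (1 - √β₂)) * ρ ≤ g t) :
    9 / 10 ≤ mom t / √(sq t) := by
  have hr : √β₂ < 1 := by rw [Real.sqrt_lt' one_pos]; simpa using h2
  have hr' : 0 < 1 - √β₂ := by linarith
  have hβ : 0 < 1 - β₁ := by linarith
  have c1 := adam_mom_close h1 h0 hm0 hm hρ.le hg t ht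
  have c2 := adam_sqrt_close h02 h2 hs0 hs hρ.le hg t ht
  have a1 : 0 < 1 / (1 - β₁) := by positivity
  have a2 : 0 < 1 / (1 - √β₂) := by positivity
  have d1 : ρ / (1 - β₁) ≤ g t / 100 := by
    rw [div_eq_mul_one_div]; nlinarith [mul_pos a2 hρ]
  have d2 : ρ / (1 - √β₂) ≤ g t / 100 := by
    rw [div_eq_mul_one_div]; nlinarith [mul_pos a1 hρ]
  have hgp : 0 < g t := lt_of_lt_of_le (by positivity) hgt
  have p1 : β₁ ^ (t + 1) ≤ 1 / 100 := (pow_le_pow_of_le_one h0 h1.le (by omega)).trans hH1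
  have p2 : β₂ ^ (t + 1) ≤ 1 / 100 := (pow_le_pow_of_le_one h02 h2.le (by omega)).trans hH2
  have p3 : 0 ≤ β₂ ^ (t + 1) := pow_nonneg h02 _
  -- The initialisation bias and the drift of the gradient cost one percent each, so the ratio is at
  -- least 0.98 / 1.01.
  have m1 : 98 / 100 * g t ≤ mom t := by
    have := (abs_le.1 (c1.trans d1)).1
    nlinarith
  have s1 : √((1 - β₂ ^ (t + 1)) * g t ^ 2) ≤ g t :=
    Real.sqrt_le_iff.2 ⟨hgp.le, by nlinarith [sq_nonneg (g t)]⟩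
  have s2 : 9 / 10 * g t ≤ √((1 - β₂ ^ (t + 1)) * g t ^ 2) :=
    Real.le_sqrt_of_sq_le (by nlinarith [sq_nonneg (g t)])
  have s3 := abs_le.1 (c2.trans d2)
  have s4 : √(sq t) ≤ 101 / 100 * g t := by linarith [s3.2]
  have s5 : 0 < √(sq t) := by linarith [s3.1]
  rw [le_div_iff₀ s5]
  linarith

end AdamScalar

/-! ### Adam on the training objective and the stationarity of its best iterate. -/

section AdamVector

/-- The bound for the speed of Adam. -/
noncomputable def adamSpeed (β₁ β₂ : ℝ) : ℝ := √((1 + 1 / (β₂ - β₁ ^ 2)) / (1 - β₂))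

/-- The constant in the threshold above which Adam follows the sign of the gradient. -/
noncomputable def adamThr (β₁ β₂ : ℝ) : ℝ := 100 * (1 / (1 - β₁) + 1 / (1 - √β₂))

variable {q lam η R B β₁ β₂ : ℝ} {n m d : ℕ} {S : Fin n → DataPoint d} {W₀ : Weights m d}

/-- `W` follows the negative sign of `G` with speed `η` up to time `T`, with burn-in time `H`,
threshold `Θ` and speed at most `C η`. -/
structure IsSignDescent {ι : Type*} (W G : ℕ → ι → ℝ) (T H : ℕ) (Θ C η : ℝ) : Prop where
  step : ∀ t < T, ∀ a, |W (t + 1) a - W t a| ≤ C * η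
  down : ∀ t < T, H ≤ t → ∀ a, Θ ≤ G t a → W (t + 1) a - W t a ≤ -(9 / 10 * η)
  up : ∀ t < T, H ≤ t → ∀ a, G t a ≤ -Θ → 9 / 10 * η ≤ W (t + 1) a - W t a

/-- The speed bound keeps the first `T` iterates in the box, whatever the loss does. Each gradient
entry then varies by at most the Lipschitz constant times one step, and the threshold is a fixed
multiple of that variation, so the scalar analysis applies to every entry. -/
lemma adam_isSignDescent (hq : 2 < q) (hl : 0 ≤ lam) (hη : 0 < η) (hR : 0 ≤ R) (hB : 0 ≤ B)
    (h1 : β₁ < 1) (h0 : 0 ≤ β₁) (h12 : β₁ ^ 2 < β₂) (h2 : β₂ < 1)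
    (hS : ∀ i p, ∑ k, |(S i).1 p k| ≤ B) {H T : ℕ} (hH1 : β₁ ^ H ≤ 1 / 100)
    (hH2 : β₂ ^ H ≤ 1 / 100) (hlip : 0 < lipBound q lam m R B)
    (hbox : ∀ a, |W₀ a| + T * (adamSpeed β₁ β₂ * η) ≤ R) :
    IsSignDescent (fun t a => adamIter (loss q lam S) β₁ β₂ η W₀ t a)
      (fun t a => lossGrad q lam S (adamIter (loss q lam S) β₁ β₂ η W₀ t) a) T H
      (adamThr β₁ β₂ * (lipBound q lam m R B * (adamSpeed β₁ β₂ * η))) (adamSpeed β₁ β₂) η ∧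
    ∀ t ≤ T, ∀ a, |adamIter (loss q lam S) β₁ β₂ η W₀ t a| ≤ R := by
  have hβ2 : 0 ≤ β₂ := by nlinarith
  set W : ℕ → Weights m d := adamIter (loss q lam S) β₁ β₂ η W₀ with hW
  set mom : ℕ → Weights m d := fun t => (adamState (loss q lam S) β₁ β₂ η W₀ (t + 1)).mom
  set sq : ℕ → Weights m d := fun t => (adamState (loss q lam S) β₁ β₂ η W₀ (t + 1)).sq
  have hg : ∀ W : Weights m d, gradient (loss q lam S) W = lossGrad q lam S W :=
    fun W => gradient_loss (by linarith) S W
  have hm0 : ∀ a, mom 0 a = (1 - β₁) * lossGrad q lam S (W 0) a := fun a => by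
    simp [mom, adamState, adamStep, hg, hW, adamIter]
  have hs0 : ∀ a, sq 0 a = (1 - β₂) * lossGrad q lam S (W 0) a ^ 2 := fun a => by
    simp [sq, adamState, adamStep, hg, hW, adamIter]
  have hm : ∀ t a, mom (t + 1) a = β₁ * mom t a + (1 - β₁) * lossGrad q lam S (W (t + 1)) a :=
    fun t a => by simp only [mom, hW, adamIter]; rw [adamState]; simp [adamStep, hg]
  have hs : ∀ t a, sq (t + 1) a = β₂ * sq t a + (1 - β₂) * lossGrad q lam S (W (t + 1)) a ^ 2 :=
    fun t a => by simp only [sq, hW, adamIter]; rw [adamState]; simp [adamStep, hg]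
  have hstep : ∀ t a, W (t + 1) a - W t a = -(η * (mom t a / √(sq t a))) := fun t a => by
    simp only [mom, sq, hW, adamIter]; rw [adamState]; simp [adamStep]
  have hu : ∀ t a, |W (t + 1) a - W t a| ≤ adamSpeed β₁ β₂ * η := fun t a => by
    rw [hstep, abs_neg, abs_mul, abs_of_pos hη, mul_comm]
    exact mul_le_mul_of_nonneg_right (adam_ratio_le (g := fun t => lossGrad q lam S (W t) a)
      (mom := fun t => mom t a) (sq := fun t => sq t a)
      h1 h0 h12 h2 (hm0 a) (hs0 a) (fun t => hm t a) (fun t => hs t a) t) hη.le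
  have hC : 0 < adamSpeed β₁ β₂ := by
    have h1 : 0 < β₂ - β₁ ^ 2 := by linarith
    have h2 : 0 < 1 - β₂ := by linarith
    unfold adamSpeed; positivity
  have hlin : ∀ t : ℕ, ∀ a, |W t a| ≤ |W₀ a| + t * (adamSpeed β₁ β₂ * η) := by
    intro t a
    induction t with
    | zero => simp [hW, adamIter, adamState]
    | succ t ih =>
      have := (abs_add_le (W t a) (W (t + 1) a - W t a)).trans (add_le_add ih (hu t a))
      rw [add_sub_cancel] at this
      push_cast
      linarith
  have hboxT : ∀ t ≤ T, ∀ a, |W t a| ≤ R := fun t ht a => by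
    refine (hlin t a).trans (le_trans ?_ (hbox a))
    have : (t : ℝ) ≤ T := by exact_mod_cast ht
    gcongr
  have hgd : ∀ t < T, ∀ a, |lossGrad q lam S (W (t + 1)) a - lossGrad q lam S (W t) a| ≤
      lipBound q lam m R B * (adamSpeed β₁ β₂ * η) := fun t ht a =>
    abs_lossGrad_sub_le hq hl hR hB (by positivity) (hboxT _ (by omega)) (hboxT _ (by omega))
      (fun a => hu t a) hS a
  have hρ : 0 < lipBound q lam m R B * (adamSpeed β₁ β₂ * η) := by positivity
  refine ⟨⟨fun t _ a => hu t a, fun t ht hHt a hΘ => ?_, fun t ht hHt a hΘ => ?_⟩, hboxT⟩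
  · have := adam_ratio_ge (g := fun t => lossGrad q lam S (W t) a)
      (mom := fun t => mom t a) (sq := fun t => sq t a) h1 h0 hβ2 h2 (hm0 a) (hs0 a)
      (fun t => hm t a) (fun t => hs t a) hρ (fun t ht => hgd t ht a) hH1 hH2 hHt ht.le hΘ
    show W (t + 1) a - W t a ≤ _
    rw [hstep]
    nlinarith
  -- Negating the gradient negates the momentum and leaves the second moment unchanged.
  · have := adam_ratio_ge (g := fun t => -lossGrad q lam S (W t) a)
      (mom := fun t => -mom t a) (sq := fun t => sq t a) h1 h0 hβ2 h2 (by simp [hm0])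
      (by simp [hs0]) (fun t => by rw [hm]; ring) (fun t => by rw [hs]; ring) hρ
      (fun t ht => by rw [neg_sub_neg, abs_sub_comm]; exact hgd t ht a) hH1 hH2 hHt ht.le
      (by unfold adamThr at hΘ; linarith)
    show _ ≤ W (t + 1) a - W t a
    rw [hstep]
    rw [neg_div] at this
    nlinarith

lemma card_mul_bound {c : ℝ} {D : Weights m d} (h : ∀ a, |D a| ≤ c) :
    ∑ a, |D a| ≤ Fintype.card (Idx m d) * c := by
  calc ∑ a, |D a| ≤ ∑ _a : Idx m d, c := Finset.sum_le_sum fun a _ => h a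
    _ = _ := by simp

/-- One step of approximate sign descent decreases the loss. -/
lemma signDescent_loss_le (hq : 2 < q) (hl : 0 ≤ lam) (hη : 0 < η) (hR : 0 ≤ R) (hB : 0 ≤ B)
    (hS : ∀ i p, ∑ k, |(S i).1 p k| ≤ B) {W : ℕ → Weights m d} {T H : ℕ} {Θ C : ℝ} (hC : 0 ≤ C)
    (hΘ : 0 ≤ Θ)
    (hW : IsSignDescent (fun t a => W t a) (fun t a => lossGrad q lam S (W t) a) T H Θ C η)
    (hbox : ∀ t ≤ T, ∀ a, |W t a| ≤ R) {t : ℕ} (ht : t < T) (hHt : H ≤ t) :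
    loss q lam S (W (t + 1)) ≤ loss q lam S (W t) - 9 / 10 * η * norm1 (lossGrad q lam S (W t)) +
      η * (Fintype.card (Idx m d) * (Θ * (C + 1)) +
        lipBound q lam m R B * C * (Fintype.card (Idx m d) * (C * η))) := by
  set G := lossGrad q lam S (W t) with hG
  have e : W (t + 1) = W t + (W (t + 1) - W t) := by simp
  have hD : ∀ a, |(W (t + 1) - W t) a| ≤ C * η := fun a => hW.step t ht a
  have key := loss_add_le (W := W t) (D := W (t + 1) - W t) (ε := C * η) hq hl hR hB
    (hbox t ht.le) (by rw [← e]; exact hbox (t + 1) ht) (by positivity) hD hS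
  rw [← e] at key
  have hL : 0 ≤ lipBound q lam m R B := by
    have : 0 ≤ gradBound q R B := by unfold gradBound; positivity
    have h1 : 0 ≤ q - 1 := by linarith
    unfold lipBound
    positivity
  have h1 : ∑ a, G a * (W (t + 1) - W t) a ≤
      ∑ a, (-(9 / 10 * η * |G a|) + η * (Θ * (C + 1))) := by
    refine Finset.sum_le_sum fun a _ => ?_
    have hst := hD a
    have hda : (W (t + 1) - W t) a = W (t + 1) a - W t a := rfl
    have hpos : 0 ≤ η * (Θ * (C + 1)) := by positivity
    rcases le_or_gt Θ (G a) with h | h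
    · have := hW.down t ht hHt a h
      have hGa : 0 ≤ G a := hΘ.trans h
      rw [abs_of_nonneg hGa, hda]
      nlinarith
    rcases le_or_gt (G a) (-Θ) with h' | h'
    · have := hW.up t ht hHt a h'
      have hGa : G a ≤ 0 := by linarith
      rw [abs_of_nonpos hGa, hda]
      nlinarith
    -- In the dead zone the direction of the step is unknown. The entry is so small that both the
    -- possible increase and the missing decrease fit into `η Θ (C + 1)`.
    · have hGa : |G a| ≤ Θ := abs_le.2 ⟨h'.le, h.le⟩
      have : G a * (W (t + 1) - W t) a ≤ Θ * (C * η) := by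
        refine (le_abs_self _).trans ?_
        rw [abs_mul]
        exact mul_le_mul hGa hst (abs_nonneg _) hΘ
      nlinarith [abs_nonneg (G a)]
  rw [Finset.sum_add_distrib, Finset.sum_neg_distrib, ← Finset.mul_sum] at h1
  simp only [Finset.sum_const, Finset.card_univ, nsmul_eq_mul] at h1
  have h2 := mul_le_mul_of_nonneg_left (card_mul_bound hD)
    (by positivity : 0 ≤ lipBound q lam m R B * (C * η))
  have h3 : norm1 G = ∑ a, |G a| := rfl
  rw [h3]
  nlinarith

/-- The best iterate of approximate sign descent is almost stationary. -/
lemma signDescent_best_iter_le (hq : 2 < q) (hl : 0 ≤ lam) (hη : 0 < η) (hR : 0 ≤ R) (hB : 0 ≤ B)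
    (hS : ∀ i p, ∑ k, |(S i).1 p k| ≤ B) {W : ℕ → Weights m d} {T H : ℕ} {Θ C : ℝ} (hC : 0 ≤ C)
    (hΘ : 0 ≤ Θ)
    (hW : IsSignDescent (fun t a => W t a) (fun t a => lossGrad q lam S (W t) a) T H Θ C η)
    (hbox : ∀ t ≤ T, ∀ a, |W t a| ≤ R)
    (hLH : loss q lam S (W H) ≤ 4 / 5) (hH : 1 ≤ H) (hHT : 100 * H ≤ T)
    (herr : T * (η * (Fintype.card (Idx m d) * (Θ * (C + 1)) +
        lipBound q lam m R B * C * (Fintype.card (Idx m d) * (C * η)))) ≤ 1 / 20)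
    {x : ℝ} (hx : ∀ t ∈ Finset.Icc 1 T, x ≤ norm1 (lossGrad q lam S (W t))) :
    x ≤ 1 / (T * η) := by
  set E := η * (Fintype.card (Idx m d) * (Θ * (C + 1)) +
        lipBound q lam m R B * C * (Fintype.card (Idx m d) * (C * η))) with hE
  have hL : 0 ≤ lipBound q lam m R B := by
    have : 0 ≤ gradBound q R B := by unfold gradBound; positivity
    have h1 : 0 ≤ q - 1 := by linarith
    unfold lipBound
    positivity
  have hE0 : 0 ≤ E := by positivity
  have hT : 0 < (T : ℝ) := by exact_mod_cast (by omega : 0 < T)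
  by_contra hcon
  push Not at hcon
  have hx0 : 0 < x := lt_trans (by positivity) hcon
  -- If all gradients exceeded `1 / (T η)`, the loss would fall after the burn-in by more than 0.99
  -- · 0.9 = 0.891. Only 4/5 plus the accumulated error 1/20 is available.
  have hsum : ∀ s : ℕ, H + s ≤ T → loss q lam S (W (H + s)) ≤
      4 / 5 - s * (9 / 10 * η * x) + s * E := by
    intro s
    induction s with
    | zero => intro _; simpa using hLH
    | succ s ih =>
      intro hs
      have h1 := signDescent_loss_le hq hl hη hR hB hS hC hΘ hW hbox (t := H + s) (by omega)
        (by omega)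
      have h2 := hx (H + s) (Finset.mem_Icc.2 ⟨by omega, by omega⟩)
      have h3 := mul_le_mul_of_nonneg_left h2 (by positivity : 0 ≤ 9 / 10 * η)
      have h4 := ih (by omega)
      rw [← add_assoc]
      push_cast
      linarith
  have h := hsum (T - H) (by omega)
  have hn := loss_nonneg (q := q) hl S (W (H + (T - H)))
  have hTH : ((T - H : ℕ) : ℝ) = T - H := by
    rw [Nat.cast_sub (by omega)]
  have hHT' : 100 * (H : ℝ) ≤ T := by exact_mod_cast hHT
  have hcon' : 1 < x * (T * η) := by rwa [div_lt_iff₀ (by positivity)] at hcon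
  have h5 : ((T - H : ℕ) : ℝ) * E ≤ 1 / 20 := by
    refine le_trans (mul_le_mul_of_nonneg_right ?_ hE0) herr
    rw [hTH]; linarith [Nat.cast_nonneg (α := ℝ) H]
  have h6 : 99 / 100 * T * (9 / 10 * η * x) ≤ ((T - H : ℕ) : ℝ) * (9 / 10 * η * x) := by
    refine mul_le_mul_of_nonneg_right ?_ (by positivity)
    rw [hTH]; linarith
  nlinarith

end AdamVector

end AdamGD


namespace AdamGD

/-! ### Features and noises seen by the neurons -/

section Observables

variable {q lam α : ℝ} {n m d : ℕ}

/-- `z` consists of a feature patch and a noise patch with Gaussian part `e`; the first coordinate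
is `k₀`. -/
structure IsPoint (α : ℝ) (k₀ : Fin d) (z : DataPoint d) (e : Fin d → ℝ) : Prop where
  first : (k₀ : ℕ) = 0
  sum_patch : ∀ f : (Fin d → ℝ) → ℝ, ∑ p, f (z.1 p) =
    f (fun k => sgn z.2 * feature d k) + f (fun k => e k - α * sgn z.2 * feature d k)
  first_eq : e k₀ = 0

/-- The alignment of the neuron `(j, r)` with the feature of the class `j`. -/
noncomputable def featU (k₀ : Fin d) (W : Weights m d) (j : ℤˣ) (r : Fin m) : ℝ :=
  sgn j * W (j, r, k₀)

/-- The response of a neuron to the Gaussian part of a noise patch. -/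
noncomputable def noiseDot (e : Fin d → ℝ) (W : Weights m d) (j : ℤˣ) (r : Fin m) : ℝ :=
  ∑ k, e k * W (j, r, k)

lemma IsPoint.feature_eq {k₀ : Fin d} {z : DataPoint d} {e : Fin d → ℝ} (h : IsPoint α k₀ z e)
    (k : Fin d) : feature d k = if k = k₀ then 1 else 0 := by
  unfold feature
  congr 1
  rw [← h.first, Fin.ext_iff]

lemma IsPoint.output_eq {k₀ : Fin d} {z : DataPoint d} {e : Fin d → ℝ} (h : IsPoint α k₀ z e)
    (W : Weights m d) (j : ℤˣ) :
    output q W j z.1 = ∑ r, (act q (sgn z.2 * sgn j * featU k₀ W j r) +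
      act q (noiseDot e W j r - α * (sgn z.2 * sgn j * featU k₀ W j r))) := by
  unfold output
  refine Finset.sum_congr rfl fun r _ => ?_
  rw [h.sum_patch fun x => act q (∑ k, W (j, r, k) * x k)]
  have e1 : sgn z.2 * sgn j * featU k₀ W j r = sgn z.2 * W (j, r, k₀) := by
    unfold featU
    rw [mul_assoc, ← mul_assoc (sgn j), sgn_mul_self, one_mul]
  rw [e1]
  simp only [h.feature_eq, mul_sub, Finset.sum_sub_distrib, mul_ite, mul_one, mul_zero,
    Finset.sum_ite_eq', Finset.mem_univ, if_true, noiseDot]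
  congr 2
  · ring
  · congr 1
    · exact Finset.sum_congr rfl fun k _ => mul_comm _ _
    · ring

/-- What the network sees of a training set: labels, alignments with the feature and responses
to the Gaussian parts. -/
structure Obs (n m : ℕ) where
  y : Fin n → ℤˣ
  U : ℤˣ → Fin m → ℝ
  H : Fin n → ℤˣ → Fin m → ℝ

namespace Obs

variable (q α : ℝ) (O : Obs n m)

/-- Agreement of the label of a sample with an output index. -/
noncomputable def ss (i : Fin n) (j : ℤˣ) : ℝ := sgn (O.y i) * sgn j

/-- The response to a noise patch. -/
noncomputable def X (i : Fin n) (j : ℤˣ) (r : Fin m) : ℝ := O.H i j r - α * (O.ss i j * O.U j r)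

/-- The network output. -/
noncomputable def out (i : Fin n) (j : ℤˣ) : ℝ :=
  ∑ r, (act q (O.ss i j * O.U j r) + act q (O.X α i j r))

/-- The loss derivative at a sample. -/
noncomputable def ell (i : Fin n) : ℝ := logi (O.out q α i (O.y i) - O.out q α i (-O.y i))

/-- The noise force. -/
noncomputable def C (i : Fin n) (j : ℤˣ) (r : Fin m) : ℝ :=
  1 / (n : ℝ) * O.ell q α i * dact q (O.X α i j r)

/-- The feature force. -/
noncomputable def D (i : Fin n) (j : ℤˣ) (r : Fin m) : ℝ :=
  1 / (n : ℝ) * O.ell q α i * dact q (O.ss i j * O.U j r)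

variable {q α O}

lemma ss_right {i : Fin n} {j : ℤˣ} (h : O.y i = j) : O.ss i j = 1 := by
  unfold ss; rw [h, sgn_mul_self]

lemma ss_wrong {i : Fin n} {j : ℤˣ} (h : O.y i = -j) : O.ss i j = -1 := by
  unfold ss; rw [h, sgn_neg, neg_mul, sgn_mul_self]

lemma X_right {i : Fin n} {j : ℤˣ} (h : O.y i = j) (r : Fin m) :
    O.X α i j r = O.H i j r - α * O.U j r := by rw [X, ss_right h, one_mul]

lemma X_wrong {i : Fin n} {j : ℤˣ} (h : O.y i = -j) (r : Fin m) :
    O.X α i j r = O.H i j r + α * O.U j r := by rw [X, ss_wrong h]; ring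

lemma ell_pos (i : Fin n) : 0 < O.ell q α i := logi_pos _

lemma ell_le_one (i : Fin n) : O.ell q α i ≤ 1 := logi_le_one _

lemma C_nonneg (hq : 0 ≤ q) (i : Fin n) (j : ℤˣ) (r : Fin m) : 0 ≤ O.C q α i j r :=
  mul_nonneg (mul_nonneg (by positivity) (ell_pos i).le) (dact_nonneg hq _)

lemma D_nonneg (hq : 0 ≤ q) (i : Fin n) (j : ℤˣ) (r : Fin m) : 0 ≤ O.D q α i j r :=
  mul_nonneg (mul_nonneg (by positivity) (ell_pos i).le) (dact_nonneg hq _)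

lemma out_nonneg (i : Fin n) (j : ℤˣ) : 0 ≤ O.out q α i j :=
  Finset.sum_nonneg fun _ _ => add_nonneg (act_nonneg _) (act_nonneg _)

end Obs

/-- The observables of a weight vector. -/
noncomputable def obs (k₀ : Fin d) (S : Fin n → DataPoint d) (e : Fin n → Fin d → ℝ)
    (W : Weights m d) : Obs n m where
  y i := (S i).2
  U := featU k₀ W
  H i := noiseDot (e i) W

section

variable {k₀ : Fin d} {S : Fin n → DataPoint d} {e : Fin n → Fin d → ℝ}

lemma obs_out (h : ∀ i, IsPoint α k₀ (S i) (e i)) (W : Weights m d) (i : Fin n) (j : ℤˣ) :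
    (obs k₀ S e W).out q α i j = output q W j (S i).1 := by
  rw [(h i).output_eq]
  rfl

lemma obs_ell (h : ∀ i, IsPoint α k₀ (S i) (e i)) (W : Weights m d) (i : Fin n) :
    (obs k₀ S e W).ell q α i = logi (margin q W (S i)) := by
  unfold Obs.ell margin
  rw [obs_out h, obs_out h]
  rfl

lemma lossGrad_eq (h : ∀ i, IsPoint α k₀ (S i) (e i)) (W : Weights m d) (j : ℤˣ) (r : Fin m)
    (k : Fin d) :
    lossGrad q lam S W (j, r, k) = lam * W (j, r, k) -
      ∑ i, (obs k₀ S e W).ss i j * ((obs k₀ S e W).D q α i j r * (sgn (S i).2 * feature d k) +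
        (obs k₀ S e W).C q α i j r * (e i k - α * sgn (S i).2 * feature d k)) := by
  rw [lossGrad_apply, Finset.mul_sum]
  congr 1
  refine Finset.sum_congr rfl fun i _ => ?_
  have e1 : neuronDot W j r (fun k => sgn (S i).2 * feature d k) =
      (obs k₀ S e W).ss i j * (obs k₀ S e W).U j r := by
    have : sgn (S i).2 * sgn j * (sgn j * W (j, r, k₀)) = sgn (S i).2 * W (j, r, k₀) := by
      rw [mul_assoc, ← mul_assoc (sgn j), sgn_mul_self, one_mul]
    simp only [neuronDot, (h i).feature_eq, mul_ite, mul_one, mul_zero,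
      Finset.sum_ite_eq', Finset.mem_univ, if_true, obs, Obs.ss, featU]
    rw [this]; ring
  have e2 : neuronDot W j r (fun k => e i k - α * sgn (S i).2 * feature d k) =
      (obs k₀ S e W).X α i j r := by
    have : sgn (S i).2 * sgn j * (sgn j * W (j, r, k₀)) = sgn (S i).2 * W (j, r, k₀) := by
      rw [mul_assoc, ← mul_assoc (sgn j), sgn_mul_self, one_mul]
    simp only [neuronDot, (h i).feature_eq, mul_sub, Finset.sum_sub_distrib, mul_ite, mul_one,
      mul_zero, Finset.sum_ite_eq', Finset.mem_univ, if_true, obs, Obs.X, Obs.ss, featU, noiseDot]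
    rw [this]
    congr 1
    · exact Finset.sum_congr rfl fun k _ => mul_comm _ _
    · ring
  rw [(h i).sum_patch fun x => dact q (neuronDot W j r x) * x k, e1, e2, ← obs_ell h]
  unfold Obs.D Obs.C
  have : (obs k₀ S e W).ss i j = sgn (S i).2 * sgn j := rfl
  rw [this]
  ring

/-- After multiplication by `sgn j` the label drops out: every sample pushes the alignment up
through its feature patch and down through its noise patch. Labels enter only through the sizes of
the forces. -/
lemma lossGrad_first (h : ∀ i, IsPoint α k₀ (S i) (e i)) (W : Weights m d) (j : ℤˣ) (r : Fin m) :
    sgn j * lossGrad q lam S W (j, r, k₀) = lam * (obs k₀ S e W).U j r -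
      ∑ i, (obs k₀ S e W).D q α i j r + α * ∑ i, (obs k₀ S e W).C q α i j r := by
  rw [lossGrad_eq h, mul_sub, Finset.mul_sum, Finset.mul_sum]
  have e1 : sgn j * (lam * W (j, r, k₀)) = lam * (obs k₀ S e W).U j r := by
    simp only [obs, featU]; ring
  rw [e1, sub_add, ← Finset.sum_sub_distrib]
  congr 1
  refine Finset.sum_congr rfl fun i _ => ?_
  rw [(h i).first_eq, (h i).feature_eq, if_pos rfl]
  have e2 : sgn j * (obs k₀ S e W).ss i j * sgn (S i).2 = 1 := by
    have : sgn j * (sgn (S i).2 * sgn j) * sgn (S i).2 =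
      (sgn (S i).2 * sgn (S i).2) * (sgn j * sgn j) := by ring
    simp only [Obs.ss, obs]
    rw [this, sgn_mul_self, sgn_mul_self, one_mul]
  linear_combination ((obs k₀ S e W).D q α i j r - α * (obs k₀ S e W).C q α i j r) * e2

lemma lossGrad_noise (h : ∀ i, IsPoint α k₀ (S i) (e i)) (W : Weights m d) (j : ℤˣ) (r : Fin m)
    {k : Fin d} (hk : k ≠ k₀) :
    lossGrad q lam S W (j, r, k) = lam * W (j, r, k) -
      ∑ i, (obs k₀ S e W).ss i j * (obs k₀ S e W).C q α i j r * e i k := by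
  rw [lossGrad_eq h]
  congr 1
  refine Finset.sum_congr rfl fun i _ => ?_
  rw [(h i).feature_eq, if_neg hk]
  ring

/-- A coordinate in the support of one noise belongs to no other, so only that sample acts on it. -/
lemma lossGrad_support (h : ∀ i, IsPoint α k₀ (S i) (e i))
    (hd : ∀ i i' k, i ≠ i' → e i k = 0 ∨ e i' k = 0) (W : Weights m d) (j : ℤˣ) (r : Fin m)
    {i : Fin n} {k : Fin d} (hk : e i k ≠ 0) :
    lossGrad q lam S W (j, r, k) = lam * W (j, r, k) -
      (obs k₀ S e W).ss i j * (obs k₀ S e W).C q α i j r * e i k := by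
  have hk0 : k ≠ k₀ := fun h' => hk (h' ▸ (h i).first_eq)
  rw [lossGrad_noise h W j r hk0]
  congr 1
  refine Finset.sum_eq_single i (fun i' _ hi => ?_) (by simp)
  rw [(hd i i' k (Ne.symm hi)).resolve_left hk, mul_zero]

/-- Coordinates untouched by the training noise feel weight decay alone. This is why a nearly
stationary network hardly reacts to fresh noise. -/
lemma lossGrad_off_support (h : ∀ i, IsPoint α k₀ (S i) (e i)) (W : Weights m d) (j : ℤˣ)
    (r : Fin m) {k : Fin d} (hk : k ≠ k₀) (hk' : ∀ i, e i k = 0) :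
    lossGrad q lam S W (j, r, k) = lam * W (j, r, k) := by
  rw [lossGrad_noise h W j r hk]
  simp [hk']

/-- Disjointness closes the system: the response to one noise is driven by that sample alone, at a
rate given by the squared norm of its noise. -/
lemma sum_mul_lossGrad (h : ∀ i, IsPoint α k₀ (S i) (e i))
    (hd : ∀ i i' k, i ≠ i' → e i k = 0 ∨ e i' k = 0) (W : Weights m d) (j : ℤˣ) (r : Fin m)
    (i : Fin n) :
    ∑ k, e i k * lossGrad q lam S W (j, r, k) = lam * (obs k₀ S e W).H i j r -
      (obs k₀ S e W).ss i j * (obs k₀ S e W).C q α i j r * ∑ k, e i k ^ 2 := by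
  have : ∀ k, e i k * lossGrad q lam S W (j, r, k) = lam * (e i k * W (j, r, k)) -
      (obs k₀ S e W).ss i j * (obs k₀ S e W).C q α i j r * e i k ^ 2 := by
    intro k
    by_cases hk : e i k = 0
    · simp [hk]
    · rw [lossGrad_support h hd W j r hk]; ring
  rw [Finset.sum_congr rfl fun k _ => this k, Finset.sum_sub_distrib, ← Finset.mul_sum,
    ← Finset.mul_sum]
  rfl

/-- The observables at a nearly stationary point. -/
structure Obs.NearStat (O : Obs n m) (q α lam τ : ℝ) (N : Fin n → ℝ) : Prop where
  feat : ∀ j r, |lam * O.U j r - ∑ i, O.D q α i j r + α * ∑ i, O.C q α i j r| ≤ τ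
  noise : ∀ i j r, |lam * O.H i j r - O.ss i j * O.C q α i j r * N i| ≤ τ

/-- Both balances are contractions of the gradient with vectors of sup norm at most 1, so its `ℓ¹`
norm controls them. -/
lemma nearStat_of_norm1_le (h : ∀ i, IsPoint α k₀ (S i) (e i))
    (hd : ∀ i i' k, i ≠ i' → e i k = 0 ∨ e i' k = 0) (he : ∀ i k, |e i k| ≤ 1) {W : Weights m d}
    {τ : ℝ} (hW : norm1 (lossGrad q lam S W) ≤ τ) :
    (obs k₀ S e W).NearStat q α lam τ fun i => ∑ k, e i k ^ 2 := by
  have hle : ∀ a, |lossGrad q lam S W a| ≤ τ := fun a =>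
    (Finset.single_le_sum (f := fun a => |lossGrad q lam S W a|) (fun _ _ => abs_nonneg _)
      (Finset.mem_univ a)).trans hW
  refine ⟨fun j r => ?_, fun i j r => ?_⟩
  · rw [← lossGrad_first h, abs_mul, abs_sgn, one_mul]
    exact hle _
  · rw [← sum_mul_lossGrad h hd]
    refine (Finset.abs_sum_le_sum_abs _ _).trans ?_
    have h1 : ∑ k, |e i k * lossGrad q lam S W (j, r, k)| ≤
        ∑ k, |lossGrad q lam S W (j, r, k)| := Finset.sum_le_sum fun k _ => by
      rw [abs_mul]
      exact mul_le_of_le_one_left (abs_nonneg _) (he i k)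
    refine h1.trans (le_trans ?_ hW)
    unfold norm1
    rw [Fintype.sum_prod_type]
    simp_rw [Fintype.sum_prod_type]
    have h2 := Finset.single_le_sum (f := fun r => ∑ k, |lossGrad q lam S W (j, r, k)|)
      (fun _ _ => Finset.sum_nonneg fun _ _ => abs_nonneg _) (Finset.mem_univ r)
    have h3 := Finset.single_le_sum (f := fun j => ∑ r, ∑ k, |lossGrad q lam S W (j, r, k)|)
      (fun _ _ => Finset.sum_nonneg fun _ _ => Finset.sum_nonneg fun _ _ => abs_nonneg _)
      (Finset.mem_univ j)
    exact h2.trans h3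

lemma trainError_eq_zero (h : ∀ i, IsPoint α k₀ (S i) (e i)) {W : Weights m d}
    (hW : ∀ i, (obs k₀ S e W).out q α i (-(obs k₀ S e W).y i) <
      (obs k₀ S e W).out q α i ((obs k₀ S e W).y i)) :
    trainError q S W = 0 := by
  unfold trainError
  refine mul_eq_zero_of_right _ (Finset.sum_eq_zero fun i _ => if_neg ?_)
  have := hW i
  rw [obs_out h, obs_out h] at this
  exact not_le.2 this

end

end Observables

end AdamGD


namespace AdamGD

/-! ### The trajectory of gradient descent -/

section Trajectory

variable {n m : ℕ}

/-- The solution of `x (t + 1) = γ x t + η f t` with `x 0 = 0`. -/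
noncomputable def decaySum (γ η : ℝ) (f : ℕ → ℝ) : ℕ → ℝ
  | 0 => 0
  | t + 1 => γ * decaySum γ η f t + η * f t

lemma decaySum_nonneg {γ η : ℝ} (hγ : 0 ≤ γ) (hη : 0 ≤ η) {f : ℕ → ℝ} (hf : ∀ t, 0 ≤ f t) (t : ℕ) :
    0 ≤ decaySum γ η f t := by
  induction t with
  | zero => exact le_rfl
  | succ t ih => exact add_nonneg (mul_nonneg hγ ih) (mul_nonneg hη (hf t))

/-- The evolution of the observables under gradient descent with step size `η`. -/
structure IsGDObs (O : ℕ → Obs n m) (y : Fin n → ℤˣ) (N : Fin n → ℝ) (q α lam η : ℝ) : Prop where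
  y_eq : ∀ t, (O t).y = y
  feat : ∀ t j r, (O (t + 1)).U j r = (1 - η * lam) * (O t).U j r +
    η * (∑ i, (O t).D q α i j r - α * ∑ i, (O t).C q α i j r)
  noise : ∀ t i j r, (O (t + 1)).H i j r = (1 - η * lam) * (O t).H i j r +
    η * ((O t).ss i j * (O t).C q α i j r * N i)

variable {O : ℕ → Obs n m} {y : Fin n → ℤˣ} {N : Fin n → ℝ} {q α lam η : ℝ}

/-- The accumulated noise force along a trajectory. -/
noncomputable def accC (O : ℕ → Obs n m) (q α lam η : ℝ) (i : Fin n) (j : ℤˣ) (r : Fin m) : ℕ → ℝ :=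
  decaySum (1 - η * lam) η fun t => (O t).C q α i j r

/-- The accumulated feature force along a trajectory. -/
noncomputable def accD (O : ℕ → Obs n m) (q α lam η : ℝ) (j : ℤˣ) (r : Fin m) : ℕ → ℝ :=
  decaySum (1 - η * lam) η fun t => ∑ i, (O t).D q α i j r

lemma accC_nonneg (hq : 0 ≤ q) (hγ : 0 ≤ 1 - η * lam) (hη : 0 ≤ η) (i : Fin n) (j : ℤˣ) (r : Fin m)
    (t : ℕ) : 0 ≤ accC O q α lam η i j r t :=
  decaySum_nonneg hγ hη (fun _ => Obs.C_nonneg hq i j r) t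

lemma accD_nonneg (hq : 0 ≤ q) (hγ : 0 ≤ 1 - η * lam) (hη : 0 ≤ η) (j : ℤˣ) (r : Fin m)
    (t : ℕ) : 0 ≤ accD O q α lam η j r t :=
  decaySum_nonneg hγ hη (fun _ => Finset.sum_nonneg fun i _ => Obs.D_nonneg hq i j r) t

lemma IsGDObs.U_eq (h : IsGDObs O y N q α lam η) (t : ℕ) (j : ℤˣ) (r : Fin m) :
    (O t).U j r = (1 - η * lam) ^ t * (O 0).U j r + accD O q α lam η j r t -
      α * ∑ i, accC O q α lam η i j r t := by
  induction t with
  | zero => simp [accD, accC, decaySum]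
  | succ t ih =>
    rw [h.feat, ih]
    simp only [accD, accC, decaySum, Finset.sum_add_distrib, ← Finset.mul_sum]
    ring

lemma IsGDObs.H_eq (h : IsGDObs O y N q α lam η) (t : ℕ) (i : Fin n) (j : ℤˣ) (r : Fin m) :
    (O t).H i j r = (1 - η * lam) ^ t * (O 0).H i j r +
      sgn (y i) * sgn j * N i * accC O q α lam η i j r t := by
  induction t with
  | zero => simp [accC, decaySum]
  | succ t ih =>
    rw [h.noise, ih]
    simp only [accC, decaySum, Obs.ss, h.y_eq]
    ring

/-- The accumulated push of a sample on a neuron of the other class is controlled by the growth of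
the neuron along the feature. -/
lemma IsGDObs.accC_wrong_le (h : IsGDObs O y N q α lam η) (hq : 0 ≤ q) (hα : 0 ≤ α) (hη : 0 ≤ η)
    (hγ : 0 ≤ 1 - η * lam) {i : Fin n} {j : ℤˣ} (hi : y i = -j) (r : Fin m)
    (hX : ∀ t, 0 < (O t).X α i j r →
      η * (N i * (O t).C q α i j r) ≤ (1 - η * lam) * (O t).X α i j r)
    (hq1 : q ≠ 1) (t : ℕ) :
    N i * accC O q α lam η i j r t ≤ (1 - η * lam) ^ t *
      (|(O 0).H i j r| + α * |(O 0).U j r|) + α * accD O q α lam η j r t := by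
  set γ := 1 - η * lam with hγdef
  have hCn : ∀ i t, 0 ≤ accC O q α lam η i j r t := fun i t => accC_nonneg hq hγ hη i j r t
  induction t with
  | zero => simp only [accC, accD, decaySum]; simp; positivity
  | succ t ih =>
    set Bt := γ ^ t * (|(O 0).H i j r| + α * |(O 0).U j r|) + α * accD O q α lam η j r t with hBt
    have hB : γ * Bt ≤ γ ^ (t + 1) * (|(O 0).H i j r| + α * |(O 0).U j r|) +
        α * accD O q α lam η j r (t + 1) := by
      have : accD O q α lam η j r (t + 1) = γ * accD O q α lam η j r t +
        η * ∑ i, (O t).D q α i j r := rfl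
      rw [this, hBt]
      have h0 : 0 ≤ α * (η * ∑ i, (O t).D q α i j r) :=
        mul_nonneg hα (mul_nonneg hη (Finset.sum_nonneg fun i _ => Obs.D_nonneg hq i j r))
      rw [pow_succ]
      linarith
    refine le_trans ?_ hB
    have e : accC O q α lam η i j r (t + 1) = γ * accC O q α lam η i j r t +
      η * (O t).C q α i j r := rfl
    rw [e]
    rcases le_or_gt ((O t).X α i j r) 0 with hx | hx
    · have : (O t).C q α i j r = 0 := by
        rw [Obs.C, dact_of_nonpos hq1 hx, mul_zero]
      rw [this]
      nlinarith [mul_le_mul_of_nonneg_left ih hγ]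
    · have h1 := hX t hx
      -- A positive response is at most the room left below the bound. By `hX` one step uses no more
      -- than the decayed response, so the accumulated push cannot overshoot; with a nonpositive
      -- response there is no push at all.
      have hXle : (O t).X α i j r ≤ Bt - N i * accC O q α lam η i j r t := by
        rw [Obs.X_wrong (by rw [h.y_eq, hi]), h.H_eq, h.U_eq, hi, sgn_neg, neg_mul, sgn_mul_self]
        have hs : 0 ≤ ∑ i, accC O q α lam η i j r t := Finset.sum_nonneg fun i _ => hCn i t
        have hp : 0 ≤ γ ^ t := pow_nonneg hγ t
        have a1 := mul_le_mul_of_nonneg_left (le_abs_self ((O 0).H i j r)) hp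
        have a2 := mul_le_mul_of_nonneg_left (mul_le_mul_of_nonneg_left
          (le_abs_self ((O 0).U j r)) hα) hp
        have a3 : 0 ≤ α * (α * ∑ i, accC O q α lam η i j r t) :=
          mul_nonneg hα (mul_nonneg hα hs)
        rw [hBt]
        linarith
      have h2 := mul_le_mul_of_nonneg_left hXle hγ
      linarith

/-- The hypotheses on the start of gradient descent for one class `j`, with `r₀` the neuron best
aligned with the feature. -/
structure GDInit (O : ℕ → Obs n m) (y : Fin n → ℤˣ) (N : Fin n → ℝ) (q α lam η : ℝ) (j : ℤˣ)
    (r₀ : Fin m) (h₀ u₀ Nm : ℝ) : Prop where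
  hq : 2 ≤ q
  hα : 0 ≤ α
  hα' : α ≤ 1 / 4
  hη : 0 ≤ η
  hγ : 0 ≤ 1 - η * lam
  Npos : 0 < Nm
  N_ge : ∀ i, Nm ≤ N i
  N_le : ∀ i, N i ≤ 1 / 8
  ν : α * n ≤ Nm / 8
  h_nonneg : 0 ≤ h₀
  h_le : ∀ i r, |(O 0).H i j r| ≤ h₀
  u_le : ∀ r, |(O 0).U j r| ≤ u₀
  u_pos : 0 < (O 0).U j r₀
  start : h₀ + 2 * α * u₀ ≤ (O 0).U j r₀ / 4
  small : ∀ t i r, 0 < (O t).X α i j r →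
      η * (N i * (O t).C q α i j r) ≤ (1 - η * lam) * (O t).X α i j r

/-- Each of the at most `n` samples of the other class obeys `IsGDObs.accC_wrong_le`; dividing by
the lower bound `Nm` and using `α n ≤ Nm / 8` leaves a factor 1/8. -/
lemma IsGDObs.sum_wrong_le (h : IsGDObs O y N q α lam η) {j : ℤˣ} {r₀ : Fin m} {h₀ u₀ Nm : ℝ}
    (g : GDInit O y N q α lam η j r₀ h₀ u₀ Nm) (r : Fin m) (t : ℕ) :
    α * ∑ i with y i = -j, accC O q α lam η i j r t ≤
      1 / 8 * ((1 - η * lam) ^ t * (h₀ + α * u₀) + α * accD O q α lam η j r t) := by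
  have hq0 : 0 ≤ q := by linarith [g.hq]
  set Bt := (1 - η * lam) ^ t * (h₀ + α * u₀) + α * accD O q α lam η j r t with hBt
  have h1 : ∀ i ∈ Finset.univ.filter (fun i => y i = -j), accC O q α lam η i j r t ≤ Bt / Nm := by
    intro i hi
    rw [le_div_iff₀ g.Npos]
    have h2 := h.accC_wrong_le hq0 g.hα g.hη g.hγ (Finset.mem_filter.1 hi).2 r
      (fun t => g.small t i r) (by linarith [g.hq]) t
    have h3 := mul_le_mul_of_nonneg_right (g.N_ge i)
      (accC_nonneg (O := O) (α := α) hq0 g.hγ g.hη i j r t)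
    have h4 : (1 - η * lam) ^ t * (|(O 0).H i j r| + α * |(O 0).U j r|) ≤
        (1 - η * lam) ^ t * (h₀ + α * u₀) := by
      refine mul_le_mul_of_nonneg_left ?_ (pow_nonneg g.hγ t)
      exact add_le_add (g.h_le i r) (mul_le_mul_of_nonneg_left (g.u_le r) g.hα)
    linarith
  have hh0 : 0 ≤ u₀ := (abs_nonneg _).trans (g.u_le r)
  have hB : 0 ≤ Bt :=
    add_nonneg (mul_nonneg (pow_nonneg g.hγ t) (add_nonneg g.h_nonneg (mul_nonneg g.hα hh0)))
      (mul_nonneg g.hα (accD_nonneg hq0 g.hγ g.hη j r t))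
  calc α * ∑ i with y i = -j, accC O q α lam η i j r t
      ≤ α * ((Finset.univ.filter (fun i => y i = -j)).card • (Bt / Nm)) :=
        mul_le_mul_of_nonneg_left (Finset.sum_le_card_nsmul _ _ _ h1) g.hα
    _ ≤ α * (n * (Bt / Nm)) := by
        rw [nsmul_eq_mul]
        refine mul_le_mul_of_nonneg_left (mul_le_mul_of_nonneg_right ?_
          (div_nonneg hB g.Npos.le)) g.hα
        exact_mod_cast (Finset.card_le_univ _).trans (by simp)
    _ = α * n * (Bt / Nm) := by ring
    _ ≤ Nm / 8 * (Bt / Nm) := mul_le_mul_of_nonneg_right g.ν (div_nonneg hB g.Npos.le)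
    _ = 1 / 8 * Bt := by have := g.Npos.ne'; field_simp

lemma sum_units_class {y : Fin n → ℤˣ} (f : Fin n → ℝ) (j : ℤˣ) :
    ∑ i, f i = ∑ i with y i = j, f i + ∑ i with y i = -j, f i := by
  rw [← Finset.sum_filter_add_sum_filter_not Finset.univ (fun i => y i = j)]
  congr 2
  ext i
  simp only [Finset.mem_filter, Finset.mem_univ, true_and]
  constructor
  · intro h; exact (units_eq_or_eq_neg (y i) j).resolve_left h
  · intro h h'; exact ne_neg_units j (h' ▸ h)

/-- The feature dominates the noise of the same class along the whole trajectory. -/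
lemma IsGDObs.invariant (h : IsGDObs O y N q α lam η) {j : ℤˣ} {r₀ : Fin m} {h₀ u₀ Nm : ℝ}
    (g : GDInit O y N q α lam η j r₀ h₀ u₀ Nm) (t : ℕ) :
    (α * ∑ i with y i = j, accC O q α lam η i j r₀ t ≤ accD O q α lam η j r₀ t / 2 ∧
    ∀ r i, y i = j → N i * accC O q α lam η i j r t +
      α ^ 2 * ∑ i' with y i' = j, accC O q α lam η i' j r t ≤ accD O q α lam η j r₀ t / 4) ∧
    (1 - η * lam) ^ t * (O 0).U j r₀ / 2 ≤ (O t).U j r₀ ∧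
    ∀ r i, y i = j → (O t).X α i j r ≤ (O t).U j r₀ := by
  have hq0 : 0 ≤ q := by linarith [g.hq]
  set γ := 1 - η * lam with hγdef
  have hp : ∀ t, 0 ≤ γ ^ t := fun t => pow_nonneg g.hγ t
  have hu0 : 0 ≤ u₀ := (abs_nonneg _).trans (g.u_le r₀)
  have hαu : 0 ≤ α * u₀ := mul_nonneg g.hα hu0
  -- the consequences at a given time of the bounds on the accumulated forces
  have key : ∀ t, (α * ∑ i with y i = j, accC O q α lam η i j r₀ t ≤ accD O q α lam η j r₀ t / 2 ∧
    ∀ r i, y i = j → N i * accC O q α lam η i j r t +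
      α ^ 2 * ∑ i' with y i' = j, accC O q α lam η i' j r t ≤ accD O q α lam η j r₀ t / 4) →
    γ ^ t * (O 0).U j r₀ / 2 ≤ (O t).U j r₀ ∧
    ∀ r i, y i = j → (O t).X α i j r ≤ (O t).U j r₀ := by
    rintro t ⟨h1, h2⟩
    have hw := h.sum_wrong_le g r₀ t
    have hD := accD_nonneg (O := O) (α := α) hq0 g.hγ g.hη j r₀ t
    have hpu : 0 ≤ γ ^ t * (O 0).U j r₀ := mul_nonneg (hp t) g.u_pos.le
    have hst : γ ^ t * (h₀ + 2 * α * u₀) ≤ γ ^ t * ((O 0).U j r₀ / 4) :=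
      mul_le_mul_of_nonneg_left g.start (hp t)
    have hph : 0 ≤ γ ^ t * h₀ := mul_nonneg (hp t) g.h_nonneg
    have hpa : 0 ≤ γ ^ t * (α * u₀) := mul_nonneg (hp t) hαu
    have hαD : α * accD O q α lam η j r₀ t ≤ 1 / 4 * accD O q α lam η j r₀ t :=
      mul_le_mul_of_nonneg_right g.hα' hD
    -- The own class takes at most half of the accumulated feature force, the other class at most `α
    -- / 8 ≤ 1/32` of it and 1/32 of the decayed initial alignment.
    have hU : 15 / 16 * (γ ^ t * (O 0).U j r₀) + 7 / 16 * accD O q α lam η j r₀ t ≤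
        (O t).U j r₀ := by
      rw [h.U_eq t j r₀, sum_units_class (y := y) _ j, mul_add]
      linarith
    refine ⟨by linarith, fun r i hi => ?_⟩
    refine le_trans ?_ hU
    rw [Obs.X_right (by rw [h.y_eq, hi]), h.H_eq t i j r, h.U_eq t j r, sum_units_class (y := y) _ j, hi,
      sgn_mul_self]
    have h3 := h2 r i hi
    have hw' := mul_le_mul_of_nonneg_left (h.sum_wrong_le g r t) g.hα
    have hDr := accD_nonneg (O := O) (α := α) hq0 g.hγ g.hη j r t
    have hαDr : 0 ≤ α * accD O q α lam η j r t := mul_nonneg g.hα hDr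
    have h4 : α * (1 / 8 * (γ ^ t * (h₀ + α * u₀) + α * accD O q α lam η j r t)) ≤
        1 / 8 * (γ ^ t * (h₀ + α * u₀)) + α * accD O q α lam η j r t := by
      have a1 : α * (γ ^ t * (h₀ + α * u₀)) ≤ 1 * (γ ^ t * (h₀ + α * u₀)) :=
        mul_le_mul_of_nonneg_right (by linarith [g.hα']) (by linarith)
      have a2 : α * (α * accD O q α lam η j r t) ≤ 1 * (α * accD O q α lam η j r t) :=
        mul_le_mul_of_nonneg_right (by linarith [g.hα']) hαDr
      linarith
    have a3 : γ ^ t * (O 0).H i j r ≤ γ ^ t * h₀ :=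
      mul_le_mul_of_nonneg_left ((le_abs_self _).trans (g.h_le i r)) (hp t)
    have a4 : -(α * (γ ^ t * (O 0).U j r)) ≤ γ ^ t * (α * u₀) := by
      have : γ ^ t * (α * (-(O 0).U j r)) ≤ γ ^ t * (α * u₀) :=
        mul_le_mul_of_nonneg_left (mul_le_mul_of_nonneg_left
          ((neg_le_abs _).trans (g.u_le r)) g.hα) (hp t)
      linarith
    nlinarith
  have hmain : ∀ t, α * ∑ i with y i = j, accC O q α lam η i j r₀ t ≤ accD O q α lam η j r₀ t / 2 ∧
    ∀ r i, y i = j → N i * accC O q α lam η i j r t +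
      α ^ 2 * ∑ i' with y i' = j, accC O q α lam η i' j r t ≤ accD O q α lam η j r₀ t / 4 := by
    intro t
    induction t with
    | zero => simp [accC, accD, decaySum]
    | succ t ih =>
      obtain ⟨-, hX⟩ := key t ih
      -- Both forces of a sample carry the same logistic weight, so `X ≤ U` compares them through
      -- monotonicity of the activation derivative. The small factors `α` and `N i` then propagate
      -- the accumulated bounds by one step, which closes the induction.
      have hCD : ∀ r i, y i = j → (O t).C q α i j r ≤ (O t).D q α i j r₀ := by
        intro r i hi
        unfold Obs.C Obs.D
        rw [Obs.ss_right (by rw [h.y_eq, hi]), one_mul]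
        exact mul_le_mul_of_nonneg_left (dact_mono (by linarith [g.hq]) (hX r i hi))
          (mul_nonneg (by positivity) (Obs.ell_pos i).le)
      have hCsum : ∀ r, ∑ i with y i = j, (O t).C q α i j r ≤ ∑ i, (O t).D q α i j r₀ := by
        intro r
        refine (Finset.sum_le_sum fun i hi => hCD r i (Finset.mem_filter.1 hi).2).trans ?_
        exact Finset.sum_le_sum_of_subset_of_nonneg (Finset.filter_subset _ _)
          fun i _ _ => Obs.D_nonneg hq0 i j r₀
      have hS : 0 ≤ ∑ i, (O t).D q α i j r₀ := Finset.sum_nonneg fun i _ => Obs.D_nonneg hq0 i j r₀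
      have e1 : ∀ i r, accC O q α lam η i j r (t + 1) = γ * accC O q α lam η i j r t +
        η * (O t).C q α i j r := fun _ _ => rfl
      have e2 : accD O q α lam η j r₀ (t + 1) = γ * accD O q α lam η j r₀ t +
        η * ∑ i, (O t).D q α i j r₀ := rfl
      have e3 : ∀ r, ∑ i with y i = j, accC O q α lam η i j r (t + 1) =
          γ * ∑ i with y i = j, accC O q α lam η i j r t +
            η * ∑ i with y i = j, (O t).C q α i j r := fun r => by
        simp only [e1, Finset.sum_add_distrib, ← Finset.mul_sum]
      refine ⟨?_, fun r i hi => ?_⟩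
      · rw [e2, e3]
        have a1 := mul_le_mul_of_nonneg_left ih.1 g.hγ
        have a2 : α * ∑ i with y i = j, (O t).C q α i j r₀ ≤
            1 / 2 * ∑ i, (O t).D q α i j r₀ :=
          mul_le_mul (by linarith [g.hα']) (hCsum r₀)
            (Finset.sum_nonneg fun i _ => Obs.C_nonneg hq0 i j r₀) (by norm_num)
        have a3 := mul_le_mul_of_nonneg_left a2 g.hη
        linarith
      · rw [e2, e3, e1]
        have a1 := mul_le_mul_of_nonneg_left (ih.2 r i hi) g.hγ
        have a2 : N i * (O t).C q α i j r ≤ 1 / 8 * ∑ i, (O t).D q α i j r₀ := by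
          refine mul_le_mul (g.N_le i) ?_ (Obs.C_nonneg hq0 i j r) (by norm_num)
          exact (hCD r i hi).trans (Finset.single_le_sum (f := fun i => (O t).D q α i j r₀)
            (fun i _ => Obs.D_nonneg hq0 i j r₀) (Finset.mem_univ i))
        have a4 : α ^ 2 * ∑ i with y i = j, (O t).C q α i j r ≤
            1 / 8 * ∑ i, (O t).D q α i j r₀ :=
          mul_le_mul (by nlinarith [g.hα', g.hα]) (hCsum r)
            (Finset.sum_nonneg fun i _ => Obs.C_nonneg hq0 i j r) (by norm_num)
        have a3 := mul_le_mul_of_nonneg_left (add_le_add a2 a4) g.hη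
        linarith
  exact ⟨hmain t, key t (hmain t)⟩

/-- Samples of the other class only push their response down, so at most the decayed initial
response remains. The alignment of `r₀` dominates it, having kept half of its own decayed start. -/
lemma IsGDObs.H_wrong_le (h : IsGDObs O y N q α lam η) {j : ℤˣ} {r₀ : Fin m} {h₀ u₀ Nm : ℝ}
    (g : GDInit O y N q α lam η j r₀ h₀ u₀ Nm) (t : ℕ) (r : Fin m) {i : Fin n} (hi : y i = -j) :
    (O t).H i j r ≤ (O t).U j r₀ / 2 := by
  have hq0 : 0 ≤ q := by linarith [g.hq]
  have hu0 : 0 ≤ u₀ := (abs_nonneg _).trans (g.u_le r₀)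
  have h1 := (h.invariant g t).2.1
  have h2 : (1 - η * lam) ^ t * (O 0).H i j r ≤ (1 - η * lam) ^ t * ((O 0).U j r₀ / 4) := by
    refine mul_le_mul_of_nonneg_left ?_ (pow_nonneg g.hγ t)
    have := (le_abs_self _).trans (g.h_le i r)
    have h3 := g.start
    nlinarith [mul_nonneg g.hα hu0]
  have h3 : 0 ≤ N i * accC O q α lam η i j r t :=
    mul_nonneg (g.Npos.le.trans (g.N_ge i)) (accC_nonneg hq0 g.hγ g.hη i j r t)
  rw [h.H_eq, hi, sgn_neg, neg_mul, sgn_mul_self]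
  linarith

lemma Obs.C_le (O : Obs n m) (hq : 1 ≤ q) {x : ℝ} (hx : 0 ≤ x) {i : Fin n} {j : ℤˣ} {r : Fin m}
    (h : O.X α i j r ≤ x) : O.C q α i j r ≤ 1 / (n : ℝ) * (q * x ^ (q - 1)) := by
  unfold Obs.C
  rw [mul_assoc]
  refine mul_le_mul_of_nonneg_left ?_ (by positivity)
  calc O.ell q α i * dact q (O.X α i j r) ≤ 1 * (q * x ^ (q - 1)) :=
        mul_le_mul (Obs.ell_le_one i) (dact_le hq hx h) (dact_nonneg (by linarith) _) zero_le_one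
    _ = _ := one_mul _

lemma Obs.sum_C_le (O : Obs n m) (hq : 1 ≤ q) {x : ℝ} (hx : 0 ≤ x) {j : ℤˣ} {r : Fin m}
    (h : ∀ i, O.X α i j r ≤ x) : ∑ i, O.C q α i j r ≤ q * x ^ (q - 1) := by
  rcases Nat.eq_zero_or_pos n with hn | hn
  · subst hn
    simp only [Finset.univ_eq_empty, Finset.sum_empty]
    have : 0 ≤ q := by linarith
    positivity
  have hn' : (n : ℝ) ≠ 0 := by positivity
  calc ∑ i, O.C q α i j r ≤ ∑ _i : Fin n, 1 / (n : ℝ) * (q * x ^ (q - 1)) :=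
        Finset.sum_le_sum fun i _ => O.C_le hq hx (h i)
    _ = _ := by simp; field_simp

lemma Obs.quarter_le_ell (O : Obs n m) {i : Fin n} (h : O.out q α i (O.y i) ≤ 1) :
    1 / 4 ≤ O.ell q α i :=
  quarter_le_logi (by linarith [O.out_nonneg (q := q) (α := α) i (-O.y i)])

lemma Obs.out_le (O : Obs n m) (hq : 0 ≤ q) {x z : ℝ} (hx : 0 ≤ x) (hz : 0 ≤ z) {i : Fin n}
    {j : ℤˣ} (h1 : ∀ r, O.ss i j * O.U j r ≤ x) (h2 : ∀ r, O.X α i j r ≤ z) :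
    O.out q α i j ≤ m * (x ^ q + z ^ q) := by
  calc O.out q α i j ≤ ∑ _r : Fin m, (x ^ q + z ^ q) :=
        Finset.sum_le_sum fun r _ => add_le_add (act_le hq hx (h1 r)) (act_le hq hz (h2 r))
    _ = _ := by simp; ring

lemma Obs.D_right_ge (O : Obs n m) {i : Fin n} {j : ℤˣ} {r : Fin m} (hi : O.y i = j)
    (hU : 0 ≤ O.U j r) (hell : 1 / 4 ≤ O.ell q α i) (hq : 0 ≤ q) :
    1 / (4 * (n : ℝ)) * (q * O.U j r ^ (q - 1)) ≤ ∑ i, O.D q α i j r := by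
  refine le_trans ?_ (Finset.single_le_sum (f := fun i => O.D q α i j r)
    (fun i _ => Obs.D_nonneg hq i j r) (Finset.mem_univ i))
  simp only [Obs.D]
  rw [Obs.ss_right hi, one_mul, dact_of_nonneg hU]
  refine mul_le_mul_of_nonneg_right ?_ (by positivity)
  rw [show 1 / (4 * (n : ℝ)) = 1 / n * (1 / 4) by rw [mul_comm 4, one_div_mul_one_div]]
  exact mul_le_mul_of_nonneg_left hell (by positivity)

/-- The best alignment with the feature never falls below its initial level. -/
lemma IsGDObs.exists_U_ge (h : IsGDObs O y N q α lam η) {j : ℤˣ} {r₀ : Fin m} {h₀ u₀ Nm : ℝ}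
    (g : GDInit O y N q α lam η j r₀ h₀ u₀ Nm) {lo hi : ℝ} (hlo : 0 < lo)
    (hlo0 : lo ≤ (O 0).U j r₀) (hlohi : 2 * lo ≤ hi) (hhi : 2 * m * hi ^ q ≤ 1)
    (hstep : ∀ t r, |(O (t + 1)).U j r - (O t).U j r| ≤ hi / 2)
    (hαn : 8 * n * α ≤ 1) (hlam : 8 * n * lam ≤ q * lo ^ (q - 2)) {i₀ : Fin n} (hi₀ : y i₀ = j)
    (t : ℕ) : ∃ r, lo ≤ (O t).U j r := by
  have hq0 : 0 ≤ q := by linarith [g.hq]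
  have hn : 0 < (n : ℝ) := by exact_mod_cast i₀.pos
  induction t with
  | zero => exact ⟨r₀, hlo0⟩
  | succ t ih =>
    obtain ⟨r₁, hr₁⟩ := ih
    -- The best neuron may change with time, so the currently best one is followed for a single
    -- step: above `hi` it cannot fall below `hi / 2 ≥ lo`, and below `hi` it increases.
    obtain ⟨r, -, hr⟩ := Finset.exists_max_image Finset.univ (fun r => (O t).U j r)
      ⟨r₁, Finset.mem_univ _⟩
    have hmax : ∀ r', (O t).U j r' ≤ (O t).U j r := fun r' => hr r' (Finset.mem_univ _)
    have hge : lo ≤ (O t).U j r := hr₁.trans (hmax r₁)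
    refine ⟨r, ?_⟩
    rcases le_or_gt hi ((O t).U j r) with hbig | hsmall
    · have := (abs_le.1 (hstep t r)).1
      linarith
    set u := (O t).U j r with hu
    have hu0 : 0 ≤ u := hlo.le.trans hge
    have hXr : ∀ r' i, y i = j → (O t).X α i j r' ≤ u := fun r' i hi =>
      ((h.invariant g t).2.2 r' i hi).trans (hmax r₀)
    have hX : ∀ i, (O t).X α i j r ≤ u := by
      intro i
      rcases units_eq_or_eq_neg (y i) j with hi | hi
      · exact hXr r i hi
      · rw [Obs.X_wrong (by rw [h.y_eq, hi])]
        have h1 := h.H_wrong_le g t r hi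
        have h2 := hmax r₀
        have h3 : α * u ≤ 1 / 4 * u := mul_le_mul_of_nonneg_right g.hα' hu0
        linarith
    have hell : 1 / 4 ≤ (O t).ell q α i₀ := by
      refine (O t).quarter_le_ell ?_
      rw [h.y_eq, hi₀]
      refine ((O t).out_le hq0 hu0 hu0 (fun r' => ?_) (fun r' => hXr r' i₀ hi₀)).trans ?_
      · rw [Obs.ss_right (by rw [h.y_eq, hi₀]), one_mul]; exact hmax r'
      · have : u ^ q ≤ hi ^ q := Real.rpow_le_rpow hu0 hsmall.le hq0
        have hm : (0 : ℝ) ≤ m := Nat.cast_nonneg m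
        nlinarith
    have hD := (O t).D_right_ge (r := r) (by rw [h.y_eq, hi₀]) hu0 hell hq0
    have hC := (O t).sum_C_le (q := q) (by linarith [g.hq]) hu0 hX
    have hpow : u ^ (q - 1) = u ^ (q - 2) * u := by
      rw [← Real.rpow_add_one' (y := q - 2) hu0 (by intro h0; linarith [g.hq])]; congr 1; ring
    rw [← hu, hpow] at hD
    rw [hpow] at hC
    have hmono : lo ^ (q - 2) ≤ u ^ (q - 2) :=
      Real.rpow_le_rpow hlo.le hge (by linarith [g.hq])
    have h1 : lam * u ≤ 1 / (8 * n) * (q * (u ^ (q - 2) * u)) := by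
      have : lam ≤ 1 / (8 * n) * (q * u ^ (q - 2)) := by
        rw [one_div, ← div_eq_inv_mul, le_div_iff₀ (by positivity)]
        have := mul_le_mul_of_nonneg_left hmono hq0
        linarith
      have := mul_le_mul_of_nonneg_right this hu0
      linarith
    have h2 : α * ∑ i, (O t).C q α i j r ≤ 1 / (8 * n) * (q * (u ^ (q - 2) * u)) := by
      refine mul_le_mul ?_ hC (Finset.sum_nonneg fun i _ => Obs.C_nonneg hq0 i j r) (by positivity)
      rw [le_div_iff₀ (by positivity)]; linarith
    -- Half of the pull of the unfitted sample pays for the weight decay, the other half for the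
    -- noise.
    have h3 : 1 / (4 * (n : ℝ)) * (q * (u ^ (q - 2) * u)) =
        1 / (8 * n) * (q * (u ^ (q - 2) * u)) + 1 / (8 * n) * (q * (u ^ (q - 2) * u)) := by
      field_simp; ring
    rw [h.feat, ← hu]
    have h4 : 0 ≤ η * (∑ i, (O t).D q α i j r - α * ∑ i, (O t).C q α i j r - lam * u) :=
      mul_nonneg g.hη (by linarith)
    linarith

end Trajectory

end AdamGD


namespace AdamGD

/-! ### Stationary points reached by gradient descent -/

section GDStationary

variable {n m : ℕ} {O : Obs n m} {N : Fin n → ℝ} {q α lam τ : ℝ}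

lemma rpow_sub_one_eq {u : ℝ} (hu : 0 ≤ u) (hq : 1 < q) : u ^ (q - 1) = u ^ (q - 2) * u := by
  rw [← Real.rpow_add_one' (y := q - 2) hu (by intro h; linarith)]; congr 1; ring

lemma Obs.act_U_le_out (O : Obs n m) {i : Fin n} {j : ℤˣ} (hi : O.y i = j) (r : Fin m) :
    act q (O.U j r) ≤ O.out q α i j := by
  refine le_trans ?_ (Finset.single_le_sum (f := fun r => act q (O.ss i j * O.U j r) +
    act q (O.X α i j r)) (fun _ _ => add_nonneg (act_nonneg _) (act_nonneg _)) (Finset.mem_univ r))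
  rw [Obs.ss_right hi, one_mul]
  exact le_add_of_nonneg_right (act_nonneg _)

lemma Obs.act_X_le_out (O : Obs n m) (i : Fin n) (j : ℤˣ) (r : Fin m) :
    act q (O.X α i j r) ≤ O.out q α i j := by
  refine le_trans ?_ (Finset.single_le_sum (f := fun r => act q (O.ss i j * O.U j r) +
    act q (O.X α i j r)) (fun _ _ => add_nonneg (act_nonneg _) (act_nonneg _)) (Finset.mem_univ r))
  exact le_add_of_nonneg_left (act_nonneg _)

/-- Here noise force and weight decay both pull a positive response down, so nothing can balance it
beyond the tolerance. -/
lemma Obs.NearStat.H_wrong_le (h : O.NearStat q α lam τ N) (hq : 0 ≤ q) (hlam : 0 < lam)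
    (hN : ∀ i, 0 ≤ N i) {i : Fin n} {j : ℤˣ} (hi : O.y i = -j) (r : Fin m) :
    O.H i j r ≤ τ / lam := by
  have h1 := (abs_le.1 (h.noise i j r)).2
  rw [Obs.ss_wrong hi] at h1
  rw [le_div_iff₀ hlam]
  nlinarith [mul_nonneg (Obs.C_nonneg (O := O) (α := α) hq i j r) (hN i)]

/-- At a nearly stationary point the negative alignments are of smaller order than a bound for the
noise responses. -/
lemma Obs.NearStat.neg_U_le (h : O.NearStat q α lam τ N) (hq : 1 < q) (hlam : 0 < lam)
    (hα : 0 ≤ α) (hτ : 0 ≤ τ) (hN : ∀ i, 1 ≤ n * N i) {j : ℤˣ} {r : Fin m} {Y : ℝ} (hY : 0 ≤ Y)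
    (hτY : τ ≤ lam * Y) (hX : ∀ i, O.y i = j → O.X α i j r ≤ Y) :
    -O.U j r ≤ 2 * α * n ^ 2 * Y + τ / lam := by
  rcases le_or_gt 0 (O.U j r) with hU | hU
  · have : 0 ≤ 2 * α * n ^ 2 * Y + τ / lam := by positivity
    linarith
  have h1 := (abs_le.1 (h.feat j r)).1
  have hD : 0 ≤ ∑ i, O.D q α i j r :=
    Finset.sum_nonneg fun i _ => Obs.D_nonneg (by linarith) i j r
  -- A negative alignment must be sustained by noise forces, and the noise balance bounds these by
  -- the weight decay of the response. For the other class a nonzero force requires a positive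
  -- response, and then the force is at most the tolerance.
  have hC : ∀ i, O.C q α i j r ≤ 2 * n * (lam * Y) := by
    intro i
    have hC0 := Obs.C_nonneg (O := O) (q := q) (α := α) (by linarith) i j r
    have hn : (0 : ℝ) ≤ n := Nat.cast_nonneg n
    have h2 : O.C q α i j r * N i ≤ 2 * (lam * Y) := by
      have h3 := h.noise i j r
      rcases units_eq_or_eq_neg (O.y i) j with hi | hi
      · rw [Obs.ss_right hi, one_mul] at h3
        have h4 := hX i hi
        rw [Obs.X_right hi] at h4
        have h5 : O.H i j r ≤ Y := by nlinarith
        nlinarith [(abs_le.1 h3).1, mul_le_mul_of_nonneg_left h5 hlam.le]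
      · rw [Obs.ss_wrong hi] at h3
        rcases le_or_gt (O.X α i j r) 0 with hx | hx
        · have : O.C q α i j r = 0 := by rw [Obs.C, dact_of_nonpos (by linarith) hx, mul_zero]
          rw [this, zero_mul]; positivity
        · rw [Obs.X_wrong hi] at hx
          have h5 : 0 ≤ O.H i j r := by nlinarith
          nlinarith [(abs_le.1 h3).2, mul_nonneg hlam.le h5, mul_nonneg hlam.le hY]
    calc O.C q α i j r ≤ O.C q α i j r * (n * N i) := le_mul_of_one_le_right hC0 (hN i)
      _ = n * (O.C q α i j r * N i) := by ring
      _ ≤ n * (2 * (lam * Y)) := mul_le_mul_of_nonneg_left h2 hn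
      _ = _ := by ring
  have hCs : ∑ i, O.C q α i j r ≤ 2 * n ^ 2 * (lam * Y) := by
    calc _ ≤ ∑ _i : Fin n, 2 * n * (lam * Y) := Finset.sum_le_sum fun i _ => hC i
      _ = _ := by simp; ring
  have h6 := mul_le_mul_of_nonneg_left hCs hα
  have h7 : lam * (-O.U j r) ≤ lam * (2 * α * n ^ 2 * Y + τ / lam) := by
    rw [mul_add, mul_div_cancel₀ _ hlam.ne']
    linarith
  exact le_of_mul_le_mul_left h7 hlam

/-- At a nearly stationary point the best alignment with the feature of a class cannot stay between
its initial scale and a constant scale. -/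
lemma Obs.NearStat.exists_U_ge (h : O.NearStat q α lam τ N) (hq : 3 ≤ q) (hlam : 0 < lam)
    (hα : 0 < α) (hα1 : α ≤ 1 / 4) (hN0 : ∀ i, 0 ≤ N i) {lo hi : ℝ}
    (hlo : 0 < lo) (hhi : 2 * m * hi ^ q ≤ 1)
    (hτ' : τ / lam ≤ α * lo / 2) (hτlo' : τ ≤ lam * lo / 2)
    (hαn : 8 * n * α ≤ 1) (hlamn : 32 * n * lam ≤ q * lo ^ (q - 2)) {j : ℤˣ}
    (hcls : ∃ i, O.y i = j)
    (hX : ∃ r₀, ∀ i r, O.y i = j → O.X α i j r ≤ O.U j r₀)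
    (hU : ∃ r, lo ≤ O.U j r) : ∃ r, hi ≤ O.U j r := by
  have hq0 : 0 ≤ q := by linarith
  have hn : (1 : ℝ) ≤ n := by
    obtain ⟨i, -⟩ := hcls
    exact_mod_cast i.pos
  obtain ⟨r₁, hr₁⟩ := hU
  obtain ⟨r₀, hr₀⟩ := hX
  obtain ⟨i₀, hi₀⟩ := hcls
  obtain ⟨r, -, hr⟩ := Finset.exists_max_image Finset.univ (fun r => O.U j r)
    ⟨r₁, Finset.mem_univ _⟩
  have hmax : ∀ r', O.U j r' ≤ O.U j r := fun r' => hr r' (Finset.mem_univ _)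
  have hge : lo ≤ O.U j r := hr₁.trans (hmax r₁)
  refine ⟨r, ?_⟩
  by_contra hc
  push Not at hc
  set u := O.U j r with hu
  have hu0 : 0 < u := hlo.trans_le hge
  have hXr : ∀ r' i, O.y i = j → O.X α i j r' ≤ u := fun r' i hi =>
    (hr₀ i r' hi).trans (hmax r₀)
  have hXa : ∀ i, O.X α i j r ≤ u := by
    intro i
    rcases units_eq_or_eq_neg (O.y i) j with hi | hi
    · exact hXr r i hi
    · rw [Obs.X_wrong hi]
      have h1 := h.H_wrong_le hq0 hlam hN0 hi r
      nlinarith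
  have hell : 1 / 4 ≤ O.ell q α i₀ := by
    refine O.quarter_le_ell ?_
    rw [hi₀]
    refine (O.out_le hq0 hu0.le hu0.le (fun r' => ?_) (fun r' => hXr r' i₀ hi₀)).trans ?_
    · rw [Obs.ss_right hi₀, one_mul]; exact hmax r'
    · have : u ^ q ≤ hi ^ q := Real.rpow_le_rpow hu0.le hc.le hq0
      have hm : (0 : ℝ) ≤ m := Nat.cast_nonneg m
      nlinarith
  have hD := O.D_right_ge (r := r) hi₀ hu0.le hell hq0
  have hC := O.sum_C_le (q := q) (by linarith) hu0.le hXa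
  rw [← hu, rpow_sub_one_eq hu0.le (by linarith)] at hD
  rw [rpow_sub_one_eq hu0.le (by linarith)] at hC
  have hmono : lo ^ (q - 2) ≤ u ^ (q - 2) := Real.rpow_le_rpow hlo.le hge (by linarith)
  have hpos : 0 < 1 / (32 * (n : ℝ)) * (q * (u ^ (q - 2) * u)) := by positivity
  have h1 : lam * u ≤ 1 / (32 * n) * (q * (u ^ (q - 2) * u)) := by
    have : lam ≤ 1 / (32 * n) * (q * u ^ (q - 2)) := by
      rw [one_div, ← div_eq_inv_mul, le_div_iff₀ (by positivity)]
      have := mul_le_mul_of_nonneg_left hmono hq0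
      linarith
    have := mul_le_mul_of_nonneg_right this hu0.le
    linarith
  have h2 : α * ∑ i, O.C q α i j r ≤ 4 * (1 / (32 * n) * (q * (u ^ (q - 2) * u))) := by
    rw [← mul_assoc]
    refine mul_le_mul ?_ hC (Finset.sum_nonneg fun i _ => Obs.C_nonneg hq0 i j r) (by positivity)
    rw [mul_one_div, le_div_iff₀ (by positivity)]; linarith
  -- Count in this unit: the feature force is at least 8, the noise takes at most 4 and the weight
  -- decay at most 1. The remaining 3 exceed the tolerance, which is at most 1/2.
  have h3 : 1 / (4 * (n : ℝ)) * (q * (u ^ (q - 2) * u)) =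
      8 * (1 / (32 * n) * (q * (u ^ (q - 2) * u))) := by
    field_simp; norm_num
  have h4 := (abs_le.1 (h.feat j r)).1
  rw [← hu] at h4
  nlinarith [mul_le_mul_of_nonneg_left hge hlam.le]

/-- The outcome of gradient descent: every class is represented by a neuron well aligned with the
feature, and no neuron is badly misaligned. -/
lemma Obs.NearStat.gd_outcome (h : O.NearStat q α lam τ N) (hq : 3 ≤ q) (hlam : 0 < lam)
    (hα : 0 < α) (hα1 : α ≤ 1 / 4) (hτ : 0 ≤ τ) (hN : ∀ i, 1 ≤ n * N i) {lo hi Yb : ℝ}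
    (hlo : 0 < lo) (hlohi : lo ≤ hi) (hhi : 2 * m * hi ^ q ≤ 1)
    (hτlo : τ ≤ lam * α * lo / 2) (hαn : 8 * n * α ≤ 1) (hlamn : 32 * n * lam ≤ q * lo ^ (q - 2))
    (hsmall : 2 * m * (3 * α * n ^ 2) ^ q ≤ 1 / 2)
    (hYb : ∀ Y, Yb ≤ Y → q * Real.exp (-(Y ^ q / 2)) * Y ^ (q - 2) < lam / 2)
    (hcls : ∀ j, ∃ i, O.y i = j)
    (hX : ∀ j, ∃ r₀, ∀ i r, O.y i = j → O.X α i j r ≤ O.U j r₀)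
    (hU : ∀ j, ∃ r, lo ≤ O.U j r) :
    (∀ j, ∃ r, hi ≤ O.U j r) ∧ (∀ j r, O.U j r ≤ Yb ∧ -O.U j r ≤ 3 * α * n ^ 2 * Yb) ∧
      0 < Yb := by
  have hq0 : 0 ≤ q := by linarith
  have hn : (1 : ℝ) ≤ n := by
    obtain ⟨i, -⟩ := hcls 1
    exact_mod_cast i.pos
  have hN0 : ∀ i, 0 ≤ N i := fun i => by
    by_contra hc
    push Not at hc
    nlinarith [hN i]
  have hτ' : τ / lam ≤ α * lo / 2 := by
    rw [div_le_iff₀ hlam]; linarith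
  have hτlo' : τ ≤ lam * lo / 2 := by
    refine hτlo.trans ?_
    have : lam * lo * α ≤ lam * lo * 1 := mul_le_mul_of_nonneg_left (by linarith) (by positivity)
    linarith
  have hlarge : ∀ j, ∃ r, hi ≤ O.U j r := fun j =>
    h.exists_U_ge hq hlam hα hα1 hN0 hlo hhi hτ' hτlo' hαn hlamn (hcls j) (hX j) (hU j)
  obtain ⟨r₁, hr₁⟩ := hlarge 1
  -- The maximum runs over both classes, so the same `Y` also bounds the output of the wrong class.
  obtain ⟨⟨j, r⟩, -, hr⟩ := Finset.exists_max_image Finset.univ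
    (fun a : ℤˣ × Fin m => O.U a.1 a.2) ⟨(1, r₁), Finset.mem_univ _⟩
  have hmax : ∀ j' r', O.U j' r' ≤ O.U j r := fun j' r' => hr (j', r') (Finset.mem_univ _)
  set Y := O.U j r with hYdef
  have hYhi : hi ≤ Y := hr₁.trans (hmax 1 r₁)
  have hY0 : 0 < Y := hlo.trans_le (hlohi.trans hYhi)
  have hloY : lo ≤ Y := hlohi.trans hYhi
  have hτY : τ ≤ lam * Y := by nlinarith
  have hneg : ∀ j' r', -O.U j' r' ≤ 3 * α * n ^ 2 * Y := by
    intro j' r'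
    obtain ⟨r₀, hr₀⟩ := hX j'
    have h1 := h.neg_U_le (j := j') (r := r') (by linarith) hlam hα.le hτ hN hY0.le hτY
      (fun i hi => (hr₀ i r' hi).trans (hmax j' r₀))
    have h2 : α * lo / 2 ≤ α * n ^ 2 * Y := by
      have h3 : α * lo ≤ α * Y := mul_le_mul_of_nonneg_left hloY hα.le
      have h4 : α * Y * 1 ≤ α * Y * n ^ 2 := mul_le_mul_of_nonneg_left (by nlinarith) (by positivity)
      nlinarith [mul_pos hα hlo]
    linarith
  -- With `Y ≥ Yb` all samples of the class would have margin at least `Y ^ q / 2`. Their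
  -- exponentially small feature force could not balance the weight decay at `Y`.
  have hYlt : Y < Yb := by
    by_contra hc
    push Not at hc
    have h1 := (abs_le.1 (h.feat j r)).2
    have hC0 : 0 ≤ α * ∑ i, O.C q α i j r :=
      mul_nonneg hα.le (Finset.sum_nonneg fun i _ => Obs.C_nonneg hq0 i j r)
    have hDi : ∀ i, O.D q α i j r ≤ 1 / (n : ℝ) *
        (Real.exp (-(Y ^ q / 2)) * (q * Y ^ (q - 1))) := by
      intro i
      unfold Obs.D
      rw [mul_assoc]
      refine mul_le_mul_of_nonneg_left ?_ (by positivity)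
      rcases units_eq_or_eq_neg (O.y i) j with hi | hi
      · rw [Obs.ss_right hi, one_mul, ← hYdef, dact_of_nonneg hY0.le]
        refine mul_le_mul_of_nonneg_right ?_ (by positivity)
        refine (logi_le_exp_neg _).trans (Real.exp_le_exp.2 (neg_le_neg ?_))
        rw [hi]
        have h3 : Y ^ q ≤ O.out q α i j := by
          have := O.act_U_le_out (q := q) (α := α) hi r
          rwa [← hYdef, act_of_nonneg hY0.le] at this
        have h4 : O.out q α i (-j) ≤ Y ^ q / 2 := by
          have hi' : O.y i = -(-j) := by rw [neg_neg, hi]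
          refine (O.out_le hq0 (x := 3 * α * n ^ 2 * Y) (z := 3 * α * n ^ 2 * Y) (by positivity)
            (by positivity) (fun r' => ?_) (fun r' => ?_)).trans ?_
          · rw [Obs.ss_wrong hi', neg_one_mul]; exact hneg _ _
          · rw [Obs.X_wrong hi']
            have h5 := h.H_wrong_le hq0 hlam hN0 hi' r'
            have h6 := mul_le_mul_of_nonneg_left (hmax (-j) r') hα.le
            have h7 : α * lo ≤ α * Y := mul_le_mul_of_nonneg_left hloY hα.le
            have h4 : α * Y * 1 ≤ α * Y * n ^ 2 :=
              mul_le_mul_of_nonneg_left (by nlinarith) (by positivity)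
            nlinarith
          · rw [Real.mul_rpow (by positivity) hY0.le]
            have : 0 ≤ Y ^ q := by positivity
            nlinarith
        linarith
      · rw [Obs.ss_wrong hi, dact_of_nonpos (by linarith) (by rw [← hYdef]; linarith), mul_zero]
        positivity
    have hDs : ∑ i, O.D q α i j r ≤ Real.exp (-(Y ^ q / 2)) * (q * Y ^ (q - 1)) := by
      have hn' : (n : ℝ) ≠ 0 := by positivity
      calc _ ≤ ∑ _i : Fin n, 1 / (n : ℝ) * (Real.exp (-(Y ^ q / 2)) * (q * Y ^ (q - 1))) :=
            Finset.sum_le_sum fun i _ => hDi i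
        _ = _ := by simp; field_simp
    rw [rpow_sub_one_eq hY0.le (by linarith)] at hDs
    have h2 := mul_lt_mul_of_pos_right (hYb Y hc) hY0
    have h3 : τ ≤ lam * Y / 2 := by nlinarith
    rw [← hYdef] at h1
    nlinarith
  refine ⟨hlarge, fun j' r' => ⟨(hmax j' r').trans hYlt.le, (hneg j' r').trans ?_⟩, hY0.trans hYlt⟩
  exact mul_le_mul_of_nonneg_left hYlt.le (by positivity)

/-- A point is classified correctly if the noise responses are small and the alignments are as
after gradient descent. -/
lemma output_lt_of_gd_outcome {d : ℕ} {k₀ : Fin d} {z : DataPoint d} {e : Fin d → ℝ}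
    (hz : IsPoint α k₀ z e) {W : Weights m d} (hq : 0 < q) (hα : 0 ≤ α) {hi Yb b : ℝ}
    (hhi : 0 < hi) (hYb : 0 ≤ Yb) (hU : ∃ r, hi ≤ featU k₀ W z.2 r)
    (hneg : ∀ r, -featU k₀ W (-z.2) r ≤ b) (hle : ∀ r, featU k₀ W (-z.2) r ≤ Yb)
    (hnoise : ∀ r, noiseDot e W (-z.2) r ≤ α * Yb) (hb : 2 * α * Yb ≤ b)
    (hlt : 2 * m * b ^ q < hi ^ q) :
    output q W (-z.2) z.1 < output q W z.2 z.1 := by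
  have hb0 : 0 ≤ b := le_trans (by positivity) hb
  rw [hz.output_eq, hz.output_eq]
  obtain ⟨r, hr⟩ := hU
  calc _ ≤ ∑ _r : Fin m, (b ^ q + b ^ q) := by
        refine Finset.sum_le_sum fun r _ => add_le_add (act_le hq.le hb0 ?_) (act_le hq.le hb0 ?_)
        · rw [sgn_mul_sgn_neg, neg_one_mul]; exact hneg r
        · rw [sgn_mul_sgn_neg, neg_one_mul, mul_neg, sub_neg_eq_add]
          have := mul_le_mul_of_nonneg_left (hle r) hα
          linarith [hnoise r]
    _ = 2 * m * b ^ q := by simp; ring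
    _ < hi ^ q := hlt
    _ ≤ act q (sgn z.2 * sgn z.2 * featU k₀ W z.2 r) +
        act q (noiseDot e W z.2 r - α * (sgn z.2 * sgn z.2 * featU k₀ W z.2 r)) := by
        rw [sgn_mul_self, one_mul, act_of_nonneg (hhi.le.trans hr)]
        have := Real.rpow_le_rpow hhi.le hr hq.le
        linarith [act_nonneg (q := q) (noiseDot e W z.2 r - α * featU k₀ W z.2 r)]
    _ ≤ _ := Finset.single_le_sum (f := fun r => act q (sgn z.2 * sgn z.2 * featU k₀ W z.2 r) +
        act q (noiseDot e W z.2 r - α * (sgn z.2 * sgn z.2 * featU k₀ W z.2 r)))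
        (fun _ _ => add_nonneg (act_nonneg _) (act_nonneg _)) (Finset.mem_univ r)

end GDStationary

end AdamGD


namespace AdamGD

/-! ### The trajectory of approximate sign descent -/

section SignTrajectory

variable {n m d : ℕ} {q lam α η Θ C E₁ E₂ : ℝ} {k₀ : Fin d} {S : Fin n → DataPoint d}
  {e : Fin n → Fin d → ℝ} {W : ℕ → Weights m d} {T H s : ℕ}

/-- A run of approximate sign descent on a training set with disjoint noise supports of size at
most `s` and noise `ℓ¹`-norms between `E₁` and `E₂`. -/
structure SignRun (q lam α : ℝ) (k₀ : Fin d) (S : Fin n → DataPoint d) (e : Fin n → Fin d → ℝ)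
    (W : ℕ → Weights m d) (T H s : ℕ) (Θ C η E₁ E₂ : ℝ) : Prop where
  point : ∀ i, IsPoint α k₀ (S i) (e i)
  disj : ∀ i i' k, i ≠ i' → e i k = 0 ∨ e i' k = 0
  run : IsSignDescent (fun t a => W t a) (fun t a => lossGrad q lam S (W t) a) T H Θ C η
  hq : 3 ≤ q
  hlam : 0 < lam
  hα : 0 ≤ α
  hη : 0 < η
  hC : 0 ≤ C
  hΘ : 0 < Θ
  hE₁ : 0 < E₁
  card_le : ∀ i, (Finset.univ.filter fun k => e i k ≠ 0).card ≤ s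
  E_ge : ∀ i, E₁ ≤ ∑ k, |e i k|
  E_le : ∀ i, ∑ k, |e i k| ≤ E₂

lemma Obs.C_right_ge (O : Obs n m) {i : Fin n} {j : ℤˣ} {r : Fin m} {x : ℝ} (hq : 1 ≤ q)
    (hx : 0 ≤ x) (hX : x ≤ O.X α i j r) (hell : 1 / 4 ≤ O.ell q α i) :
    1 / (4 * (n : ℝ)) * (q * x ^ (q - 1)) ≤ O.C q α i j r := by
  unfold Obs.C
  rw [show 1 / (4 * (n : ℝ)) = 1 / n * (1 / 4) by rw [mul_comm 4, one_div_mul_one_div],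
    mul_assoc, mul_assoc]
  refine mul_le_mul_of_nonneg_left ?_ (by positivity)
  refine mul_le_mul hell ?_ (by positivity) (Obs.ell_pos i).le
  rw [← dact_of_nonneg hx]
  exact dact_mono hq hX

variable (R : SignRun q lam α k₀ S e W T H s Θ C η E₁ E₂)

include R

lemma SignRun.U_step {t : ℕ} (ht : t < T) (j : ℤˣ) (r : Fin m) :
    |(obs k₀ S e (W (t + 1))).U j r - (obs k₀ S e (W t)).U j r| ≤ C * η := by
  simp only [obs, featU]
  rw [← mul_sub, abs_mul, abs_sgn, one_mul]
  exact R.run.step t ht _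

/-- The alignment is the first entry of the weight or its negative according to `j`, so the two
directions of sign descent trade places. -/
lemma SignRun.U_down {t : ℕ} (ht : t < T) (hHt : H ≤ t) {j : ℤˣ} {r : Fin m}
    (h : Θ ≤ lam * (obs k₀ S e (W t)).U j r - ∑ i, (obs k₀ S e (W t)).D q α i j r +
      α * ∑ i, (obs k₀ S e (W t)).C q α i j r) :
    (obs k₀ S e (W (t + 1))).U j r ≤ (obs k₀ S e (W t)).U j r - 9 / 10 * η := by
  rw [← lossGrad_first R.point] at h
  simp only [obs, featU]
  rcases Int.units_eq_one_or j with hj | hj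
  · subst hj
    simp only [sgn, Units.val_one, Int.cast_one, one_mul] at h ⊢
    have := R.run.down t ht hHt (1, r, k₀) h
    linarith
  · subst hj
    simp only [sgn, Units.val_neg, Units.val_one, Int.cast_neg, Int.cast_one, neg_mul,
      one_mul] at h ⊢
    have := R.run.up t ht hHt (-1, r, k₀) (by linarith)
    linarith

lemma SignRun.H_step {t : ℕ} (ht : t < T) (i : Fin n) (j : ℤˣ) (r : Fin m) :
    |(obs k₀ S e (W (t + 1))).H i j r - (obs k₀ S e (W t)).H i j r| ≤ C * η * E₂ := by
  simp only [obs, noiseDot]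
  rw [← Finset.sum_sub_distrib]
  calc |∑ k, (e i k * W (t + 1) (j, r, k) - e i k * W t (j, r, k))|
      ≤ ∑ k, |e i k * W (t + 1) (j, r, k) - e i k * W t (j, r, k)| :=
        Finset.abs_sum_le_sum_abs _ _
    _ ≤ ∑ k, |e i k| * (C * η) := Finset.sum_le_sum fun k _ => by
        rw [← mul_sub, abs_mul]
        exact mul_le_mul_of_nonneg_left (R.run.step t ht _) (abs_nonneg _)
    _ = C * η * ∑ k, |e i k| := by rw [← Finset.sum_mul, mul_comm]
    _ ≤ _ := mul_le_mul_of_nonneg_left (R.E_le i) (mul_nonneg R.hC R.hη.le)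

/-- An entry on the support of a sample of the same class moves in the direction of the sample when
the noise force beats the weight decay. -/
lemma SignRun.entry_up {t : ℕ} (ht : t < T) (hHt : H ≤ t) {i : Fin n} {j : ℤˣ} {r : Fin m}
    (hi : (S i).2 = j) {k : Fin d}
    (h : Θ * |e i k| ≤ (obs k₀ S e (W t)).C q α i j r * e i k ^ 2 -
      lam * (e i k * W t (j, r, k))) :
    9 / 10 * η * |e i k| ≤ e i k * (W (t + 1) (j, r, k) - W t (j, r, k)) := by
  rcases eq_or_ne (e i k) 0 with h0 | h0
  · simp [h0]
  have hg := lossGrad_support (lam := lam) (q := q) R.point R.disj (W t) j r h0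
  rw [Obs.ss_right (show (obs k₀ S e (W t)).y i = j from hi), one_mul] at hg
  set c := (obs k₀ S e (W t)).C q α i j r
  rcases lt_or_gt_of_ne h0 with hneg | hpos
  · rw [abs_of_neg hneg] at h ⊢
    have h1 : Θ ≤ lossGrad q lam S (W t) (j, r, k) := by
      rw [hg]
      by_contra hc
      push Not at hc
      nlinarith
    have := R.run.down t ht hHt _ h1
    simp only at this
    nlinarith
  · rw [abs_of_pos hpos] at h ⊢
    have h1 : lossGrad q lam S (W t) (j, r, k) ≤ -Θ := by
      rw [hg]
      by_contra hc
      push Not at hc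
      nlinarith
    have := R.run.up t ht hHt _ h1
    simp only at this
    nlinarith

open Classical in
/-- The noise response grows when the weight decay dominates only on a small part of the support. -/
lemma SignRun.H_grow {t : ℕ} (ht : t < T) (hHt : H ≤ t) {i : Fin n} {j : ℤˣ} {r : Fin m}
    (hi : (S i).2 = j)
    (hbad : (1 + C) * ∑ k with (obs k₀ S e (W t)).C q α i j r * e i k ^ 2 -
      lam * (e i k * W t (j, r, k)) < Θ * |e i k|, |e i k| ≤ E₁ / 4) :
    (obs k₀ S e (W t)).H i j r + η * (E₁ / 2) ≤ (obs k₀ S e (W (t + 1))).H i j r := by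
  set P : Fin d → Prop := fun k => (obs k₀ S e (W t)).C q α i j r * e i k ^ 2 -
      lam * (e i k * W t (j, r, k)) < Θ * |e i k| with hP
  -- A bad entry can retreat by `C η`, so relative to the speed 9/10 it loses at most `1 + C`. As
  -- these losses total at most `E₁ / 4`, a net growth of `E₁ / 2` survives.
  have h1 : ∀ k, 9 / 10 * η * |e i k| - (if P k then η * ((1 + C) * |e i k|) else 0) ≤
      e i k * (W (t + 1) (j, r, k) - W t (j, r, k)) := by
    intro k
    by_cases hk : P k
    · rw [if_pos hk]
      have h2 := R.run.step t ht (j, r, k)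
      have h3 : |e i k * (W (t + 1) (j, r, k) - W t (j, r, k))| ≤ |e i k| * (C * η) := by
        rw [abs_mul]; exact mul_le_mul_of_nonneg_left h2 (abs_nonneg _)
      have h4 := (abs_le.1 h3).1
      nlinarith [mul_nonneg R.hη.le (abs_nonneg (e i k))]
    · rw [if_neg hk, sub_zero]
      exact R.entry_up ht hHt hi (not_lt.1 hk)
  have h2 := Finset.sum_le_sum fun k (_ : k ∈ Finset.univ) => h1 k
  rw [Finset.sum_sub_distrib, ← Finset.mul_sum, ← Finset.sum_filter, ← Finset.mul_sum,
    ← Finset.mul_sum] at h2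
  have h3 : ∑ k, e i k * (W (t + 1) (j, r, k) - W t (j, r, k)) =
      (obs k₀ S e (W (t + 1))).H i j r - (obs k₀ S e (W t)).H i j r := by
    simp only [obs, noiseDot, mul_sub, Finset.sum_sub_distrib]
  have h4 := mul_le_mul_of_nonneg_left (R.E_ge i) (by have := R.hη; positivity : 0 ≤ 9 / 10 * η)
  have h5 := mul_le_mul_of_nonneg_left hbad R.hη.le
  have h6 := mul_pos R.hη R.hE₁
  rw [h3] at h2
  linarith

/-- Entries on the support of a sample of the same class become almost nonnegative multiples of
the sample, and stay so. -/
lemma SignRun.entry_ge {w₁ θ₀ : ℝ} (hθ : Θ ≤ lam * θ₀) {tₐ : ℕ}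
    (hHa : H ≤ tₐ) (hw : ∀ a, |W H a| ≤ w₁) (hta : w₁ ≤ 9 / 10 * η * (tₐ - H : ℕ))
    {i : Fin n} {j : ℤˣ} (hi : (S i).2 = j) (r : Fin m) (k : Fin d) {t : ℕ} (hat : tₐ ≤ t)
    (htT : t ≤ T) : -((θ₀ + C * η) * |e i k|) ≤ e i k * W t (j, r, k) := by
  have hθ0 : 0 < θ₀ := by
    have := R.hΘ; have := R.hlam
    by_contra hc
    push Not at hc
    nlinarith
  -- Below `-θ₀` weight decay alone passes the threshold and lifts the entry at speed 9/10. Above it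
  -- a single step can lose only `C η`. The minimum of the two lower bounds covers both regimes.
  have hmain : ∀ u : ℕ, H + u ≤ T → min (-(w₁ * |e i k|) + 9 / 10 * η * u * |e i k|)
      (-((θ₀ + C * η) * |e i k|)) ≤ e i k * W (H + u) (j, r, k) := by
    intro u
    induction u with
    | zero =>
      intro _
      refine (min_le_left _ _).trans ?_
      have h1 : |e i k * W H (j, r, k)| ≤ |e i k| * w₁ := by
        rw [abs_mul]; exact mul_le_mul_of_nonneg_left (hw _) (abs_nonneg _)
      have := (abs_le.1 h1).1
      simp only [Nat.cast_zero, mul_zero, zero_mul, add_zero]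
      linarith
    | succ u ih =>
      intro hu
      have ih := ih (by omega)
      rw [← add_assoc]
      rcases le_or_gt (e i k * W (H + u) (j, r, k)) (-(θ₀ * |e i k|)) with h | h
      · have h2 : Θ * |e i k| ≤ (obs k₀ S e (W (H + u))).C q α i j r * e i k ^ 2 -
            lam * (e i k * W (H + u) (j, r, k)) := by
          have h3 : 0 ≤ (obs k₀ S e (W (H + u))).C q α i j r * e i k ^ 2 :=
            mul_nonneg (Obs.C_nonneg (by linarith [R.hq]) i j r) (sq_nonneg _)
          have h4 := mul_le_mul_of_nonneg_left h R.hlam.le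
          have h5 := mul_le_mul_of_nonneg_right hθ (abs_nonneg (e i k))
          linarith
        have h3 := R.entry_up (by omega) (by omega) hi h2
        have h4 : 0 ≤ 9 / 10 * η * |e i k| := by have := R.hη; positivity
        have h5 : min (-(w₁ * |e i k|) + 9 / 10 * η * (u + 1 : ℕ) * |e i k|)
            (-((θ₀ + C * η) * |e i k|)) ≤ min (-(w₁ * |e i k|) + 9 / 10 * η * u * |e i k|)
            (-((θ₀ + C * η) * |e i k|)) + 9 / 10 * η * |e i k| := by
          rw [← min_add_add_right]
          refine min_le_min ?_ (by linarith)
          push_cast; linarith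
        linarith
      · refine (min_le_right _ _).trans ?_
        have h2 := R.run.step (H + u) (by omega) (j, r, k)
        have h3 : |e i k * (W (H + u + 1) (j, r, k) - W (H + u) (j, r, k))| ≤ |e i k| * (C * η) := by
          rw [abs_mul]; exact mul_le_mul_of_nonneg_left h2 (abs_nonneg _)
        have := (abs_le.1 h3).1
        linarith
  have h := hmain (t - H) (by omega)
  rw [Nat.add_sub_cancel' (by omega)] at h
  refine le_trans (le_min ?_ le_rfl) h
  have h1 : ((tₐ - H : ℕ) : ℝ) ≤ ((t - H : ℕ) : ℝ) := by exact_mod_cast (by omega : tₐ - H ≤ t - H)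
  have h2 : w₁ ≤ 9 / 10 * η * ((t - H : ℕ) : ℝ) :=
    hta.trans (mul_le_mul_of_nonneg_left h1 (by have := R.hη; positivity))
  have h3 := mul_le_mul_of_nonneg_right h2 (abs_nonneg (e i k))
  have h4 : 0 ≤ (θ₀ + C * η) * |e i k| :=
    mul_nonneg (add_nonneg hθ0.le (mul_nonneg R.hC R.hη.le)) (abs_nonneg _)
  linarith

/-- Once nonpositive, the alignments with the feature stay below a small barrier. -/
lemma SignRun.U_le {δ : ℝ} (hδ : 0 < δ) (hqδ : q * δ ^ (q - 2) ≤ lam / 2)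
    (hΘδ : Θ ≤ lam * δ / 4) (hCδ : C * η ≤ δ / 2) {tₐ : ℕ} (hHa : H ≤ tₐ)
    {j : ℤˣ} {r : Fin m} (h0 : (obs k₀ S e (W tₐ)).U j r ≤ 0) {t : ℕ} (hat : tₐ ≤ t)
    (htT : t ≤ T) : (obs k₀ S e (W t)).U j r ≤ δ := by
  have hq := R.hq
  induction t, hat using Nat.le_induction with
  | base => linarith
  | succ t hat ih =>
    have ih := ih (by omega)
    have hst := (abs_le.1 (R.U_step (j := j) (r := r) (by omega : t < T))).2
    rcases le_or_gt ((obs k₀ S e (W t)).U j r) (δ / 2) with h | h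
    · linarith
    · have := R.U_down (t := t) (j := j) (r := r) (by omega) (by omega) ?_
      · have := R.hη; linarith
      · set u := (obs k₀ S e (W t)).U j r with hu
        have hu0 : 0 < u := by linarith
        have hn : (0 : ℝ) ≤ n := Nat.cast_nonneg n
        have hDi : ∀ i, (obs k₀ S e (W t)).D q α i j r ≤ 1 / (n : ℝ) * (q * u ^ (q - 1)) := by
          intro i
          unfold Obs.D
          rw [mul_assoc]
          refine mul_le_mul_of_nonneg_left ?_ (by positivity)
          have h1 : (obs k₀ S e (W t)).ss i j * (obs k₀ S e (W t)).U j r ≤ u := by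
            rcases units_eq_or_eq_neg ((obs k₀ S e (W t)).y i) j with hi | hi
            · rw [Obs.ss_right hi, one_mul]
            · rw [Obs.ss_wrong hi]; linarith
          calc _ ≤ 1 * (q * u ^ (q - 1)) := mul_le_mul (Obs.ell_le_one i)
                (dact_le (by linarith) hu0.le h1) (dact_nonneg (by linarith) _) zero_le_one
            _ = _ := one_mul _
        have hDs : ∑ i, (obs k₀ S e (W t)).D q α i j r ≤ q * u ^ (q - 1) := by
          rcases Nat.eq_zero_or_pos n with h0 | h0
          · subst h0
            simp only [Finset.univ_eq_empty, Finset.sum_empty]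
            positivity
          · have hn' : (n : ℝ) ≠ 0 := by positivity
            calc _ ≤ ∑ _i : Fin n, 1 / (n : ℝ) * (q * u ^ (q - 1)) :=
                  Finset.sum_le_sum fun i _ => hDi i
              _ = _ := by simp; field_simp
        -- Since `u ≤ δ`, the feature force takes at most half of the weight decay. As `u > δ / 2`,
        -- the other half exceeds the threshold, so the alignment moves down.
        have h1 : q * u ^ (q - 1) ≤ lam / 2 * u := by
          rw [rpow_sub_one_eq hu0.le (by linarith), ← mul_assoc]
          refine mul_le_mul_of_nonneg_right (le_trans ?_ hqδ) hu0.le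
          exact mul_le_mul_of_nonneg_left (Real.rpow_le_rpow hu0.le ih (by linarith)) (by linarith)
        have h2 : 0 ≤ α * ∑ i, (obs k₀ S e (W t)).C q α i j r :=
          mul_nonneg R.hα (Finset.sum_nonneg fun i _ => Obs.C_nonneg (by linarith) i j r)
        have h3 := mul_lt_mul_of_pos_left h R.hlam
        linarith

lemma SignRun.X_step {t : ℕ} (ht : t < T) (i : Fin n) (j : ℤˣ) (r : Fin m) :
    (obs k₀ S e (W t)).X α i j r - C * η * (E₂ + α) ≤ (obs k₀ S e (W (t + 1))).X α i j r := by
  have h1 := (abs_le.1 (R.H_step ht i j r)).1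
  have h2 := R.U_step ht j r
  have h3 : |(obs k₀ S e (W t)).ss i j *
      ((obs k₀ S e (W (t + 1))).U j r - (obs k₀ S e (W t)).U j r)| ≤ C * η := by
    rw [abs_mul, Obs.ss, abs_mul, abs_sgn, abs_sgn, one_mul, one_mul]; exact h2
  have h4 := mul_le_mul_of_nonneg_left (abs_le.1 h3).2 R.hα
  have h5 : (obs k₀ S e (W (t + 1))).ss i j = (obs k₀ S e (W t)).ss i j := rfl
  simp only [Obs.X, h5]
  linarith

/-- Every sample keeps being memorised by some neuron. -/
lemma SignRun.exists_X_ge {δ θ₁ xc xb : ℝ} (hδ : 0 < δ) (hθ₁ : 0 ≤ θ₁) (hxc : 0 < xc)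
    (hcb : 2 * xc ≤ xb) {tₐ : ℕ} (hHa : H ≤ tₐ)
    (hU : ∀ t, tₐ ≤ t → t ≤ T → ∀ j r, (obs k₀ S e (W t)).U j r ≤ δ)
    (hent : ∀ t, tₐ ≤ t → t ≤ T → ∀ i r k,
      -(θ₁ * |e i k|) ≤ e i k * W t ((S i).2, r, k))
    (hsmall : m * (δ ^ q + xb ^ q) ≤ 1) (hstep : C * η * (E₂ + α) ≤ xc)
    (herr : lam * (α * δ + θ₁ * E₂) + Θ * E₂ ≤ lam * xc)
    (hbad : (1 + C) ^ 2 * (s * (8 * n * lam)) ≤ q * xc ^ (q - 2) * (E₁ / 4) ^ 2)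
    (hαC : α * C ≤ E₁ / 2) (i : Fin n)
    (h0 : ∃ r, xc ≤ (obs k₀ S e (W tₐ)).X α i (S i).2 r) {t : ℕ} (hat : tₐ ≤ t) (htT : t ≤ T) :
    ∃ r, xc ≤ (obs k₀ S e (W t)).X α i (S i).2 r := by
  have hq := R.hq
  have hn : 0 < (n : ℝ) := by exact_mod_cast i.pos
  have hlam := R.hlam
  have hη := R.hη
  have hC := R.hC
  induction t, hat using Nat.le_induction with
  | base => exact h0
  | succ t hat ih =>
    obtain ⟨r₁, hr₁⟩ := ih (by omega)
    obtain ⟨r, -, hr⟩ := Finset.exists_max_image Finset.univ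
      (fun r => (obs k₀ S e (W t)).X α i (S i).2 r) ⟨r₁, Finset.mem_univ _⟩
    have hmax : ∀ r', (obs k₀ S e (W t)).X α i (S i).2 r' ≤ (obs k₀ S e (W t)).X α i (S i).2 r :=
      fun r' => hr r' (Finset.mem_univ _)
    have hge := hr₁.trans (hmax r₁)
    refine ⟨r, ?_⟩
    have hst := R.X_step (t := t) (by omega) i (S i).2 r
    -- A response above `xb` stays above `xc` for one step because a step loses at most `xc`. Below
    -- `xb` the sample is unfitted and the response must be shown not to decrease.
    rcases le_or_gt xb ((obs k₀ S e (W t)).X α i (S i).2 r) with hbig | hlt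
    · linarith
    set x := (obs k₀ S e (W t)).X α i (S i).2 r with hx
    have hx0 : 0 < x := hxc.trans_le hge
    have hX := fun t => Obs.X_right (α := α) (show (obs k₀ S e (W t)).y i = (S i).2 from rfl) r
    have hell : 1 / 4 ≤ (obs k₀ S e (W t)).ell q α i := by
      refine Obs.quarter_le_ell _ ?_
      refine (Obs.out_le _ (by linarith) hδ.le (by linarith : 0 ≤ xb) (fun r' => ?_)
        (fun r' => ?_)).trans hsmall
      · rw [Obs.ss_right rfl, one_mul]; exact hU t hat (by omega) _ _
      · exact (hmax r').trans hlt.le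
    have hc := Obs.C_right_ge (obs k₀ S e (W t)) (by linarith) hx0.le hx.le hell
    have hgrow := R.H_grow (t := t) (r := r) (by omega) (by omega) (rfl : (S i).2 = (S i).2) ?_
    · have h2 := R.U_step (t := t) (by omega) (S i).2 r
      have h3 := mul_le_mul_of_nonneg_left (abs_le.1 h2).2 R.hα
      have h4 := mul_le_mul_of_nonneg_left hαC hη.le
      rw [hX] at hx ⊢
      linarith
    · set c := (obs k₀ S e (W t)).C q α i (S i).2 r with hcdef
      have hc0 : 0 < c := lt_of_lt_of_le (by positivity) hc
      set P := Finset.univ.filter fun k => c * e i k ^ 2 - lam * (e i k * W t ((S i).2, r, k)) <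
        Θ * |e i k| with hP
      have hent' := fun k => hent t hat (by omega) i r k
      have hH : (obs k₀ S e (W t)).H i (S i).2 r ≤ x + α * δ := by
        have h1 := hU t hat (by omega) (S i).2 r
        have h2 := mul_le_mul_of_nonneg_left h1 R.hα
        rw [hX] at hx
        linarith
      have hE2 : 0 ≤ E₂ := (Finset.sum_nonneg fun _ _ => abs_nonneg _).trans (R.E_le i)
      -- On bad entries the noise force is at most the weight decay plus the threshold. Adding the
      -- deviation `θ₁` makes every summand nonnegative, so the sum extends to all coordinates and
      -- becomes the full response, itself about `x`.
      have hsq : c * ∑ k ∈ P, e i k ^ 2 ≤ 2 * lam * x := by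
        calc c * ∑ k ∈ P, e i k ^ 2 = ∑ k ∈ P, c * e i k ^ 2 := Finset.mul_sum _ _ _
          _ ≤ ∑ k ∈ P, (lam * (e i k * W t ((S i).2, r, k) + θ₁ * |e i k|) + Θ * |e i k|) :=
              Finset.sum_le_sum fun k hk => by
                have h1 := (Finset.mem_filter.1 hk).2
                have h2 : 0 ≤ lam * (θ₁ * |e i k|) := by positivity
                linarith
          _ ≤ ∑ k, (lam * (e i k * W t ((S i).2, r, k) + θ₁ * |e i k|) + Θ * |e i k|) :=
              Finset.sum_le_sum_of_subset_of_nonneg (Finset.filter_subset _ _) fun k _ _ =>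
                add_nonneg (mul_nonneg hlam.le (by linarith [hent' k]))
                  (mul_nonneg R.hΘ.le (abs_nonneg _))
          _ = lam * ((obs k₀ S e (W t)).H i (S i).2 r + θ₁ * ∑ k, |e i k|) +
                Θ * ∑ k, |e i k| := by
              simp only [Finset.sum_add_distrib, ← Finset.mul_sum]; rfl
          _ ≤ lam * ((x + α * δ) + θ₁ * E₂) + Θ * E₂ := by
              have := R.E_le i
              have := R.hΘ
              gcongr
          _ ≤ 2 * lam * x := by
              have := mul_le_mul_of_nonneg_left hge hlam.le
              linarith
      have hcard : (Finset.card (P.filter fun k => e i k ≠ 0) : ℝ) ≤ s := by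
        exact_mod_cast (Finset.card_le_card (Finset.filter_subset_filter _
          (Finset.subset_univ P))).trans (R.card_le i)
      -- Cauchy–Schwarz on a support of size at most `s` turns a small `ℓ²` mass of bad entries into
      -- a small `ℓ¹` mass, as `H_grow` requires.
      have hCS : (∑ k ∈ P, |e i k|) ^ 2 ≤ s * ∑ k ∈ P, e i k ^ 2 := by
        have h1 : ∑ k ∈ P, |e i k| = ∑ k ∈ P.filter (fun k => e i k ≠ 0), |e i k| := by
          exact (Finset.sum_filter_of_ne fun k _ h => by simpa using h).symm
        rw [h1]
        refine (sq_sum_le_card_mul_sum_sq).trans ?_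
        refine mul_le_mul hcard ?_ (Finset.sum_nonneg fun _ _ => sq_nonneg _) (Nat.cast_nonneg _)
        simp only [sq_abs]
        exact Finset.sum_le_sum_of_subset_of_nonneg (Finset.filter_subset _ _)
          fun _ _ _ => sq_nonneg _
      have hxpow : xc ^ (q - 2) ≤ x ^ (q - 2) := Real.rpow_le_rpow hxc.le hge (by linarith)
      rw [rpow_sub_one_eq hx0.le (by linarith)] at hc
      have hsq2 : q * xc ^ (q - 2) * ∑ k ∈ P, e i k ^ 2 ≤ 8 * n * lam := by
        have h1 : 1 / (4 * (n : ℝ)) * (q * (xc ^ (q - 2) * x)) ≤ c := by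
          refine le_trans ?_ hc
          gcongr
        have h2 : 0 ≤ ∑ k ∈ P, e i k ^ 2 := Finset.sum_nonneg fun _ _ => sq_nonneg _
        have h3 := (mul_le_mul_of_nonneg_right h1 h2).trans hsq
        -- Force and weight decay share a factor `x`; after cancelling it the bound is uniform in
        -- the size of the response.
        have h4 : x * (q * xc ^ (q - 2) * ∑ k ∈ P, e i k ^ 2) ≤ x * (8 * n * lam) := by
          have h5 : 1 / (4 * (n : ℝ)) * (q * (xc ^ (q - 2) * x)) * ∑ k ∈ P, e i k ^ 2 =
            (x * (q * xc ^ (q - 2) * ∑ k ∈ P, e i k ^ 2)) / (4 * n) := by field_simp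
          rw [h5, div_le_iff₀ (by positivity)] at h3
          linarith
        exact le_of_mul_le_mul_left h4 hx0
      refine abs_le_of_sq_le_sq' ?_ (by linarith [R.hE₁]) |>.2
      have hpos : 0 < q * xc ^ (q - 2) := by positivity
      refine le_of_mul_le_mul_left ?_ hpos
      calc q * xc ^ (q - 2) * ((1 + C) * ∑ k ∈ P, |e i k|) ^ 2
          = (1 + C) ^ 2 * (q * xc ^ (q - 2) * (∑ k ∈ P, |e i k|) ^ 2) := by ring
        _ ≤ (1 + C) ^ 2 * (q * xc ^ (q - 2) * (s * ∑ k ∈ P, e i k ^ 2)) := by gcongr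
        _ = (1 + C) ^ 2 * (s * (q * xc ^ (q - 2) * ∑ k ∈ P, e i k ^ 2)) := by ring
        _ ≤ (1 + C) ^ 2 * (s * (8 * n * lam)) := by gcongr
        _ ≤ _ := hbad

end SignTrajectory

end AdamGD


/-! ### The initial phase of approximate sign descent. -/

namespace AdamGD

section SignStart

variable {n m d : ℕ} {q lam α η Θ C E₁ E₂ : ℝ} {k₀ : Fin d} {S : Fin n → DataPoint d}
  {e : Fin n → Fin d → ℝ} {W : ℕ → Weights m d} {T H s : ℕ}

/-- The hypotheses on the start of approximate sign descent: up to time `tₐ` the weights are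
bounded by `w₁`, responses of size `x₀` suffice for growth, and after `t₀` steps the noise dominates
the feature. -/
structure SignStart (α q lam : ℝ) (k₀ : Fin d) (S : Fin n → DataPoint d) (e : Fin n → Fin d → ℝ)
    (W : ℕ → Weights m d) (H s : ℕ) (Θ C η E₁ E₂ w₀ w₁ x₀ θ : ℝ) (t₀ tₐ : ℕ) : Prop where
  w_le : ∀ a, |W 0 a| ≤ w₀
  w₁_ge : w₀ + C * η * tₐ ≤ w₁
  x₀_pos : 0 < x₀
  θ_ge : Θ ≤ θ
  small : m * (w₁ ^ q + ((E₂ + α) * w₁) ^ q) ≤ 1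
  bad : (1 + C) * (s * (lam * w₁ + θ)) ≤ 1 / (4 * (n : ℝ)) * (q * (x₀ / 2) ^ (q - 1)) * (E₁ / 4)
  αw : α * w₁ ≤ x₀ / 4
  burn : C * η * E₂ * H ≤ x₀ / 4
  time : H + t₀ ≤ tₐ
  force : lam * w₁ + q * w₁ ^ (q - 1) + Θ ≤
    α * (1 / (4 * (n : ℝ)) * (q * (t₀ * (η * (E₁ / 2))) ^ (q - 1)))
  descend : w₀ + C * η * (H + t₀) ≤ 9 / 10 * η * (tₐ - (H + t₀) : ℕ)
  active_sample : ∀ i, ∃ r, x₀ ≤ (obs k₀ S e (W 0)).H i (S i).2 r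
  active_neuron : ∀ j r, ∃ i, (S i).2 = j ∧ x₀ ≤ (obs k₀ S e (W 0)).H i j r

variable {w₀ w₁ x₀ θ : ℝ} {t₀ tₐ : ℕ} (R : SignRun q lam α k₀ S e W T H s Θ C η E₁ E₂)
  (B : SignStart α q lam k₀ S e W H s Θ C η E₁ E₂ w₀ w₁ x₀ θ t₀ tₐ)

include R B

lemma SignStart.w_bound_linear {t : ℕ} (ht : t ≤ T) (a : Idx m d) :
    |W t a| ≤ w₀ + C * η * t := by
  induction t with
  | zero => simpa using B.w_le a
  | succ t ih =>
    have h1 := ih (by omega)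
    have h2 := R.run.step t (by omega) a
    have h3 := (abs_add_le (W t a) (W (t + 1) a - W t a)).trans (add_le_add h1 h2)
    rw [add_sub_cancel] at h3
    push_cast
    linarith

lemma SignStart.w_bound (haT : tₐ ≤ T) {t : ℕ} (ht : t ≤ tₐ) (a : Idx m d) : |W t a| ≤ w₁ := by
  refine (B.w_bound_linear R (ht.trans haT) a).trans (le_trans ?_ B.w₁_ge)
  have h1 : (t : ℝ) ≤ tₐ := by exact_mod_cast ht
  have := mul_le_mul_of_nonneg_left h1 (mul_nonneg R.hC R.hη.le)
  linarith

lemma SignStart.w₁_nonneg (i : Fin n) (r : Fin m) : 0 ≤ w₁ := by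
  have h := B.w_le ((S i).2, r, k₀)
  have h1 : 0 ≤ C * η * tₐ := mul_nonneg (mul_nonneg R.hC R.hη.le) (Nat.cast_nonneg _)
  linarith [abs_nonneg (W 0 ((S i).2, r, k₀)), B.w₁_ge]

lemma SignStart.U_abs_le (haT : tₐ ≤ T) {t : ℕ} (ht : t ≤ tₐ) (j : ℤˣ) (r : Fin m) :
    |(obs k₀ S e (W t)).U j r| ≤ w₁ := by
  simp only [obs, featU]
  rw [abs_mul, abs_sgn, one_mul]
  exact B.w_bound R haT ht _

lemma SignStart.X_le (haT : tₐ ≤ T) {t : ℕ} (ht : t ≤ tₐ) (i : Fin n) (j : ℤˣ) (r : Fin m) :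
    (obs k₀ S e (W t)).X α i j r ≤ (E₂ + α) * w₁ := by
  have hw := B.w₁_nonneg R i r
  have h1 : |(obs k₀ S e (W t)).H i j r| ≤ E₂ * w₁ := by
    simp only [obs, noiseDot]
    calc |∑ k, e i k * W t (j, r, k)| ≤ ∑ k, |e i k * W t (j, r, k)| :=
          Finset.abs_sum_le_sum_abs _ _
      _ ≤ ∑ k, |e i k| * w₁ := Finset.sum_le_sum fun k _ => by
          rw [abs_mul]
          exact mul_le_mul_of_nonneg_left (B.w_bound R haT ht _) (abs_nonneg _)
      _ ≤ _ := by
          rw [← Finset.sum_mul]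
          exact mul_le_mul_of_nonneg_right (R.E_le i) hw
  have h2 : |(obs k₀ S e (W t)).ss i j * (obs k₀ S e (W t)).U j r| ≤ w₁ := by
    rw [abs_mul, Obs.ss, abs_mul, abs_sgn, abs_sgn, one_mul, one_mul]
    exact B.U_abs_le R haT ht j r
  have h3 := mul_le_mul_of_nonneg_left (abs_le.1 h2).1 R.hα
  unfold Obs.X
  linarith [(abs_le.1 h1).2]

lemma SignStart.ell_ge (haT : tₐ ≤ T) {t : ℕ} (ht : t ≤ tₐ) (i : Fin n) (r : Fin m) :
    1 / 4 ≤ (obs k₀ S e (W t)).ell q α i := by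
  have hw := B.w₁_nonneg R i r
  have hE : 0 ≤ E₂ := (Finset.sum_nonneg fun _ _ => abs_nonneg _).trans (R.E_le i)
  refine Obs.quarter_le_ell _ ((Obs.out_le _ (by linarith [R.hq]) hw
    (mul_nonneg (add_nonneg hE R.hα) hw) (fun r' => ?_) (fun r' => B.X_le R haT ht i _ r')).trans
    B.small)
  rw [Obs.ss_right rfl, one_mul]
  exact (le_abs_self _).trans (B.U_abs_le R haT ht _ r')

open Classical in
/-- The entries at which the noise force does not dominate carry little mass. -/
lemma SignStart.sum_bad_le (haT : tₐ ≤ T) {t : ℕ} (ht : t ≤ tₐ) {i : Fin n} {r : Fin m}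
    (hX : x₀ / 2 ≤ (obs k₀ S e (W t)).X α i (S i).2 r) {P : Fin d → Prop}
    (hP : ∀ k, e i k ≠ 0 → P k →
      (obs k₀ S e (W t)).C q α i (S i).2 r * |e i k| ≤ lam * w₁ + θ) :
    (1 + C) * ∑ k with P k, |e i k| ≤ E₁ / 4 := by
  have hq := R.hq
  have hn : 0 < (n : ℝ) := by exact_mod_cast i.pos
  have hc := Obs.C_right_ge (obs k₀ S e (W t)) (by linarith) (by linarith [B.x₀_pos]) hX
    (B.ell_ge R haT ht i r)
  set c := (obs k₀ S e (W t)).C q α i (S i).2 r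
  have hx := B.x₀_pos
  have hc0 : 0 < 1 / (4 * (n : ℝ)) * (q * (x₀ / 2) ^ (q - 1)) := by positivity
  set c₀ := 1 / (4 * (n : ℝ)) * (q * (x₀ / 2) ^ (q - 1)) with hc₀def
  have hw := B.w₁_nonneg R i r
  have hω : 0 ≤ lam * w₁ + θ := by
    have := R.hlam; have := R.hΘ; have := B.θ_ge
    have : 0 < θ := by linarith
    positivity
  have h1 : c₀ * ∑ k with P k, |e i k| ≤ s * (lam * w₁ + θ) := by
    have e1 : ∑ k with P k, |e i k| =
        ∑ k ∈ (Finset.univ.filter P).filter (fun k => e i k ≠ 0), |e i k| :=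
      (Finset.sum_filter_of_ne fun k _ h => by simpa using h).symm
    rw [e1, Finset.mul_sum]
    have hcard : (Finset.card ((Finset.univ.filter P).filter fun k => e i k ≠ 0) : ℝ) ≤ s := by
      exact_mod_cast (Finset.card_le_card (Finset.filter_subset_filter _
        (Finset.subset_univ _))).trans (R.card_le i)
    calc _ ≤ ∑ _k ∈ (Finset.univ.filter P).filter (fun k => e i k ≠ 0), (lam * w₁ + θ) := by
          refine Finset.sum_le_sum fun k hk => ?_
          obtain ⟨hk1, hk2⟩ := Finset.mem_filter.1 hk
          exact (mul_le_mul_of_nonneg_right hc (abs_nonneg _)).trans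
            (hP k hk2 (Finset.mem_filter.1 hk1).2)
      _ = _ := by rw [Finset.sum_const, nsmul_eq_mul]
      _ ≤ _ := mul_le_mul_of_nonneg_right hcard hω
  refine le_of_mul_le_mul_left ?_ hc0
  have h2 := mul_le_mul_of_nonneg_left h1 (by linarith [R.hC] : 0 ≤ 1 + C)
  have h3 := B.bad
  linarith

/-- The responses of active pairs grow linearly. -/
lemma SignStart.X_ge (haT : tₐ ≤ T) {i : Fin n} {r : Fin m}
    (h0 : x₀ ≤ (obs k₀ S e (W 0)).H i (S i).2 r) {t : ℕ} (ht : t ≤ tₐ) :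
    x₀ / 2 + (t - H : ℕ) * (η * (E₁ / 2)) ≤ (obs k₀ S e (W t)).X α i (S i).2 r := by
  have hη := R.hη
  have hE : 0 ≤ E₂ := (Finset.sum_nonneg fun _ _ => abs_nonneg _).trans (R.E_le i)
  have hE1 := R.hE₁
  have hXH : ∀ t ≤ tₐ, (obs k₀ S e (W t)).H i (S i).2 r - x₀ / 4 ≤
      (obs k₀ S e (W t)).X α i (S i).2 r := by
    intro t ht
    have e1 := Obs.X_right (α := α) (show (obs k₀ S e (W t)).y i = (S i).2 from rfl) r
    have h1 := mul_le_mul_of_nonneg_left ((le_abs_self _).trans (B.U_abs_le R haT ht (S i).2 r)) R.hα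
    have h2 := B.αw
    rw [e1]; linarith
  -- During the burn-in the response may lose `C η E₂` per step, in total at most `x₀ / 4`;
  -- afterwards each step gains `η E₁ / 2`. Truncated subtraction and `min` put both phases into one
  -- formula.
  have hmain : ∀ t ≤ tₐ, x₀ - C * η * E₂ * (min t H : ℕ) + (t - H : ℕ) * (η * (E₁ / 2)) ≤
      (obs k₀ S e (W t)).H i (S i).2 r := by
    intro t
    induction t with
    | zero => intro _; simpa using h0
    | succ t ih =>
      intro ht
      have ih := ih (by omega)
      rcases lt_or_ge t H with h | h
      · have h1 := (abs_le.1 (R.H_step (by omega : t < T) i (S i).2 r)).1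
        have e1 : t - H = 0 := by omega
        have e2 : t + 1 - H = 0 := by omega
        rw [e1, min_eq_left h.le] at ih
        rw [e2, min_eq_left (by omega)]
        push_cast at ih ⊢
        linarith
      · have hb : C * η * E₂ * (min t H : ℕ) ≤ x₀ / 4 := by rw [min_eq_right h]; exact B.burn
        have hX : x₀ / 2 ≤ (obs k₀ S e (W t)).X α i (S i).2 r := by
          have h1 := hXH t (by omega)
          have h2 : 0 ≤ ((t - H : ℕ) : ℝ) * (η * (E₁ / 2)) := by positivity
          linarith
        have hg := R.H_grow (t := t) (r := r) (by omega) h (rfl : (S i).2 = (S i).2)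
          (B.sum_bad_le R haT (by omega) hX (fun k hk hPk => by
            have h1 := B.w_bound R haT (by omega : t ≤ tₐ) ((S i).2, r, k)
            have h2 : e i k * W t ((S i).2, r, k) ≤ |e i k| * w₁ := by
              refine (le_abs_self _).trans ?_
              rw [abs_mul]; exact mul_le_mul_of_nonneg_left h1 (abs_nonneg _)
            have h3 := mul_le_mul_of_nonneg_left h2 R.hlam.le
            have h4 := abs_pos.2 hk
            have h5 := mul_le_mul_of_nonneg_right B.θ_ge h4.le
            refine le_of_mul_le_mul_right ?_ h4
            rw [mul_assoc, ← sq, sq_abs]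
            linarith))
        have e1 : t + 1 - H = (t - H) + 1 := by omega
        rw [e1, min_eq_right (by omega)]
        rw [min_eq_right h] at ih
        push_cast
        linarith
  have h1 := hmain t ht
  have h2 := hXH t ht
  have h3 : C * η * E₂ * (min t H : ℕ) ≤ x₀ / 4 := by
    refine le_trans (mul_le_mul_of_nonneg_left ?_ (mul_nonneg (mul_nonneg R.hC hη.le) hE)) B.burn
    exact_mod_cast min_le_right t H
  linarith

/-- The gradient is not small during the initial phase. -/
lemma SignStart.exists_grad_ge (haT : tₐ ≤ T) (hn : 0 < n) {t : ℕ} (ht : t ≤ tₐ) :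
    ∃ a, θ ≤ |lossGrad q lam S (W t) a| := by
  classical
  set i : Fin n := ⟨0, hn⟩
  obtain ⟨r, hr⟩ := B.active_sample i
  by_contra hcon
  push Not at hcon
  have hX := B.X_ge R haT hr ht
  have hη := R.hη
  have hE1 := R.hE₁
  have hX' : x₀ / 2 ≤ (obs k₀ S e (W t)).X α i (S i).2 r := by
    have h2 : 0 ≤ ((t - H : ℕ) : ℝ) * (η * (E₁ / 2)) := by positivity
    linarith
  -- If every gradient entry were below `θ`, the force could not dominate anywhere on the support.
  -- The bad set would then carry the whole `ℓ¹` norm instead of at most a quarter.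
  have h := B.sum_bad_le R haT ht hX' (P := fun _ => True) (fun k hk _ => by
    have hg := lossGrad_support (lam := lam) (q := q) R.point R.disj (W t) (S i).2 r hk
    rw [Obs.ss_right (show (obs k₀ S e (W t)).y i = (S i).2 from rfl), one_mul] at hg
    have h1 := hcon ((S i).2, r, k)
    have h2 := mul_le_mul_of_nonneg_left (B.w_bound R haT ht ((S i).2, r, k)) R.hlam.le
    have hc : 0 ≤ (obs k₀ S e (W t)).C q α i (S i).2 r := Obs.C_nonneg (by linarith [R.hq]) _ _ _
    rw [← abs_of_nonneg hc, ← abs_mul]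
    have e1 : (obs k₀ S e (W t)).C q α i (S i).2 r * e i k = lam * W t ((S i).2, r, k) -
      lossGrad q lam S (W t) ((S i).2, r, k) := by rw [hg]; ring
    rw [e1]
    refine (abs_sub _ _).trans (add_le_add ?_ h1.le)
    rw [abs_mul, abs_of_pos R.hlam]
    exact h2)
  simp only [Finset.filter_true] at h
  have h2 := R.E_ge i
  have h3 := R.hC
  nlinarith

/-- At the end of the initial phase all alignments with the feature are nonpositive. -/
lemma SignStart.U_nonpos (haT : tₐ ≤ T) (j : ℤˣ) (r : Fin m) :
    (obs k₀ S e (W tₐ)).U j r ≤ 0 := by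
  obtain ⟨i, rfl, hi⟩ := B.active_neuron j r
  have hq := R.hq
  have hη := R.hη
  have hE1 := R.hE₁
  have hn : 0 < (n : ℝ) := by exact_mod_cast i.pos
  have hw := B.w₁_nonneg R i r
  have hstart : ∀ t : ℕ, t ≤ tₐ → (obs k₀ S e (W t)).U (S i).2 r ≤ w₀ + C * η * t := by
    intro t
    induction t with
    | zero =>
      intro _
      refine (le_abs_self _).trans ?_
      simp only [obs, featU]
      rw [abs_mul, abs_sgn, one_mul]
      simpa using B.w_le ((S i).2, r, k₀)
    | succ t ih =>
      intro ht
      have h1 := ih (by omega)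
      have h2 := (abs_le.1 (R.U_step (by omega : t < T) (S i).2 r)).2
      push_cast
      linarith
  -- Before time `H + t₀` the alignment may rise at speed `C η`; from then on the noise controls the
  -- first coordinate and the alignment falls by `9/10 η` per step.
  have hmain : ∀ u : ℕ, H + t₀ + u ≤ tₐ → (obs k₀ S e (W (H + t₀ + u))).U (S i).2 r ≤
      w₀ + C * η * (H + t₀) - 9 / 10 * η * u := by
    intro u
    induction u with
    | zero =>
      intro h
      have := hstart (H + t₀) B.time
      push_cast at this
      simpa using this
    | succ u ih =>
      intro hu
      have ih := ih (by omega)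
      have h1 := R.U_down (t := H + t₀ + u) (j := (S i).2) (r := r) (by omega) (by omega) ?_
      · rw [← add_assoc]
        push_cast
        linarith
      · set t := H + t₀ + u with ht
        have hU := abs_le.1 (B.U_abs_le R haT (by omega : t ≤ tₐ) (S i).2 r)
        have hX := B.X_ge R haT hi (by omega : t ≤ tₐ)
        -- At least `t₀` steps after the burn-in one active sample already has this response. By
        -- `force`, `α` times its noise force beats the combined feature forces, the weight decay
        -- and the threshold.
        have hXt : t₀ * (η * (E₁ / 2)) ≤ (obs k₀ S e (W t)).X α i (S i).2 r := by
          refine le_trans ?_ hX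
          have h2 : (t₀ : ℝ) ≤ ((t - H : ℕ) : ℝ) := by exact_mod_cast (by omega : t₀ ≤ t - H)
          have h3 := mul_le_mul_of_nonneg_right h2 (by positivity : 0 ≤ η * (E₁ / 2))
          linarith [B.x₀_pos]
        have hc := Obs.C_right_ge (obs k₀ S e (W t)) (by linarith : 1 ≤ q) (by positivity) hXt
          (B.ell_ge R haT (by omega) i r)
        have hcs := hc.trans (Finset.single_le_sum
          (f := fun i' => (obs k₀ S e (W t)).C q α i' (S i).2 r)
          (fun i' _ => Obs.C_nonneg (by linarith) i' _ r) (Finset.mem_univ i))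
        have hαc := mul_le_mul_of_nonneg_left hcs R.hα
        have hDs : ∑ i', (obs k₀ S e (W t)).D q α i' (S i).2 r ≤ q * w₁ ^ (q - 1) := by
          have hn' : (n : ℝ) ≠ 0 := by positivity
          calc _ ≤ ∑ _i : Fin n, 1 / (n : ℝ) * (q * w₁ ^ (q - 1)) := by
                refine Finset.sum_le_sum fun i' _ => ?_
                unfold Obs.D
                rw [mul_assoc]
                refine mul_le_mul_of_nonneg_left ?_ (by positivity)
                have h1 : (obs k₀ S e (W t)).ss i' (S i).2 * (obs k₀ S e (W t)).U (S i).2 r ≤ w₁ := by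
                  rcases units_eq_or_eq_neg ((obs k₀ S e (W t)).y i') (S i).2 with h | h
                  · rw [Obs.ss_right h, one_mul]; exact hU.2
                  · rw [Obs.ss_wrong h]; linarith [hU.1]
                calc _ ≤ 1 * (q * w₁ ^ (q - 1)) := mul_le_mul (Obs.ell_le_one i')
                      (dact_le (by linarith) hw h1) (dact_nonneg (by linarith) _) zero_le_one
                  _ = _ := one_mul _
            _ = _ := by simp; field_simp
        have hf := B.force
        have hlU := mul_le_mul_of_nonneg_left hU.1 R.hlam.le
        linarith
  have h := hmain (tₐ - (H + t₀)) (by have := B.time; omega)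
  rw [Nat.add_sub_cancel' B.time] at h
  linarith [B.descend]

/-- The state of approximate sign descent after the initial phase. -/
lemma SignStart.outcome {δ θ₀ xb : ℝ} (haT : tₐ ≤ T) (hδ : 0 < δ)
    (hqδ : q * δ ^ (q - 2) ≤ lam / 2) (hΘδ : Θ ≤ lam * δ / 4) (hCδ : C * η ≤ δ / 2)
    (hθ₀ : Θ ≤ lam * θ₀) (hcb : x₀ ≤ xb) (hsmall : m * (δ ^ q + xb ^ q) ≤ 1) (hstep : C * η * (E₂ + α) ≤ x₀ / 2)
    (herr : lam * (α * δ + (θ₀ + C * η) * E₂) + Θ * E₂ ≤ lam * (x₀ / 2))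
    (hbad : (1 + C) ^ 2 * (s * (8 * n * lam)) ≤ q * (x₀ / 2) ^ (q - 2) * (E₁ / 4) ^ 2)
    (hαC : α * C ≤ E₁ / 2) {t : ℕ} (hat : tₐ ≤ t) (htT : t ≤ T) :
    (∀ j r, (obs k₀ S e (W t)).U j r ≤ δ) ∧
      ∀ i, ∃ r, x₀ / 2 ≤ (obs k₀ S e (W t)).X α i (S i).2 r := by
  have hHa : H ≤ tₐ := by have := B.time; omega
  have hU : ∀ t, tₐ ≤ t → t ≤ T → ∀ j r, (obs k₀ S e (W t)).U j r ≤ δ := fun t h1 h2 j r =>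
    R.U_le hδ hqδ hΘδ hCδ hHa (B.U_nonpos R haT j r) h1 h2
  refine ⟨hU t hat htT, fun i => ?_⟩
  have hx := B.x₀_pos
  have hη := R.hη
  have hE1 := R.hE₁
  have hθ : 0 ≤ θ₀ + C * η := by
    have := R.hΘ; have := R.hlam
    have h1 : 0 < θ₀ := by
      by_contra hc
      push Not at hc
      nlinarith
    have := R.hC
    positivity
  refine R.exists_X_ge (xb := xb) hδ hθ (by linarith) (by linarith) hHa hU (fun t h1 h2 i r k => ?_)
    hsmall hstep herr hbad hαC i ?_ hat htT
  · have hwa : w₀ + C * η * H ≤ 9 / 10 * η * (tₐ - H : ℕ) := by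
      have h3 : ((tₐ - (H + t₀) : ℕ) : ℝ) ≤ (tₐ - H : ℕ) := by exact_mod_cast (by omega)
      have h4 := mul_le_mul_of_nonneg_left h3 (by positivity : 0 ≤ 9 / 10 * η)
      have h5 : 0 ≤ C * η * t₀ := mul_nonneg (mul_nonneg R.hC hη.le) (Nat.cast_nonneg _)
      linarith [B.descend]
    exact R.entry_ge hθ₀ hHa (fun a => B.w_bound_linear R (hHa.trans haT) a) hwa rfl r k h1 h2
  · obtain ⟨r, hr⟩ := B.active_sample i
    refine ⟨r, le_trans ?_ (B.X_ge R haT hr le_rfl)⟩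
    have : 0 ≤ ((tₐ - H : ℕ) : ℝ) * (η * (E₁ / 2)) := by positivity
    linarith

end SignStart

end AdamGD


namespace AdamGD

/-! ### Stationary points reached by sign descent -/

section SignStationary

variable {n m : ℕ} {O : Obs n m} {N : Fin n → ℝ} {q α lam τ : ℝ}

/-- Small positive alignments with the feature are suppressed by the weight decay at a nearly
stationary point. -/
lemma Obs.NearStat.U_le (h : O.NearStat q α lam τ N) (hq : 3 ≤ q) (hlam : 0 < lam) (hα : 0 ≤ α)
    (hτ : 0 ≤ τ) {δ : ℝ} (hδ : q * δ ^ (q - 2) ≤ lam / 2) {j : ℤˣ} {r : Fin m}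
    (hU : O.U j r ≤ δ) :
    O.U j r ≤ 2 * τ / lam ∧ ∑ i with O.y i = j, O.D q α i j r ≤ τ := by
  have hq0 : 0 ≤ q := by linarith
  rcases le_or_gt (O.U j r) 0 with h0 | h0
  · refine ⟨h0.trans (by positivity), le_trans (le_of_eq ?_) hτ⟩
    refine Finset.sum_eq_zero fun i hi => ?_
    rw [Obs.D, Obs.ss_right (Finset.mem_filter.1 hi).2, one_mul, dact_of_nonpos (by linarith) h0,
      mul_zero]
  · have hC : 0 ≤ α * ∑ i, O.C q α i j r :=
      mul_nonneg hα (Finset.sum_nonneg fun i _ => Obs.C_nonneg hq0 i j r)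
    have hu : q * O.U j r ^ (q - 1) ≤ lam / 2 * O.U j r := by
      rw [rpow_sub_one_eq h0.le (by linarith), ← mul_assoc]
      refine mul_le_mul_of_nonneg_right (le_trans ?_ hδ) h0.le
      exact mul_le_mul_of_nonneg_left (Real.rpow_le_rpow h0.le hU (by linarith)) hq0
    -- Below the barrier the feature force is at most half the weight decay, so stationarity leaves
    -- `lam / 2 * U ≤ τ`.
    have hD : ∑ i with O.y i = j, O.D q α i j r ≤ lam / 2 * O.U j r := by
      refine le_trans ?_ hu
      have hi : ∀ i, (if O.y i = j then O.D q α i j r else 0) ≤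
          1 / (n : ℝ) * (q * O.U j r ^ (q - 1)) := by
        intro i
        split_ifs with hi
        · rw [Obs.D, Obs.ss_right hi, one_mul, dact_of_nonneg h0.le]
          have := Obs.ell_le_one (O := O) (q := q) (α := α) i
          refine mul_le_mul_of_nonneg_right (mul_le_of_le_one_right (by positivity) this)
            (by positivity)
        · positivity
      rw [Finset.sum_filter]
      calc _ ≤ ∑ _i : Fin n, 1 / (n : ℝ) * (q * O.U j r ^ (q - 1)) :=
            Finset.sum_le_sum fun i _ => hi i
        _ ≤ q * O.U j r ^ (q - 1) := by
            simp only [Finset.sum_const, Finset.card_univ, Fintype.card_fin, nsmul_eq_mul]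
            rw [← mul_assoc, mul_one_div]
            exact mul_le_of_le_one_left (by positivity) (div_self_le_one _)
    have hDall : ∑ i, O.D q α i j r = ∑ i with O.y i = j, O.D q α i j r := by
      rw [Finset.sum_filter]
      refine Finset.sum_congr rfl fun i _ => ?_
      split_ifs with hi
      · rfl
      · have hi' : O.y i = -j := (units_eq_or_eq_neg (O.y i) j).resolve_left hi
        rw [Obs.D, Obs.ss_wrong hi', dact_of_nonpos (by linarith) (by linarith), mul_zero]
    have h1 := (abs_le.1 (h.feat j r)).2
    rw [hDall] at h1
    have h2 : O.U j r ≤ 2 * τ / lam := by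
      rw [le_div_iff₀ hlam]; linarith
    refine ⟨h2, hD.trans ?_⟩
    have := mul_le_mul_of_nonneg_left h2 (by positivity : 0 ≤ lam / 2)
    calc _ ≤ _ := this
      _ = τ := by field_simp

/-- Loss derivatives at a nearly stationary point are controlled by the largest noise response. -/
lemma Obs.NearStat.ell_mul_le (h : O.NearStat q α lam τ N) (hq : 3 ≤ q) (hlam : 0 < lam)
    (hα : 0 ≤ α) (hα1 : α ≤ 1 / 4) (hτ : 0 ≤ τ) (hN : ∀ i, 1 ≤ n * N i) {i : Fin n} {r : Fin m}
    (hU : O.U (O.y i) r ≤ 2 * τ / lam) {x : ℝ} (hx : 0 < x) (hτx : 2 * τ ≤ lam * x)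
    (hX : x ≤ O.X α i (O.y i) r) :
    O.ell q α i * (q * x ^ (q - 2)) ≤ 2 * n ^ 2 * lam := by
  have hn : (0 : ℝ) < n := by exact_mod_cast i.pos
  set Y := O.X α i (O.y i) r with hY
  have hY0 : 0 < Y := hx.trans_le hX
  have hC0 := Obs.C_nonneg (O := O) (α := α) (q := q) (by linarith) i (O.y i) r
  have h1 := (abs_le.1 (h.noise i (O.y i) r)).1
  rw [Obs.ss_right rfl, one_mul] at h1
  have hHY : O.H i (O.y i) r = Y + α * O.U (O.y i) r := by rw [hY, Obs.X_right rfl]; ring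
  have h2 : lam * O.U (O.y i) r ≤ 2 * τ := by
    have := mul_le_mul_of_nonneg_left hU hlam.le
    rwa [mul_div_cancel₀ _ hlam.ne'] at this
  have h3 : O.C q α i (O.y i) r * N i ≤ 2 * (lam * Y) := by
    rw [hHY] at h1
    have h4 := mul_le_mul_of_nonneg_left h2 hα
    have h5 := mul_le_mul_of_nonneg_left hX hlam.le
    nlinarith
  have h4 : O.C q α i (O.y i) r ≤ n * (2 * (lam * Y)) := by
    calc O.C q α i (O.y i) r ≤ O.C q α i (O.y i) r * (n * N i) := le_mul_of_one_le_right hC0 (hN i)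
      _ = n * (O.C q α i (O.y i) r * N i) := by ring
      _ ≤ _ := mul_le_mul_of_nonneg_left h3 hn.le
  -- The noise force and its balancing weight decay are both proportional to `Y`. Cancelling that
  -- factor leaves a bound on the logistic weight that improves as the response grows.
  have h5 : O.C q α i (O.y i) r = 1 / n * (O.ell q α i * (q * Y ^ (q - 2))) * Y := by
    rw [Obs.C, ← hY, dact_of_nonneg hY0.le, rpow_sub_one_eq hY0.le (by linarith)]; ring
  have h6 : 1 / n * (O.ell q α i * (q * Y ^ (q - 2))) ≤ n * (2 * lam) := by
    refine le_of_mul_le_mul_right ?_ hY0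
    rw [← h5]; linarith
  rw [one_div, ← div_eq_inv_mul, div_le_iff₀ hn] at h6
  refine le_trans (mul_le_mul_of_nonneg_left (mul_le_mul_of_nonneg_left ?_ (by linarith))
    (Obs.ell_pos i).le) (h6.trans (by nlinarith))
  exact Real.rpow_le_rpow hx.le hX (by linarith)

/-- Because `e ^ 2 < 8`. -/
lemma two_lt_of_logi_le {z : ℝ} (h : logi z ≤ 1 / 9) : 2 < z := by
  unfold logi at h
  rw [div_le_div_iff₀ (by positivity) (by norm_num)] at h
  by_contra hc
  push Not at hc
  have h1 := Real.exp_le_exp.2 hc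
  have h2 : Real.exp 2 = Real.exp 1 * Real.exp 1 := by rw [← Real.exp_add]; norm_num
  have h3 := Real.exp_one_lt_d9
  have h4 := Real.exp_pos 1
  nlinarith

set_option maxHeartbeats 1000000 in
/-- The outcome of sign descent: the training points are fitted by the noise responses, and every
class is represented by a neuron that is misaligned with the feature. -/
lemma Obs.NearStat.sign_outcome (h : O.NearStat q α lam τ N) (hq : 3 ≤ q) (hlam : 0 < lam)
    (hα : 0 < α) (hα1 : α ≤ 1 / 4) (hτ : 0 ≤ τ) (hN : ∀ i, 1 ≤ n * N i) (hN1 : ∀ i, N i ≤ 1)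
    {δ x Yb : ℝ} (hδ : q * δ ^ (q - 2) ≤ lam / 2) (hx : 0 < x) (hτx : 2 * τ ≤ lam * x)
    (hτα : 16 * m * τ ≤ lam * α) (hlamx : 18 * n ^ 2 * lam ≤ q * x ^ (q - 2))
    (hYb0 : 0 ≤ Yb) (hαY : 16 * m * (α * (3 * α * n ^ 2 * Yb)) ≤ 1) (hα2 : 12 * α ^ 2 * n ^ 2 ≤ 1)
    (hDsmall : 2 * n ^ 2 * m ^ (q - 2) * (q * (3 * α * n ^ 2 * Yb) ^ (q - 2)) ≤ 1)
    (hsmall : 2 * m * (3 * α * n ^ 2) ^ q ≤ 1 / 2)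
    (hYb : ∀ Y, Yb ≤ Y → q * Real.exp (-(Y ^ q / 2)) * Y ^ (q - 2) < lam / 2)
    (hcls : ∀ j, ∃ i, O.y i = j) (hU : ∀ j r, O.U j r ≤ δ)
    (hX : ∀ i, ∃ r, x ≤ O.X α i (O.y i) r) :
    (∀ i, O.out q α i (-O.y i) < O.out q α i (O.y i)) ∧ (∀ j r, O.U j r ≤ 2 * τ / lam) ∧
      (∀ j r, -O.U j r ≤ 3 * α * n ^ 2 * Yb) ∧ ∀ j, ∃ r, α / (8 * m) ≤ -O.U j r := by
  have hq0 : 0 ≤ q := by linarith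
  obtain ⟨i₀, -⟩ := hcls 1
  obtain ⟨r₀, -⟩ := hX i₀
  have hn : (1 : ℝ) ≤ n := by exact_mod_cast i₀.pos
  have hm : (1 : ℝ) ≤ m := by exact_mod_cast r₀.pos
  have hm0 : (0 : ℝ) < m := by linarith
  have hN0 : ∀ i, 0 ≤ N i := fun i => by
    by_contra hc
    push Not at hc
    nlinarith [hN i]
  have hU2 : ∀ j r, O.U j r ≤ 2 * τ / lam := fun j r => (h.U_le hq hlam hα.le hτ hδ (hU j r)).1
  have hell : ∀ i, O.ell q α i ≤ 1 / 9 := by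
    intro i
    obtain ⟨r, hr⟩ := hX i
    have h1 := h.ell_mul_le hq hlam hα.le hα1 hτ hN (hU2 _ r) hx hτx hr
    have h2 : 0 < 2 * (n : ℝ) ^ 2 * lam := by positivity
    have h3 := mul_le_mul_of_nonneg_left hlamx (Obs.ell_pos (O := O) (q := q) (α := α) i).le
    have h4 : O.ell q α i * 9 * (2 * (n : ℝ) ^ 2 * lam) ≤ 1 * (2 * (n : ℝ) ^ 2 * lam) := by
      linarith
    have := le_of_mul_le_mul_right h4 h2
    linarith
  have hmargin : ∀ i, 2 < O.out q α i (O.y i) - O.out q α i (-O.y i) := fun i =>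
    two_lt_of_logi_le (hell i)
  have hτl : 2 * τ / lam ≤ 1 / (8 * m) := by
    rw [div_le_div_iff₀ hlam (by positivity)]
    nlinarith
  have hτα' : τ / lam ≤ α / (16 * m) := by
    rw [div_le_div_iff₀ hlam (by positivity)]
    linarith
  -- every sample has a large noise response
  have hbig : ∀ i, ∃ r, 1 / (m : ℝ) ≤ O.X α i (O.y i) r := by
    intro i
    by_contra hc
    push Not at hc
    -- With all responses below `1 / m` the output would be at most 9/8, against a margin above 2.
    have h1 : O.out q α i (O.y i) ≤ m * ((1 / (8 * m)) ^ q + (1 / m) ^ q) := by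
      refine O.out_le hq0 (by positivity) (by positivity) (fun r => ?_) (fun r => (hc r).le)
      rw [Obs.ss_right rfl, one_mul]
      exact (hU2 _ r).trans hτl
    have h2 : ∀ z : ℝ, 0 < z → z ≤ 1 → z ^ q ≤ z := fun z hz hz1 =>
      (Real.rpow_le_rpow_of_exponent_ge hz hz1 (by linarith : (1 : ℝ) ≤ q)).trans_eq
        (Real.rpow_one z)
    have h3 := h2 (1 / m) (by positivity) (by rw [div_le_one hm0]; exact hm)
    have h4 := h2 (1 / (8 * m)) (by positivity) (by rw [div_le_one (by positivity)]; linarith)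
    have h5 : (m : ℝ) * (1 / (8 * m) + 1 / m) = 9 / 8 := by field_simp; norm_num
    have h6 := mul_le_mul_of_nonneg_left (add_le_add h4 h3) hm0.le
    have h7 := Obs.out_nonneg (O := O) (q := q) (α := α) i (-O.y i)
    linarith [hmargin i]
  -- the largest response
  obtain ⟨⟨i₁, r₁⟩, -, hmax'⟩ := Finset.exists_max_image Finset.univ
    (fun a : Fin n × Fin m => O.X α a.1 (O.y a.1) a.2) ⟨(i₀, r₀), Finset.mem_univ _⟩
  have hmax : ∀ i r, O.X α i (O.y i) r ≤ O.X α i₁ (O.y i₁) r₁ := fun i r =>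
    hmax' (i, r) (Finset.mem_univ _)
  set Y := O.X α i₁ (O.y i₁) r₁ with hYdef
  have hYm : 1 / (m : ℝ) ≤ Y := by
    obtain ⟨r, hr⟩ := hbig i₀
    exact hr.trans (hmax i₀ r)
  have hY0 : 0 < Y := lt_of_lt_of_le (by positivity) hYm
  have hατY : τ / lam ≤ α * Y / 16 := by
    refine hτα'.trans ?_
    have := mul_le_mul_of_nonneg_left hYm hα.le
    calc α / (16 * m) = α * (1 / m) / 16 := by field_simp
      _ ≤ _ := by linarith
  have hτY : τ ≤ lam * (α * Y / 16) := by
    rwa [div_le_iff₀' hlam] at hατY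
  have hn2 : (1 : ℝ) ≤ n ^ 2 := by nlinarith
  have hneg : ∀ j r, -O.U j r ≤ 3 * α * n ^ 2 * Y := by
    intro j r
    have h1 := h.neg_U_le (j := j) (r := r) (by linarith) hlam hα.le hτ hN hY0.le
      (hτY.trans (mul_le_mul_of_nonneg_left (by nlinarith) hlam.le))
      (fun i hi => by subst hi; exact hmax i r)
    have h4 : α * Y * 1 ≤ α * Y * n ^ 2 := mul_le_mul_of_nonneg_left hn2 (by positivity)
    have := mul_pos hα hY0
    linarith
  -- A response of size `Yb` or more would give margin at least `Y ^ q / 2`, and an exponentially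
  -- small noise force cannot hold a response of at least `3/4 Y` against weight decay.
  have hYlt : Y < Yb := by
    by_contra hc
    push Not at hc
    have h1 := (abs_le.1 (h.noise i₁ (O.y i₁) r₁)).2
    rw [Obs.ss_right rfl, one_mul] at h1
    have hHY : O.H i₁ (O.y i₁) r₁ = Y + α * O.U (O.y i₁) r₁ := by
      rw [hYdef, Obs.X_right rfl]; ring
    have hH : 3 / 4 * Y ≤ O.H i₁ (O.y i₁) r₁ := by
      have h2 := mul_le_mul_of_nonneg_left (hneg (O.y i₁) r₁) hα.le
      have h3 := mul_le_mul_of_nonneg_right hα2 hY0.le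
      rw [hHY]
      nlinarith
    have hell' : O.ell q α i₁ ≤ Real.exp (-(Y ^ q / 2)) := by
      refine (logi_le_exp_neg _).trans (Real.exp_le_exp.2 (neg_le_neg ?_))
      have h3 : Y ^ q ≤ O.out q α i₁ (O.y i₁) := by
        have := O.act_X_le_out (q := q) (α := α) i₁ (O.y i₁) r₁
        rwa [← hYdef, act_of_nonneg hY0.le] at this
      have h4 : O.out q α i₁ (-O.y i₁) ≤ Y ^ q / 2 := by
        have hi' : O.y i₁ = -(-O.y i₁) := by rw [neg_neg]
        refine (O.out_le hq0 (x := 3 * α * n ^ 2 * Y) (z := 3 * α * n ^ 2 * Y) (by positivity)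
          (by positivity) (fun r' => ?_) (fun r' => ?_)).trans ?_
        · rw [Obs.ss_wrong hi', neg_one_mul]; exact hneg _ _
        · rw [Obs.X_wrong hi']
          have h5 := h.H_wrong_le hq0 hlam hN0 hi' r'
          have h6 := mul_le_mul_of_nonneg_left (hU2 (-O.y i₁) r') hα.le
          rw [mul_div_assoc] at h6
          have h4 : α * Y * 1 ≤ α * Y * n ^ 2 :=
            mul_le_mul_of_nonneg_left hn2 (by positivity)
          have h7 : 0 ≤ τ / lam := by positivity
          have h8 := mul_le_mul_of_nonneg_right hα1 h7
          have h9 := mul_pos hα hY0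
          linarith
        · rw [Real.mul_rpow (by positivity) hY0.le]
          have : 0 ≤ Y ^ q := by positivity
          nlinarith
      linarith
    have hCN : O.C q α i₁ (O.y i₁) r₁ * N i₁ ≤ Real.exp (-(Y ^ q / 2)) * (q * Y ^ (q - 1)) := by
      refine (mul_le_of_le_one_right (Obs.C_nonneg hq0 _ _ _) (hN1 i₁)).trans ?_
      rw [Obs.C, ← hYdef, dact_of_nonneg hY0.le]
      refine mul_le_mul_of_nonneg_right ?_ (by positivity)
      refine (mul_le_of_le_one_left (Obs.ell_pos _).le ?_).trans hell'
      rw [div_le_one (by linarith)]; exact hn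
    rw [rpow_sub_one_eq hY0.le (by linarith)] at hCN
    have h2 := mul_lt_mul_of_pos_right (hYb Y hc) hY0
    have h3 := mul_le_mul_of_nonneg_left hH hlam.le
    have h4 : lam * (α * Y / 16) ≤ lam * (Y / 16) := by
      refine mul_le_mul_of_nonneg_left ?_ hlam.le
      nlinarith
    nlinarith [mul_pos hlam hY0]
  set β := 3 * α * n ^ 2 * Yb with hβ
  have hβ0 : 0 ≤ β := by positivity
  have hnegβ : ∀ j r, -O.U j r ≤ β := fun j r =>
    (hneg j r).trans (mul_le_mul_of_nonneg_left hYlt.le (by positivity))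
  refine ⟨fun i => by linarith [hmargin i], hU2, hnegβ, fun j => ?_⟩
  obtain ⟨i, rfl⟩ := hcls j
  obtain ⟨r, hr⟩ := hbig i
  refine ⟨r, ?_⟩
  set a := -O.U (O.y i) r with ha
  have haβ : a ≤ β := hnegβ _ r
  -- A response of order `1 / m` is held up by its noise force against weight decay. The same force
  -- enters the first coordinate with factor `α` and a negative sign.
  have hC : lam / (2 * m) ≤ ∑ i', O.C q α i' (O.y i) r := by
    refine le_trans ?_ (Finset.single_le_sum (f := fun i' => O.C q α i' (O.y i) r)
      (fun i' _ => Obs.C_nonneg hq0 i' _ r) (Finset.mem_univ i))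
    refine le_trans ?_ (mul_le_of_le_one_right (Obs.C_nonneg hq0 _ _ _) (hN1 i))
    have h1 := (abs_le.1 (h.noise i (O.y i) r)).2
    rw [Obs.ss_right rfl, one_mul] at h1
    rw [Obs.X_right rfl] at hr
    have h2 : α * β ≤ 1 / (16 * m) := by rw [le_div_iff₀ (by positivity)]; linarith
    have h3 := mul_le_mul_of_nonneg_left haβ hα.le
    have h4 : 15 / (16 * m) ≤ O.H i (O.y i) r := by
      have e : (1 : ℝ) / m - 1 / (16 * m) = 15 / (16 * m) := by field_simp; norm_num
      rw [← e]
      nlinarith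
    have h5 := mul_le_mul_of_nonneg_left h4 hlam.le
    have h6 : τ ≤ lam * (1 / (16 * m)) := by
      rw [div_le_iff₀' hlam] at hτα'
      refine hτα'.trans (mul_le_mul_of_nonneg_left ?_ hlam.le)
      gcongr
      linarith
    have e : lam / (2 * m) = lam * (15 / (16 * m)) - 7 * (lam * (1 / (16 * m))) := by
      field_simp; norm_num
    have : 0 < lam * (1 / (16 * m)) := by positivity
    rw [e]
    linarith
  by_contra hc
  push Not at hc
  -- A misaligned neuron is pushed back by the feature patches of the other class. Those samples are
  -- fitted too, so their logistic weights are of order `lam` up to powers of `n` and `m`, and the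
  -- push is no stronger than the weight decay.
  have hDw : ∑ i' with ¬O.y i' = O.y i, O.D q α i' (O.y i) r ≤ lam * max 0 a := by
    have hi' : ∀ i', (if ¬O.y i' = O.y i then O.D q α i' (O.y i) r else 0) ≤
        1 / (n : ℝ) * (lam * max 0 a) := by
      intro i'
      split_ifs with hi'
      · positivity
      · have hiw : O.y i' = -O.y i := (units_eq_or_eq_neg _ _).resolve_left hi'
        rw [Obs.D, Obs.ss_wrong hiw, neg_one_mul, ← ha, mul_assoc]
        refine mul_le_mul_of_nonneg_left ?_ (by positivity)
        rcases le_or_gt a 0 with ha0 | ha0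
        · rw [dact_of_nonpos (by linarith) ha0, mul_zero]; positivity
        rw [dact_of_nonneg ha0.le, max_eq_right ha0.le, rpow_sub_one_eq ha0.le (by linarith)]
        obtain ⟨r', hr'⟩ := hbig i'
        have h1 := h.ell_mul_le hq hlam hα.le hα1 hτ hN (hU2 _ r') (x := 1 / m) (by positivity)
          (by rw [mul_one_div, le_div_iff₀ hm0]; nlinarith) hr'
        rw [Real.div_rpow zero_le_one hm0.le, Real.one_rpow, ← mul_assoc, mul_one_div,
          div_le_iff₀ (by positivity)] at h1
        have h2 : a ^ (q - 2) ≤ β ^ (q - 2) := Real.rpow_le_rpow ha0.le haβ (by linarith)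
        have h3 : O.ell q α i' * (q * a ^ (q - 2)) ≤ lam := by
          have h5 : 0 ≤ O.ell q α i' := (Obs.ell_pos i').le
          have h4 : O.ell q α i' * q ≤ q * (2 * n ^ 2 * lam * m ^ (q - 2)) :=
            h1.trans (le_mul_of_one_le_left (by positivity) (by linarith))
          calc O.ell q α i' * (q * a ^ (q - 2)) = (O.ell q α i' * q) * a ^ (q - 2) := by ring
            _ ≤ (q * (2 * n ^ 2 * lam * m ^ (q - 2))) * β ^ (q - 2) :=
                mul_le_mul h4 h2 (by positivity) (by positivity)
            _ = lam * (2 * n ^ 2 * m ^ (q - 2) * (q * β ^ (q - 2))) := by ring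
            _ ≤ lam * 1 := mul_le_mul_of_nonneg_left hDsmall hlam.le
            _ = lam := mul_one _
        calc _ = O.ell q α i' * (q * a ^ (q - 2)) * a := by ring
          _ ≤ _ := mul_le_mul_of_nonneg_right h3 ha0.le
    rw [Finset.sum_filter]
    calc _ ≤ ∑ _i : Fin n, 1 / (n : ℝ) * (lam * max 0 a) := Finset.sum_le_sum fun i _ => hi' i
      _ = _ := by
        have : (n : ℝ) ≠ 0 := by positivity
        simp; field_simp
  have hDr := (h.U_le hq hlam hα.le hτ hδ (hU (O.y i) r)).2
  have hDall := Finset.sum_filter_add_sum_filter_not Finset.univ (fun i' => O.y i' = O.y i)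
    (fun i' => O.D q α i' (O.y i) r)
  have h1 := (abs_le.1 (h.feat (O.y i) r)).2
  have h1' := (abs_le.1 (h.feat (O.y i) r)).1
  have h2 := mul_le_mul_of_nonneg_left hC hα.le
  have hUa : O.U (O.y i) r = -a := by rw [ha, neg_neg]
  rw [hUa, ← hDall] at h1
  -- In units of `lam * α / (8 m)`: the noise force contributes 4, while weight decay and the other
  -- class take less than 1 each and the two tolerances at most 1/2 each.
  have h3 : max 0 a < α / (8 * m) := max_lt (by positivity) hc
  have h4 := mul_lt_mul_of_pos_left h3 hlam
  have h5 := mul_lt_mul_of_pos_left hc hlam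
  rw [div_le_iff₀' hlam] at hτα'
  have e1 : α * (lam / (2 * m)) = 4 * (lam * (α / (8 * m))) := by field_simp; norm_num
  have e2 : lam * (α / (16 * m)) = 1 / 2 * (lam * (α / (8 * m))) := by field_simp; norm_num
  rw [e1] at h2
  rw [e2] at hτα'
  have : 0 < lam * (α / (8 * m)) := by positivity
  linarith

/-- A point is misclassified if the noise responses are small and the alignments are as after sign
descent. -/
lemma output_lt_of_sign_outcome {d : ℕ} {k₀ : Fin d} {z : DataPoint d} {e : Fin d → ℝ}
    (hz : IsPoint α k₀ z e) {W : Weights m d} (hq : 0 < q) (hα : 0 ≤ α) {lo b x : ℝ}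
    (hlo : 0 < lo) (hU : ∃ r, lo ≤ -featU k₀ W (-z.2) r) (hle : ∀ r, featU k₀ W z.2 r ≤ x)
    (hneg : ∀ r, -featU k₀ W z.2 r ≤ b) (hx : 0 ≤ x) (hnoise : ∀ r, noiseDot e W z.2 r ≤ α * b)
    (hxb : x ≤ 2 * α * b) (hb : 2 * m * (2 * α * b) ^ q < lo ^ q) :
    output q W z.2 z.1 < output q W (-z.2) z.1 := by
  have hb0 : 0 ≤ 2 * α * b := hx.trans hxb
  rw [hz.output_eq, hz.output_eq]
  obtain ⟨r, hr⟩ := hU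
  calc _ ≤ ∑ _r : Fin m, ((2 * α * b) ^ q + (2 * α * b) ^ q) := by
        refine Finset.sum_le_sum fun r _ => add_le_add (act_le hq.le hb0 ?_) (act_le hq.le hb0 ?_)
        · rw [sgn_mul_self, one_mul]; exact (hle r).trans hxb
        · rw [sgn_mul_self, one_mul]
          have := mul_le_mul_of_nonneg_left (hneg r) hα
          linarith [hnoise r]
    _ = 2 * m * (2 * α * b) ^ q := by simp; ring
    _ < lo ^ q := hb
    _ ≤ act q (sgn z.2 * sgn (-z.2) * featU k₀ W (-z.2) r) +
        act q (noiseDot e W (-z.2) r - α * (sgn z.2 * sgn (-z.2) * featU k₀ W (-z.2) r)) := by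
        rw [sgn_mul_sgn_neg, neg_one_mul, act_of_nonneg (hlo.le.trans hr)]
        have := Real.rpow_le_rpow hlo.le hr hq.le
        exact le_add_of_le_of_nonneg this (act_nonneg _)
    _ ≤ _ := Finset.single_le_sum (f := fun r => act q (sgn z.2 * sgn (-z.2) * featU k₀ W (-z.2) r) +
        act q (noiseDot e W (-z.2) r - α * (sgn z.2 * sgn (-z.2) * featU k₀ W (-z.2) r)))
        (fun _ _ => add_nonneg (act_nonneg _) (act_nonneg _)) (Finset.mem_univ r)

end SignStationary

end AdamGD


namespace AdamGD

/-! ### Typical training sets and initialisations -/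

section GoodSample

variable {n m d s : ℕ} {q lam α η : ℝ} {k₀ : Fin d} {S : Fin n → DataPoint d}
  {e : Fin n → Fin d → ℝ} {W₀ : Weights m d} {g₀ E₁ w₀ h₀ x₀ u₁ : ℝ}

/-- The properties of a typical training set and initialisation. -/
structure GoodSample (α : ℝ) (k₀ : Fin d) (S : Fin n → DataPoint d) (e : Fin n → Fin d → ℝ)
    (W₀ : Weights m d) (s : ℕ) (g₀ E₁ w₀ h₀ x₀ u₁ : ℝ) : Prop where
  point : ∀ i, IsPoint α k₀ (S i) (e i)
  disj : ∀ i i' k, i ≠ i' → e i k = 0 ∨ e i' k = 0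
  e_le : ∀ i k, |e i k| ≤ g₀
  card_le : ∀ i, (Finset.univ.filter fun k => e i k ≠ 0).card ≤ s
  E_ge : ∀ i, E₁ ≤ ∑ k, |e i k|
  w_le : ∀ a, |W₀ a| ≤ w₀
  h_le : ∀ i j r, |noiseDot (e i) W₀ j r| ≤ h₀
  active_sample : ∀ i, ∃ r, x₀ ≤ noiseDot (e i) W₀ (S i).2 r
  active_neuron : ∀ j r, ∃ i, (S i).2 = j ∧ x₀ ≤ noiseDot (e i) W₀ j r
  aligned : ∀ j, ∃ r, u₁ ≤ featU k₀ W₀ j r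

/-- A fresh data point whose noise does not meet the noise of the training points. -/
structure FreshPoint (α : ℝ) (k₀ : Fin d) (e : Fin n → Fin d → ℝ) (s : ℕ) (g₀ : ℝ)
    (z : DataPoint d) (e' : Fin d → ℝ) : Prop where
  point : IsPoint α k₀ z e'
  disj : ∀ i k, e i k = 0 ∨ e' k = 0
  e_le : ∀ k, |e' k| ≤ g₀
  card_le : (Finset.univ.filter fun k => e' k ≠ 0).card ≤ s

lemma sum_abs_le_of_card_le {x : Fin d → ℝ} (hx : ∀ k, |x k| ≤ g₀) (hg : 0 ≤ g₀)
    (hs : (Finset.univ.filter fun k => x k ≠ 0).card ≤ s) : ∑ k, |x k| ≤ s * g₀ := by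
  have e1 : ∑ k, |x k| = ∑ k with x k ≠ 0, |x k| :=
    (Finset.sum_filter_of_ne fun k _ h => by simpa using h).symm
  rw [e1]
  refine (Finset.sum_le_card_nsmul _ _ _ fun k _ => hx k).trans ?_
  rw [nsmul_eq_mul]
  exact mul_le_mul_of_nonneg_right (by exact_mod_cast hs) hg

lemma sum_sq_le_of_card_le {x : Fin d → ℝ} (hx : ∀ k, |x k| ≤ g₀)
    (hs : (Finset.univ.filter fun k => x k ≠ 0).card ≤ s) : ∑ k, x k ^ 2 ≤ s * g₀ ^ 2 := by
  have e1 : ∑ k, x k ^ 2 = ∑ k with x k ≠ 0, x k ^ 2 :=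
    (Finset.sum_filter_of_ne fun k _ h => by simpa using h).symm
  rw [e1]
  refine (Finset.sum_le_card_nsmul _ _ (g₀ ^ 2) fun k _ => ?_).trans ?_
  · rw [← sq_abs]
    exact pow_le_pow_left₀ (abs_nonneg _) (hx k) 2
  · rw [nsmul_eq_mul]
    exact mul_le_mul_of_nonneg_right (by exact_mod_cast hs) (sq_nonneg _)

lemma sq_sum_abs_le_of_card_le {x : Fin d → ℝ}
    (hs : (Finset.univ.filter fun k => x k ≠ 0).card ≤ s) :
    (∑ k, |x k|) ^ 2 ≤ s * ∑ k, x k ^ 2 := by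
  have e1 : ∑ k, |x k| = ∑ k with x k ≠ 0, |x k| :=
    (Finset.sum_filter_of_ne fun k _ h => by simpa using h).symm
  have e2 : ∑ k, x k ^ 2 = ∑ k with x k ≠ 0, |x k| ^ 2 := by
    simp only [sq_abs]
    exact (Finset.sum_filter_of_ne fun k _ h => by simpa using h).symm
  rw [e1, e2]
  refine (sq_sum_le_card_mul_sum_sq).trans ?_
  exact mul_le_mul_of_nonneg_right (by exact_mod_cast hs) (Finset.sum_nonneg fun _ _ => sq_nonneg _)

lemma IsPoint.sum_abs_noise_le {z : DataPoint d} {x : Fin d → ℝ} (h : IsPoint α k₀ z x)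
    (hα : 0 ≤ α) : ∑ k, |x k - α * sgn z.2 * feature d k| ≤ ∑ k, |x k| + α := by
  have h3 : ∑ k, |α * sgn z.2 * feature d k| = α := by
    rw [Finset.sum_eq_single k₀ (fun k _ hk => by rw [h.feature_eq, if_neg hk]; simp) (by simp),
      h.feature_eq, if_pos rfl, mul_one, abs_mul, abs_sgn, mul_one, abs_of_nonneg hα]
  calc _ ≤ ∑ k, (|x k| + |α * sgn z.2 * feature d k|) :=
        Finset.sum_le_sum fun k _ => abs_sub _ _
    _ = _ := by rw [Finset.sum_add_distrib, h3]

lemma IsPoint.sum_abs_patch_le {z : DataPoint d} {x : Fin d → ℝ} (h : IsPoint α k₀ z x)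
    (hα : 0 ≤ α) (p : Fin 2) : ∑ k, |z.1 p k| ≤ ∑ k, |x k| + 1 + α := by
  have h1 := h.sum_patch fun v => ∑ k, |v k|
  have h2 := Finset.single_le_sum (f := fun p => ∑ k, |z.1 p k|)
    (fun _ _ => Finset.sum_nonneg fun _ _ => abs_nonneg _) (Finset.mem_univ p)
  have h3 : ∑ k, |sgn z.2 * feature d k| = 1 := by
    rw [Finset.sum_eq_single k₀ (fun k _ hk => by rw [h.feature_eq, if_neg hk]; simp) (by simp),
      h.feature_eq, if_pos rfl, mul_one, abs_sgn]
  have h4 := h.sum_abs_noise_le hα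
  rw [h3] at h1
  have h5 : ∑ k, |z.1 p k| ≤ ∑ p, ∑ k, |z.1 p k| := h2
  linarith

namespace GoodSample

variable (h : GoodSample α k₀ S e W₀ s g₀ E₁ w₀ h₀ x₀ u₁)

include h

lemma g₀_nonneg (i : Fin n) : 0 ≤ g₀ := (abs_nonneg _).trans (h.e_le i k₀)

lemma sum_abs_le (i : Fin n) : ∑ k, |e i k| ≤ s * g₀ :=
  sum_abs_le_of_card_le (h.e_le i) (h.g₀_nonneg i) (h.card_le i)

lemma sum_abs_patch_le (hα : 0 ≤ α) {B : ℝ} (hB : s * g₀ + 1 + α ≤ B) (i : Fin n) (p : Fin 2) :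
    ∑ k, |(S i).1 p k| ≤ B := by
  linarith [(h.point i).sum_abs_patch_le hα p, h.sum_abs_le i]

/-- Cauchy–Schwarz on the support: the `ℓ¹` lower bound also controls the squared norm, so no
separate concentration estimate is needed. -/
lemma sum_sq_ge (hE : 0 ≤ E₁) {Nm : ℝ} (hs : 0 < s) (hN : s * Nm ≤ E₁ ^ 2) (i : Fin n) :
    Nm ≤ ∑ k, e i k ^ 2 := by
  have h1 := sq_sum_abs_le_of_card_le (h.card_le i)
  have h2 := pow_le_pow_left₀ hE (h.E_ge i) 2
  have h3 : (0 : ℝ) < s := by exact_mod_cast hs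
  exact le_of_mul_le_mul_left (hN.trans (h2.trans h1)) h3

/-- On the support of the fresh noise the gradient is the weight decay alone, so stationarity bounds
each such weight by `τ / lam`. -/
lemma noiseDot_fresh_le {z : DataPoint d} {e' : Fin d → ℝ}
    (hz : FreshPoint α k₀ e s g₀ z e') (hlam : 0 < lam) {W : Weights m d} {τ : ℝ}
    (hW : norm1 (lossGrad q lam S W) ≤ τ) (hg : 0 ≤ g₀) (j : ℤˣ) (r : Fin m) :
    noiseDot e' W j r ≤ s * g₀ * (τ / lam) := by
  have hτ : 0 ≤ τ := (Finset.sum_nonneg fun _ _ => abs_nonneg _).trans hW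
  calc noiseDot e' W j r ≤ ∑ k, |e' k| * (τ / lam) := by
        refine Finset.sum_le_sum fun k _ => ?_
        by_cases hk : e' k = 0
        · simp [hk]
        have h0 : k ≠ k₀ := fun hk' => hk (hk' ▸ hz.point.first_eq)
        have h1 := lossGrad_off_support (q := q) (lam := lam) h.point W j r h0
          (fun i => (hz.disj i k).resolve_right hk)
        have h2 : |lossGrad q lam S W (j, r, k)| ≤ τ :=
          (Finset.single_le_sum (f := fun a => |lossGrad q lam S W a|) (fun _ _ => abs_nonneg _)
            (Finset.mem_univ (j, r, k))).trans hW
        rw [h1, abs_mul, abs_of_pos hlam, ← le_div_iff₀' hlam] at h2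
        refine (le_abs_self _).trans ?_
        rw [abs_mul]
        exact mul_le_mul_of_nonneg_left h2 (abs_nonneg _)
    _ = (∑ k, |e' k|) * (τ / lam) := by rw [Finset.sum_mul]
    _ ≤ _ := mul_le_mul_of_nonneg_right (sum_abs_le_of_card_le hz.e_le hg hz.card_le)
        (by positivity)

end GoodSample

lemma output_nonneg (W : Weights m d) (j : ℤˣ) (x : Patches d) : 0 ≤ output q W j x :=
  Finset.sum_nonneg fun _ _ => Finset.sum_nonneg fun _ _ => act_nonneg _

/-- The loss is close to `log 2` for small weights. -/
lemma loss_le_of_small {W : Weights m d} {w B : ℝ} (hq : 0 ≤ q) (hlam : 0 ≤ lam) (hw : 0 ≤ w)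
    (hB : 0 ≤ B) (hS : ∀ i p, ∑ k, |(S i).1 p k| ≤ B) (hW : ∀ a, |W a| ≤ w)
    (h1 : 2 * m * (w * B) ^ q ≤ 1 / 50) (h2 : lam * (Fintype.card (Idx m d) * w ^ 2) ≤ 1 / 25) :
    loss q lam S W ≤ 3 / 4 := by
  have hlog := Real.log_two_lt_d9
  have hs : ∀ i, sampleLoss q (S i) W ≤ Real.log 2 + 1 / 50 := by
    intro i
    rw [sampleLoss_eq]
    have hm : -margin q W (S i) ≤ 1 / 50 := by
      unfold margin
      have h3 := output_nonneg (q := q) W (S i).2 (S i).1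
      have h4 : output q W (-(S i).2) (S i).1 ≤ 1 / 50 := by
        refine le_trans ?_ h1
        unfold output
        calc _ ≤ ∑ _r : Fin m, ∑ _p : Fin 2, (w * B) ^ q :=
              Finset.sum_le_sum fun r _ => Finset.sum_le_sum fun p _ =>
                act_le hq (by positivity)
                  ((le_abs_self _).trans (abs_neuronDot_le hW (hS i p) hw _ r))
          _ = _ := by simp; ring
      linarith
    calc Real.log (1 + Real.exp (-margin q W (S i))) ≤
        Real.log (2 * Real.exp (1 / 50)) := by
          refine Real.log_le_log (by positivity) ?_
          have := Real.exp_le_exp.2 hm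
          have : (1 : ℝ) ≤ Real.exp (1 / 50) := Real.one_le_exp (by norm_num)
          linarith
      _ = _ := by rw [Real.log_mul (by norm_num) (Real.exp_pos _).ne', Real.log_exp]
  have hnorm : ‖W‖ ^ 2 ≤ Fintype.card (Idx m d) * w ^ 2 := by
    rw [EuclideanSpace.norm_sq_eq]
    calc ∑ a, ‖W a‖ ^ 2 ≤ ∑ _a : Idx m d, w ^ 2 := Finset.sum_le_sum fun a _ => by
          rw [Real.norm_eq_abs]; exact pow_le_pow_left₀ (abs_nonneg _) (hW a) 2
      _ = _ := by simp
  have havg : 1 / (n : ℝ) * ∑ i, sampleLoss q (S i) W ≤ Real.log 2 + 1 / 50 := by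
    have hl : 0 ≤ Real.log 2 + 1 / 50 := by have := Real.log_two_gt_d9; linarith
    calc _ ≤ 1 / (n : ℝ) * ∑ _i : Fin n, (Real.log 2 + 1 / 50) :=
          mul_le_mul_of_nonneg_left (Finset.sum_le_sum fun i _ => hs i) (by positivity)
      _ ≤ _ := by
        simp only [Finset.sum_const, Finset.card_univ, Fintype.card_fin, nsmul_eq_mul]
        rw [← mul_assoc, one_div_mul_eq_div]
        exact mul_le_of_le_one_left hl (div_self_le_one _)
  unfold loss
  have := mul_le_mul_of_nonneg_left hnorm hlam
  linarith

end GoodSample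

/-! ### The result of gradient descent -/

section GDResult

variable {n m d s : ℕ} {q lam α η : ℝ} {k₀ : Fin d} {S : Fin n → DataPoint d}
  {e : Fin n → Fin d → ℝ} {W₀ : Weights m d} {g₀ E₁ w₀ h₀ x₀ u₁ : ℝ}

lemma isGDObs_gdIter (hq : 1 < q) (h : ∀ i, IsPoint α k₀ (S i) (e i))
    (hd : ∀ i i' k, i ≠ i' → e i k = 0 ∨ e i' k = 0) (W₀ : Weights m d) :
    IsGDObs (fun t => obs k₀ S e (gdIter (loss q lam S) η W₀ t)) (fun i => (S i).2)
      (fun i => ∑ k, e i k ^ 2) q α lam η := by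
  refine ⟨fun t => rfl, fun t j r => ?_, fun t i j r => ?_⟩
  · have h1 := lossGrad_first (lam := lam) (q := q) h (gdIter (loss q lam S) η W₀ t) j r
    have e1 : (obs k₀ S e (gdIter (loss q lam S) η W₀ (t + 1))).U j r =
        (obs k₀ S e (gdIter (loss q lam S) η W₀ t)).U j r -
        η * (sgn j * lossGrad q lam S (gdIter (loss q lam S) η W₀ t) (j, r, k₀)) := by
      simp only [obs, featU]
      rw [gdIter_succ hq]
      simp only [PiLp.add_apply, PiLp.neg_apply, PiLp.smul_apply, smul_eq_mul]
      ring
    rw [e1, h1]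
    ring
  · have h1 := sum_mul_lossGrad (lam := lam) (q := q) h hd (gdIter (loss q lam S) η W₀ t) j r i
    have e1 : (obs k₀ S e (gdIter (loss q lam S) η W₀ (t + 1))).H i j r =
        (obs k₀ S e (gdIter (loss q lam S) η W₀ t)).H i j r -
        η * ∑ k, e i k * lossGrad q lam S (gdIter (loss q lam S) η W₀ t) (j, r, k) := by
      simp only [obs, noiseDot]
      rw [gdIter_succ hq, Finset.mul_sum, ← Finset.sum_sub_distrib]
      refine Finset.sum_congr rfl fun k _ => ?_
      simp only [PiLp.add_apply, PiLp.neg_apply, PiLp.smul_apply, smul_eq_mul]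
      ring
    rw [e1, h1]
    ring

/-- The numerical conditions under which gradient descent learns the feature. -/
structure GDNumerics (q α lam η : ℝ) (n m d s T : ℕ) (g₀ E₁ w₀ h₀ u₁ hi Yb R B Nm τ : ℝ) :
    Prop where
  q_ge : 3 ≤ q
  lam_pos : 0 < lam
  α_pos : 0 < α
  α_le : α ≤ 1 / 4
  αn : 8 * n * α ≤ 1
  η_pos : 0 < η
  s_pos : 0 < s
  g₀_nonneg : 0 ≤ g₀
  E₁_nonneg : 0 ≤ E₁
  B_ge : s * g₀ + 1 + α ≤ B
  R_ge : 1 ≤ R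
  R_sq : 2 / lam ≤ (R - 1) ^ 2
  step : η * (lam * R + gradBound q R B) ≤ hi / 2
  lip : η * (lipBound q lam m R B * Fintype.card (Idx m d)) ≤ 1 / 10
  small : η * (q * (R * B) ^ (q - 2)) ≤ 1 / 2
  ηlam : η * lam ≤ 1 / 2
  Nm_pos : 0 < Nm
  Nm_le : s * Nm ≤ E₁ ^ 2
  nN : 1 ≤ n * Nm
  N_le : s * g₀ ^ 2 ≤ 1 / 8
  αN : α * n ≤ Nm / 8
  h₀_nonneg : 0 ≤ h₀
  w₀_nonneg : 0 ≤ w₀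
  start : h₀ + 2 * α * w₀ ≤ u₁ / 4
  u₁_pos : 0 < u₁
  u₁_hi : 2 * u₁ ≤ hi
  hi_le : hi ≤ 1
  hi_pow : 2 * m * hi ^ q ≤ 1
  lam_le : 32 * n * lam ≤ q * u₁ ^ (q - 2)
  τ_ge : Fintype.card (Idx m d) * √(1 / (T * η)) ≤ τ
  τ_le : τ ≤ lam * α * u₁ / 2
  α_pow : 2 * m * (3 * α * n ^ 2) ^ q ≤ 1 / 2
  Yb_exp : ∀ Y, Yb ≤ Y → q * Real.exp (-(Y ^ q / 2)) * Y ^ (q - 2) < lam / 2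
  noise : s * g₀ * (τ / lam) ≤ α * Yb
  classify : 2 * m * (3 * α * n ^ 2 * Yb) ^ q < hi ^ q
  init : 2 * m * (w₀ * B) ^ q ≤ 1 / 50
  init_sq : lam * (Fintype.card (Idx m d) * w₀ ^ 2) ≤ 1 / 25

/-- The result of gradient descent on a typical training set. -/
lemma GoodSample.gd_result (h : GoodSample α k₀ S e W₀ s g₀ E₁ w₀ h₀ x₀ u₁) {T : ℕ}
    {hi Yb R B Nm τ : ℝ}
    (p : GDNumerics q α lam η n m d s T g₀ E₁ w₀ h₀ u₁ hi Yb R B Nm τ) {t : ℕ}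
    (ht : IsBestIter T (fun t => ‖gradient (loss q lam S) (gdIter (loss q lam S) η W₀ t)‖) t) :
    ‖gradient (loss q lam S) (gdIter (loss q lam S) η W₀ t)‖ ^ 2 ≤ 1 / (T * η) ∧
    trainError q S (gdIter (loss q lam S) η W₀ t) = 0 ∧
    ∀ z e', FreshPoint α k₀ e s g₀ z e' →
      output q (gdIter (loss q lam S) η W₀ t) (-z.2) z.1 <
        output q (gdIter (loss q lam S) η W₀ t) z.2 z.1 := by
  have hq := p.q_ge
  have hq0 : 0 ≤ q := by linarith
  have hlam := p.lam_pos
  have hη := p.η_pos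
  have hα := p.α_pos
  have hsg : 0 ≤ s * g₀ := mul_nonneg (Nat.cast_nonneg s) p.g₀_nonneg
  have hB : 0 ≤ B := by linarith [p.B_ge]
  have hB1 : 1 ≤ B := by linarith [p.B_ge]
  have hR := p.R_ge
  have hS := h.sum_abs_patch_le hα.le p.B_ge
  have hstep1 : η * (lam * R + gradBound q R B) ≤ 1 := by linarith [p.step, p.hi_le]
  have hl0 : loss q lam S W₀ ≤ 3 / 4 :=
    loss_le_of_small hq0 hlam.le p.w₀_nonneg hB hS h.w_le p.init p.init_sq
  have hgrad := gd_best_iter_grad_le (by linarith) hlam hη hR hB p.R_sq hS hstep1 p.lip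
    (by linarith) ht
  refine ⟨hgrad, ?_⟩
  set W := gdIter (loss q lam S) η W₀ with hWdef
  -- The stationarity estimates use the `ℓ¹` norm, while gradient descent controls the Frobenius
  -- norm. The crude factor, the number of weights, is polynomial and is absorbed by the long time
  -- horizon.
  have hn1 : norm1 (lossGrad q lam S (W t)) ≤ τ := by
    refine (sum_abs_le_card_mul_norm _).trans (le_trans ?_ p.τ_ge)
    refine mul_le_mul_of_nonneg_left ?_ (Nat.cast_nonneg _)
    rw [← gradient_loss (by linarith : 1 < q)]
    exact Real.le_sqrt_of_sq_le hgrad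
  have hbox : ∀ t a, |W t a| ≤ R := by
    intro t a
    have h1 := gd_descent (by linarith) hlam hη hR hB p.R_sq hS hstep1 p.lip
      (hl0.trans (by norm_num)) t
    have h2 : 0 ≤ 9 / 10 * η * ∑ s ∈ Finset.range t, ‖lossGrad q lam S (W s)‖ ^ 2 := by positivity
    have h3 := abs_le_of_loss_le_one (q := q) (S := S) hlam hR p.R_sq (W := W t) (by linarith) a
    linarith
  have hτ0 : 0 ≤ τ := le_trans (by positivity) p.τ_ge
  have hNge : ∀ i, Nm ≤ ∑ k, e i k ^ 2 := h.sum_sq_ge p.E₁_nonneg p.s_pos p.Nm_le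
  have hNle : ∀ i, ∑ k, e i k ^ 2 ≤ 1 / 8 := fun i =>
    (sum_sq_le_of_card_le (h.e_le i) (h.card_le i)).trans p.N_le
  have he1 : ∀ i k, |e i k| ≤ 1 := by
    intro i k
    have h1 := Finset.single_le_sum (f := fun k => e i k ^ 2) (fun _ _ => sq_nonneg _)
      (Finset.mem_univ k)
    rw [← sq_le_one_iff_abs_le_one]
    exact h1.trans ((hNle i).trans (by norm_num))
  have hG : IsGDObs (fun t => obs k₀ S e (W t)) (fun i => (S i).2) (fun i => ∑ k, e i k ^ 2)
    q α lam η := isGDObs_gdIter (by linarith) h.point h.disj W₀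
  have hXle : ∀ t i j r, (obs k₀ S e (W t)).X α i j r ≤ R * B := by
    intro t i j r
    have h1 : ∑ k, |e i k - α * sgn (S i).2 * feature d k| ≤ B := by
      linarith [(h.point i).sum_abs_noise_le hα.le, h.sum_abs_le i, p.B_ge]
    have h2 := (le_abs_self _).trans
      (abs_neuronDot_le (hbox t) h1 (by linarith) j r)
    refine le_trans (le_of_eq ?_) h2
    have e2 : sgn (S i).2 * sgn j * (sgn j * W t (j, r, k₀)) = sgn (S i).2 * W t (j, r, k₀) := by
      rw [mul_assoc, ← mul_assoc (sgn j), sgn_mul_self, one_mul]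
    unfold neuronDot
    simp only [(h.point i).feature_eq, mul_sub, Finset.sum_sub_distrib, mul_ite, mul_one, mul_zero,
      Finset.sum_ite_eq', Finset.mem_univ, if_true, obs, Obs.X, Obs.ss, featU, noiseDot]
    rw [e2]
    congr 1
    · exact Finset.sum_congr rfl fun k _ => mul_comm _ _
    · ring
  have hinit : ∀ j, ∃ r₀, u₁ ≤ (obs k₀ S e (W 0)).U j r₀ ∧
      GDInit (fun t => obs k₀ S e (W t)) (fun i => (S i).2) (fun i => ∑ k, e i k ^ 2)
        q α lam η j r₀ h₀ w₀ Nm := by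
    intro j
    obtain ⟨r₀, hr₀⟩ := h.aligned j
    refine ⟨r₀, hr₀, ⟨by linarith, hα.le, p.α_le, hη.le, by linarith [p.ηlam], p.Nm_pos, hNge,
      hNle, p.αN, p.h₀_nonneg, fun i r => h.h_le i j r, fun r => ?_, p.u₁_pos.trans_le hr₀,
      p.start.trans ?_, fun t i r hx => ?_⟩⟩
    · change |sgn j * W₀ (j, r, k₀)| ≤ w₀
      rw [abs_mul, abs_sgn, one_mul]
      exact h.w_le _
    · have : u₁ ≤ (obs k₀ S e (W 0)).U j r₀ := hr₀
      linarith
    -- The no-overshoot condition: the force is at most linear in the response on the box, with a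
    -- coefficient whose product with the step size is at most 1/2.
    · set X := (obs k₀ S e (W t)).X α i j r with hX
      have hn : (1 : ℝ) ≤ n := by exact_mod_cast i.pos
      have h1 : (obs k₀ S e (W t)).C q α i j r ≤ q * (R * B) ^ (q - 2) * X := by
        unfold Obs.C
        rw [← hX, dact_of_nonneg hx.le, rpow_sub_one_eq hx.le (by linarith)]
        have h2 : X ^ (q - 2) ≤ (R * B) ^ (q - 2) :=
          Real.rpow_le_rpow hx.le (hXle t i j r) (by linarith)
        have h3 : 1 / (n : ℝ) * (obs k₀ S e (W t)).ell q α i ≤ 1 :=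
          mul_le_one₀ (by rw [div_le_one (by linarith)]; exact hn) (Obs.ell_pos i).le
            (Obs.ell_le_one i)
        calc _ ≤ 1 * (q * (X ^ (q - 2) * X)) :=
              mul_le_mul_of_nonneg_right h3 (by positivity)
          _ = q * X ^ (q - 2) * X := by ring
          _ ≤ _ := mul_le_mul_of_nonneg_right (mul_le_mul_of_nonneg_left h2 hq0) hx.le
      have hC0 := Obs.C_nonneg (O := obs k₀ S e (W t)) (α := α) hq0 i j r
      have h2 : (∑ k, e i k ^ 2) * (obs k₀ S e (W t)).C q α i j r ≤
          q * (R * B) ^ (q - 2) * X := by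
        refine le_trans (mul_le_of_le_one_left hC0 ((hNle i).trans (by norm_num))) h1
      have h3 := mul_le_mul_of_nonneg_left h2 hη.le
      have h4 := mul_le_mul_of_nonneg_right p.small hx.le
      have h5 := mul_le_mul_of_nonneg_right p.ηlam hx.le
      linarith
  have hstat := nearStat_of_norm1_le h.point h.disj he1 hn1
  have hcls : ∀ j, ∃ i, (S i).2 = j := by
    intro j
    obtain ⟨r₀, -⟩ := h.aligned j
    obtain ⟨i, hi, -⟩ := h.active_neuron j r₀
    exact ⟨i, hi⟩
  have hUge : ∀ j, ∃ r, u₁ ≤ (obs k₀ S e (W t)).U j r := by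
    intro j
    obtain ⟨r₀, hr₀, hg⟩ := hinit j
    obtain ⟨i₀, hi₀⟩ := hcls j
    refine hG.exists_U_ge hg p.u₁_pos hr₀ p.u₁_hi p.hi_pow (fun t r => ?_) p.αn ?_ hi₀ t
    · have e1 : (obs k₀ S e (W (t + 1))).U j r - (obs k₀ S e (W t)).U j r =
          -(sgn j * (η * lossGrad q lam S (W t) (j, r, k₀))) := by
        simp only [obs, featU]
        rw [hWdef, gdIter_succ (by linarith)]
        simp only [PiLp.add_apply, PiLp.neg_apply, PiLp.smul_apply, smul_eq_mul]
        ring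
      rw [e1, abs_neg, abs_mul, abs_sgn, one_mul, abs_mul, abs_of_pos hη]
      refine le_trans (mul_le_mul_of_nonneg_left ?_ hη.le) p.step
      exact abs_lossGrad_le (by linarith) hlam.le (by linarith) hB (hbox t) hS _
    · have : 0 ≤ (n : ℝ) * lam := by positivity
      linarith [p.lam_le]
  have hXinv : ∀ j, ∃ r₀, ∀ i r, (S i).2 = j →
      (obs k₀ S e (W t)).X α i j r ≤ (obs k₀ S e (W t)).U j r₀ := by
    intro j
    obtain ⟨r₀, -, hg⟩ := hinit j
    exact ⟨r₀, fun i r hi => (hG.invariant hg t).2.2 r i hi⟩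
  have hnN : ∀ i, 1 ≤ n * ∑ k, e i k ^ 2 := fun i =>
    p.nN.trans (mul_le_mul_of_nonneg_left (hNge i) (Nat.cast_nonneg n))
  have hout := hstat.gd_outcome hq hlam hα p.α_le hτ0 hnN p.u₁_pos (by linarith [p.u₁_hi, p.u₁_pos])
    p.hi_pow p.τ_le p.αn p.lam_le p.α_pow p.Yb_exp hcls hXinv hUge
  obtain ⟨hbig, hbd, hYb⟩ := hout
  have hn1' : (1 : ℝ) ≤ n := by
    obtain ⟨i, -⟩ := hcls 1
    exact_mod_cast i.pos
  have hhi : 0 < hi := by linarith [p.u₁_pos, p.u₁_hi]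
  have hb : 2 * α * Yb ≤ 3 * α * n ^ 2 * Yb := by
    have h1 : (1 : ℝ) ≤ n ^ 2 := by nlinarith
    have h2 := mul_le_mul_of_nonneg_left h1 (by positivity : 0 ≤ α * Yb)
    have := mul_pos hα hYb
    linarith
  have hclass : ∀ z e', IsPoint α k₀ z e' → (∀ r, noiseDot e' (W t) (-z.2) r ≤ α * Yb) →
      output q (W t) (-z.2) z.1 < output q (W t) z.2 z.1 := fun z e' hz hnoise =>
    output_lt_of_gd_outcome hz (by linarith) hα.le hhi hYb.le (hbig z.2)
      (fun r => (hbd (-z.2) r).2) (fun r => (hbd (-z.2) r).1) hnoise hb p.classify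
  refine ⟨trainError_eq_zero h.point fun i => ?_, fun z e' hz => ?_⟩
  · rw [obs_out h.point, obs_out h.point]
    refine hclass (S i) (e i) (h.point i) fun r => ?_
    have h1 := hstat.H_wrong_le hq0 hlam (fun i => p.Nm_pos.le.trans (hNge i))
      (j := -(S i).2) (i := i) (by rw [neg_neg]; rfl) r
    refine (show noiseDot (e i) (W t) (-(S i).2) r ≤ τ / lam from h1).trans ?_
    have h2 : τ / lam ≤ α * u₁ / 2 := by rw [div_le_iff₀ hlam]; linarith [p.τ_le]
    obtain ⟨r', hr'⟩ := hUge 1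
    have h3 := mul_le_mul_of_nonneg_left (hr'.trans (hbd 1 r').1) hα.le
    have := mul_pos hα p.u₁_pos
    linarith
  · exact hclass z e' hz.point fun r =>
      (h.noiseDot_fresh_le hz hlam hn1 p.g₀_nonneg _ r).trans p.noise

end GDResult

end AdamGD


namespace AdamGD

/-! ### The result of Adam -/

section AdamResult

variable {n m d s : ℕ} {q lam α η β₁ β₂ : ℝ} {k₀ : Fin d} {S : Fin n → DataPoint d}
  {e : Fin n → Fin d → ℝ} {W₀ : Weights m d} {g₀ E₁ w₀ h₀ x₀ u₁ : ℝ}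

/-- The numerical conditions under which approximate sign descent with speed `C`, threshold `Θ`
and burn-in time `H` memorises the noise. -/
structure SignNumerics (q α lam η : ℝ) (n m d s T H tₐ t₀ : ℕ)
    (g₀ E₁ w₀ w₁ x₀ xb θ θ₀ δ Yb R B Nm Θ C : ℝ) : Prop where
  q_ge : 3 ≤ q
  lam_pos : 0 < lam
  α_pos : 0 < α
  α_le : α ≤ 1 / 4
  η_pos : 0 < η
  C_nonneg : 0 ≤ C
  s_pos : 0 < s
  n_pos : 0 < n
  g₀_nonneg : 0 ≤ g₀
  E₁_pos : 0 < E₁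
  B_ge : s * g₀ + 1 + α ≤ B
  R_pos : 0 < R
  box : w₀ + T * (C * η) ≤ R
  Θ_pos : 0 < Θ
  H_pos : 1 ≤ H
  H_le : 100 * H ≤ T
  err : T * (η * (Fintype.card (Idx m d) * (Θ * (C + 1)) +
    lipBound q lam m R B * C * (Fintype.card (Idx m d) * (C * η)))) ≤ 1 / 20
  init : 2 * m * (w₁ * B) ^ q ≤ 1 / 50
  init_sq : lam * (Fintype.card (Idx m d) * w₁ ^ 2) ≤ 1 / 25
  tₐ_le : tₐ ≤ T
  w₁_ge : w₀ + C * η * tₐ ≤ w₁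
  w₀_nonneg : 0 ≤ w₀
  x₀_pos : 0 < x₀
  θ_ge : Θ ≤ θ
  θ_gt : 1 / (T * η) < θ
  out_small : m * (w₁ ^ q + ((s * g₀ + α) * w₁) ^ q) ≤ 1
  bad : (1 + C) * (s * (lam * w₁ + θ)) ≤ 1 / (4 * (n : ℝ)) * (q * (x₀ / 2) ^ (q - 1)) * (E₁ / 4)
  αw : α * w₁ ≤ x₀ / 4
  burn : C * η * (s * g₀) * H ≤ x₀ / 4
  time : H + t₀ ≤ tₐ
  force : lam * w₁ + q * w₁ ^ (q - 1) + Θ ≤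
    α * (1 / (4 * (n : ℝ)) * (q * (t₀ * (η * (E₁ / 2))) ^ (q - 1)))
  descend : w₀ + C * η * (H + t₀) ≤ 9 / 10 * η * (tₐ - (H + t₀) : ℕ)
  δ_pos : 0 < δ
  δ_pow : q * δ ^ (q - 2) ≤ lam / 2
  Θ_δ : Θ ≤ lam * δ / 4
  C_δ : C * η ≤ δ / 2
  Θ_θ₀ : Θ ≤ lam * θ₀
  x₀_le : x₀ ≤ xb
  barrier : m * (δ ^ q + xb ^ q) ≤ 1
  step : C * η * (s * g₀ + α) ≤ x₀ / 2
  dev : lam * (α * δ + (θ₀ + C * η) * (s * g₀)) + Θ * (s * g₀) ≤ lam * (x₀ / 2)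
  bad_late : (1 + C) ^ 2 * (s * (8 * n * lam)) ≤ q * (x₀ / 2) ^ (q - 2) * (E₁ / 4) ^ 2
  αC : α * C ≤ E₁ / 2
  Nm_le : s * Nm ≤ E₁ ^ 2
  nN : 1 ≤ n * Nm
  N_le : s * g₀ ^ 2 ≤ 1 / 8
  τ_x : 2 * (1 / (T * η)) ≤ lam * (x₀ / 2)
  τ_α : 16 * m * (1 / (T * η)) ≤ lam * α
  lam_x : 18 * n ^ 2 * lam ≤ q * (x₀ / 2) ^ (q - 2)
  Yb_pos : 0 < Yb
  αY : 16 * m * (α * (3 * α * n ^ 2 * Yb)) ≤ 1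
  α_sq : 12 * α ^ 2 * n ^ 2 ≤ 1
  D_small : 2 * n ^ 2 * m ^ (q - 2) * (q * (3 * α * n ^ 2 * Yb) ^ (q - 2)) ≤ 1
  α_pow : 2 * m * (3 * α * n ^ 2) ^ q ≤ 1 / 2
  Yb_exp : ∀ Y, Yb ≤ Y → q * Real.exp (-(Y ^ q / 2)) * Y ^ (q - 2) < lam / 2
  noise : s * g₀ * (1 / (T * η) / lam) ≤ α * (3 * α * n ^ 2 * Yb)
  τ_test : 2 * (1 / (T * η)) / lam ≤ 2 * α * (3 * α * n ^ 2 * Yb)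
  misclassify : 2 * m * (2 * α * (3 * α * n ^ 2 * Yb)) ^ q < (α / (8 * m)) ^ q

/-- The result of approximate sign descent on a typical training set. -/
lemma GoodSample.sign_result (h : GoodSample α k₀ S e W₀ s g₀ E₁ w₀ h₀ x₀ u₁)
    {T H tₐ t₀ : ℕ} {w₁ xb θ θ₀ δ Yb R B Nm Θ C : ℝ}
    (p : SignNumerics q α lam η n m d s T H tₐ t₀ g₀ E₁ w₀ w₁ x₀ xb θ θ₀ δ Yb R B Nm Θ C)
    {W : ℕ → Weights m d} (hW0 : W 0 = W₀)
    (hrun : IsSignDescent (fun t a => W t a) (fun t a => lossGrad q lam S (W t) a) T H Θ C η)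
    (hbox : ∀ t ≤ T, ∀ a, |W t a| ≤ R) {t : ℕ}
    (ht : IsBestIter T (fun t => norm1 (lossGrad q lam S (W t))) t) :
    norm1 (lossGrad q lam S (W t)) ≤ 1 / (T * η) ∧ trainError q S (W t) = 0 ∧
    ∀ z e', FreshPoint α k₀ e s g₀ z e' → output q (W t) z.2 z.1 < output q (W t) (-z.2) z.1 := by
  have hq := p.q_ge
  have hq0 : 0 ≤ q := by linarith
  have hlam := p.lam_pos
  have hη := p.η_pos
  have hα := p.α_pos
  have hsg : 0 ≤ s * g₀ := mul_nonneg (Nat.cast_nonneg s) p.g₀_nonneg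
  have hB : 0 ≤ B := by linarith [p.B_ge]
  have hS := h.sum_abs_patch_le hα.le p.B_ge
  have hτ0 : 0 ≤ 1 / (T * η) := by positivity
  have run : SignRun q lam α k₀ S e W T H s Θ C η E₁ (s * g₀) :=
    ⟨h.point, h.disj, hrun, hq, hlam, hα.le, hη, p.C_nonneg, p.Θ_pos, p.E₁_pos, h.card_le, h.E_ge,
      h.sum_abs_le⟩
  have start : SignStart α q lam k₀ S e W H s Θ C η E₁ (s * g₀) w₀ w₁ x₀ θ t₀ tₐ :=
    ⟨by rw [hW0]; exact h.w_le, p.w₁_ge, p.x₀_pos, p.θ_ge, p.out_small, p.bad, p.αw, p.burn,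
      p.time, p.force, p.descend, by rw [hW0]; exact h.active_sample,
      by rw [hW0]; exact h.active_neuron⟩
  have hw₁ : 0 ≤ w₁ := by
    have : 0 ≤ C * η * tₐ := mul_nonneg (mul_nonneg p.C_nonneg hη.le) (Nat.cast_nonneg _)
    linarith [p.w₁_ge, p.w₀_nonneg]
  have hLH : loss q lam S (W H) ≤ 4 / 5 :=
    (loss_le_of_small hq0 hlam.le hw₁ hB hS (fun a => start.w_bound run p.tₐ_le
      (by have := p.time; omega) a) p.init p.init_sq).trans (by norm_num)
  have hgrad : norm1 (lossGrad q lam S (W t)) ≤ 1 / (T * η) :=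
    signDescent_best_iter_le (by linarith) hlam.le hη p.R_pos.le hB hS p.C_nonneg p.Θ_pos.le hrun
      hbox hLH p.H_pos p.H_le p.err ht.2
  refine ⟨hgrad, ?_⟩
  have htT : t ≤ T := (Finset.mem_Icc.1 ht.1).2
  -- The best iterate has gradient norm below `θ`, which is impossible during the initial phase.
  have hat : tₐ ≤ t := by
    by_contra hc
    push Not at hc
    obtain ⟨a, ha⟩ := start.exists_grad_ge run p.tₐ_le p.n_pos hc.le
    have h1 : |lossGrad q lam S (W t) a| ≤ norm1 (lossGrad q lam S (W t)) :=
      Finset.single_le_sum (f := fun a => |lossGrad q lam S (W t) a|) (fun _ _ => abs_nonneg _)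
        (Finset.mem_univ a)
    linarith [p.θ_gt]
  obtain ⟨hU, hX⟩ := start.outcome run p.tₐ_le p.δ_pos p.δ_pow p.Θ_δ p.C_δ p.Θ_θ₀ p.x₀_le
    p.barrier p.step p.dev p.bad_late p.αC hat htT
  have hNge : ∀ i, Nm ≤ ∑ k, e i k ^ 2 := h.sum_sq_ge p.E₁_pos.le p.s_pos p.Nm_le
  have hNle : ∀ i, ∑ k, e i k ^ 2 ≤ 1 := fun i =>
    (sum_sq_le_of_card_le (h.e_le i) (h.card_le i)).trans (p.N_le.trans (by norm_num))
  have he1 : ∀ i k, |e i k| ≤ 1 := by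
    intro i k
    have h1 := Finset.single_le_sum (f := fun k => e i k ^ 2) (fun _ _ => sq_nonneg _)
      (Finset.mem_univ k)
    rw [← sq_le_one_iff_abs_le_one]
    exact h1.trans (hNle i)
  have hstat := nearStat_of_norm1_le h.point h.disj he1 hgrad
  have hnN : ∀ i, 1 ≤ n * ∑ k, e i k ^ 2 := fun i =>
    p.nN.trans (mul_le_mul_of_nonneg_left (hNge i) (Nat.cast_nonneg n))
  have hcls : ∀ j, ∃ i, (S i).2 = j := by
    intro j
    obtain ⟨r₀, -⟩ := h.aligned j
    obtain ⟨i, hi, -⟩ := h.active_neuron j r₀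
    exact ⟨i, hi⟩
  obtain ⟨htrain, hU2, hneg, hlow⟩ := hstat.sign_outcome hq hlam hα p.α_le hτ0 hnN hNle p.δ_pow
    (half_pos p.x₀_pos) p.τ_x p.τ_α p.lam_x p.Yb_pos.le p.αY p.α_sq p.D_small p.α_pow p.Yb_exp
    hcls hU hX
  refine ⟨trainError_eq_zero h.point htrain, fun z e' hz => ?_⟩
  obtain ⟨r₀, -⟩ := h.aligned 1
  have hm : (0 : ℝ) < m := by exact_mod_cast r₀.pos
  exact output_lt_of_sign_outcome hz.point (by linarith) hα.le (by positivity) (hlow (-z.2))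
    (hU2 z.2) (hneg z.2) (by positivity)
    (fun r => (h.noiseDot_fresh_le hz hlam hgrad p.g₀_nonneg _ r).trans p.noise) p.τ_test
    p.misclassify

/-- The result of Adam on a typical training set. -/
lemma GoodSample.adam_result (h : GoodSample α k₀ S e W₀ s g₀ E₁ w₀ h₀ x₀ u₁)
    {T H tₐ t₀ : ℕ} {w₁ xb θ θ₀ δ Yb R B Nm : ℝ} (hβ₁ : β₁ < 1) (h0 : 0 ≤ β₁) (h12 : β₁ ^ 2 < β₂)
    (hβ₂ : β₂ < 1) (hH1 : β₁ ^ H ≤ 1 / 100) (hH2 : β₂ ^ H ≤ 1 / 100)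
    (hlip : 0 < lipBound q lam m R B)
    (p : SignNumerics q α lam η n m d s T H tₐ t₀ g₀ E₁ w₀ w₁ x₀ xb θ θ₀ δ Yb R B Nm
      (adamThr β₁ β₂ * (lipBound q lam m R B * (adamSpeed β₁ β₂ * η))) (adamSpeed β₁ β₂)) {t : ℕ}
    (ht : IsBestIter T
      (fun t => norm1 (gradient (loss q lam S) (adamIter (loss q lam S) β₁ β₂ η W₀ t))) t) :
    norm1 (gradient (loss q lam S) (adamIter (loss q lam S) β₁ β₂ η W₀ t)) ≤ 1 / (T * η) ∧
    trainError q S (adamIter (loss q lam S) β₁ β₂ η W₀ t) = 0 ∧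
    ∀ z e', FreshPoint α k₀ e s g₀ z e' →
      output q (adamIter (loss q lam S) β₁ β₂ η W₀ t) z.2 z.1 <
        output q (adamIter (loss q lam S) β₁ β₂ η W₀ t) (-z.2) z.1 := by
  have hq := p.q_ge
  have hsg : 0 ≤ s * g₀ := mul_nonneg (Nat.cast_nonneg s) p.g₀_nonneg
  have hB : 0 ≤ B := by linarith [p.B_ge, p.α_pos]
  obtain ⟨hrun, hbox⟩ := adam_isSignDescent (W₀ := W₀) (by linarith) p.lam_pos.le p.η_pos p.R_pos.le
    hB hβ₁ h0 h12 hβ₂ (h.sum_abs_patch_le p.α_pos.le p.B_ge) hH1 hH2 hlip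
    (fun a => (add_le_add_left (h.w_le a) _).trans p.box)
  have hg : ∀ W : Weights m d, gradient (loss q lam S) W = lossGrad q lam S W :=
    fun W => gradient_loss (by linarith) S W
  simp only [hg] at ht ⊢
  exact h.sign_result p rfl hrun hbox ht

end AdamResult

end AdamGD


namespace AdamGD

/-! ### Gaussian estimates -/

section Gaussian

lemma gaussianReal_real_Ico_le {v : NNReal} (hv : v ≠ 0) {a b : ℝ} (hab : a ≤ b) :
    (gaussianReal 0 v).real (Set.Ico a b) ≤ (b - a) * (√(2 * Real.pi * v))⁻¹ := by
  have h0 : 0 ≤ (√(2 * Real.pi * v))⁻¹ := by positivity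
  have h1 : gaussianReal 0 v (Set.Ico a b) ≤
      ENNReal.ofReal ((b - a) * (√(2 * Real.pi * v))⁻¹) := by
    rw [gaussianReal_apply 0 hv]
    calc ∫⁻ x in Set.Ico a b, gaussianPDF 0 v x
        ≤ ∫⁻ _x in Set.Ico a b, ENNReal.ofReal (√(2 * Real.pi * v))⁻¹ := by
          refine lintegral_mono fun x => ENNReal.ofReal_le_ofReal ?_
          unfold gaussianPDFReal
          refine mul_le_of_le_one_right h0 (Real.exp_le_one_iff.2 ?_)
          rw [neg_div]
          exact neg_nonpos.2 (by positivity)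
      _ = _ := by
          rw [setLIntegral_const, Real.volume_Ico, mul_comm, ← ENNReal.ofReal_mul (by linarith)]
  rw [measureReal_def]
  exact ENNReal.toReal_le_of_le_ofReal (mul_nonneg (by linarith) h0) h1

lemma inv_sqrt_two_pi_mul_le {v : NNReal} : (√(2 * Real.pi * v))⁻¹ ≤ (√v)⁻¹ / 2 := by
  rw [Real.sqrt_mul (by positivity), mul_inv, div_eq_inv_mul]
  refine mul_le_mul_of_nonneg_right ?_ (by positivity)
  rw [inv_le_inv₀ (by positivity) (by norm_num)]
  refine Real.le_sqrt_of_sq_le ?_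
  have := Real.pi_gt_three
  linarith

lemma gaussianReal_real_abs_lt_le {v : NNReal} (hv : v ≠ 0) {a : ℝ} (ha : 0 ≤ a) :
    (gaussianReal 0 v).real {x | |x| < a * √v} ≤ a := by
  have hs : 0 < √(v : ℝ) := Real.sqrt_pos.2 (by positivity)
  have h1 : (gaussianReal 0 v).real {x | |x| < a * √v} ≤
      (gaussianReal 0 v).real (Set.Ico (-(a * √v)) (a * √v)) :=
    measureReal_mono fun x hx => ⟨(abs_lt.1 hx).1.le, (abs_lt.1 hx).2⟩
  have h0 : 0 ≤ a * √v := by positivity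
  refine h1.trans ((gaussianReal_real_Ico_le hv (by linarith)).trans ?_)
  refine (mul_le_mul_of_nonneg_left inv_sqrt_two_pi_mul_le (by linarith)).trans (le_of_eq ?_)
  field_simp
  ring

/-- At most half of the mass is negative by symmetry, and the density bound `1 / (2 √v)` allows at
most 1/4 on an interval of length `√v / 2`. -/
lemma gaussianReal_real_lt_le {v : NNReal} (hv : v ≠ 0) {x : ℝ} (hx : x ≤ √v / 2) :
    (gaussianReal 0 v).real (Set.Iio x) ≤ 3 / 4 := by
  have hs : 0 < √(v : ℝ) := Real.sqrt_pos.2 (by positivity)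
  have h1 : (gaussianReal 0 v).real (Set.Iio 0) ≤ 1 / 2 := by
    have hsym : (gaussianReal 0 v).real (Set.Iio 0) = (gaussianReal 0 v).real (Set.Ioi 0) := by
      have h := gaussianReal_map_neg (μ := 0) (v := v)
      rw [neg_zero] at h
      conv_lhs => rw [← h]
      rw [map_measureReal_apply measurable_neg measurableSet_Iio]
      congr 1
      ext z
      simp
    have h2 : (gaussianReal 0 v).real (Set.Iio 0 ∪ Set.Ioi 0) ≤ 1 := measureReal_le_one
    have hd : Disjoint (Set.Iio (0 : ℝ)) (Set.Ioi 0) :=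
      Set.disjoint_left.2 fun z h1 h2 => lt_asymm (Set.mem_Iio.1 h1) (Set.mem_Ioi.1 h2)
    rw [measureReal_union hd measurableSet_Ioi, ← hsym] at h2
    linarith
  have h2 : (gaussianReal 0 v).real (Set.Ico 0 (√v / 2)) ≤ 1 / 4 := by
    refine (gaussianReal_real_Ico_le hv (by positivity)).trans ?_
    refine (mul_le_mul_of_nonneg_left inv_sqrt_two_pi_mul_le (by linarith)).trans (le_of_eq ?_)
    field_simp
    norm_num
  have h3 : Set.Iio x ⊆ Set.Iio 0 ∪ Set.Ico 0 (√v / 2) := fun z hz => by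
    rcases lt_or_ge z 0 with h | h
    · exact Or.inl h
    · exact Or.inr ⟨h, lt_of_lt_of_le hz hx⟩
  have := (measureReal_mono h3).trans (measureReal_union_le (μ := gaussianReal 0 v) _ _)
  linarith

/-- Chernoff's bound on each side, with the optimal parameter `t / √v`. Zero variance is kept
separate, since linear functionals with zero coefficients are allowed. -/
lemma gaussianReal_real_abs_gt_le (v : NNReal) {t : ℝ} (ht : 0 ≤ t) :
    (gaussianReal 0 v).real {x | t * √v < |x|} ≤ 2 * Real.exp (-(t ^ 2 / 2)) := by
  rcases eq_or_ne v 0 with rfl | hv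
  · have : {x : ℝ | t * √((0 : NNReal) : ℝ) < |x|} = {0}ᶜ := by
      ext x; simp
    rw [this, gaussianReal_zero_var, measureReal_def,
      Measure.dirac_apply' _ (MeasurableSet.singleton _).compl]
    simp
    positivity
  have hv0 : 0 < (v : ℝ) := by positivity
  have hs : 0 < √(v : ℝ) := Real.sqrt_pos.2 hv0
  have hss : √(v : ℝ) * √(v : ℝ) = v := Real.mul_self_sqrt hv0.le
  have hmgf : ∀ r : ℝ, mgf id (gaussianReal 0 v) r = Real.exp (v * r ^ 2 / 2) := fun r => by
    rw [mgf_id_gaussianReal]; simp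
  have h1 := measure_ge_le_exp_mul_mgf (μ := gaussianReal 0 v) (X := id) (t := t / √v) (t * √v)
    (by positivity) (by simpa using integrable_exp_mul_gaussianReal (μ := 0) (v := v) (t / √v))
  have h2 := measure_le_le_exp_mul_mgf (μ := gaussianReal 0 v) (X := id) (t := -(t / √v))
    (-(t * √v)) (by simp; positivity)
    (by simpa using integrable_exp_mul_gaussianReal (μ := 0) (v := v) (-(t / √v)))
  rw [hmgf, ← Real.exp_add] at h1 h2
  have e1 : -(t / √(v : ℝ)) * (t * √v) + v * (t / √v) ^ 2 / 2 = -(t ^ 2 / 2) := by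
    rw [div_pow, sq (√(v : ℝ)), hss]; field_simp; ring
  have e2 : - -(t / √(v : ℝ)) * -(t * √v) + v * (-(t / √v)) ^ 2 / 2 = -(t ^ 2 / 2) := by
    rw [neg_sq, ← e1]; ring
  rw [e1] at h1
  rw [e2] at h2
  have h3 : {x : ℝ | t * √v < |x|} ⊆ {x | t * √v ≤ id x} ∪ {x | id x ≤ -(t * √v)} := fun x hx => by
    rcases lt_abs.1 (show t * √v < |x| from hx) with h | h
    · exact Or.inl h.le
    · exact Or.inr (by simp only [Set.mem_ofPred_eq, id]; linarith)
  have := (measureReal_mono h3).trans (measureReal_union_le (μ := gaussianReal 0 v) _ _)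
  linarith

variable {ι : Type} [Fintype ι] {σ : ℝ}

lemma iIndepFun_gaussianVec (ι : Type) [Fintype ι] (σ : ℝ) :
    iIndepFun (fun (a : ι) (w : ι → ℝ) => w a) (gaussianVec ι σ) :=
  iIndepFun_pi (X := fun _ x => x) fun _ => aemeasurable_id

lemma gaussianVec_map_eval (a : ι) :
    (gaussianVec ι σ).map (fun w => w a) = gaussianReal 0 (Real.toNNReal (σ ^ 2)) :=
  (measurePreserving_eval (fun _ : ι => gaussianReal 0 (Real.toNNReal (σ ^ 2))) a).map_eq

/-- Linear combinations of independent centred Gaussian variables are Gaussian. -/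
lemma gaussianVec_map_sum (c : ι → ℝ) :
    (gaussianVec ι σ).map (fun w => ∑ a, c a * w a) =
      gaussianReal 0 (Real.toNNReal (σ ^ 2 * ∑ a, c a ^ 2)) := by
  classical
  have hind : iIndepFun (fun (a : ι) (w : ι → ℝ) => c a * w a) (gaussianVec ι σ) :=
    (iIndepFun_gaussianVec ι σ).comp (fun a x => c a * x) fun a => by fun_prop
  have key : ∀ s : Finset ι, (gaussianVec ι σ).map (∑ a ∈ s, fun w : ι → ℝ => c a * w a) =
      gaussianReal 0 (Real.toNNReal (σ ^ 2 * ∑ a ∈ s, c a ^ 2)) := by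
    intro s
    induction s using Finset.induction_on with
    | empty =>
      simp only [Finset.sum_empty, mul_zero, Real.toNNReal_zero, gaussianReal_zero_var]
      have : (0 : (ι → ℝ) → ℝ) = fun _ => 0 := rfl
      rw [this, Measure.map_const]
      simp
    | insert a s ha ih =>
      have h1 : (gaussianVec ι σ).map (fun w : ι → ℝ => c a * w a) =
          gaussianReal 0 (Real.toNNReal (σ ^ 2 * c a ^ 2)) := by
        have e : (fun w : ι → ℝ => c a * w a) = (fun x => c a * x) ∘ fun w : ι → ℝ => w a := rfl
        rw [e, ← Measure.map_map (by fun_prop) (by fun_prop), gaussianVec_map_eval,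
          gaussianReal_map_const_mul, mul_zero]
        congr 1
        ext
        rw [NNReal.coe_mul, NNReal.coe_mk, Real.coe_toNNReal _ (by positivity),
          Real.coe_toNNReal _ (by positivity), mul_comm]
      have hi := (hind.indepFun_finsetSum_of_notMem (fun a => by fun_prop) ha).symm
      rw [Finset.sum_insert ha, gaussianReal_add_gaussianReal_of_indepFun hi h1 ih, add_zero,
        ← Real.toNNReal_add (by positivity) (by positivity), Finset.sum_insert ha, mul_add]
  rw [← key Finset.univ]
  congr 1
  ext w
  simp

lemma gaussianVec_real_abs_sum_gt_le (hσ : 0 ≤ σ) (c : ι → ℝ) {t : ℝ} (ht : 0 ≤ t) :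
    (gaussianVec ι σ).real {w | t * (σ * √(∑ a, c a ^ 2)) < |∑ a, c a * w a|} ≤
      2 * Real.exp (-(t ^ 2 / 2)) := by
  refine le_trans (le_of_eq ?_)
    (gaussianReal_real_abs_gt_le (Real.toNNReal (σ ^ 2 * ∑ a, c a ^ 2)) ht)
  rw [← gaussianVec_map_sum, map_measureReal_apply (by fun_prop)
    (measurableSet_lt measurable_const (by fun_prop)), Real.coe_toNNReal _ (by positivity),
    Real.sqrt_mul (sq_nonneg _), Real.sqrt_sq hσ]
  rfl

lemma gaussianVec_real_abs_gt_le (hσ : 0 ≤ σ) (a : ι) {t : ℝ} (ht : 0 ≤ t) :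
    (gaussianVec ι σ).real {w | t * σ < |w a|} ≤ 2 * Real.exp (-(t ^ 2 / 2)) := by
  classical
  have := gaussianVec_real_abs_sum_gt_le hσ (fun b => if b = a then 1 else 0) ht
  simpa using this

/-- Gaussian linear functionals with disjoint supports are unlikely to be all small. -/
lemma gaussianVec_real_forall_lt_le (hσ : 0 < σ) {κ : Type*} (L : Finset κ) (c : κ → ι → ℝ)
    (x : κ → ℝ) (hd : ∀ l ∈ L, ∀ l' ∈ L, l ≠ l' → ∀ a, c l a = 0 ∨ c l' a = 0)
    (hc : ∀ l ∈ L, 0 < ∑ a, c l a ^ 2) (hx : ∀ l ∈ L, x l ≤ σ * √(∑ a, c l a ^ 2) / 2) :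
    (gaussianVec ι σ).real {w | ∀ l ∈ L, ∑ a, c l a * w a < x l} ≤ (3 / 4) ^ L.card := by
  classical
  induction L using Finset.induction_on with
  | empty => simp
  | insert l L hl ih =>
    have ih' := ih (fun l hl l' hl' => hd l (Finset.mem_insert_of_mem hl) l'
      (Finset.mem_insert_of_mem hl')) (fun l hl => hc l (Finset.mem_insert_of_mem hl))
      (fun l hl => hx l (Finset.mem_insert_of_mem hl))
    set A : Finset ι := Finset.univ.filter fun a => c l a ≠ 0 with hA
    have hsum1 : ∀ w : ι → ℝ, ∑ a, c l a * w a = ∑ a : A, c l a * w a := fun w => by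
      rw [Finset.sum_coe_sort A fun a => c l a * w a, hA]
      refine (Finset.sum_filter_of_ne fun a _ h => ?_).symm
      exact left_ne_zero_of_mul h
    have hsum2 : ∀ l' ∈ L, ∀ w : ι → ℝ, ∑ a, c l' a * w a = ∑ a : (Aᶜ : Finset ι), c l' a * w a := by
      intro l' hl' w
      rw [Finset.sum_coe_sort Aᶜ fun a => c l' a * w a]
      refine (Finset.sum_subset (Finset.subset_univ _) fun a _ ha => ?_).symm
      have ha' : c l a ≠ 0 := by simpa [hA] using ha
      have hne : l ≠ l' := fun h => hl (h ▸ hl')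
      rw [(hd l (Finset.mem_insert_self _ _) l' (Finset.mem_insert_of_mem hl') hne a).resolve_left
        ha', zero_mul]
    -- The new functional uses only coordinates in `A` and the remaining ones only coordinates
    -- outside, so each further functional contributes an independent factor 3/4.
    have hind := (iIndepFun_gaussianVec ι σ).indepFun_finset A Aᶜ disjoint_compl_right
      fun a => measurable_pi_apply a
    set S1 : Set (A → ℝ) := {v | ∑ a : A, c l a * v a < x l} with hS1
    set S2 : Set ((Aᶜ : Finset ι) → ℝ) :=
      {v | ∀ l' ∈ L, ∑ a : (Aᶜ : Finset ι), c l' a * v a < x l'} with hS2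
    have hm1 : MeasurableSet S1 := measurableSet_lt (by fun_prop) measurable_const
    have hm2 : MeasurableSet S2 := by
      have : S2 = ⋂ l' ∈ L, {v | ∑ a : (Aᶜ : Finset ι), c l' a * v a < x l'} := by
        ext v; simp [hS2]
      rw [this]
      exact Finset.measurableSet_biInter _ fun l' _ =>
        measurableSet_lt (by fun_prop) measurable_const
    have hmul := hind.measure_inter_preimage_eq_mul S1 S2 hm1 hm2
    have e1 : {w : ι → ℝ | ∀ l' ∈ insert l L, ∑ a, c l' a * w a < x l'} =
        (fun (w : ι → ℝ) (a : A) => w a) ⁻¹' S1 ∩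
        (fun (w : ι → ℝ) (a : (Aᶜ : Finset ι)) => w a) ⁻¹' S2 := by
      ext w
      simp only [Set.mem_ofPred_eq, Finset.forall_mem_insert, Set.mem_inter_iff, Set.mem_preimage,
        hS1, hS2, hsum1]
      refine and_congr_right fun _ => forall₂_congr fun l' hl' => ?_
      rw [hsum2 l' hl']
    have e2 : {w : ι → ℝ | ∀ l' ∈ L, ∑ a, c l' a * w a < x l'} =
        (fun (w : ι → ℝ) (a : (Aᶜ : Finset ι)) => w a) ⁻¹' S2 := by
      ext w
      simp only [Set.mem_ofPred_eq, Set.mem_preimage, hS2]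
      refine forall₂_congr fun l' hl' => ?_
      rw [hsum2 l' hl']
    have e3 : (fun (w : ι → ℝ) (a : A) => w a) ⁻¹' S1 =
        (fun w : ι → ℝ => ∑ a, c l a * w a) ⁻¹' Set.Iio (x l) := by
      ext w
      simp only [hS1, Set.mem_preimage, Set.mem_ofPred_eq, Set.mem_Iio, hsum1]
    have hl1 : (gaussianVec ι σ).real ((fun (w : ι → ℝ) (a : A) => w a) ⁻¹' S1) ≤ 3 / 4 := by
      rw [e3, ← map_measureReal_apply (by fun_prop) measurableSet_Iio, gaussianVec_map_sum]
      have hpos : 0 < σ ^ 2 * ∑ a, c l a ^ 2 :=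
        mul_pos (by positivity) (hc l (Finset.mem_insert_self _ _))
      refine gaussianReal_real_lt_le (by simpa using hpos) ?_
      rw [Real.coe_toNNReal _ hpos.le, Real.sqrt_mul (sq_nonneg _), Real.sqrt_sq hσ.le]
      exact hx l (Finset.mem_insert_self _ _)
    rw [e1, measureReal_def, hmul, ENNReal.toReal_mul, Finset.card_insert_of_notMem hl, pow_succ',
      ← measureReal_def, ← measureReal_def]
    rw [e2] at ih'
    exact mul_le_mul hl1 ih' measureReal_nonneg (by norm_num)

/-- The `ℓ¹`-norm of a Gaussian vector on a set of coordinates is unlikely to be small. -/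
lemma gaussianVec_real_sum_abs_lt_le (hσ : 0 < σ) (A : Finset ι) :
    (gaussianVec ι σ).real {g | ∑ a ∈ A, |g a| < A.card * (σ / 100)} ≤ (1 / 2) ^ A.card := by
  set v := Real.toNNReal (σ ^ 2) with hv
  have hvσ : √(v : ℝ) = σ := by
    rw [hv, Real.coe_toNNReal _ (sq_nonneg _), Real.sqrt_sq hσ.le]
  have hv0 : v ≠ 0 := by
    have : 0 < σ ^ 2 := by positivity
    rw [hv]; simpa using this.ne'
  have hind : iIndepFun (fun (a : ι) (w : ι → ℝ) => |w a|) (gaussianVec ι σ) :=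
    (iIndepFun_gaussianVec ι σ).comp (fun _ x => |x|) fun a => by fun_prop
  -- Chernoff at this parameter: `exp (t |x|)` is at most 1 when `|x| < σ / 10` and at most `e ^
  -- (-3) ≤ 1/20` otherwise. Its mean is therefore at most 1/10 + 1/20 = 3/20, and the factor `e ^
  -- (3/10) ≤ 3` gives 9/20 per coordinate.
  set t := -(30 / σ) with ht
  have ht0 : t ≤ 0 := by rw [ht]; exact neg_nonpos.2 (by positivity)
  have hint : ∀ (μ : Measure ℝ) [IsProbabilityMeasure μ],
      Integrable (fun x : ℝ => Real.exp (t * |x|)) μ := by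
    intro μ _
    refine Integrable.of_bound (C := 1) (by fun_prop) (ae_of_all _ fun x => ?_)
    rw [Real.norm_eq_abs, abs_of_pos (Real.exp_pos _), Real.exp_le_one_iff]
    exact mul_nonpos_of_nonpos_of_nonneg ht0 (abs_nonneg x)
  have hmgf : ∀ a : ι, mgf (fun w : ι → ℝ => |w a|) (gaussianVec ι σ) t ≤ 3 / 20 := by
    intro a
    have e1 : mgf (fun w : ι → ℝ => |w a|) (gaussianVec ι σ) t =
        ∫ x, Real.exp (t * |x|) ∂(gaussianReal 0 v) := by
      unfold mgf
      rw [← gaussianVec_map_eval (σ := σ) a, integral_map (measurable_pi_apply a).aemeasurable (by fun_prop)]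
    rw [e1]
    set I : Set ℝ := {x | |x| < 1 / 10 * √v} with hI
    have hIm : MeasurableSet I := measurableSet_lt (by fun_prop) measurable_const
    have h1 : ∀ x : ℝ, Real.exp (t * |x|) ≤ I.indicator (fun _ => (1 : ℝ)) x + 1 / 20 := by
      intro x
      by_cases hx : x ∈ I
      · rw [Set.indicator_of_mem hx]
        have : Real.exp (t * |x|) ≤ 1 :=
          Real.exp_le_one_iff.2 (mul_nonpos_of_nonpos_of_nonneg ht0 (abs_nonneg x))
        linarith
      · rw [Set.indicator_of_notMem hx, zero_add]
        have hx' : 1 / 10 * σ ≤ |x| := by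
          rw [← hvσ]; exact not_lt.1 hx
        have h2 : t * |x| ≤ -3 := by
          have := mul_le_mul_of_nonpos_left hx' ht0
          refine this.trans (le_of_eq ?_)
          rw [ht]; field_simp; norm_num
        refine (Real.exp_le_exp.2 h2).trans ?_
        have h3 : Real.exp 3 = Real.exp 1 ^ 3 := by rw [← Real.exp_nat_mul]; norm_num
        rw [Real.exp_neg, h3, one_div, inv_le_inv₀ (by positivity) (by norm_num)]
        have h4 := Real.exp_one_gt_d9
        calc (20 : ℝ) ≤ 2.718 ^ 3 := by norm_num
          _ ≤ _ := pow_le_pow_left₀ (by norm_num) (by linarith) 3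
    calc ∫ x, Real.exp (t * |x|) ∂(gaussianReal 0 v) ≤
        ∫ x, (I.indicator (fun _ => (1 : ℝ)) x + 1 / 20) ∂(gaussianReal 0 v) := by
          refine integral_mono (hint _) ?_ h1
          exact ((integrable_const 1).indicator hIm).add (integrable_const _)
      _ = (gaussianReal 0 v).real I + 1 / 20 := by
          rw [integral_add ((integrable_const 1).indicator hIm) (integrable_const _),
            integral_indicator_const _ hIm]
          simp
      _ ≤ _ := by
          have := gaussianReal_real_abs_lt_le hv0 (by norm_num : (0 : ℝ) ≤ 1 / 10)
          linarith
  have hsum := hind.mgf_sum (fun a => by fun_prop) A (t := t)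
  have hch := measure_le_le_exp_mul_mgf (μ := gaussianVec ι σ)
    (X := ∑ a ∈ A, fun w : ι → ℝ => |w a|) (t := t) (A.card * (σ / 100)) ht0 (by
      refine Integrable.of_bound (C := 1) (by fun_prop) (ae_of_all _ fun x => ?_)
      rw [Real.norm_eq_abs, abs_of_pos (Real.exp_pos _), Real.exp_le_one_iff]
      refine mul_nonpos_of_nonpos_of_nonneg ht0 ?_
      rw [Finset.sum_apply]
      exact Finset.sum_nonneg fun _ _ => abs_nonneg _)
  rw [hsum] at hch
  have hmono : (gaussianVec ι σ).real {g | ∑ a ∈ A, |g a| < A.card * (σ / 100)} ≤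
      (gaussianVec ι σ).real {g | (∑ a ∈ A, fun w : ι → ℝ => |w a|) g ≤ A.card * (σ / 100)} := by
    refine measureReal_mono fun g hg => ?_
    simp only [Set.mem_ofPred_eq, Finset.sum_apply] at hg ⊢
    exact hg.le
  refine hmono.trans (hch.trans ?_)
  have e2 : -t * (A.card * (σ / 100)) = A.card * (3 / 10) := by
    rw [ht]; field_simp; ring
  have e3 : Real.exp (3 / 10) ≤ 3 := by
    refine (Real.exp_le_exp.2 (by norm_num : (3 / 10 : ℝ) ≤ 1)).trans ?_
    have := Real.exp_one_lt_d9
    linarith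
  rw [e2, Real.exp_nat_mul]
  calc Real.exp (3 / 10) ^ A.card * ∏ a ∈ A, mgf (fun w : ι → ℝ => |w a|) (gaussianVec ι σ) t
      ≤ 3 ^ A.card * (3 / 20) ^ A.card := by
        refine mul_le_mul (pow_le_pow_left₀ (Real.exp_pos _).le e3 _) ?_
          (Finset.prod_nonneg fun a _ => mgf_nonneg) (by positivity)
        rw [← Finset.prod_const]
        exact Finset.prod_le_prod (fun a _ => mgf_nonneg) fun a _ => hmgf a
    _ = (9 / 20) ^ A.card := by rw [← mul_pow]; norm_num
    _ ≤ _ := pow_le_pow_left₀ (by norm_num) (by norm_num) _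

end Gaussian

end AdamGD


namespace AdamGD

/-! ### Random masks -/

section Masks

variable {d s : ℕ}

-- Swapping two coordinates other than the first is a bijection on masks, so these coordinates are
-- exchangeable.
open Classical in
lemma masks_card_filter_eq {k k' : Fin d} (hk : (k : ℕ) ≠ 0) (hk' : (k' : ℕ) ≠ 0) :
    ((masks d s).toFinset.filter fun b => b k = true).card =
      ((masks d s).toFinset.filter fun b => b k' = true).card := by
  refine Finset.card_bij (fun b _ => b ∘ Equiv.swap k k') ?_ ?_ ?_
  · intro b hb
    rw [Finset.mem_filter, Set.mem_toFinset] at hb ⊢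
    obtain ⟨⟨h1, h2⟩, h3⟩ := hb
    refine ⟨⟨fun l hl => ?_, ?_⟩, by simpa using h3⟩
    · have h4 : l ≠ k := fun h => hk (h ▸ hl)
      have h5 : l ≠ k' := fun h => hk' (h ▸ hl)
      simp only [Function.comp, Equiv.swap_apply_of_ne_of_ne h4 h5]
      exact h1 l hl
    · rw [← h2]
      refine Finset.card_bij (fun l _ => Equiv.swap k k' l) ?_ ?_ ?_
      · intro l hl; simpa using hl
      · intro l _ l' _ h; exact (Equiv.swap k k').injective h
      · intro l hl
        refine ⟨Equiv.swap k k' l, ?_, by simp⟩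
        simpa using hl
  · intro b _ b' _ h
    funext l
    have := congrFun h (Equiv.swap k k' l)
    simpa using this
  · intro b hb
    refine ⟨b ∘ Equiv.swap k k', ?_, ?_⟩
    · rw [Finset.mem_filter, Set.mem_toFinset] at hb ⊢
      obtain ⟨⟨h1, h2⟩, h3⟩ := hb
      refine ⟨⟨fun l hl => ?_, ?_⟩, by simpa using h3⟩
      · have h4 : l ≠ k := fun h => hk (h ▸ hl)
        have h5 : l ≠ k' := fun h => hk' (h ▸ hl)
        simp only [Function.comp, Equiv.swap_apply_of_ne_of_ne h4 h5]
        exact h1 l hl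
      · rw [← h2]
        refine Finset.card_bij (fun l _ => Equiv.swap k k' l) ?_ ?_ ?_
        · intro l hl; simpa using hl
        · intro l _ l' _ h; exact (Equiv.swap k k').injective h
        · intro l hl
          refine ⟨Equiv.swap k k' l, ?_, by simp⟩
          simpa using hl
    · funext l; simp

/-- Double counting of pairs of a mask and a selected coordinate: every mask selects `s`
coordinates, and the `d - 1` admissible ones contribute equally. -/
lemma uniformOn_masks_real_le (hs : s < d) {k : Fin d} (hk : (k : ℕ) ≠ 0) :
    (uniformOn (masks d s)).real {b | b k = true} ≤ s / (d - 1) := by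
  classical
  set M := (masks d s).toFinset with hM
  have hMne : M.Nonempty := by
    obtain ⟨b, hb⟩ := masks_nonempty hs
    exact ⟨b, by rw [hM]; simpa using hb⟩
  have hsum : ∑ l : Fin d, (M.filter fun b => b l = true).card = s * M.card := by
    simp_rw [Finset.card_filter]
    rw [Finset.sum_comm]
    have : ∀ b ∈ M, ∑ l : Fin d, (if b l = true then 1 else 0) = s := by
      intro b hb
      rw [← Finset.card_filter]
      have hb' : b ∈ masks d s := by rw [hM] at hb; simpa using hb
      exact hb'.2
    rw [Finset.sum_congr rfl this, Finset.sum_const, smul_eq_mul, mul_comm]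
  have hd : 1 ≤ d := k.pos
  have hlow : (d - 1) * (M.filter fun b => b k = true).card ≤ s * M.card := by
    rw [← hsum]
    set k₀ : Fin d := ⟨0, k.pos⟩
    have h1 : ∑ l ∈ Finset.univ.erase k₀, (M.filter fun b => b l = true).card =
        (d - 1) * (M.filter fun b => b k = true).card := by
      rw [Finset.sum_congr rfl (g := fun _ => (M.filter fun b => b k = true).card)]
      · rw [Finset.sum_const, Finset.card_erase_of_mem (Finset.mem_univ _), Finset.card_univ,
          Fintype.card_fin, smul_eq_mul]
      · intro l hl
        refine masks_card_filter_eq (fun h => ?_) hk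
        exact (Finset.mem_erase.1 hl).1 (Fin.ext h)
    rw [← h1]
    exact Finset.sum_le_sum_of_subset (Finset.erase_subset _ _)
  have hd1 : (0 : ℝ) < d - 1 := by
    have : 1 < d := by have := k.isLt; omega
    have : (1 : ℝ) < d := by exact_mod_cast this
    linarith
  have hcard : (0 : ℝ) < M.card := by exact_mod_cast hMne.card_pos
  have e : (uniformOn (masks d s)).real {b | b k = true} =
      (M.filter fun b => b k = true).card / M.card := by
    have h1 : masks d s = (M : Set (Fin d → Bool)) := by rw [hM]; simp
    have h2 : {b : Fin d → Bool | b k = true} =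
        ((Finset.univ.filter fun b : Fin d → Bool => b k = true : Finset _) : Set _) := by
      ext b; simp
    rw [h1, h2, measureReal_def, uniformOn_apply_finset, ENNReal.toReal_div, ENNReal.toReal_natCast,
      ENNReal.toReal_natCast]
    congr 3
    ext b; simp
  rw [e, div_le_div_iff₀ hcard hd1]
  have : ((d - 1 : ℕ) : ℝ) * (M.filter fun b => b k = true).card ≤ s * M.card := by
    exact_mod_cast hlow
  rw [Nat.cast_sub hd, Nat.cast_one] at this
  linarith

lemma uniformOn_masks_ae : ∀ᵐ b ∂(uniformOn (masks d s)), b ∈ masks d s :=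
  ae_cond_mem (Set.toFinite _).measurableSet

/-- A random mask is unlikely to meet a small set of coordinates. -/
lemma uniformOn_masks_meet_le (hs : s < d) (A : Finset (Fin d)) (hA : ∀ k ∈ A, (k : ℕ) ≠ 0) :
    (uniformOn (masks d s)).real {b | ∃ k ∈ A, b k = true} ≤ A.card * (s / (d - 1)) := by
  have : IsProbabilityMeasure (uniformOn (masks d s)) :=
    isProbabilityMeasure_uniformOn (Set.toFinite _) (masks_nonempty hs)
  have e : {b : Fin d → Bool | ∃ k ∈ A, b k = true} = ⋃ k ∈ A, {b | b k = true} := by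
    ext b; simp
  rw [e]
  refine (measureReal_biUnion_finset_le _ _).trans ?_
  rw [← nsmul_eq_mul]
  exact Finset.sum_le_card_nsmul _ _ _ fun k hk => uniformOn_masks_real_le hs (hA k hk)

end Masks

/-! ### The law of a data point -/

section PointLaw

/-- The randomness of a data point: label and position, mask and Gaussian vector. -/
abbrev PointBase (d : ℕ) : Type := (ℤˣ × Fin 2) × ((Fin d → Bool) × (Fin d → ℝ))

variable {d s : ℕ} {σp α : ℝ}

/-- The Gaussian part of the noise patch. -/
noncomputable def ptNoise (ω : PointBase d) (k : Fin d) : ℝ :=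
  if ω.2.1 k = true then ω.2.2 k else 0

lemma isPoint_mkData {k₀ : Fin d} (h0 : (k₀ : ℕ) = 0) {ω : PointBase d}
    (hω : ω.2.1 ∈ masks d s) : IsPoint α k₀ (mkData d α ω) (ptNoise ω) := by
  refine ⟨h0, fun f => ?_, ?_⟩
  · obtain ⟨⟨y, p⟩, b, g⟩ := ω
    simp only [mkData, Fin.sum_univ_two]
    have e : noiseVec d α y b g = fun k => ptNoise ((y, p), b, g) k - α * sgn y * feature d k := rfl
    fin_cases p
    · simp [e]
    · simp [e, add_comm]
  · simp [ptNoise, hω.1 k₀ h0]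

lemma card_ptNoise_le {ω : PointBase d} (hω : ω.2.1 ∈ masks d s) :
    (Finset.univ.filter fun k => ptNoise ω k ≠ 0).card ≤ s := by
  rw [← hω.2]
  refine Finset.card_le_card fun k hk => ?_
  simp only [Finset.mem_filter, Finset.mem_univ, true_and] at hk ⊢
  by_contra h
  exact hk (if_neg h)

/-- The law of the randomness of a data point. -/
noncomputable def pointLaw (d s : ℕ) (σp : ℝ) (ρ : Measure (ℤˣ × Fin 2)) : Measure (PointBase d) :=
  ρ.prod ((uniformOn (masks d s)).prod (gaussianVec (Fin d) σp))

variable {ρ : Measure (ℤˣ × Fin 2)}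

lemma isProbabilityMeasure_masks (h : s < d) : IsProbabilityMeasure (uniformOn (masks d s)) :=
  isProbabilityMeasure_uniformOn (Set.toFinite _) (masks_nonempty h)

lemma pointLaw_label (h : s < d) (A : Set (ℤˣ × Fin 2)) :
    (pointLaw d s σp ρ).real {ω | ω.1 ∈ A} = ρ.real A := by
  have := isProbabilityMeasure_masks h
  unfold pointLaw
  exact measurePreserving_fst.measureReal_preimage (Set.to_countable A).measurableSet.nullMeasurableSet

variable [IsProbabilityMeasure ρ]

lemma isProbabilityMeasure_pointLaw (h : s < d) : IsProbabilityMeasure (pointLaw d s σp ρ) := by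
  have := isProbabilityMeasure_masks h
  unfold pointLaw
  infer_instance

/-- Fubini: a bound on almost every section is a bound on the whole event. This is how one
conditions on the mask. -/
lemma prod_real_le {A B : Type*} [MeasurableSpace A] [MeasurableSpace B] {μ : Measure A}
    {ν : Measure B} [IsProbabilityMeasure μ] [IsProbabilityMeasure ν] {E : Set (A × B)}
    (hE : MeasurableSet E) {δ : ℝ} (hδ : 0 ≤ δ) (h : ∀ᵐ a ∂μ, ν.real {b | (a, b) ∈ E} ≤ δ) :
    (μ.prod ν).real E ≤ δ := by
  rw [measureReal_def]
  refine ENNReal.toReal_le_of_le_ofReal hδ ?_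
  rw [Measure.prod_apply hE]
  calc ∫⁻ a, ν (Prod.mk a ⁻¹' E) ∂μ ≤ ∫⁻ _a, ENNReal.ofReal δ ∂μ := by
        refine lintegral_mono_ae ?_
        filter_upwards [h] with a ha
        rw [ENNReal.le_ofReal_iff_toReal_le (measure_ne_top _ _) hδ]
        exact ha
    _ = _ := by simp

lemma pointLaw_mask (h : s < d) (A : Set (Fin d → Bool)) :
    (pointLaw d s σp ρ).real {ω | ω.2.1 ∈ A} = (uniformOn (masks d s)).real A := by
  have := isProbabilityMeasure_masks h
  unfold pointLaw
  exact (measurePreserving_fst.comp measurePreserving_snd).measureReal_preimage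
    (Set.toFinite A).measurableSet.nullMeasurableSet

lemma pointLaw_gauss (h : s < d) {A : Set (Fin d → ℝ)} (hA : MeasurableSet A) :
    (pointLaw d s σp ρ).real {ω | ω.2.2 ∈ A} = (gaussianVec (Fin d) σp).real A := by
  have := isProbabilityMeasure_masks h
  unfold pointLaw
  exact (measurePreserving_snd.comp measurePreserving_snd).measureReal_preimage
    hA.nullMeasurableSet

lemma pointLaw_mask_ae (h : s < d) : ∀ᵐ ω ∂(pointLaw d s σp ρ), ω.2.1 ∈ masks d s := by
  have := isProbabilityMeasure_masks h
  unfold pointLaw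
  exact (measurePreserving_fst.comp measurePreserving_snd).quasiMeasurePreserving.ae
    uniformOn_masks_ae

lemma pointLaw_gauss_gt_le (h : s < d) (hσ : 0 ≤ σp) {t : ℝ} (ht : 0 ≤ t) :
    (pointLaw d s σp ρ).real {ω | ∃ k, t * σp < |ω.2.2 k|} ≤ d * (2 * Real.exp (-(t ^ 2 / 2))) := by
  have hm : MeasurableSet {g : Fin d → ℝ | ∃ k, t * σp < |g k|} := by
    have : {g : Fin d → ℝ | ∃ k, t * σp < |g k|} = ⋃ k, {g | t * σp < |g k|} := by
      ext g; simp
    rw [this]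
    exact MeasurableSet.iUnion fun k => measurableSet_lt measurable_const (by fun_prop)
  refine (pointLaw_gauss h hm).trans_le ?_
  have : {g : Fin d → ℝ | ∃ k, t * σp < |g k|} = ⋃ k, {g | t * σp < |g k|} := by
    ext g; simp
  rw [this]
  refine (measureReal_iUnion_fintype_le _).trans ?_
  refine (Finset.sum_le_sum fun k _ => gaussianVec_real_abs_gt_le hσ k ht).trans ?_
  simp

lemma measurable_ptNoise (k : Fin d) : Measurable fun ω : PointBase d => ptNoise ω k := by
  unfold ptNoise
  refine Measurable.ite ?_ (by fun_prop) measurable_const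
  have h : Measurable fun ω : PointBase d => ω.2.1 k := by fun_prop
  exact h (MeasurableSet.singleton true)

/-- Given the mask, this is the `ℓ¹` norm of a Gaussian vector on exactly `s` coordinates. -/
lemma pointLaw_sum_lt_le (h : s < d) (hσ : 0 < σp) :
    (pointLaw d s σp ρ).real {ω | ∑ k, |ptNoise ω k| < s * (σp / 100)} ≤ (1 / 2) ^ s := by
  have := isProbabilityMeasure_masks h
  have hm : MeasurableSet {ω : PointBase d | ∑ k, |ptNoise ω k| < s * (σp / 100)} := by
    refine measurableSet_lt ?_ measurable_const
    exact Finset.measurable_sum _ fun k _ => (measurable_ptNoise k).abs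
  unfold pointLaw
  refine prod_real_le hm (by positivity) (ae_of_all _ fun a => ?_)
  refine prod_real_le (measurable_prodMk_left hm) (by positivity) ?_
  filter_upwards [uniformOn_masks_ae] with b hb
  have e : {g : Fin d → ℝ | (b, g) ∈ {x | (a, x) ∈ {ω : PointBase d | ∑ k, |ptNoise ω k| <
      s * (σp / 100)}}} = {g | ∑ k with b k = true, |g k| <
        (Finset.univ.filter fun k => b k = true).card * (σp / 100)} := by
    ext g
    simp only [Set.mem_ofPred_eq, hb.2, ptNoise, Finset.sum_filter]
    refine Eq.to_iff (congrArg (· < (s : ℝ) * (σp / 100)) (Finset.sum_congr rfl fun k _ => ?_))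
    split_ifs <;> simp
  have h1 := gaussianVec_real_sum_abs_lt_le hσ (Finset.univ.filter fun k => b k = true)
  rw [hb.2] at h1 e
  exact (le_of_eq (congrArg _ e)).trans h1

/-- A fresh point is typical with high probability. -/
lemma pointLaw_not_fresh_le {n : ℕ} {k₀ : Fin d} (h0 : (k₀ : ℕ) = 0) (h : s < d) (hσ : 0 ≤ σp)
    {t : ℝ} (ht : 0 ≤ t) {e : Fin n → Fin d → ℝ}
    (hcard : ∀ i, (Finset.univ.filter fun k => e i k ≠ 0).card ≤ s) (he : ∀ i, e i k₀ = 0) :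
    (pointLaw d s σp ρ).real {ω | ¬FreshPoint α k₀ e s (t * σp) (mkData d α ω) (ptNoise ω)} ≤
      n * (s * (s / (d - 1))) + d * (2 * Real.exp (-(t ^ 2 / 2))) := by
  have hP := isProbabilityMeasure_pointLaw (σp := σp) (ρ := ρ) h
  have hd : (0 : ℝ) ≤ s / (d - 1) := by
    have : (1 : ℝ) ≤ d := by exact_mod_cast k₀.pos
    exact div_nonneg (Nat.cast_nonneg s) (by linarith)
  set E1 : Set (PointBase d) := {ω | ω.2.1 ∉ masks d s}
  set E2 : Set (PointBase d) := {ω | ∃ k, t * σp < |ω.2.2 k|}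
  set E3 : Fin n → Set (PointBase d) := fun i =>
    {ω | ω.2.1 ∈ {b : Fin d → Bool | ∃ k ∈ Finset.univ.filter fun k => e i k ≠ 0, b k = true}}
  have hsub : {ω | ¬FreshPoint α k₀ e s (t * σp) (mkData d α ω) (ptNoise ω)} ⊆
      E1 ∪ ((⋃ i, E3 i) ∪ E2) := by
    intro ω hω
    by_contra hc
    simp only [Set.mem_union, Set.mem_iUnion, not_or, not_exists] at hc
    obtain ⟨h1, h3, h2⟩ := hc
    have h1' : ω.2.1 ∈ masks d s := not_not.1 h1
    have h2' : ∀ k, |ω.2.2 k| ≤ t * σp := fun k => not_lt.1 fun hk => h2 ⟨k, hk⟩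
    refine hω ⟨isPoint_mkData h0 h1', fun i k => ?_, fun k => ?_, card_ptNoise_le h1'⟩
    · by_contra hk
      push Not at hk
      refine h3 i ⟨k, by simpa using hk.1, ?_⟩
      by_contra hb
      exact hk.2 (if_neg hb)
    · unfold ptNoise
      split_ifs
      · exact h2' k
      · simpa using mul_nonneg ht hσ
  have hE1 : (pointLaw d s σp ρ).real E1 = 0 := by
    rw [measureReal_def, ENNReal.toReal_eq_zero_iff]
    left
    exact pointLaw_mask_ae h
  have hE3 : ∀ i, (pointLaw d s σp ρ).real (E3 i) ≤ s * (s / (d - 1)) := by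
    intro i
    refine (pointLaw_mask h _).trans_le ((uniformOn_masks_meet_le h _ fun k hk hk0 => ?_).trans ?_)
    · have : k = k₀ := Fin.ext (hk0.trans h0.symm)
      rw [this] at hk
      simp [he i] at hk
    · exact mul_le_mul_of_nonneg_right (by exact_mod_cast hcard i) hd
  have hE3' : (pointLaw d s σp ρ).real (⋃ i, E3 i) ≤ n * (s * (s / (d - 1))) := by
    refine (measureReal_iUnion_fintype_le _).trans ((Finset.sum_le_sum fun i _ => hE3 i).trans ?_)
    simp
  have hE2 := pointLaw_gauss_gt_le (s := s) (ρ := ρ) h hσ ht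
  have h4 := measureReal_mono (μ := pointLaw d s σp ρ) hsub
  have h5 := measureReal_union_le (μ := pointLaw d s σp ρ) E1 ((⋃ i, E3 i) ∪ E2)
  have h6 := measureReal_union_le (μ := pointLaw d s σp ρ) (⋃ i, E3 i) E2
  linarith

end PointLaw

end AdamGD


namespace AdamGD

/-! ### Random training sets -/

section TrainLaw

variable {n m d s : ℕ} {σp σ₀ α p₀ : ℝ} {ρ : Measure (ℤˣ × Fin 2)} [IsProbabilityMeasure ρ]

/-- The properties of a typical training set. -/
structure GoodData (ω : Fin n → PointBase d) (s Nc : ℕ) (g₀ E₁ : ℝ) : Prop where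
  mask : ∀ i, (ω i).2.1 ∈ masks d s
  disj : ∀ i i' k, i ≠ i' → ptNoise (ω i) k = 0 ∨ ptNoise (ω i') k = 0
  g_le : ∀ i k, |(ω i).2.2 k| ≤ g₀
  E_ge : ∀ i, E₁ ≤ ∑ k, |ptNoise (ω i) k|
  cls : ∀ j, Nc ≤ (Finset.univ.filter fun i => (ω i).1.1 = j).card

/-- Each class has many members with high probability. -/
lemma pi_real_card_class_lt_le {A : Type*} [MeasurableSpace A] (μ : Measure A)
    [IsProbabilityMeasure μ] {B : Set A} [DecidablePred (· ∈ B)] (hB : MeasurableSet B) {p : ℝ}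
    (hp : p ≤ μ.real B) (n Nc : ℕ) :
    (Measure.pi fun _ : Fin n => μ).real
      {ω | (Finset.univ.filter fun i => ω i ∈ B).card < Nc} ≤ 2 ^ Nc * (1 - p / 2) ^ n := by
  set f : A → ℝ := B.indicator fun _ => 1 with hf
  have hfm : Measurable f := measurable_const.indicator hB
  have hind : iIndepFun (fun (i : Fin n) (ω : Fin n → A) => f (ω i)) (Measure.pi fun _ => μ) :=
    iIndepFun_pi (X := fun _ => f) fun _ => hfm.aemeasurable
  -- With this parameter the exponential of an indicator is the affine function `1 - indicator / 2`,
  -- so its mean is read off directly.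
  set t := -Real.log 2 with ht
  have ht0 : t ≤ 0 := neg_nonpos.2 (Real.log_nonneg (by norm_num))
  have hexp : ∀ x, Real.exp (t * f x) = 1 - 1 / 2 * f x := by
    intro x
    by_cases hx : x ∈ B
    · rw [hf, Set.indicator_of_mem hx, mul_one, mul_one, ht, Real.exp_neg,
        Real.exp_log (by norm_num)]
      norm_num
    · rw [hf, Set.indicator_of_notMem hx]; simp
  have hmgf : ∀ i : Fin n, mgf (fun ω : Fin n → A => f (ω i)) (Measure.pi fun _ => μ) t ≤
      1 - p / 2 := by
    intro i
    have hmp := measurePreserving_eval (fun _ : Fin n => μ) i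
    unfold mgf
    simp_rw [hexp]
    have hint := integral_map (μ := Measure.pi fun _ : Fin n => μ) (φ := Function.eval i)
      (f := fun x => 1 - 1 / 2 * f x) (measurable_pi_apply i).aemeasurable (by fun_prop)
    rw [hmp.map_eq] at hint
    rw [show (∫ ω : Fin n → A, (1 - 1 / 2 * f (ω i)) ∂(Measure.pi fun _ => μ)) =
      ∫ x, (1 - 1 / 2 * f x) ∂μ from hint.symm]
    have hfi : Integrable f μ := (integrable_const 1).indicator hB
    rw [integral_sub (integrable_const _) (hfi.const_mul _), integral_const_mul, hf,
      integral_indicator_const _ hB]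
    simp
    linarith
  have hsum := hind.mgf_sum (fun i => by fun_prop) Finset.univ (t := t)
  have hcard : ∀ ω : Fin n → A, (∑ i, fun ω : Fin n → A => f (ω i)) ω =
      ((Finset.univ.filter fun i => ω i ∈ B).card : ℝ) := by
    intro ω
    rw [Finset.sum_apply, Finset.card_filter, Nat.cast_sum]
    refine Finset.sum_congr rfl fun i _ => ?_
    simp [hf, Set.indicator]
  have hch := measure_le_le_exp_mul_mgf (μ := Measure.pi fun _ : Fin n => μ)
    (X := ∑ i, fun ω : Fin n → A => f (ω i)) (t := t) Nc ht0 (by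
      refine Integrable.of_bound (C := 1) (by fun_prop) (ae_of_all _ fun x => ?_)
      rw [Real.norm_eq_abs, abs_of_pos (Real.exp_pos _), Real.exp_le_one_iff, hcard]
      exact mul_nonpos_of_nonpos_of_nonneg ht0 (Nat.cast_nonneg _))
  rw [hsum] at hch
  refine (measureReal_mono fun ω hω => ?_).trans (hch.trans ?_)
  · have h1 : (Finset.univ.filter fun i => ω i ∈ B).card < Nc := hω
    show (∑ i, fun ω : Fin n → A => f (ω i)) ω ≤ Nc
    rw [hcard]
    exact_mod_cast h1.le
  · have e : Real.exp (-t * Nc) = 2 ^ Nc := by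
      rw [ht, neg_neg, mul_comm, Real.exp_nat_mul, Real.exp_log (by norm_num)]
    rw [e]
    refine mul_le_mul_of_nonneg_left ?_ (by positivity)
    calc _ ≤ ∏ _i : Fin n, (1 - p / 2) :=
          Finset.prod_le_prod (fun i _ => mgf_nonneg) fun i _ => hmgf i
      _ = _ := by simp

lemma measureReal_toMeasurable {A : Type*} [MeasurableSpace A] (μ : Measure A) (B : Set A) :
    μ.real (toMeasurable μ B) = μ.real B := by
  rw [measureReal_def, measure_toMeasurable, ← measureReal_def]

/-- Passing to a measurable hull avoids checking measurability of each atypical event. -/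
lemma pi_real_preimage_le {A : Type*} [MeasurableSpace A] (μ : Measure A)
    [IsProbabilityMeasure μ] {n : ℕ} (i : Fin n) (B : Set A) :
    (Measure.pi fun _ : Fin n => μ).real {ω | ω i ∈ B} ≤ μ.real B := by
  have h := (measurePreserving_eval (fun _ : Fin n => μ) i).measureReal_preimage
    (measurableSet_toMeasurable μ B).nullMeasurableSet
  rw [measureReal_toMeasurable] at h
  rw [← h]
  exact measureReal_mono fun ω hω => subset_toMeasurable μ B hω

lemma pi_real_pair_eq {A : Type*} [MeasurableSpace A] (μ : Measure A)
    [IsProbabilityMeasure μ] {n : ℕ} {i i' : Fin n} (hi : i ≠ i') {B : Set A}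
    (hB : MeasurableSet B) :
    (Measure.pi fun _ : Fin n => μ).real {ω | ω i ∈ B ∧ ω i' ∈ B} = μ.real B ^ 2 := by
  have hind : iIndepFun (fun (i : Fin n) (ω : Fin n → A) => ω i) (Measure.pi fun _ => μ) :=
    iIndepFun_pi (X := fun _ x => x) fun _ => aemeasurable_id
  have h := (hind.indepFun hi).measure_inter_preimage_eq_mul B B hB hB
  have h1 := fun i => (measurePreserving_eval (fun _ : Fin n => μ) i).measure_preimage
    hB.nullMeasurableSet
  have e : {ω : Fin n → A | ω i ∈ B ∧ ω i' ∈ B} =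
      (fun ω : Fin n → A => ω i) ⁻¹' B ∩ (fun ω : Fin n → A => ω i') ⁻¹' B := rfl
  rw [e, measureReal_def, h, ENNReal.toReal_mul, sq]
  congr 1
  · exact congrArg ENNReal.toReal (h1 i)
  · exact congrArg ENNReal.toReal (h1 i')

/-- A training set is typical with high probability. -/
lemma pi_real_not_goodData_le (h : s < d) (hσ : 0 < σp) {t : ℝ} (ht : 0 ≤ t)
    (hp : ∀ y : ℤˣ, p₀ ≤ ρ.real {z | z.1 = y}) (Nc : ℕ) :
    (Measure.pi fun _ : Fin n => pointLaw d s σp ρ).real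
      {ω | ¬GoodData ω s Nc (t * σp) (s * (σp / 100))} ≤
    n ^ 2 * (d * (s / (d - 1)) ^ 2) + n * (d * (2 * Real.exp (-(t ^ 2 / 2)))) +
      n * (1 / 2) ^ s + 2 * (2 ^ Nc * (1 - p₀ / 2) ^ n) := by
  have hP := isProbabilityMeasure_pointLaw (σp := σp) (ρ := ρ) h
  set μ := pointLaw d s σp ρ with hμ
  set E1 : Fin n → Set (Fin n → PointBase d) := fun i =>
    {ω | ω i ∈ {x : PointBase d | x.2.1 ∉ masks d s}}
  set E2 : Fin n → Set (Fin n → PointBase d) := fun i =>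
    {ω | ω i ∈ {x : PointBase d | ∃ k, t * σp < |x.2.2 k|}}
  set E3 : Fin n → Set (Fin n → PointBase d) := fun i =>
    {ω | ω i ∈ {x : PointBase d | ∑ k, |ptNoise x k| < s * (σp / 100)}}
  set E4 : ℤˣ → Set (Fin n → PointBase d) := fun j =>
    {ω | (Finset.univ.filter fun i => ω i ∈ {x : PointBase d | x.1.1 = j}).card < Nc}
  -- Two masks meet at a given coordinate with probability at most `(s / (d - 1)) ^ 2` by
  -- independence; the first coordinate is never selected, so it needs no estimate.
  set E5 : Fin n × Fin n → Set (Fin n → PointBase d) := fun a =>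
    if a.1 = a.2 then ∅ else ⋃ k ∈ (Finset.univ.filter fun k : Fin d => (k : ℕ) ≠ 0),
      {ω | ω a.1 ∈ {x : PointBase d | x.2.1 k = true} ∧ ω a.2 ∈ {x : PointBase d | x.2.1 k = true}}
  have hE1 : (Measure.pi fun _ : Fin n => μ).real (⋃ i, E1 i) = 0 := by
    refine le_antisymm ((measureReal_iUnion_fintype_le _).trans
      (Finset.sum_nonpos fun i _ => (pi_real_preimage_le μ i _).trans (le_of_eq ?_)))
      measureReal_nonneg
    rw [measureReal_def, ENNReal.toReal_eq_zero_iff]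
    left
    exact pointLaw_mask_ae h
  have hE2 : (Measure.pi fun _ : Fin n => μ).real (⋃ i, E2 i) ≤
      n * (d * (2 * Real.exp (-(t ^ 2 / 2)))) := by
    refine (measureReal_iUnion_fintype_le _).trans ((Finset.sum_le_sum fun i _ =>
      (pi_real_preimage_le μ i _).trans (pointLaw_gauss_gt_le h hσ.le ht)).trans ?_)
    simp
  have hE3 : (Measure.pi fun _ : Fin n => μ).real (⋃ i, E3 i) ≤ n * (1 / 2) ^ s := by
    refine (measureReal_iUnion_fintype_le _).trans ((Finset.sum_le_sum fun i _ =>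
      (pi_real_preimage_le μ i _).trans (pointLaw_sum_lt_le h hσ)).trans ?_)
    simp
  have hE4 : (Measure.pi fun _ : Fin n => μ).real (⋃ j, E4 j) ≤
      2 * (2 ^ Nc * (1 - p₀ / 2) ^ n) := by
    refine (measureReal_iUnion_fintype_le _).trans ((Finset.sum_le_sum fun j _ =>
      pi_real_card_class_lt_le μ (B := {x : PointBase d | x.1.1 = j}) ?_ (p := p₀) ?_ n Nc).trans ?_)
    · have hm : Measurable fun x : PointBase d => x.1.1 := by fun_prop
      exact hm (MeasurableSet.singleton j)
    · exact (hp j).trans_eq (pointLaw_label h {z | z.1 = j}).symm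
    · simp
  have hd : (0 : ℝ) ≤ (s / (d - 1) : ℝ) := by
    have : (1 : ℝ) ≤ d := by exact_mod_cast (by omega : 1 ≤ d)
    exact div_nonneg (Nat.cast_nonneg s) (by linarith)
  have hE5 : (Measure.pi fun _ : Fin n => μ).real (⋃ a, E5 a) ≤
      n ^ 2 * (d * (s / (d - 1)) ^ 2) := by
    refine (measureReal_iUnion_fintype_le _).trans ((Finset.sum_le_sum (g := fun _ =>
      (d * (s / (d - 1)) ^ 2 : ℝ)) fun a _ => ?_).trans ?_)
    · by_cases ha : a.1 = a.2
      · simp only [E5, if_pos ha, measureReal_empty]; positivity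
      · simp only [E5, if_neg ha]
        refine (measureReal_biUnion_finset_le _ _).trans
          ((Finset.sum_le_card_nsmul _ _ ((s / (d - 1) : ℝ) ^ 2) fun k hk => ?_).trans ?_)
        · have hm : Measurable fun x : PointBase d => x.2.1 k := by fun_prop
          rw [pi_real_pair_eq μ ha (B := {x : PointBase d | x.2.1 k = true})
            (hm (MeasurableSet.singleton true))]
          refine pow_le_pow_left₀ measureReal_nonneg ?_ 2
          exact (pointLaw_mask h {b | b k = true}).trans_le
            (uniformOn_masks_real_le h (Finset.mem_filter.1 hk).2)
        · rw [nsmul_eq_mul]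
          refine mul_le_mul_of_nonneg_right ?_ (by positivity)
          exact_mod_cast (Finset.card_le_univ _).trans (by simp)
    · simp [sq]
  have hsub : {ω | ¬GoodData ω s Nc (t * σp) (s * (σp / 100))} ⊆
      (⋃ i, E1 i) ∪ ((⋃ i, E2 i) ∪ ((⋃ i, E3 i) ∪ ((⋃ j, E4 j) ∪ (⋃ a, E5 a)))) := by
    intro ω hω
    by_contra hc
    simp only [Set.mem_union, Set.mem_iUnion, not_or, not_exists] at hc
    obtain ⟨h1, h2, h3, h4, h5⟩ := hc
    have h1' : ∀ i, (ω i).2.1 ∈ masks d s := fun i => not_not.1 (h1 i)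
    refine hω ⟨h1', fun i i' k hi => ?_, fun i k => not_lt.1 fun hk => h2 i ⟨k, hk⟩,
      fun i => not_lt.1 (h3 i), fun j => not_lt.1 (h4 j)⟩
    by_contra hk
    push Not at hk
    have hb : ∀ x : PointBase d, ptNoise x k ≠ 0 → x.2.1 k = true := fun x hx => by
      by_contra hb
      exact hx (if_neg hb)
    have hk0 : (k : ℕ) ≠ 0 := fun h0 => by
      have := (h1' i).1 k h0
      rw [hb _ hk.1] at this
      exact Bool.noConfusion this
    have := h5 (i, i')
    simp only [E5, if_neg hi, Set.mem_iUnion, not_exists] at this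
    exact this k (by simpa using hk0) ⟨hb _ hk.1, hb _ hk.2⟩
  have l0 := measureReal_mono (μ := Measure.pi fun _ : Fin n => μ) hsub
  have l1 := measureReal_union_le (μ := Measure.pi fun _ : Fin n => μ) (⋃ i, E1 i)
    ((⋃ i, E2 i) ∪ ((⋃ i, E3 i) ∪ ((⋃ j, E4 j) ∪ (⋃ a, E5 a))))
  have l2 := measureReal_union_le (μ := Measure.pi fun _ : Fin n => μ) (⋃ i, E2 i)
    ((⋃ i, E3 i) ∪ ((⋃ j, E4 j) ∪ (⋃ a, E5 a)))
  have l3 := measureReal_union_le (μ := Measure.pi fun _ : Fin n => μ) (⋃ i, E3 i)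
    ((⋃ j, E4 j) ∪ (⋃ a, E5 a))
  have l4 := measureReal_union_le (μ := Measure.pi fun _ : Fin n => μ) (⋃ j, E4 j) (⋃ a, E5 a)
  linarith

/-! ### Random initialisations -/

/-- The coefficient vector of the response of the neuron `(j, r)` to `x`. -/
noncomputable def blockVec (j : ℤˣ) (r : Fin m) (x : Fin d → ℝ) (a : Idx m d) : ℝ :=
  if a.1 = j ∧ a.2.1 = r then x a.2.2 else 0

lemma sum_blockVec (j : ℤˣ) (r : Fin m) (f : Idx m d → ℝ) :
    (∑ a : Idx m d, if a.1 = j ∧ a.2.1 = r then f a else 0) = ∑ k, f (j, r, k) := by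
  rw [Fintype.sum_prod_type, Finset.sum_eq_single j _ fun h => absurd (Finset.mem_univ j) h]
  · rw [Fintype.sum_prod_type, Finset.sum_eq_single r _ (by simp)]
    · simp
    · intro r' _ hr'; simp [hr']
  · intro j' _ hj'; simp [hj']

lemma sum_blockVec_mul (j : ℤˣ) (r : Fin m) (x : Fin d → ℝ) (w : Idx m d → ℝ) :
    ∑ a, blockVec j r x a * w a = noiseDot x (WithLp.toLp 2 w) j r := by
  have := sum_blockVec j r fun a => x a.2.2 * w a
  simp only [blockVec, ite_mul, zero_mul]
  exact this

lemma sum_blockVec_sq (j : ℤˣ) (r : Fin m) (x : Fin d → ℝ) :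
    ∑ a, blockVec j r x a ^ 2 = ∑ k, x k ^ 2 := by
  have := sum_blockVec j r fun a => x a.2.2 ^ 2
  simp only [blockVec, ite_pow, ne_eq, OfNat.ofNat_ne_zero, not_false_eq_true, zero_pow]
  exact this

lemma blockVec_disjoint {j j' : ℤˣ} {r r' : Fin m} {x x' : Fin d → ℝ}
    (h : (j = j' ∧ r = r') → ∀ k, x k = 0 ∨ x' k = 0) (a : Idx m d) :
    blockVec j r x a = 0 ∨ blockVec j' r' x' a = 0 := by
  unfold blockVec
  by_cases h1 : a.1 = j ∧ a.2.1 = r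
  · by_cases h2 : a.1 = j' ∧ a.2.1 = r'
    · rw [if_pos h1, if_pos h2]
      exact h ⟨h1.1.symm.trans h2.1, h1.2.symm.trans h2.2⟩ _
    · right; rw [if_neg h2]
  · left; rw [if_neg h1]

/-- The properties of a typical initialisation for given labels and noises. -/
structure GoodInit (k₀ : Fin d) (y : Fin n → ℤˣ) (e : Fin n → Fin d → ℝ) (W : Weights m d)
    (w₀ h₀ x₀ u₁ : ℝ) : Prop where
  w_le : ∀ a, |W a| ≤ w₀
  h_le : ∀ i j r, |noiseDot (e i) W j r| ≤ h₀
  active_sample : ∀ i j, y i = j → ∃ r, x₀ ≤ noiseDot (e i) W j r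
  active_neuron : ∀ j r, ∃ i, y i = j ∧ x₀ ≤ noiseDot (e i) W j r
  aligned : ∀ j, ∃ r, u₁ ≤ featU k₀ W j r

/-- Different neurons, or disjoint noises on one neuron, give independent Gaussian functionals. A
sample fails to activate any of `m` neurons with probability at most `(3/4) ^ m`, and a neuron fails
on all samples of its class with probability at most `(3/4) ^ Nc`. -/
lemma gaussianVec_not_goodInit_le (hσ : 0 < σ₀) {t : ℝ} (ht : 0 ≤ t) (k₀ : Fin d)
    {y : Fin n → ℤˣ} {e : Fin n → Fin d → ℝ} {Nc : ℕ}
    (hd : ∀ i i' k, i ≠ i' → e i k = 0 ∨ e i' k = 0)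
    (hy : ∀ j, Nc ≤ (Finset.univ.filter fun i => y i = j).card) {Nm NM x₀ h₀ u₁ : ℝ} (hNm : 0 < Nm)
    (hN : ∀ i, Nm ≤ ∑ k, e i k ^ 2) (hN' : ∀ i, ∑ k, e i k ^ 2 ≤ NM)
    (hx₀ : x₀ ≤ σ₀ * √Nm / 2) (hh₀ : t * (σ₀ * √NM) ≤ h₀) (hu₁ : u₁ ≤ σ₀ / 2) :
    (gaussianVec (Idx m d) σ₀).real
      {w | ¬GoodInit k₀ y e (WithLp.toLp 2 w) (t * σ₀) h₀ x₀ u₁} ≤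
    (Fintype.card (Idx m d) + n * (2 * m)) * (2 * Real.exp (-(t ^ 2 / 2))) +
      (n + 2) * (3 / 4) ^ m + 2 * m * (3 / 4) ^ Nc := by
  set ν := gaussianVec (Idx m d) σ₀ with hν
  set F1 : Idx m d → Set (Idx m d → ℝ) := fun a => {w | t * σ₀ < |w a|}
  set F2 : Fin n × ℤˣ × Fin m → Set (Idx m d → ℝ) := fun b =>
    {w | t * (σ₀ * √(∑ a, blockVec b.2.1 b.2.2 (e b.1) a ^ 2)) <
      |∑ a, blockVec b.2.1 b.2.2 (e b.1) a * w a|}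
  set F3 : Fin n → Set (Idx m d → ℝ) := fun i =>
    {w | ∀ r ∈ (Finset.univ : Finset (Fin m)), ∑ a, blockVec (y i) r (e i) a * w a < x₀}
  set F4 : ℤˣ × Fin m → Set (Idx m d → ℝ) := fun b =>
    {w | ∀ i ∈ Finset.univ.filter fun i => y i = b.1, ∑ a, blockVec b.1 b.2 (e i) a * w a < x₀}
  set F5 : ℤˣ → Set (Idx m d → ℝ) := fun j =>
    {w | ∀ r ∈ (Finset.univ : Finset (Fin m)),
      ∑ a, blockVec j r (fun k => if k = k₀ then sgn j else 0) a * w a < u₁}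
  have hsq : ∀ j : ℤˣ, ∑ k : Fin d, (if k = k₀ then sgn j else 0) ^ 2 = 1 := fun j => by
    simp [ite_pow, sq, sgn_mul_self]
  have hF1 : ν.real (⋃ a, F1 a) ≤ Fintype.card (Idx m d) * (2 * Real.exp (-(t ^ 2 / 2))) := by
    refine (measureReal_iUnion_fintype_le _).trans ((Finset.sum_le_sum fun a _ =>
      gaussianVec_real_abs_gt_le hσ.le a ht).trans ?_)
    rw [Finset.sum_const, nsmul_eq_mul, Finset.card_univ]
  have hF2 : ν.real (⋃ b, F2 b) ≤ n * (2 * m) * (2 * Real.exp (-(t ^ 2 / 2))) := by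
    refine (measureReal_iUnion_fintype_le _).trans ((Finset.sum_le_sum fun b _ =>
      gaussianVec_real_abs_sum_gt_le hσ.le _ ht).trans ?_)
    rw [Finset.sum_const, nsmul_eq_mul, Finset.card_univ]
    simp
  have hx : ∀ i, ∀ j : ℤˣ, ∀ r : Fin m,
      x₀ ≤ σ₀ * √(∑ a, blockVec j r (e i) a ^ 2) / 2 := fun i j r => by
    rw [sum_blockVec_sq]
    refine hx₀.trans ?_
    have := mul_le_mul_of_nonneg_left (Real.sqrt_le_sqrt (hN i)) hσ.le
    linarith
  have hF3 : ν.real (⋃ i, F3 i) ≤ n * (3 / 4) ^ m := by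
    refine (measureReal_iUnion_fintype_le _).trans ((Finset.sum_le_sum fun i _ =>
      gaussianVec_real_forall_lt_le hσ Finset.univ (fun r => blockVec (y i) r (e i)) (fun _ => x₀)
        (fun r _ r' _ hr => blockVec_disjoint fun h => absurd h.2 hr)
        (fun r _ => by rw [sum_blockVec_sq]; exact hNm.trans_le (hN i))
        (fun r _ => hx i _ r)).trans ?_)
    simp
  have hF4 : ν.real (⋃ b, F4 b) ≤ 2 * m * (3 / 4) ^ Nc := by
    refine (measureReal_iUnion_fintype_le _).trans ((Finset.sum_le_sum (g := fun _ =>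
      ((3 / 4) ^ Nc : ℝ)) fun b _ =>
      (gaussianVec_real_forall_lt_le hσ _ (fun i => blockVec b.1 b.2 (e i)) (fun _ => x₀)
        (fun i _ i' _ hi => blockVec_disjoint fun _ k => hd i i' k hi)
        (fun i _ => by rw [sum_blockVec_sq]; exact hNm.trans_le (hN i))
        (fun i _ => hx i _ _)).trans ?_).trans ?_)
    · exact pow_le_pow_of_le_one (by norm_num) (by norm_num) (hy b.1)
    · simp
  have hF5 : ν.real (⋃ j, F5 j) ≤ 2 * (3 / 4) ^ m := by
    refine (measureReal_iUnion_fintype_le _).trans ((Finset.sum_le_sum fun j _ =>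
      gaussianVec_real_forall_lt_le hσ Finset.univ
        (fun r => blockVec j r (fun k => if k = k₀ then sgn j else 0)) (fun _ => u₁)
        (fun r _ r' _ hr => blockVec_disjoint fun h => absurd h.2 hr)
        (fun r _ => by rw [sum_blockVec_sq, hsq]; exact one_pos)
        (fun r _ => by rw [sum_blockVec_sq, hsq, Real.sqrt_one, mul_one]; exact hu₁)).trans ?_)
    simp
  have hsub : {w | ¬GoodInit k₀ y e (WithLp.toLp 2 w) (t * σ₀) h₀ x₀ u₁} ⊆
      (⋃ a, F1 a) ∪ ((⋃ b, F2 b) ∪ ((⋃ i, F3 i) ∪ ((⋃ b, F4 b) ∪ (⋃ j, F5 j)))) := by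
    intro w hw
    by_contra hc
    simp only [Set.mem_union, Set.mem_iUnion, not_or, not_exists] at hc
    obtain ⟨h1, h2, h3, h4, h5⟩ := hc
    refine hw ⟨fun a => not_lt.1 (h1 a), fun i j r => ?_, fun i j hij => ?_, fun j r => ?_,
      fun j => ?_⟩
    · have : |∑ a, blockVec j r (e i) a * w a| ≤
          t * (σ₀ * √(∑ a, blockVec j r (e i) a ^ 2)) := le_of_not_gt fun hlt => h2 (i, j, r) hlt
      rw [sum_blockVec_mul, sum_blockVec_sq] at this
      refine this.trans (le_trans ?_ hh₀)
      exact mul_le_mul_of_nonneg_left (mul_le_mul_of_nonneg_left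
        (Real.sqrt_le_sqrt (hN' i)) hσ.le) ht
    · by_contra hc
      push Not at hc
      subst hij
      exact h3 i fun r _ => by rw [sum_blockVec_mul]; exact hc r
    · by_contra hc
      push Not at hc
      refine h4 (j, r) fun i hi => ?_
      rw [sum_blockVec_mul]
      exact hc i (Finset.mem_filter.1 hi).2
    · by_contra hc
      push Not at hc
      refine h5 j fun r _ => ?_
      rw [sum_blockVec_mul]
      refine lt_of_eq_of_lt ?_ (hc r)
      simp [noiseDot, featU]
  have l0 := measureReal_mono (μ := ν) hsub
  have l1 := measureReal_union_le (μ := ν) (⋃ a, F1 a)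
    ((⋃ b, F2 b) ∪ ((⋃ i, F3 i) ∪ ((⋃ b, F4 b) ∪ (⋃ j, F5 j))))
  have l2 := measureReal_union_le (μ := ν) (⋃ b, F2 b) ((⋃ i, F3 i) ∪ ((⋃ b, F4 b) ∪ (⋃ j, F5 j)))
  have l3 := measureReal_union_le (μ := ν) (⋃ i, F3 i) ((⋃ b, F4 b) ∪ (⋃ j, F5 j))
  have l4 := measureReal_union_le (μ := ν) (⋃ b, F4 b) (⋃ j, F5 j)
  linarith

/-- Joint measurability in data and initialisation is needed to apply Fubini to sections with fixed
data. -/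
lemma measurableSet_goodInit (k₀ : Fin d) (w₀ h₀ x₀ u₁ : ℝ) :
    MeasurableSet {p : (Fin n → PointBase d) × (Idx m d → ℝ) |
      GoodInit k₀ (fun i => (p.1 i).1.1) (fun i => ptNoise (p.1 i)) (WithLp.toLp 2 p.2)
        w₀ h₀ x₀ u₁} := by
  have hdot : ∀ i j r, Measurable fun p : (Fin n → PointBase d) × (Idx m d → ℝ) =>
      noiseDot (ptNoise (p.1 i)) (WithLp.toLp 2 p.2) j r := by
    intro i j r
    unfold noiseDot
    refine Finset.measurable_sum _ fun k _ => Measurable.mul ?_ (by fun_prop)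
    exact (measurable_ptNoise k).comp ((measurable_pi_apply i).comp measurable_fst)
  have hy : ∀ (i : Fin n) (j : ℤˣ), MeasurableSet
      {p : (Fin n → PointBase d) × (Idx m d → ℝ) | (p.1 i).1.1 = j} := by
    intro i j
    have hm : Measurable fun p : (Fin n → PointBase d) × (Idx m d → ℝ) => (p.1 i).1.1 := by fun_prop
    exact hm (MeasurableSet.singleton j)
  have e : {p : (Fin n → PointBase d) × (Idx m d → ℝ) |
      GoodInit k₀ (fun i => (p.1 i).1.1) (fun i => ptNoise (p.1 i)) (WithLp.toLp 2 p.2)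
        w₀ h₀ x₀ u₁} =
      (⋂ a, {p | |p.2 a| ≤ w₀}) ∩
      (⋂ i, ⋂ j, ⋂ r, {p | |noiseDot (ptNoise (p.1 i)) (WithLp.toLp 2 p.2) j r| ≤ h₀}) ∩
      (⋂ i, ⋂ j, {p | (p.1 i).1.1 = j}ᶜ ∪
        ⋃ r, {p | x₀ ≤ noiseDot (ptNoise (p.1 i)) (WithLp.toLp 2 p.2) j r}) ∩
      (⋂ j, ⋂ r, ⋃ i, {p | (p.1 i).1.1 = j} ∩
        {p | x₀ ≤ noiseDot (ptNoise (p.1 i)) (WithLp.toLp 2 p.2) j r}) ∩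
      (⋂ j, ⋃ r, {p | u₁ ≤ featU k₀ (WithLp.toLp 2 p.2) j r}) := by
    ext p
    simp only [Set.mem_inter_iff, Set.mem_iInter, Set.mem_iUnion, Set.mem_union,
      Set.mem_compl_iff]
    constructor
    · intro h
      exact ⟨⟨⟨⟨h.w_le, h.h_le⟩, fun i j => or_iff_not_imp_left.2 fun hi =>
        h.active_sample i j (not_not.1 hi)⟩, h.active_neuron⟩, h.aligned⟩
    · rintro ⟨⟨⟨⟨h1, h2⟩, h3⟩, h4⟩, h5⟩
      exact ⟨h1, h2, fun i j hi => (h3 i j).resolve_left (not_not.2 hi), h4, h5⟩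
  rw [e]
  refine ((((MeasurableSet.iInter fun a => ?_).inter (MeasurableSet.iInter fun i =>
    MeasurableSet.iInter fun j => MeasurableSet.iInter fun r => ?_)).inter
    (MeasurableSet.iInter fun i => MeasurableSet.iInter fun j => (hy i j).compl.union
      (MeasurableSet.iUnion fun r => ?_))).inter (MeasurableSet.iInter fun j =>
    MeasurableSet.iInter fun r => MeasurableSet.iUnion fun i => (hy i j).inter ?_)).inter
    (MeasurableSet.iInter fun j => MeasurableSet.iUnion fun r => ?_)
  · exact measurableSet_le (by fun_prop) measurable_const
  · exact measurableSet_le (hdot i j r).abs measurable_const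
  · exact measurableSet_le measurable_const (hdot i j r)
  · exact measurableSet_le measurable_const (hdot i j r)
  · refine measurableSet_le measurable_const ?_
    unfold featU
    fun_prop

/-- Conditioning on a good set that need not be measurable: its complement is replaced by a
measurable hull of the same mass. -/
lemma prod_real_le_add {A B : Type*} [MeasurableSpace A] [MeasurableSpace B] {μ : Measure A}
    {ν : Measure B} [IsProbabilityMeasure μ] [IsProbabilityMeasure ν] {E : Set (A × B)}
    (hE : MeasurableSet E) (G : Set A) {δ : ℝ} (hδ : 0 ≤ δ)
    (h : ∀ a ∈ G, ν.real {b | (a, b) ∈ E} ≤ δ) :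
    (μ.prod ν).real E ≤ μ.real Gᶜ + δ := by
  set M := toMeasurable μ Gᶜ with hM
  have hMm : MeasurableSet M := measurableSet_toMeasurable μ _
  have h1 : (μ.prod ν).real (Prod.fst ⁻¹' M) = μ.real Gᶜ := by
    rw [measurePreserving_fst.measureReal_preimage hMm.nullMeasurableSet, hM,
      measureReal_toMeasurable]
  have h2 : (μ.prod ν).real (E \ Prod.fst ⁻¹' M) ≤ δ := by
    refine prod_real_le (hE.diff (measurable_fst hMm)) hδ (ae_of_all _ fun a => ?_)
    by_cases ha : a ∈ M
    · have : {b | (a, b) ∈ E \ Prod.fst ⁻¹' M} = (∅ : Set B) := by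
        ext b
        simp only [Set.mem_empty_iff_false, iff_false]
        exact fun hb => hb.2 ha
      rw [this, measureReal_empty]
      exact hδ
    · have haG : a ∈ G := by
        by_contra hc
        exact ha (subset_toMeasurable μ _ hc)
      exact (measureReal_mono fun b hb => hb.1).trans (h a haG)
  have h3 : E ⊆ Prod.fst ⁻¹' M ∪ (E \ Prod.fst ⁻¹' M) := fun x hx => by
    by_cases hxM : x ∈ Prod.fst ⁻¹' M
    · exact Or.inl hxM
    · exact Or.inr ⟨hx, hxM⟩
  have := (measureReal_mono h3).trans (measureReal_union_le (μ := μ.prod ν) _ _)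
  linarith

end TrainLaw

end AdamGD


namespace AdamGD

/-! ### From typical training sets to the theorem -/

section Conclusion

variable {n : ℕ} {P : Params} {p₀ : ℝ}

/-- The probability bound for atypical training sets and initialisations. -/
noncomputable def failBound (n m d s Nc : ℕ) (t p₀ : ℝ) : ℝ :=
  n ^ 2 * (d * (s / (d - 1)) ^ 2) + n * (d * (2 * Real.exp (-(t ^ 2 / 2)))) +
      n * (1 / 2) ^ s + 2 * (2 ^ Nc * (1 - p₀ / 2) ^ n) +
    ((2 * (m * d) + n * (2 * m)) * (2 * Real.exp (-(t ^ 2 / 2))) +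
      (n + 2) * (3 / 4) ^ m + 2 * m * (3 / 4) ^ Nc)

lemma GoodData.goodSample {d s m : ℕ} {α : ℝ} {ω : Fin n → PointBase d} {Nc : ℕ} {g₀ E₁ : ℝ}
    (h : GoodData ω s Nc g₀ E₁) (hg : 0 ≤ g₀) {k₀ : Fin d} (h0 : (k₀ : ℕ) = 0) {W : Weights m d}
    {w₀ h₀ x₀ u₁ : ℝ} (hW : GoodInit k₀ (fun i => (ω i).1.1) (fun i => ptNoise (ω i)) W w₀ h₀ x₀ u₁) :
    GoodSample α k₀ (fun i => mkData d α (ω i)) (fun i => ptNoise (ω i)) W s g₀ E₁ w₀ h₀ x₀ u₁ where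
  point i := isPoint_mkData h0 (h.mask i)
  disj := h.disj
  e_le i k := by
    unfold ptNoise
    split_ifs
    · exact h.g_le i k
    · simpa using hg
  card_le i := card_ptNoise_le (h.mask i)
  E_ge := h.E_ge
  w_le := hW.w_le
  h_le := hW.h_le
  active_sample i := hW.active_sample i _ rfl
  active_neuron := hW.active_neuron
  aligned := hW.aligned

/-- Training sets and initialisations are typical with high probability. -/
lemma trainLaw_real_ge (hs : P.s < P.d) (hs0 : 0 < P.s) [IsProbabilityMeasure P.ρ]
    (hσp : 0 < P.σp) (hσ₀ : 0 < P.σ₀) (hp : ∀ y : ℤˣ, p₀ ≤ P.ρ.real {z | z.1 = y}) {t : ℝ}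
    (ht : 0 ≤ t) (Nc : ℕ) {k₀ : Fin P.d} (h0 : (k₀ : ℕ) = 0) {x₀ h₀ u₁ Nm : ℝ} (hNm : 0 < Nm)
    (hNmE : P.s * Nm ≤ (P.s * (P.σp / 100)) ^ 2) (hx₀ : x₀ ≤ P.σ₀ * √Nm / 2)
    (hh₀ : t * (P.σ₀ * √(P.s * (t * P.σp) ^ 2)) ≤ h₀) (hu₁ : u₁ ≤ P.σ₀ / 2)
    {A : Set ((Fin n → DataPoint P.d) × (Idx P.m P.d → ℝ))}
    (hA : ∀ S e w, GoodSample P.α k₀ S e (WithLp.toLp 2 w) P.s (t * P.σp) (P.s * (P.σp / 100))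
      (t * P.σ₀) h₀ x₀ u₁ → (S, w) ∈ A) :
    1 - failBound n P.m P.d P.s Nc t p₀ ≤ (P.trainLaw n).real A := by
  have hPL := isProbabilityMeasure_pointLaw (σp := P.σp) (ρ := P.ρ) hs
  have hlaw : IsProbabilityMeasure P.law := isProbabilityMeasure_dataLaw hs _ _ _
  have hTL := P.isProbabilityMeasure_trainLaw hs n
  set μ := Measure.pi fun _ : Fin n => pointLaw P.d P.s P.σp P.ρ with hμ
  set ν := gaussianVec (Idx P.m P.d) P.σ₀ with hν
  have hg : 0 ≤ t * P.σp := by positivity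
  have hmp1 : MeasurePreserving (mkData P.d P.α) (pointLaw P.d P.s P.σp P.ρ) P.law :=
    ⟨measurable_mkData _ _, rfl⟩
  have hmp : MeasurePreserving (Prod.map (fun (ω : Fin n → PointBase P.d) i => mkData P.d P.α (ω i))
      (id : (Idx P.m P.d → ℝ) → _)) (μ.prod ν) (P.trainLaw n) :=
    (measurePreserving_pi _ _ fun _ => hmp1).prod (MeasurePreserving.id ν)
  set f := Prod.map (fun (ω : Fin n → PointBase P.d) i => mkData P.d P.α (ω i))
      (id : (Idx P.m P.d → ℝ) → _) with hf
  set G : Set (Fin n → PointBase P.d) :=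
    {ω | GoodData ω P.s Nc (t * P.σp) (P.s * (P.σp / 100))} with hG
  set I : Set ((Fin n → PointBase P.d) × (Idx P.m P.d → ℝ)) := {p |
      GoodInit k₀ (fun i => (p.1 i).1.1) (fun i => ptNoise (p.1 i)) (WithLp.toLp 2 p.2)
        (t * P.σ₀) h₀ x₀ u₁} with hI
  have hIm : MeasurableSet I := measurableSet_goodInit _ _ _ _ _
  have hGc : μ.real Gᶜ ≤ _ := pi_real_not_goodData_le (n := n) hs hσp ht hp Nc
  set δ₂ : ℝ := (2 * (P.m * P.d) + n * (2 * P.m)) * (2 * Real.exp (-(t ^ 2 / 2))) +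
      (n + 2) * (3 / 4) ^ P.m + 2 * P.m * (3 / 4) ^ Nc with hδ₂
  have hsec : ∀ ω ∈ G, ν.real {w | (ω, w) ∈ Iᶜ} ≤ δ₂ := by
    intro ω hω
    have hω' : GoodData ω P.s Nc (t * P.σp) (P.s * (P.σp / 100)) := hω
    have hcard : ∀ i, (Finset.univ.filter fun k => ptNoise (ω i) k ≠ 0).card ≤ P.s := fun i =>
      card_ptNoise_le (hω'.mask i)
    have hle : ∀ i k, |ptNoise (ω i) k| ≤ t * P.σp := fun i k => by
      unfold ptNoise
      split_ifs
      · exact hω'.g_le i k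
      · simpa using hg
    have hNge : ∀ i, Nm ≤ ∑ k, ptNoise (ω i) k ^ 2 := fun i => by
      have h1 := sq_sum_abs_le_of_card_le (hcard i)
      have h2 := pow_le_pow_left₀ (by positivity) (hω'.E_ge i) 2
      have h3 : (0 : ℝ) < P.s := by exact_mod_cast hs0
      exact le_of_mul_le_mul_left (hNmE.trans (h2.trans h1)) h3
    have h := gaussianVec_not_goodInit_le (m := P.m) hσ₀ ht k₀ (y := fun i => (ω i).1.1)
      (e := fun i => ptNoise (ω i)) hω'.disj hω'.cls hNm hNge
      (fun i => sum_sq_le_of_card_le (hle i) (hcard i)) hx₀ hh₀ hu₁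
    refine (le_of_eq ?_).trans (h.trans (le_of_eq ?_))
    · rfl
    · rw [hδ₂]; simp [Fintype.card_prod]
  have hδ₂0 : 0 ≤ δ₂ := by positivity
  set M := toMeasurable μ Gᶜ with hM
  have hMm : MeasurableSet M := measurableSet_toMeasurable μ _
  have hMG : ∀ ω, ω ∉ M → ω ∈ G := fun ω hω => by
    by_contra hc
    exact hω (subset_toMeasurable μ _ hc)
  have hE : MeasurableSet (Iᶜ ∪ Prod.fst ⁻¹' M) := hIm.compl.union (measurable_fst hMm)
  have hprod := prod_real_le_add (μ := μ) (ν := ν) hE Mᶜ hδ₂0 fun ω hω =>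
    (measureReal_mono fun w hw => hw.resolve_right hω).trans (hsec ω (hMG ω hω))
  rw [compl_compl, hM, measureReal_toMeasurable] at hprod
  have hsub : (Iᶜ ∪ Prod.fst ⁻¹' M)ᶜ ⊆ f ⁻¹' A := by
    rintro ⟨ω, w⟩ hω
    rw [Set.mem_compl_iff, Set.mem_union, not_or, Set.mem_compl_iff, not_not] at hω
    exact hA _ (fun i => ptNoise (ω i)) _ ((hMG ω hω.2 : GoodData ω P.s Nc (t * P.σp)
      (P.s * (P.σp / 100))).goodSample hg h0 hω.1)
  have h1 := measureReal_mono (μ := μ.prod ν) hsub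
  rw [measureReal_compl hE, probReal_univ] at h1
  -- The event about the algorithms is not assumed measurable; pushing forward can only increase its
  -- outer measure, which is the direction needed.
  have h2 : (μ.prod ν).real (f ⁻¹' A) ≤ (P.trainLaw n).real A := by
    rw [← hmp.map_eq, measureReal_def, measureReal_def]
    exact ENNReal.toReal_mono (by rw [hmp.map_eq]; exact measure_ne_top _ _)
      (Measure.le_map_apply hmp.measurable.aemeasurable A)
  unfold failBound
  linarith

/-- The probability bound for atypical fresh points. -/
noncomputable def freshBound (n d s : ℕ) (t : ℝ) : ℝ :=
  n * (s * (s / (d - 1))) + d * (2 * Real.exp (-(t ^ 2 / 2)))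

lemma measurable_output {q : ℝ} {m d : ℕ} (W : Weights m d) (j : ℤˣ) :
    Measurable fun x : Patches d => output q W j x := by
  unfold output act
  refine Finset.measurable_sum _ fun r _ => Finset.measurable_sum _ fun p _ =>
    Measurable.pow_const (measurable_const.max ?_) q
  refine Finset.measurable_sum _ fun k _ => measurable_const.mul ?_
  exact (measurable_pi_apply k).comp (measurable_pi_apply p)

variable {k₀ : Fin P.d} {S : Fin n → DataPoint P.d} {e : Fin n → Fin P.d → ℝ}
  {W₀ : Weights P.m P.d} {t E₁ w₀ h₀ x₀ u₁ : ℝ} {q : ℝ} {W : Weights P.m P.d}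

lemma GoodSample.testError_le
    (h : GoodSample P.α k₀ S e W₀ P.s (t * P.σp) E₁ w₀ h₀ x₀ u₁) (hs : P.s < P.d)
    [IsProbabilityMeasure P.ρ] (hσ : 0 ≤ P.σp) (ht : 0 ≤ t)
    (hW : ∀ z e', FreshPoint P.α k₀ e P.s (t * P.σp) z e' →
      output q W (-z.2) z.1 < output q W z.2 z.1) (i₀ : Fin n) :
    testError q P.law W ≤ freshBound n P.d P.s t := by
  have hPL := isProbabilityMeasure_pointLaw (σp := P.σp) (ρ := P.ρ) hs
  have hmp : MeasurePreserving (mkData P.d P.α) (pointLaw P.d P.s P.σp P.ρ) P.law :=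
    ⟨measurable_mkData _ _, rfl⟩
  have hm : MeasurableSet {z : DataPoint P.d | output q W z.2 z.1 ≤ output q W (-z.2) z.1} := by
    refine measurableSet_le ?_ ?_
    · exact measurable_from_prod_countable_left fun y => measurable_output W y
    · exact measurable_from_prod_countable_left fun y => measurable_output W (-y)
  unfold testError
  rw [← hmp.measureReal_preimage hm.nullMeasurableSet]
  refine (measureReal_mono fun ω hω hf => ?_).trans (pointLaw_not_fresh_le (n := n) (α := P.α)
    (h.point i₀).first hs hσ ht h.card_le fun i => (h.point i).first_eq)
  exact absurd (hW _ _ hf) (not_lt.2 hω)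

lemma GoodSample.testError_ge
    (h : GoodSample P.α k₀ S e W₀ P.s (t * P.σp) E₁ w₀ h₀ x₀ u₁) (hs : P.s < P.d)
    [IsProbabilityMeasure P.ρ] (hσ : 0 ≤ P.σp) (ht : 0 ≤ t)
    (hW : ∀ z e', FreshPoint P.α k₀ e P.s (t * P.σp) z e' →
      output q W z.2 z.1 < output q W (-z.2) z.1) (i₀ : Fin n) :
    1 - freshBound n P.d P.s t ≤ testError q P.law W := by
  have hPL := isProbabilityMeasure_pointLaw (σp := P.σp) (ρ := P.ρ) hs
  have hlaw : IsProbabilityMeasure P.law := isProbabilityMeasure_dataLaw hs _ _ _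
  have hmp : MeasurePreserving (mkData P.d P.α) (pointLaw P.d P.s P.σp P.ρ) P.law :=
    ⟨measurable_mkData _ _, rfl⟩
  have h1 := pointLaw_not_fresh_le (n := n) (α := P.α) (ρ := P.ρ)
    (h.point i₀).first hs hσ ht h.card_le fun i => (h.point i).first_eq
  set F := {ω : PointBase P.d |
    ¬FreshPoint P.α k₀ e P.s (t * P.σp) (mkData P.d P.α ω) (ptNoise ω)} with hF
  set A := {z : DataPoint P.d | output q W z.2 z.1 ≤ output q W (-z.2) z.1} with hA
  have h2 : (Set.univ : Set (PointBase P.d)) ⊆ F ∪ mkData P.d P.α ⁻¹' A := fun ω _ => by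
    by_cases hf : FreshPoint P.α k₀ e P.s (t * P.σp) (mkData P.d P.α ω) (ptNoise ω)
    · exact Or.inr (hW _ _ hf).le
    · exact Or.inl hf
  have h3 := (measureReal_mono (μ := pointLaw P.d P.s P.σp P.ρ) h2).trans
    (measureReal_union_le _ _)
  rw [probReal_univ] at h3
  have h4 : (pointLaw P.d P.s P.σp P.ρ).real (mkData P.d P.α ⁻¹' A) ≤ P.law.real A := by
    rw [← hmp.map_eq, measureReal_def, measureReal_def]
    exact ENNReal.toReal_mono (by rw [hmp.map_eq]; exact measure_ne_top _ _)
      (Measure.le_map_apply hmp.measurable.aemeasurable A)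
  unfold testError freshBound
  linarith

end Conclusion

end AdamGD


namespace AdamGD

/-! ### The parameter regime on the logarithmic scale -/

set_option linter.unusedSimpArgs false

lemma le_of_log_le {x y : ℝ} (hx : 0 < x) (hy : 0 < y) (h : Real.log x ≤ Real.log y) : x ≤ y :=
  (Real.log_le_log_iff hx hy).1 h

lemma lt_of_log_lt {x y : ℝ} (hx : 0 < x) (hy : 0 < y) (h : Real.log x < Real.log y) : x < y :=
  (Real.log_lt_log_iff hx hy).1 h

/-- The scales of the problem parameters and of the quantities derived from them, up to a
multiplicative error `exp v`. -/
structure Scales (q v Z : ℝ) (n d s m : ℕ) (α lam g₀ E₁ w₀ w₁ x₀ u₁ B Nm : ℝ) : Prop where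
  q_ge : 3 ≤ q
  n_pos : 0 < n
  d_pos : 0 < d
  s_pos : 0 < s
  m_pos : 0 < m
  α_pos : 0 < α
  lam_pos : 0 < lam
  g₀_pos : 0 < g₀
  E₁_pos : 0 < E₁
  w₀_pos : 0 < w₀
  w₁_pos : 0 < w₁
  x₀_pos : 0 < x₀
  u₁_pos : 0 < u₁
  B_pos : 0 < B
  Nm_pos : 0 < Nm
  num : ∀ z : ℝ, 1 ≤ z → z ≤ 20000 → 0 ≤ Real.log z ∧ Real.log z ≤ v
  v_ge : 10 ≤ v
  log_q : Real.log q ≤ v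
  q_mul_v : 1000 * (q * v) ≤ Real.log n
  dim_ge : 100 * (q * Real.log n) ≤ Real.log d
  dim_le : Real.log d ≤ Z * Real.log n
  m_le : Real.log m ≤ v
  s_ge : Real.log d / 2 - 2 * Real.log n - v ≤ Real.log s
  s_le : Real.log s ≤ Real.log d / 2 - 2 * Real.log n + v
  α_ge : Real.log n - Real.log d / 4 - v ≤ Real.log α
  α_le : Real.log α ≤ Real.log n - Real.log d / 4 + v
  lam_ge : -(Z * Real.log n) ≤ Real.log lam
  lam_le : Real.log lam ≤ -((q - 1) / 4 * Real.log d) - Real.log n + v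
  g₀_le : Real.log g₀ ≤ Real.log n - Real.log d / 4 + v
  E₁_ge : Real.log d / 4 - Real.log n - v ≤ Real.log E₁
  w₀_le : Real.log w₀ ≤ -(Real.log d / 4) + v
  w₁_le : Real.log w₁ ≤ -(Real.log d / 4) + v
  x₀_ge : -(Real.log d / 4) - v ≤ Real.log x₀
  x₀_le : Real.log x₀ ≤ -(Real.log d / 4) + v
  u₁_ge : -(Real.log d / 4) - v ≤ Real.log u₁
  u₁_le : Real.log u₁ ≤ -(Real.log d / 4) + v
  B_ge : s * g₀ + 1 + α ≤ B
  B_le : Real.log B ≤ Real.log d / 4 - Real.log n + v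
  Nm_ge : -v ≤ Real.log Nm
  N_le : s * g₀ ^ 2 ≤ 1 / 8
  Nm_le : s * Nm ≤ E₁ ^ 2

/-- The scales of the step size and of the time horizon. -/
structure Horizon (q lam v Z A : ℝ) (n m T : ℕ) (η R B : ℝ) : Prop where
  T_pos : 0 < T
  η_pos : 0 < η
  A_nonneg : 0 ≤ A
  R_pos : 0 < R
  R_eq : Real.log R = (Z + A + 2) * Real.log n
  ge : (20 * Z + 20) * Real.log n ≤ Real.log T + Real.log η
  le : Real.log T + Real.log η ≤ A * Real.log n
  lip_le : Real.log (lipBound q lam m R B) + Real.log η ≤ -((A + 20 * Z + 20) * Real.log n)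
  lip_one : 1 ≤ lipBound q lam m R B
  grad_le : gradBound q R B ≤ lipBound q lam m R B
  pow_le : q * (R * B) ^ (q - 2) ≤ lipBound q lam m R B
  R_le : R ≤ lipBound q lam m R B

variable {q v Z A α lam η g₀ E₁ w₀ w₁ x₀ u₁ h₀ R B Nm : ℝ} {n d s m T : ℕ}

-- After taking logarithms each numerical condition is linear in the logarithmic scales. Since `d`
-- is at least `n ^ (100 q)`, powers of `d ^ (1/4)` decide, and powers of `n` and the errors `v` are
-- lower order. Here alignments reach `n ^ (-2)` and the ceiling for them is `n`.
set_option maxHeartbeats 1000000 in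
lemma Scales.gdNumerics (h : Scales q v Z n d s m α lam g₀ E₁ w₀ w₁ x₀ u₁ B Nm)
    (k : Horizon q lam v Z A n m T η R B) (hh₀ : 0 ≤ h₀) (start : h₀ + 2 * α * w₀ ≤ u₁ / 4)
    (hY : ∀ Y, (n : ℝ) ≤ Y → q * Real.exp (-(Y ^ q / 2)) * Y ^ (q - 2) < lam / 2) :
    GDNumerics q α lam η n m d s T g₀ E₁ w₀ h₀ u₁ ((n : ℝ) ^ (-2 : ℝ)) n R B Nm
      (2 * (m * d) * √(1 / (T * η))) := by
  obtain ⟨hq, hn, hd, hs, hm, hα, hlam, hg, hE, hw₀, hw₁, hx₀, hu₁, hB, hNm, num, c1, c2, c3, c4,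
    c5, c6, c7, c8, c9, c10, c11, c12, c13, c14, c15, c16, c17, c18, c19, c20, B_ge, c21, c22,
    N_le, Nm_le⟩ := h
  obtain ⟨hT, hη, hA, hR, k1, k2, k3, k4, lip1, lipg, lipp, lipR⟩ := k
  have hq0 : 0 < q := by linarith
  have hcard : (Fintype.card (Idx m d) : ℝ) = 2 * (m * d) := by
    simp [Fintype.card_prod]
  have hlip : 0 < lipBound q lam m R B := by linarith
  set Λ := lipBound q lam m R B with hΛ
  have hq3 : 0 ≤ q - 3 := sub_nonneg.2 hq
  have r0 : 0 ≤ (q - 3) * Real.log n := mul_nonneg hq3 (Real.log_natCast_nonneg n)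
  have r1 : 0 ≤ (q - 3) * (v - 10) := mul_nonneg hq3 (sub_nonneg.2 c1)
  have r2 : 1000 * v ≤ Real.log n := by
    linarith only [c3, mul_nonneg hq3 (by linarith only [c1] : 0 ≤ v), c1]
  have r3 : 0 ≤ (q - 3) * (Real.log n - 1000 * v) := mul_nonneg hq3 (sub_nonneg.2 r2)
  have r4 : 300 * Real.log n ≤ Real.log d := by
    linarith only [c4, mul_nonneg hq3 (by linarith only [r2, c1] : 0 ≤ Real.log n)]
  have r5 : 0 ≤ (q - 3) * (Real.log d - 300 * Real.log n) := mul_nonneg hq3 (sub_nonneg.2 r4)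
  have r6 : 0 ≤ (q - 3) * (Real.log n - Real.log d / 4 + v - Real.log α) :=
    mul_nonneg hq3 (sub_nonneg.2 c10)
  have r7 : 0 ≤ (q - 3) * (Real.log u₁ - (-(Real.log d / 4) - v)) :=
    mul_nonneg hq3 (sub_nonneg.2 c19)
  have r8 : 0 ≤ (q - 3) * (-(Real.log d / 4) + v - Real.log w₀) := mul_nonneg hq3 (sub_nonneg.2 c15)
  have r9 : 0 ≤ (q - 3) * (Real.log d / 4 - Real.log n + v - Real.log B) :=
    mul_nonneg hq3 (sub_nonneg.2 c21)
  have r10 : 0 ≤ (q - 3) * (v - Real.log m) := mul_nonneg hq3 (sub_nonneg.2 c6)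
  have r11 : 0 ≤ A * Real.log n := mul_nonneg hA (Real.log_natCast_nonneg n)
  have lipL : 0 ≤ Real.log Λ := Real.log_nonneg lip1
  have n2 := num 2 (by norm_num) (by norm_num)
  have n3 := num 3 (by norm_num) (by norm_num)
  have rn3 : 0 ≤ (q - 3) * (v - Real.log 3) := mul_nonneg hq3 (sub_nonneg.2 n3.2)
  have n4 := num 4 (by norm_num) (by norm_num)
  have n8 := num 8 (by norm_num) (by norm_num)
  have n10 := num 10 (by norm_num) (by norm_num)
  have n25 := num 25 (by norm_num) (by norm_num)
  have n32 := num 32 (by norm_num) (by norm_num)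
  have n50 := num 50 (by norm_num) (by norm_num)
  have hlq : 0 ≤ Real.log q := Real.log_nonneg (by linarith)
  have bounds := And.intro c2 <| And.intro c3 <| And.intro c4 <| And.intro c5 <| And.intro c6 <|
    And.intro c7 <| And.intro c8 <| And.intro c9 <| And.intro c10 <| And.intro c11 <| And.intro
    c12 <| And.intro c13 <| And.intro c14 <| And.intro c15 <| And.intro c16 <| And.intro c17 <|
    And.intro c18 <| And.intro c19 <| And.intro c20 <| And.intro c21 <| And.intro c22 <| And.intro
    k1 <| And.intro k2 <| And.intro k3 <| And.intro k4 <| And.intro r0 <| And.intro r1 <|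
    And.intro r3 <| And.intro r5 <| And.intro r6 <| And.intro r7 <| And.intro r8 <| And.intro r9
    <| And.intro r10 <| And.intro r11 <| And.intro rn3 <| And.intro lipL <| And.intro n2 <|
    And.intro n3 <| And.intro n4 <| And.intro n8 <| And.intro n10 <| And.intro n25 <| And.intro
    n32 <| And.intro n50 <| And.intro c1 <| And.intro r2 <| And.intro r4 hlq
  clear c2 c3 c4 c5 c6 c7 c8 c9 c10 c11 c12 c13 c14 c15 c16 c17 c18 c19 c20 c21 c22 k1 k2 k3 k4 r0
    r1 r3 r5 r6 r7 r8 r9 r10 r11 rn3 lipL n2 n3 n4 n8 n10 n25 n32 n50 c1 r2 r4 hlq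
  constructor
  case q_ge => exact hq
  case lam_pos => exact hlam
  case α_pos => exact hα
  case η_pos => exact hη
  case s_pos => exact hs
  case g₀_nonneg => exact hg.le
  case E₁_nonneg => exact hE.le
  case B_ge => exact B_ge
  case Nm_pos => exact hNm
  case Nm_le => exact Nm_le
  case N_le => exact N_le
  case h₀_nonneg => exact hh₀
  case w₀_nonneg => exact hw₀.le
  case start => exact start
  case u₁_pos => exact hu₁
  case Yb_exp => exact hY
  case τ_ge => rw [hcard]
  case R_ge =>
    refine le_of_log_le (by positivity) (by positivity) ?_
    simp (disch := positivity) only [Real.log_one]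
    linarith
  case R_sq =>
    have h1 : 2 ≤ R := by
      refine le_of_log_le (by positivity) (by positivity) ?_
      linarith
    have h2 : 2 / lam ≤ (R / 2) ^ 2 := by
      refine le_of_log_le (by positivity) (by positivity) ?_
      simp (disch := positivity) only [Real.log_mul, Real.log_div, Real.log_pow]
      push_cast
      linarith
    exact h2.trans (pow_le_pow_left₀ (by positivity) (by linarith) 2)
  case α_le =>
    refine le_of_log_le (by positivity) (by positivity) ?_
    simp (disch := positivity) only [Real.log_mul, Real.log_div, Real.log_rpow, Real.log_pow,
      Real.log_sqrt, Real.log_one, Nat.cast_ofNat]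
    linarith
  case αn =>
    refine le_of_log_le (by positivity) (by positivity) ?_
    simp (disch := positivity) only [Real.log_mul, Real.log_div, Real.log_rpow, Real.log_pow,
      Real.log_sqrt, Real.log_one, Nat.cast_ofNat]
    linarith
  case ηlam =>
    refine le_of_log_le (by positivity) (by positivity) ?_
    simp (disch := positivity) only [Real.log_mul, Real.log_div, Real.log_rpow, Real.log_pow,
      Real.log_sqrt, Real.log_one, Nat.cast_ofNat]
    linarith
  case nN =>
    refine le_of_log_le (by positivity) (by positivity) ?_
    simp (disch := positivity) only [Real.log_mul, Real.log_div, Real.log_rpow, Real.log_pow,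
      Real.log_sqrt, Real.log_one, Nat.cast_ofNat]
    linarith
  case αN =>
    refine le_of_log_le (by positivity) (by positivity) ?_
    simp (disch := positivity) only [Real.log_mul, Real.log_div, Real.log_rpow, Real.log_pow,
      Real.log_sqrt, Real.log_one, Nat.cast_ofNat]
    linarith
  case u₁_hi =>
    refine le_of_log_le (by positivity) (by positivity) ?_
    simp (disch := positivity) only [Real.log_mul, Real.log_div, Real.log_rpow, Real.log_pow,
      Real.log_sqrt, Real.log_one, Nat.cast_ofNat]
    linarith
  case hi_le =>
    refine le_of_log_le (by positivity) (by positivity) ?_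
    simp (disch := positivity) only [Real.log_mul, Real.log_div, Real.log_rpow, Real.log_pow,
      Real.log_sqrt, Real.log_one, Nat.cast_ofNat]
    linarith
  case hi_pow =>
    refine le_of_log_le (by positivity) (by positivity) ?_
    simp (disch := positivity) only [Real.log_mul, Real.log_div, Real.log_rpow, Real.log_pow,
      Real.log_sqrt, Real.log_one, Nat.cast_ofNat]
    linarith
  case lam_le =>
    refine le_of_log_le (by positivity) (by positivity) ?_
    simp (disch := positivity) only [Real.log_mul, Real.log_div, Real.log_rpow, Real.log_pow,
      Real.log_sqrt, Real.log_one, Nat.cast_ofNat]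
    linarith
  case τ_le =>
    refine le_of_log_le (by positivity) (by positivity) ?_
    simp (disch := positivity) only [Real.log_mul, Real.log_div, Real.log_rpow, Real.log_pow,
      Real.log_sqrt, Real.log_one, Nat.cast_ofNat]
    linarith
  case α_pow =>
    refine le_of_log_le (by positivity) (by positivity) ?_
    simp (disch := positivity) only [Real.log_mul, Real.log_div, Real.log_rpow, Real.log_pow,
      Real.log_sqrt, Real.log_one, Nat.cast_ofNat]
    linarith
  case noise =>
    refine le_of_log_le (by positivity) (by positivity) ?_
    simp (disch := positivity) only [Real.log_mul, Real.log_div, Real.log_rpow, Real.log_pow,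
      Real.log_sqrt, Real.log_one, Nat.cast_ofNat]
    linarith
  case init =>
    refine le_of_log_le (by positivity) (by positivity) ?_
    simp (disch := positivity) only [Real.log_mul, Real.log_div, Real.log_rpow, Real.log_pow,
      Real.log_sqrt, Real.log_one, Nat.cast_ofNat]
    linarith
  case classify =>
    refine lt_of_log_lt (by positivity) (by positivity) ?_
    simp (disch := positivity) only [Real.log_mul, Real.log_div, Real.log_rpow, Real.log_pow,
      Real.log_sqrt, Real.log_one, Nat.cast_ofNat]
    linarith
  case init_sq =>
    rw [hcard]
    refine le_of_log_le (by positivity) (by positivity) ?_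
    simp (disch := positivity) only [Real.log_mul, Real.log_div, Real.log_rpow, Real.log_pow,
      Real.log_sqrt, Real.log_one, Nat.cast_ofNat]
    linarith
  case lip =>
    rw [hcard]
    refine le_of_log_le (by positivity) (by positivity) ?_
    simp (disch := positivity) only [Real.log_mul, Real.log_div, Real.log_rpow, Real.log_pow,
      Real.log_sqrt, Real.log_one, Nat.cast_ofNat]
    linarith
  case small =>
    refine (mul_le_mul_of_nonneg_left lipp hη.le).trans
      (le_of_log_le (by positivity) (by positivity) ?_)
    simp (disch := positivity) only [Real.log_mul, Real.log_div, Real.log_rpow, Real.log_pow,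
      Real.log_sqrt, Real.log_one, Nat.cast_ofNat]
    linarith
  case step =>
    have hl1 : lam ≤ 1 := by
      refine le_of_log_le (by positivity) (by positivity) ?_
      rw [Real.log_one]
      linarith
    have h1 : lam * R + gradBound q R B ≤ 2 * Λ := by
      linarith only [mul_le_mul_of_nonneg_right hl1 hR.le, lipR, lipg]
    refine (mul_le_mul_of_nonneg_left h1 hη.le).trans
      (le_of_log_le (by positivity) (by positivity) ?_)
    simp (disch := positivity) only [Real.log_mul, Real.log_div, Real.log_rpow, Real.log_pow,
      Real.log_sqrt, Real.log_one, Nat.cast_ofNat]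
    linarith


-- The choices: `θ = lam * w₁` makes the gradient threshold comparable with weight decay, the
-- barrier `δ = lam / (2 q)` satisfies its power condition because `q - 2 ≥ 1`, and `xb = x₀` is
-- twice the level kept later. The condition `force` holds since `α E₁` is of order 1 up to the
-- errors, while `E₁ ^ (q - 2)` far exceeds `n` and its fixed powers.
set_option maxHeartbeats 2000000 in
lemma Scales.signNumerics (h : Scales q v Z n d s m α lam g₀ E₁ w₀ w₁ x₀ u₁ B Nm)
    (k : Horizon q lam v Z A n m T η R B) {H tₐ t₀ : ℕ} {C θ₀ Θ thr : ℝ} (hH1 : 1 ≤ H)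
    (hH : Real.log H ≤ v) (hC : 0 < C) (hC1 : Real.log (1 + C) ≤ v) (hthr : 0 < thr)
    (hthr1 : Real.log thr ≤ v) (hΘeq : Θ = thr * (lipBound q lam m R B * (C * η)))
    (hθ₀ : θ₀ = Θ / lam) (hw₁ge : -(Real.log d / 4) - v ≤ Real.log w₁) (ht₀ : 0 < t₀)
    (ht₀η : -(Real.log d / 4) - v ≤ Real.log t₀ + Real.log η)
    (tₐ_le : tₐ ≤ T) (w₁_ge : w₀ + C * η * tₐ ≤ w₁) (time : H + t₀ ≤ tₐ)
    (descend : w₀ + C * η * (H + t₀) ≤ 9 / 10 * η * (tₐ - (H + t₀) : ℕ))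
    (hY : ∀ Y, (n : ℝ) ≤ Y → q * Real.exp (-(Y ^ q / 2)) * Y ^ (q - 2) < lam / 2) :
    SignNumerics q α lam η n m d s T H tₐ t₀ g₀ E₁ w₀ w₁ x₀ x₀ (lam * w₁) θ₀ (lam / (2 * q)) n
      R B Nm Θ C := by
  obtain ⟨hq, hn, hd, hs, hm, hα, hlam, hg, hE, hw₀, hw₁, hx₀, hu₁, hB, hNm, num, c1, c2, c3, c4,
    c5, c6, c7, c8, c9, c10, c11, c12, c13, c14, c15, c16, c17, c18, c19, c20, B_ge, c21, c22,
    N_le, Nm_le⟩ := h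
  obtain ⟨hT, hη, hA, hR, k1, k2, k3, k4, lip1, lipg, lipp, lipR⟩ := k
  have hq0 : 0 < q := by linarith
  have hcard : (Fintype.card (Idx m d) : ℝ) = 2 * (m * d) := by
    simp [Fintype.card_prod]
  have hlip : 0 < lipBound q lam m R B := by linarith
  set Λ := lipBound q lam m R B with hΛ
  have hq3 : 0 ≤ q - 3 := sub_nonneg.2 hq
  have r0 : 0 ≤ (q - 3) * Real.log n := mul_nonneg hq3 (Real.log_natCast_nonneg n)
  have r1 : 0 ≤ (q - 3) * (v - 10) := mul_nonneg hq3 (sub_nonneg.2 c1)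
  have r2 : 1000 * v ≤ Real.log n := by
    linarith only [c3, mul_nonneg hq3 (by linarith only [c1] : 0 ≤ v), c1]
  have r3 : 0 ≤ (q - 3) * (Real.log n - 1000 * v) := mul_nonneg hq3 (sub_nonneg.2 r2)
  have r4 : 300 * Real.log n ≤ Real.log d := by
    linarith only [c4, mul_nonneg hq3 (by linarith only [r2, c1] : 0 ≤ Real.log n)]
  have r5 : 0 ≤ (q - 3) * (Real.log d - 300 * Real.log n) := mul_nonneg hq3 (sub_nonneg.2 r4)
  have r6 : 0 ≤ (q - 3) * (Real.log n - Real.log d / 4 + v - Real.log α) :=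
    mul_nonneg hq3 (sub_nonneg.2 c10)
  have r7 : 0 ≤ (q - 3) * (Real.log u₁ - (-(Real.log d / 4) - v)) :=
    mul_nonneg hq3 (sub_nonneg.2 c19)
  have r8 : 0 ≤ (q - 3) * (-(Real.log d / 4) + v - Real.log w₀) := mul_nonneg hq3 (sub_nonneg.2 c15)
  have r9 : 0 ≤ (q - 3) * (Real.log d / 4 - Real.log n + v - Real.log B) :=
    mul_nonneg hq3 (sub_nonneg.2 c21)
  have r10 : 0 ≤ (q - 3) * (v - Real.log m) := mul_nonneg hq3 (sub_nonneg.2 c6)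
  have r11 : 0 ≤ A * Real.log n := mul_nonneg hA (Real.log_natCast_nonneg n)
  have lipL : 0 ≤ Real.log Λ := Real.log_nonneg lip1
  have n2 := num 2 (by norm_num) (by norm_num)
  have n3 := num 3 (by norm_num) (by norm_num)
  have rn3 : 0 ≤ (q - 3) * (v - Real.log 3) := mul_nonneg hq3 (sub_nonneg.2 n3.2)
  have n4 := num 4 (by norm_num) (by norm_num)
  have n8 := num 8 (by norm_num) (by norm_num)
  have rx : 0 ≤ (q - 3) * (Real.log x₀ - (-(Real.log d / 4) - v)) :=
    mul_nonneg hq3 (sub_nonneg.2 c17)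
  have rx' : 0 ≤ (q - 3) * (-(Real.log d / 4) + v - Real.log x₀) :=
    mul_nonneg hq3 (sub_nonneg.2 c18)
  have rw : 0 ≤ (q - 3) * (-(Real.log d / 4) + v - Real.log w₁) := mul_nonneg hq3 (sub_nonneg.2 c16)
  have rE : 0 ≤ (q - 3) * (Real.log E₁ - (Real.log d / 4 - Real.log n - v)) :=
    mul_nonneg hq3 (sub_nonneg.2 c14)
  have rt : 0 ≤ (q - 3) * (Real.log t₀ + Real.log η - (-(Real.log d / 4) - v)) :=
    mul_nonneg hq3 (sub_nonneg.2 ht₀η)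
  have rn2 : 0 ≤ (q - 3) * (v - Real.log 2) := mul_nonneg hq3 (sub_nonneg.2 n2.2)
  have rn8 : 0 ≤ (q - 3) * (v - Real.log 8) := mul_nonneg hq3 (sub_nonneg.2 n8.2)
  have n12 := num 12 (by norm_num) (by norm_num)
  have n16 := num 16 (by norm_num) (by norm_num)
  have n18 := num 18 (by norm_num) (by norm_num)
  have n40 := num 40 (by norm_num) (by norm_num)
  have n100 := num 100 (by norm_num) (by norm_num)
  have n10 := num 10 (by norm_num) (by norm_num)
  have n25 := num 25 (by norm_num) (by norm_num)
  have n32 := num 32 (by norm_num) (by norm_num)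
  have n50 := num 50 (by norm_num) (by norm_num)
  have hlq : 0 ≤ Real.log q := Real.log_nonneg (by linarith)
  have hC2 : Real.log C ≤ v := (Real.log_le_log hC (by linarith)).trans hC1
  have hHpos : 0 < H := hH1
  have hΘ : 0 < Θ := by rw [hΘeq]; positivity
  have hlΘ : Real.log Θ ≤ 2 * v - (A + 20 * Z + 20) * Real.log n := by
    rw [hΘeq]
    simp (disch := positivity) only [Real.log_mul]
    linarith
  have hlηΛ : Real.log η ≤ -((A + 20 * Z + 20) * Real.log n) := by linarith
  have hδ1 : lam / (2 * q) ≤ 1 := by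
    refine le_of_log_le (by positivity) (by positivity) ?_
    simp (disch := positivity) only [Real.log_mul, Real.log_div, Real.log_one]
    linarith
  have hTpos : (0 : ℝ) < T := by exact_mod_cast hT
  have hsg : s * g₀ + α ≤ B := by linarith
  clear hΘeq hthr1
  have bounds := And.intro c2 <| And.intro c3 <| And.intro c4 <| And.intro c5 <| And.intro c6 <|
    And.intro c7 <| And.intro c8 <| And.intro c9 <| And.intro c10 <| And.intro c11 <| And.intro
    c12 <| And.intro c13 <| And.intro c14 <| And.intro c15 <| And.intro c16 <| And.intro c17 <|
    And.intro c18 <| And.intro c19 <| And.intro c20 <| And.intro c21 <| And.intro c22 <| And.intro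
    k1 <| And.intro k2 <| And.intro k3 <| And.intro k4 <| And.intro r0 <| And.intro r1 <|
    And.intro r3 <| And.intro r5 <| And.intro r6 <| And.intro r7 <| And.intro r8 <| And.intro r9
    <| And.intro r10 <| And.intro r11 <| And.intro rn3 <| And.intro rx <| And.intro rx' <|
    And.intro rw <| And.intro rE <| And.intro rt <| And.intro rn2 <| And.intro rn8 <| And.intro
    lipL <| And.intro hlΘ <| And.intro hlηΛ <| And.intro n2 <| And.intro n3 <| And.intro n4 <|
    And.intro n8 <| And.intro n10 <| And.intro n12 <| And.intro n16 <| And.intro n18 <| And.intro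
    n25 <| And.intro n32 <| And.intro n40 <| And.intro n50 <| And.intro n100 <| And.intro hH <|
    And.intro hC1 <| And.intro hC2 <| And.intro ht₀η <| And.intro hw₁ge <| And.intro c1 <|
    And.intro r2 <| And.intro r4 hlq
  clear c2 c3 c4 c5 c6 c7 c8 c9 c10 c11 c12 c13 c14 c15 c16 c17 c18 c19 c20 c21 c22 k1 k2 k3 k4 r0
    r1 r3 r5 r6 r7 r8 r9 r10 r11 rn3 rx rx' rw rE rt rn2 rn8 lipL hlΘ hlηΛ n2 n3 n4 n8 n10 n12 n16
    n18 n25 n32 n40 n50 n100 hH hC1 hC2 ht₀η hw₁ge c1 r2 r4 hlq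
  constructor
  case q_ge => exact hq
  case lam_pos => exact hlam
  case α_pos => exact hα
  case η_pos => exact hη
  case C_nonneg => exact hC.le
  case s_pos => exact hs
  case n_pos => exact hn
  case g₀_nonneg => exact hg.le
  case E₁_pos => exact hE
  case B_ge => exact B_ge
  case R_pos => exact hR
  case Θ_pos => exact hΘ
  case H_pos => exact hH1
  case tₐ_le => exact tₐ_le
  case w₁_ge => exact w₁_ge
  case w₀_nonneg => exact hw₀.le
  case x₀_pos => exact hx₀
  case time => exact time
  case descend => exact descend
  case x₀_le => exact le_rfl
  case Nm_le => exact Nm_le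
  case N_le => exact N_le
  case Yb_exp => exact hY
  case δ_pos => positivity
  case Yb_pos => positivity
  case Θ_θ₀ => rw [hθ₀, mul_div_cancel₀ _ hlam.ne']
  case α_le =>
    refine le_of_log_le (by positivity) (by positivity) ?_
    simp (disch := positivity) only [Real.log_mul, Real.log_div, Real.log_rpow, Real.log_pow,
      Real.log_sqrt, Real.log_one, Nat.cast_ofNat]
    linarith
  case init =>
    refine le_of_log_le (by positivity) (by positivity) ?_
    simp (disch := positivity) only [Real.log_mul, Real.log_div, Real.log_rpow, Real.log_pow,
      Real.log_sqrt, Real.log_one, Nat.cast_ofNat]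
    linarith
  case θ_ge =>
    refine le_of_log_le (by positivity) (by positivity) ?_
    simp (disch := positivity) only [Real.log_mul, Real.log_div, Real.log_rpow, Real.log_pow,
      Real.log_sqrt, Real.log_one, Nat.cast_ofNat]
    linarith
  case αw =>
    refine le_of_log_le (by positivity) (by positivity) ?_
    simp (disch := positivity) only [Real.log_mul, Real.log_div, Real.log_rpow, Real.log_pow,
      Real.log_sqrt, Real.log_one, Nat.cast_ofNat]
    linarith
  case burn =>
    refine le_of_log_le (by positivity) (by positivity) ?_
    simp (disch := positivity) only [Real.log_mul, Real.log_div, Real.log_rpow, Real.log_pow,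
      Real.log_sqrt, Real.log_one, Nat.cast_ofNat]
    linarith
  case C_δ =>
    refine le_of_log_le (by positivity) (by positivity) ?_
    simp (disch := positivity) only [Real.log_mul, Real.log_div, Real.log_rpow, Real.log_pow,
      Real.log_sqrt, Real.log_one, Nat.cast_ofNat]
    linarith
  case Θ_δ =>
    refine le_of_log_le (by positivity) (by positivity) ?_
    simp (disch := positivity) only [Real.log_mul, Real.log_div, Real.log_rpow, Real.log_pow,
      Real.log_sqrt, Real.log_one, Nat.cast_ofNat]
    linarith
  case bad_late =>
    refine le_of_log_le (by positivity) (by positivity) ?_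
    simp (disch := positivity) only [Real.log_mul, Real.log_div, Real.log_rpow, Real.log_pow,
      Real.log_sqrt, Real.log_one, Nat.cast_ofNat]
    linarith
  case αC =>
    refine le_of_log_le (by positivity) (by positivity) ?_
    simp (disch := positivity) only [Real.log_mul, Real.log_div, Real.log_rpow, Real.log_pow,
      Real.log_sqrt, Real.log_one, Nat.cast_ofNat]
    linarith
  case nN =>
    refine le_of_log_le (by positivity) (by positivity) ?_
    simp (disch := positivity) only [Real.log_mul, Real.log_div, Real.log_rpow, Real.log_pow,
      Real.log_sqrt, Real.log_one, Nat.cast_ofNat]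
    linarith
  case τ_x =>
    refine le_of_log_le (by positivity) (by positivity) ?_
    simp (disch := positivity) only [Real.log_mul, Real.log_div, Real.log_rpow, Real.log_pow,
      Real.log_sqrt, Real.log_one, Nat.cast_ofNat]
    linarith
  case τ_α =>
    refine le_of_log_le (by positivity) (by positivity) ?_
    simp (disch := positivity) only [Real.log_mul, Real.log_div, Real.log_rpow, Real.log_pow,
      Real.log_sqrt, Real.log_one, Nat.cast_ofNat]
    linarith
  case lam_x =>
    refine le_of_log_le (by positivity) (by positivity) ?_
    simp (disch := positivity) only [Real.log_mul, Real.log_div, Real.log_rpow, Real.log_pow,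
      Real.log_sqrt, Real.log_one, Nat.cast_ofNat]
    linarith
  case αY =>
    refine le_of_log_le (by positivity) (by positivity) ?_
    simp (disch := positivity) only [Real.log_mul, Real.log_div, Real.log_rpow, Real.log_pow,
      Real.log_sqrt, Real.log_one, Nat.cast_ofNat]
    linarith
  case α_sq =>
    refine le_of_log_le (by positivity) (by positivity) ?_
    simp (disch := positivity) only [Real.log_mul, Real.log_div, Real.log_rpow, Real.log_pow,
      Real.log_sqrt, Real.log_one, Nat.cast_ofNat]
    linarith
  case D_small =>
    refine le_of_log_le (by positivity) (by positivity) ?_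
    simp (disch := positivity) only [Real.log_mul, Real.log_div, Real.log_rpow, Real.log_pow,
      Real.log_sqrt, Real.log_one, Nat.cast_ofNat]
    linarith
  case α_pow =>
    refine le_of_log_le (by positivity) (by positivity) ?_
    simp (disch := positivity) only [Real.log_mul, Real.log_div, Real.log_rpow, Real.log_pow,
      Real.log_sqrt, Real.log_one, Nat.cast_ofNat]
    linarith
  case noise =>
    refine le_of_log_le (by positivity) (by positivity) ?_
    simp (disch := positivity) only [Real.log_mul, Real.log_div, Real.log_rpow, Real.log_pow,
      Real.log_sqrt, Real.log_one, Nat.cast_ofNat]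
    linarith
  case τ_test =>
    refine le_of_log_le (by positivity) (by positivity) ?_
    simp (disch := positivity) only [Real.log_mul, Real.log_div, Real.log_rpow, Real.log_pow,
      Real.log_sqrt, Real.log_one, Nat.cast_ofNat]
    linarith
  case θ_gt =>
    refine lt_of_log_lt (by positivity) (by positivity) ?_
    simp (disch := positivity) only [Real.log_mul, Real.log_div, Real.log_rpow, Real.log_pow,
      Real.log_sqrt, Real.log_one, Nat.cast_ofNat]
    linarith
  case misclassify =>
    refine lt_of_log_lt (by positivity) (by positivity) ?_
    simp (disch := positivity) only [Real.log_mul, Real.log_div, Real.log_rpow, Real.log_pow,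
      Real.log_sqrt, Real.log_one, Nat.cast_ofNat]
    linarith
  case init_sq =>
    rw [hcard]
    refine le_of_log_le (by positivity) (by positivity) ?_
    simp (disch := positivity) only [Real.log_mul, Real.log_div, Real.log_rpow, Real.log_pow,
      Real.log_sqrt, Real.log_one, Nat.cast_ofNat]
    linarith
  case H_le =>
    have h1 : (100 : ℝ) * H ≤ T := by
      refine le_of_log_le (by positivity) (by positivity) ?_
      simp (disch := positivity) only [Real.log_mul, Real.log_div, Real.log_rpow, Real.log_pow,
        Real.log_sqrt, Real.log_one, Nat.cast_ofNat]
      linarith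
    exact_mod_cast h1
  case box =>
    have h1 : w₀ ≤ R / 2 := by
      refine le_of_log_le (by positivity) (by positivity) ?_
      simp (disch := positivity) only [Real.log_mul, Real.log_div, Real.log_rpow, Real.log_pow,
        Real.log_sqrt, Real.log_one, Nat.cast_ofNat]
      linarith
    have h2 : T * (C * η) ≤ R / 2 := by
      refine le_of_log_le (by positivity) (by positivity) ?_
      simp (disch := positivity) only [Real.log_mul, Real.log_div, Real.log_rpow, Real.log_pow,
        Real.log_sqrt, Real.log_one, Nat.cast_ofNat]
      linarith
    linarith only [h1, h2]
  case err =>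
    rw [hcard, add_comm C 1, mul_add, mul_add]
    change _ + T * (η * (Λ * C * _)) ≤ _
    have h1 : T * (η * (2 * (m * d) * (Θ * (1 + C)))) ≤ 1 / 40 := by
      refine le_of_log_le (by positivity) (by positivity) ?_
      simp (disch := positivity) only [Real.log_mul, Real.log_div, Real.log_rpow, Real.log_pow,
        Real.log_sqrt, Real.log_one, Nat.cast_ofNat]
      linarith
    have h2 : T * (η * (Λ * C * (2 * (m * d) * (C * η)))) ≤ 1 / 40 := by
      refine le_of_log_le (by positivity) (by positivity) ?_
      simp (disch := positivity) only [Real.log_mul, Real.log_div, Real.log_rpow, Real.log_pow,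
        Real.log_sqrt, Real.log_one, Nat.cast_ofNat]
      linarith
    linarith only [h1, h2]
  case out_small =>
    have h1 : m * w₁ ^ q ≤ 1 / 2 := by
      refine le_of_log_le (by positivity) (by positivity) ?_
      simp (disch := positivity) only [Real.log_mul, Real.log_div, Real.log_rpow, Real.log_pow,
        Real.log_sqrt, Real.log_one, Nat.cast_ofNat]
      linarith
    have h2 : m * (B * w₁) ^ q ≤ 1 / 2 := by
      refine le_of_log_le (by positivity) (by positivity) ?_
      simp (disch := positivity) only [Real.log_mul, Real.log_div, Real.log_rpow, Real.log_pow,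
        Real.log_sqrt, Real.log_one, Nat.cast_ofNat]
      linarith
    have h3 : ((s * g₀ + α) * w₁) ^ q ≤ (B * w₁) ^ q :=
      Real.rpow_le_rpow (by positivity) (mul_le_mul_of_nonneg_right hsg hw₁.le) hq0.le
    have h4 := mul_le_mul_of_nonneg_left h3 (Nat.cast_nonneg (α := ℝ) m)
    rw [mul_add]
    linarith only [h1, h2, h4]
  case bad =>
    rw [← two_mul]
    refine le_of_log_le (by positivity) (by positivity) ?_
    simp (disch := positivity) only [Real.log_mul, Real.log_div, Real.log_rpow, Real.log_pow,
      Real.log_sqrt, Real.log_one, Nat.cast_ofNat]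
    linarith
  case force =>
    have h1 : lam * w₁ ≤ α * (1 / (4 * (n : ℝ)) * (q * (t₀ * (η * (E₁ / 2))) ^ (q - 1))) / 3 := by
      refine le_of_log_le (by positivity) (by positivity) ?_
      simp (disch := positivity) only [Real.log_mul, Real.log_div, Real.log_rpow, Real.log_pow,
        Real.log_sqrt, Real.log_one, Nat.cast_ofNat]
      linarith
    have h2 : q * w₁ ^ (q - 1) ≤
        α * (1 / (4 * (n : ℝ)) * (q * (t₀ * (η * (E₁ / 2))) ^ (q - 1))) / 3 := by
      refine le_of_log_le (by positivity) (by positivity) ?_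
      simp (disch := positivity) only [Real.log_mul, Real.log_div, Real.log_rpow, Real.log_pow,
        Real.log_sqrt, Real.log_one, Nat.cast_ofNat]
      linarith
    have h3 : Θ ≤ α * (1 / (4 * (n : ℝ)) * (q * (t₀ * (η * (E₁ / 2))) ^ (q - 1))) / 3 := by
      refine le_of_log_le (by positivity) (by positivity) ?_
      simp (disch := positivity) only [Real.log_mul, Real.log_div, Real.log_rpow, Real.log_pow,
        Real.log_sqrt, Real.log_one, Nat.cast_ofNat]
      linarith
    linarith only [h1, h2, h3]
  case δ_pow =>
    have h1 : (lam / (2 * q)) ^ (q - 2) ≤ (lam / (2 * q)) ^ (1 : ℝ) :=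
      Real.rpow_le_rpow_of_exponent_ge (by positivity) hδ1 (by linarith only [hq])
    rw [Real.rpow_one] at h1
    calc q * (lam / (2 * q)) ^ (q - 2) ≤ q * (lam / (2 * q)) := mul_le_mul_of_nonneg_left h1 hq0.le
      _ = lam / 2 := by field_simp
  case barrier =>
    have h1 : (lam / (2 * q)) ^ q ≤ (lam / (2 * q)) ^ (1 : ℝ) :=
      Real.rpow_le_rpow_of_exponent_ge (by positivity) hδ1 (by linarith only [hq])
    rw [Real.rpow_one] at h1
    have h2 := mul_le_mul_of_nonneg_left h1 (Nat.cast_nonneg (α := ℝ) m)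
    have h3 : m * (lam / (2 * q)) ≤ 1 / 2 := by
      refine le_of_log_le (by positivity) (by positivity) ?_
      simp (disch := positivity) only [Real.log_mul, Real.log_div, Real.log_rpow, Real.log_pow,
        Real.log_sqrt, Real.log_one, Nat.cast_ofNat]
      linarith
    have h4 : m * x₀ ^ q ≤ 1 / 2 := by
      refine le_of_log_le (by positivity) (by positivity) ?_
      simp (disch := positivity) only [Real.log_mul, Real.log_div, Real.log_rpow, Real.log_pow,
        Real.log_sqrt, Real.log_one, Nat.cast_ofNat]
      linarith
    rw [mul_add]
    linarith only [h2, h3, h4]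
  case step =>
    refine (mul_le_mul_of_nonneg_left hsg (by positivity)).trans
      (le_of_log_le (by positivity) (by positivity) ?_)
    simp (disch := positivity) only [Real.log_mul, Real.log_div, Real.log_rpow, Real.log_pow,
      Real.log_sqrt, Real.log_one, Nat.cast_ofNat]
    linarith
  case dev =>
    -- The deviation `θ₀` is `Θ / lam`, so the threshold error occurs twice. With the barrier and
    -- the drift there are four terms, each at most a quarter of the target.
    have h1 : lam * (α * (lam / (2 * q))) ≤ lam * (x₀ / 2) / 4 := by
      refine le_of_log_le (by positivity) (by positivity) ?_
      simp (disch := positivity) only [Real.log_mul, Real.log_div, Real.log_rpow, Real.log_pow,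
        Real.log_sqrt, Real.log_one, Nat.cast_ofNat]
      linarith
    have h2 : Θ * (s * g₀) ≤ lam * (x₀ / 2) / 4 := by
      refine le_of_log_le (by positivity) (by positivity) ?_
      simp (disch := positivity) only [Real.log_mul, Real.log_div, Real.log_rpow, Real.log_pow,
        Real.log_sqrt, Real.log_one, Nat.cast_ofNat]
      linarith
    have h3 : lam * (C * η * (s * g₀)) ≤ lam * (x₀ / 2) / 4 := by
      refine le_of_log_le (by positivity) (by positivity) ?_
      simp (disch := positivity) only [Real.log_mul, Real.log_div, Real.log_rpow, Real.log_pow,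
        Real.log_sqrt, Real.log_one, Nat.cast_ofNat]
      linarith
    have h4 : lam * (α * (lam / (2 * q)) + (θ₀ + C * η) * (s * g₀)) + Θ * (s * g₀) =
        lam * (α * (lam / (2 * q))) + lam * (C * η * (s * g₀)) + 2 * (Θ * (s * g₀)) := by
      rw [hθ₀]
      field_simp
      ring
    rw [h4]
    linarith only [h1, h2, h3]

end AdamGD


/-! ### The admissible parameters on the logarithmic scale. -/

namespace AdamGD

lemma Theta.log_bounds {c x y : ℝ} (h : Theta c x y) (hc : 0 < c) (hy : 0 < y) :
    0 < x ∧ Real.log y - Real.log c ≤ Real.log x ∧ Real.log x ≤ Real.log c + Real.log y := by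
  have hx : 0 < x := (div_pos hy hc).trans_le h.1
  refine ⟨hx, ?_, ?_⟩
  · rw [← Real.log_div hy.ne' hc.ne']
    exact Real.log_le_log (div_pos hy hc) h.1
  · rw [← Real.log_mul hc.ne' hy.ne']
    exact Real.log_le_log hx h.2

lemma IsPolylog.log_bounds {κ K n : ℕ} {x : ℝ} (h : IsPolylog κ K n x) (hn : 0 < Real.log n) :
    0 < x ∧ κ * Real.log (Real.log n) ≤ Real.log x ∧
      Real.log x ≤ K * Real.log (Real.log n) := by
  have hp : 0 < Real.log n ^ κ := pow_pos hn κ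
  have hx : 0 < x := hp.trans_le h.1
  refine ⟨hx, ?_, ?_⟩
  · rw [← Real.log_pow]
    exact Real.log_le_log hp h.1
  · rw [← Real.log_pow]
    exact Real.log_le_log hx h.2

lemma IsPoly.log_bounds {κ K n : ℕ} {x : ℝ} (h : IsPoly κ K n x) (hn : 0 < n) :
    0 < x ∧ κ * Real.log n ≤ Real.log x ∧ Real.log x ≤ K * Real.log n := by
  have hp : 0 < (n : ℝ) ^ κ := pow_pos (by exact_mod_cast hn) κ
  have hx : 0 < x := hp.trans_le h.1
  refine ⟨hx, ?_, ?_⟩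
  · rw [← Real.log_pow]
    exact Real.log_le_log hp h.1
  · rw [← Real.log_pow]
    exact Real.log_le_log hx h.2

lemma log_le_ten {z : ℝ} (hz : 1 ≤ z) (hz' : z ≤ 20000) : Real.log z ≤ 10 := by
  rw [Real.log_le_iff_le_exp (by linarith)]
  have h1 : (2.7 : ℝ) ^ 10 ≤ Real.exp 1 ^ 10 :=
    pow_le_pow_left₀ (by norm_num) (by linarith [Real.exp_one_gt_d9]) 10
  rw [← Real.exp_nat_mul] at h1
  norm_num at h1
  linarith

/-- The sample size `n` is large compared with the exponent `q`, the polylogarithmic degree `K` and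
the constant `exp M`. -/
structure IsLarge (q M : ℝ) (K n : ℕ) : Prop where
  M_ge : 10 ≤ M
  M_le : 20 * M ≤ Real.log (Real.log n)
  log_ge : 1000 * (q * (20 * ((K + 1) * Real.log (Real.log n)))) ≤ Real.log n

/-- The parameters of the problem on the logarithmic scale. -/
structure LogParams (P : Params) (q M : ℝ) (κ K n : ℕ) : Prop where
  n_pos : 0 < n
  log_pos : 0 < Real.log n
  d_pos : 0 < P.d
  s_pos : 0 < P.s
  m_pos : 0 < P.m
  σp_pos : 0 < P.σp
  α_pos : 0 < P.α
  σ₀_pos : 0 < P.σ₀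
  lam_pos : 0 < P.lam
  dim_ge : κ * Real.log n ≤ Real.log P.d
  dim_le : Real.log P.d ≤ K * Real.log n
  width_ge : κ * Real.log (Real.log n) ≤ Real.log P.m
  width_le : Real.log P.m ≤ K * Real.log (Real.log n)
  s_ge : Real.log P.d / 2 - 2 * Real.log n - M ≤ Real.log P.s
  s_le : Real.log P.s ≤ Real.log P.d / 2 - 2 * Real.log n + M
  σp_ge : -(K * Real.log (Real.log n)) - M ≤ Real.log P.s + 2 * Real.log P.σp
  σp_le : Real.log P.s + 2 * Real.log P.σp ≤ -(κ * Real.log (Real.log n)) + M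
  α_ge : κ * Real.log (Real.log n) + Real.log P.σp - M ≤ Real.log P.α
  α_le : Real.log P.α ≤ K * Real.log (Real.log n) + Real.log P.σp + M
  σ₀_ge : -(Real.log P.d / 4) - M ≤ Real.log P.σ₀
  σ₀_le : Real.log P.σ₀ ≤ -(Real.log P.d / 4) + M
  lam_ge : -(K * Real.log n) ≤ Real.log P.lam
  lam_le : Real.log P.lam ≤ -((q - 1) / 4 * Real.log P.d) - Real.log n -
    κ * Real.log (Real.log n) + M

lemma Params.Admissible.logParams {P : Params} {q c p₀ M : ℝ} {κ K n : ℕ}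
    (h : P.Admissible q κ K c p₀ n) (hn : 0 < n) (hl : 0 < Real.log n) (hc : 0 < c)
    (hM : Real.log c ≤ M) : LogParams P q M κ K n := by
  obtain ⟨hd, d1, d2⟩ := h.dim.log_bounds hn
  obtain ⟨hm, m1, m2⟩ := h.width.log_bounds hl
  have hn' : (0 : ℝ) < n := by exact_mod_cast hn
  obtain ⟨hs, s1, s2⟩ := h.sparsity.log_bounds hc (by positivity)
  obtain ⟨l, hl1, hσ⟩ := h.noise
  obtain ⟨hlp, l1, l2⟩ := hl1.log_bounds hl
  obtain ⟨hσ2, σ1, σ2⟩ := hσ.log_bounds hc (by positivity)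
  have hσp := h.noise_pos
  obtain ⟨l', hl1', hα'⟩ := h.strength
  obtain ⟨hlp', l1', l2'⟩ := hl1'.log_bounds hl
  obtain ⟨hα, α1, α2⟩ := hα'.log_bounds hc (by positivity)
  obtain ⟨hσ₀, i1, i2⟩ := h.init.log_bounds hc (by positivity)
  obtain ⟨lam₀, l'', hl1'', hlam₀, hlt⟩ := h.decay_lt
  obtain ⟨hlp'', l1'', l2''⟩ := hl1''.log_bounds hl
  obtain ⟨hlam₀p, e1, e2⟩ := hlam₀.log_bounds hc (by positivity)
  have hlam : 0 < P.lam := (by positivity : (0 : ℝ) < 1 / (n : ℝ) ^ K).trans_le h.decay_ge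
  have f1 := Real.log_le_log (by positivity) h.decay_ge
  have f2 := Real.log_le_log hlam hlt.le
  simp (disch := positivity) only [Real.log_mul, Real.log_div, Real.log_rpow, Real.log_pow,
    Real.log_sqrt, Real.log_one, Nat.cast_ofNat] at s1 s2 σ1 σ2 α1 α2 i1 i2 e1 e2 f1
  constructor
  case n_pos => exact hn
  case log_pos => exact hl
  case d_pos => exact_mod_cast hd
  case s_pos => exact_mod_cast hs
  case m_pos => exact_mod_cast hm
  case σp_pos => exact hσp
  case α_pos => exact hα
  case σ₀_pos => exact hσ₀
  case lam_pos => exact hlam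
  all_goals linarith

variable {P : Params} {q M C : ℝ} {κ K n : ℕ}

/-- All constants and polylogarithms are collected in one error of order `log log n`. The Gaussian
truncation level is `log n`, and the squared noise norm stays below 1/8 because the polylogarithm in
the noise variance has degree at least `κ`. -/
lemma LogParams.scales (h : LogParams P q M κ K n) (hL : IsLarge q M K n) (hq : 3 ≤ q)
    (hκ : 100 * q ≤ κ) (hqM : Real.log q ≤ M) (hC : 0 ≤ C) (hCM : Real.log (1 + 5 * C) ≤ M) :
    Scales q (20 * ((K + 1) * Real.log (Real.log n))) K n P.d P.s P.m P.α P.lam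
      (Real.log n * P.σp) (P.s * (P.σp / 100)) (Real.log n * P.σ₀)
      (Real.log n * P.σ₀ * (1 + 5 * C)) (P.σ₀ * √(P.s * P.σp ^ 2 / 10000) / 2) (P.σ₀ / 2)
      (3 * (P.s * (Real.log n * P.σp))) (P.s * P.σp ^ 2 / 10000) := by
  obtain ⟨hn, hl, hd, hs, hm, hσp, hα, hσ₀, hlam, d1, d2, m1, m2, s1, s2, σ1, σ2, α1, α2, i1, i2,
    e1, e2⟩ := h
  obtain ⟨M1, M2, L1⟩ := hL
  set x := Real.log (Real.log n) with hx
  set D := Real.log P.d with hD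
  set y := Real.log n with hy
  have hx0 : 0 ≤ x := by linarith
  have hKx : 0 ≤ K * x := mul_nonneg (Nat.cast_nonneg K) hx0
  have hκx : 300 * x ≤ κ * x := mul_le_mul_of_nonneg_right (by linarith) hx0
  have hκy : 100 * q * y ≤ κ * y := mul_le_mul_of_nonneg_right hκ hl.le
  have hKq : 0 ≤ (q - 3) * ((K + 1) * x) := mul_nonneg (by linarith) (by positivity)
  have hyq : 0 ≤ (q - 3) * y := mul_nonneg (by linarith) hl.le
  have hylow : 60000 * ((K + 1) * x) ≤ y := by linarith
  have num : ∀ z : ℝ, 1 ≤ z → z ≤ 20000 → 0 ≤ Real.log z ∧ Real.log z ≤ 10 :=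
    fun z h1 h2 => ⟨Real.log_nonneg h1, log_le_ten h1 h2⟩
  have n2 := num 2 (by norm_num) (by norm_num)
  have n3 := num 3 (by norm_num) (by norm_num)
  have n100 := num 100 (by norm_num) (by norm_num)
  have n8 := num 8 (by norm_num) (by norm_num)
  have n10000 := num 10000 (by norm_num) (by norm_num)
  have hC5 : 0 < 1 + 5 * C := by linarith
  have hC6 : 0 ≤ Real.log (1 + 5 * C) := Real.log_nonneg (by linarith)
  constructor
  case q_ge => exact hq
  case n_pos => exact hn
  case num => exact fun z h1 h2 => ⟨(num z h1 h2).1, by linarith [(num z h1 h2).2]⟩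
  case d_pos => exact hd
  case s_pos => exact hs
  case m_pos => exact hm
  case α_pos => exact hα
  case lam_pos => exact hlam
  case g₀_pos => positivity
  case E₁_pos => positivity
  case w₀_pos => positivity
  case w₁_pos => positivity
  case x₀_pos => positivity
  case u₁_pos => positivity
  case B_pos => positivity
  case Nm_pos => positivity
  case q_mul_v => exact L1
  case Nm_le => exact le_of_eq (by ring)
  case B_ge =>
    have h1 : (1 : ℝ) ≤ P.s * (y * P.σp) := by
      refine le_of_log_le (by positivity) (by positivity) ?_
      simp (disch := positivity) only [Real.log_mul, Real.log_one]
      linarith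
    have h2 : P.α ≤ 1 := by
      refine le_of_log_le (by positivity) (by positivity) ?_
      rw [Real.log_one]
      linarith
    linarith only [h1, h2]
  case N_le =>
    refine le_of_log_le (by positivity) (by positivity) ?_
    simp (disch := positivity) only [Real.log_mul, Real.log_div, Real.log_pow, Real.log_one,
      Nat.cast_ofNat]
    linarith
  all_goals
    try simp (disch := positivity) only [Real.log_mul, Real.log_div, Real.log_pow, Real.log_sqrt,
      Nat.cast_ofNat]
    linarith

/-- The initial noise responses are below the initial best alignment by a large power of `log n`,
since the noise norm is small; the second term is negligible because `α` is. -/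
lemma LogParams.start (h : LogParams P q M κ K n) (hL : IsLarge q M K n) (hκ : 300 ≤ κ)
    (hq : 3 ≤ q) :
    Real.log n * (P.σ₀ * √(P.s * (Real.log n * P.σp) ^ 2)) +
      2 * P.α * (Real.log n * P.σ₀) ≤ P.σ₀ / 2 / 4 := by
  obtain ⟨hn, hl, hd, hs, hm, hσp, hα, hσ₀, hlam, d1, d2, m1, m2, s1, s2, σ1, σ2, α1, α2, i1, i2,
    e1, e2⟩ := h
  obtain ⟨M1, M2, L1⟩ := hL
  set x := Real.log (Real.log n) with hx
  set D := Real.log P.d with hD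
  set y := Real.log n with hy
  have hx0 : 0 ≤ x := by linarith
  have hκ' : (300 : ℝ) ≤ κ := by exact_mod_cast hκ
  have hKx : 0 ≤ K * x := mul_nonneg (Nat.cast_nonneg K) hx0
  have hκx : 300 * x ≤ κ * x := mul_le_mul_of_nonneg_right hκ' hx0
  have hκy : 300 * y ≤ κ * y := mul_le_mul_of_nonneg_right hκ' hl.le
  have hKq : 0 ≤ (q - 3) * ((K + 1) * x) := mul_nonneg (by linarith) (by positivity)
  have hylow : 60000 * ((K + 1) * x) ≤ y := by linarith
  have n2 := log_le_ten (z := 2) (by norm_num) (by norm_num)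
  have n16 := log_le_ten (z := 16) (by norm_num) (by norm_num)
  have h1 : y * (P.σ₀ * √(P.s * (y * P.σp) ^ 2)) ≤ P.σ₀ / 16 := by
    refine le_of_log_le (by positivity) (by positivity) ?_
    simp (disch := positivity) only [Real.log_mul, Real.log_div, Real.log_pow, Real.log_sqrt,
      Nat.cast_ofNat]
    linarith
  have h2 : 2 * P.α * (y * P.σ₀) ≤ P.σ₀ / 16 := by
    refine le_of_log_le (by positivity) (by positivity) ?_
    simp (disch := positivity) only [Real.log_mul, Real.log_div]
    linarith
  linarith only [h1, h2]

end AdamGD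


/-! ### Step size, time horizon and the schedule of the initial phase. -/

namespace AdamGD

variable {q lam R B v Z A η : ℝ} {m : ℕ}

lemma lipBound_bounds (hq : 3 ≤ q) (hm : 1 ≤ m) (hl0 : 0 ≤ lam) (hl1 : lam ≤ 1) (hR : 1 ≤ R)
    (hB : 1 ≤ B) :
    1 ≤ lipBound q lam m R B ∧ gradBound q R B ≤ lipBound q lam m R B ∧
      q * (R * B) ^ (q - 2) ≤ lipBound q lam m R B ∧ R ≤ lipBound q lam m R B ∧
      lipBound q lam m R B ≤ 11 * (m * (q * (R * B) ^ (q - 1) * B) ^ 2) := by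
  have hRB : 1 ≤ R * B := one_le_mul_of_one_le_of_one_le hR hB
  have hm' : (1 : ℝ) ≤ m := by exact_mod_cast hm
  have hy : 1 ≤ (R * B) ^ (q - 2) := Real.one_le_rpow hRB (by linarith)
  have hyX : (R * B) ^ (q - 2) ≤ (R * B) ^ (q - 1) :=
    Real.rpow_le_rpow_of_exponent_le hRB (by linarith)
  have hRX : R ≤ (R * B) ^ (q - 1) := by
    have h1 : (R * B) ^ (1 : ℝ) ≤ (R * B) ^ (q - 1) :=
      Real.rpow_le_rpow_of_exponent_le hRB (by linarith)
    rw [Real.rpow_one] at h1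
    exact (le_mul_of_one_le_right (by linarith) hB).trans h1
  unfold lipBound gradBound
  set y := (R * B) ^ (q - 2)
  set X := (R * B) ^ (q - 1)
  have hX : 1 ≤ X := hy.trans hyX
  have hXB : X ≤ X * B := le_mul_of_one_le_right (by linarith) hB
  have hqX : q * X ≤ q * X * B := le_mul_of_one_le_right (by positivity) hB
  have hXq : X ≤ q * X := le_mul_of_one_le_left (by linarith) (by linarith)
  have hqy : q * y ≤ q * X := mul_le_mul_of_nonneg_left hyX (by linarith)
  set Y := q * X * B with hY
  have hY1 : 1 ≤ Y := by linarith
  have hYY : Y ≤ m * Y ^ 2 := by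
    have h1 : Y * 1 ≤ Y * Y := mul_le_mul_of_nonneg_left hY1 (by linarith)
    have h2 : 1 * Y ^ 2 ≤ m * Y ^ 2 := mul_le_mul_of_nonneg_right hm' (by positivity)
    linarith
  have h3 : 0 ≤ 2 * (q * (q - 1) * y * B ^ 2) := by
    have : 0 ≤ q - 1 := by linarith
    positivity
  have h4 : q * (q - 1) * y * B ^ 2 ≤ Y ^ 2 := by
    have h5 : y ≤ X ^ 2 := hyX.trans (by nlinarith only [hX])
    calc q * (q - 1) * y * B ^ 2 ≤ q * q * X ^ 2 * B ^ 2 := by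
          refine mul_le_mul_of_nonneg_right (mul_le_mul ?_ h5 (by linarith) (by positivity))
            (by positivity)
          exact mul_le_mul_of_nonneg_left (by linarith) (by linarith)
      _ = Y ^ 2 := by rw [hY]; ring
  have h6 : Y ^ 2 ≤ m * Y ^ 2 := le_mul_of_one_le_left (by positivity) hm'
  have e : 4 * m * Y * (2 * Y) = 8 * (m * Y ^ 2) := by ring
  rw [e]
  refine ⟨?_, ?_, ?_, ?_, ?_⟩ <;> linarith

/-- The box of radius `n ^ (Z + A' + 2)` contains the sublevel set used for gradient descent and
everything Adam can reach in time `T`. The Lipschitz constant on it is polynomial with a degree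
fixed by `q`, `Z` and `A'`, so a small enough polynomial step size beats it. -/
lemma Scales.horizon {n d s T a b A' : ℕ} {α g₀ E₁ w₀ w₁ x₀ u₁ Nm : ℝ}
    (h : Scales q v Z n d s m α lam g₀ E₁ w₀ w₁ x₀ u₁ B Nm) (hη : 0 < η)
    (hb : 2 * q * (Z + A' + 2) + q * Z + A' + 20 * Z + 30 ≤ b) (ha : 20 * Z + 20 ≤ a)
    {b' : ℕ} (h1 : IsPoly b b' n (1 / η)) (h2 : IsPoly a A' n (T * η)) :
    Horizon q lam v Z A' n m T η ((n : ℝ) ^ (Z + A' + 2)) B := by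
  obtain ⟨hTη, p1, p2⟩ := h2.log_bounds h.n_pos
  obtain ⟨-, p3, -⟩ := h1.log_bounds h.n_pos
  have hT : (0 : ℝ) < T := by
    by_contra hc
    exact absurd hTη (not_lt.2 (mul_nonpos_of_nonpos_of_nonneg (not_lt.1 hc) hη.le))
  have hq := h.q_ge
  have hn : (0 : ℝ) < n := by exact_mod_cast h.n_pos
  have hB := h.B_pos
  have hv := h.v_ge
  have hqv : 0 ≤ (q - 3) * v := mul_nonneg (by linarith) (by linarith)
  have hnv : 1000 * v ≤ Real.log n := by linarith [h.q_mul_v]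
  have hqn : 0 ≤ (q - 3) * Real.log n := mul_nonneg (by linarith) (by linarith)
  have hZn : 300 * Real.log n ≤ Z * Real.log n := by linarith [h.dim_ge, h.dim_le]
  have hZ : 300 ≤ Z := le_of_mul_le_mul_right hZn (by linarith)
  have hA : (0 : ℝ) ≤ A' := Nat.cast_nonneg _
  have hR1 : 1 ≤ (n : ℝ) ^ (Z + A' + 2) :=
    Real.one_le_rpow (by exact_mod_cast h.n_pos) (by linarith)
  have hB1 : 1 ≤ B := by
    have := h.B_ge
    have := h.α_pos
    have : 0 ≤ s * g₀ := mul_nonneg (Nat.cast_nonneg _) h.g₀_pos.le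
    linarith
  have hl := h.lam_pos
  have hqd : 0 ≤ (q - 3) * Real.log d := mul_nonneg (by linarith) (by linarith [h.dim_ge])
  have hl1 : lam ≤ 1 := by
    refine le_of_log_le hl one_pos ?_
    rw [Real.log_one]
    linarith [h.lam_le, h.dim_ge]
  obtain ⟨b1, b2, b3, b4, b5⟩ := lipBound_bounds hq h.m_pos hl.le hl1 hR1 hB1
  have hm := h.m_pos
  have hq0 : 0 < q := by linarith
  have hlip := Real.log_le_log (by linarith) b5
  simp (disch := positivity) only [Real.log_mul, Real.log_div, Real.log_rpow, Real.log_pow,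
    Real.log_one, Nat.cast_ofNat] at hlip p1 p2 p3
  have n11 := h.num 11 (by norm_num) (by norm_num)
  have hBn : 0 ≤ (q - 3) * (Z * Real.log n / 4 - Real.log B) :=
    mul_nonneg (by linarith) (by linarith [h.B_le, h.dim_le])
  have hbn := mul_le_mul_of_nonneg_right hb (by linarith : 0 ≤ Real.log n)
  have han := mul_le_mul_of_nonneg_right ha (by linarith : 0 ≤ Real.log n)
  have hZq : 0 ≤ (q - 3) * (Z * Real.log n - 300 * Real.log n) := mul_nonneg (by linarith) (by linarith)
  have hAn : 0 ≤ A' * Real.log n := mul_nonneg hA (by linarith)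
  have hqA : 0 ≤ (q - 3) * (A' * Real.log n) := mul_nonneg (by linarith) hAn
  constructor
  case T_pos => exact_mod_cast hT
  case η_pos => exact hη
  case A_nonneg => exact hA
  case R_pos => positivity
  case R_eq => rw [Real.log_rpow hn]
  case lip_one => exact b1
  case grad_le => exact b2
  case pow_le => exact b3
  case R_le => exact b4
  case ge => linarith
  case le => linarith
  case lip_le => linarith [h.m_le, h.log_q, h.B_le, h.dim_le]

/-- The loss at a point cannot balance the weight decay of large activations. -/
lemma exp_rpow_lt_of_ge {N Y : ℝ} (hq : 3 ≤ q) (hl : 0 < lam) (hN : 12 ≤ N) (hqN : q ≤ N)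
    (hlam : 4 * (q + -Real.log lam) ≤ N) (hY : N ≤ Y) :
    q * Real.exp (-(Y ^ q / 2)) * Y ^ (q - 2) < lam / 2 := by
  have hY0 : 0 < Y := by linarith
  have hq0 : 0 < q := by linarith
  have h1 : Y ^ 2 * Y ≤ Y ^ q := by
    have := Real.rpow_le_rpow_of_exponent_le ((by linarith : (1 : ℝ) ≤ N).trans hY) hq
    rw [show (3 : ℝ) = ((3 : ℕ) : ℝ) by norm_num, Real.rpow_natCast] at this
    linarith [pow_succ Y 2]
  have h2 : Real.log Y ≤ Y := (Real.log_le_sub_one_of_pos hY0).trans (by linarith)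
  have h3 : Real.log q ≤ q := (Real.log_le_sub_one_of_pos hq0).trans (by linarith)
  have h4 : Real.log 2 ≤ 1 := (Real.log_le_sub_one_of_pos two_pos).trans (by norm_num)
  refine lt_of_log_lt (by positivity) (by positivity) ?_
  rw [Real.log_mul (by positivity) (by positivity), Real.log_mul hq0.ne' (by positivity),
    Real.log_exp, Real.log_rpow hY0, Real.log_div hl.ne' two_ne_zero]
  have h5 : (q - 2) * Real.log Y ≤ (Y - 2) * Y :=
    (mul_le_mul_of_nonneg_left h2 (by linarith)).trans
      (mul_le_mul_of_nonneg_right (by linarith) hY0.le)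
  have h6 : 12 * (Y * Y) ≤ Y ^ 2 * Y := by
    nlinarith only [mul_nonneg (sq_nonneg Y) (by linarith : 0 ≤ Y - 12)]
  nlinarith only [h1, h3, h4, h5, h6, hlam, hY, hN, hqN]

/-- The initial phase of Adam lasts `tₐ` steps; the features are overtaken after `t₀` steps. -/
lemma adam_schedule {T H : ℕ} {l σ C : ℝ} (hη : 0 < η) (hσ : 0 < σ) (hC : 0 ≤ C)
    (hCl : C + 10 ≤ l / 10) (hH : (H + 1) * η ≤ σ) (hT : 5 * (l * σ) ≤ T * η) :
    let t₀ := ⌈σ / η⌉₊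
    let tₐ := ⌈4 * (l * σ) / η⌉₊
    tₐ ≤ T ∧ l * σ + C * η * tₐ ≤ l * σ * (1 + 5 * C) ∧ H + t₀ ≤ tₐ ∧
      l * σ + C * η * (H + t₀) ≤ 9 / 10 * η * (tₐ - (H + t₀) : ℕ) ∧ 0 < t₀ ∧ σ ≤ t₀ * η := by
  intro t₀ tₐ
  have hl : 100 ≤ l := by linarith
  have hlσ : 100 * σ ≤ l * σ := mul_le_mul_of_nonneg_right hl hσ.le
  have h1 : σ ≤ t₀ * η := (div_le_iff₀ hη).1 (Nat.le_ceil _)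
  -- Rounding times up to integers costs one step size, far below the initialisation scale.
  have h2 : t₀ * η ≤ σ + η := by
    have := mul_le_mul_of_nonneg_right (Nat.ceil_lt_add_one (by positivity : 0 ≤ σ / η)).le hη.le
    rwa [add_mul, one_mul, div_mul_cancel₀ _ hη.ne'] at this
  have h3 : 4 * (l * σ) ≤ tₐ * η := (div_le_iff₀ hη).1 (Nat.le_ceil _)
  have h4 : tₐ * η ≤ 4 * (l * σ) + η := by
    have := mul_le_mul_of_nonneg_right
      (Nat.ceil_lt_add_one (by positivity : 0 ≤ 4 * (l * σ) / η)).le hη.le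
    rwa [add_mul, one_mul, div_mul_cancel₀ _ hη.ne'] at this
  have hHη : 0 ≤ H * η := by positivity
  have htime : H + t₀ ≤ tₐ := by
    have : ((H + t₀ : ℕ) : ℝ) ≤ tₐ := by
      refine le_of_mul_le_mul_right ?_ hη
      push_cast
      linarith
    exact_mod_cast this
  refine ⟨?_, ?_, htime, ?_, Nat.ceil_pos.2 (by positivity), h1⟩
  · have : (tₐ : ℝ) ≤ T := le_of_mul_le_mul_right (by linarith) hη
    exact_mod_cast this
  · have h5 := mul_le_mul_of_nonneg_left (by linarith : tₐ * η ≤ 5 * (l * σ)) hC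
    linarith
  · rw [Nat.cast_sub htime]
    push_cast
    have h5 := mul_le_mul_of_nonneg_left (by linarith : (H + t₀) * η ≤ 2 * σ) hC
    have h6 := mul_le_mul_of_nonneg_right hCl hσ.le
    linarith

end AdamGD


/-! ### Smallness of the failure probabilities. -/

namespace AdamGD

lemma one_sub_pow_le_exp {x : ℝ} (hx : x ≤ 1) (k : ℕ) : (1 - x) ^ k ≤ Real.exp (-(k * x)) := by
  have h1 : 1 - x ≤ Real.exp (-x) := by linarith [Real.add_one_le_exp (-x)]
  refine (pow_le_pow_left₀ (by linarith) h1 k).trans (le_of_eq ?_)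
  rw [← Real.exp_nat_mul, mul_neg]

variable {P : Params} {q M p₀ : ℝ} {κ K n : ℕ}

/-- With `s` of order `√d / n ^ 2`, a fresh mask meets the training masks with probability of order
`n ^ (-3)`. The Gaussian tail at level `log n` is smaller than every power of `n` and hence absorbs
the factor `d`. -/
lemma LogParams.freshBound_le (h : LogParams P q M κ K n) (hL : IsLarge q M K n) (hκ : 300 ≤ κ)
    (hq : 3 ≤ q) : freshBound n P.d P.s (Real.log n) ≤ 1 / n := by
  obtain ⟨hn, hl, hd, hs, hm, hσp, hα, hσ₀, hlam, d1, d2, m1, m2, s1, s2, σ1, σ2, α1, α2, i1, i2,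
    e1, e2⟩ := h
  obtain ⟨M1, M2, L1⟩ := hL
  set x := Real.log (Real.log n) with hx
  set D := Real.log P.d with hD
  set y := Real.log n with hy
  have hx0 : 0 ≤ x := by linarith
  have hκ' : (300 : ℝ) ≤ κ := by exact_mod_cast hκ
  have hK0 : (0 : ℝ) ≤ K := Nat.cast_nonneg K
  have hKx : 200 * K ≤ K * x := by
    rw [mul_comm]
    exact mul_le_mul_of_nonneg_left (by linarith) hK0
  have hκy : 300 * y ≤ κ * y := mul_le_mul_of_nonneg_right hκ' hl.le
  have hKq : 0 ≤ (q - 3) * ((K + 1) * x) := mul_nonneg (by linarith) (by positivity)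
  have hylow : 60000 * ((K + 1) * x) ≤ y := by linarith
  have hy2 : (200 * K + 1000) * y ≤ y ^ 2 := by
    rw [pow_two]
    exact mul_le_mul_of_nonneg_right (by linarith) hl.le
  have hKy : 0 ≤ K * y := by positivity
  have n2 := log_le_ten (z := 2) (by norm_num) (by norm_num)
  have n2' : 0 ≤ Real.log 2 := Real.log_nonneg (by norm_num)
  have hd2 : (2 : ℝ) ≤ P.d := by
    refine le_of_log_le (by positivity) (by positivity) ?_
    linarith
  have hsd : (P.s : ℝ) / (P.d - 1) ≤ 2 * P.s / P.d := by
    rw [div_le_div_iff₀ (by linarith) (by linarith)]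
    nlinarith [Nat.cast_nonneg (α := ℝ) P.s]
  have h1 : (n : ℝ) * (P.s * (P.s / (P.d - 1))) ≤ 1 / (2 * n) := by
    have : (n : ℝ) * (P.s * (P.s / (P.d - 1))) ≤ n * (P.s * (2 * P.s / P.d)) := by gcongr
    refine this.trans (le_of_log_le (by positivity) (by positivity) ?_)
    simp (disch := positivity) only [Real.log_mul, Real.log_div, Real.log_one]
    linarith
  have h2 : (P.d : ℝ) * (2 * Real.exp (-(y ^ 2 / 2))) ≤ 1 / (2 * n) := by
    refine le_of_log_le (by positivity) (by positivity) ?_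
    simp (disch := positivity) only [Real.log_mul, Real.log_div, Real.log_one, Real.log_exp]
    linarith
  have e : (1 : ℝ) / n = 1 / (2 * n) + 1 / (2 * n) := by
    field_simp
    norm_num
  rw [e]
  exact add_le_add h1 h2

-- There are seven contributions, each at most `1 / (8 n)`. The critical one is a collision of
-- training masks, of order `n ^ (-2)`; the others are superpolynomially small, thanks to width and
-- class sizes at least `(log n) ^ 2`.
set_option maxHeartbeats 1000000 in
lemma LogParams.failBound_le (h : LogParams P q M κ K n) (hL : IsLarge q M K n) (hκ : 300 ≤ κ)
    (hq : 3 ≤ q) (hp : p₀ ≤ 1) (hpn : 8 * Real.log n ^ 2 ≤ p₀ * n) (hm2 : Real.log n ^ 2 ≤ P.m) :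
    failBound n P.m P.d P.s ⌈Real.log n ^ 2⌉₊ (Real.log n) p₀ ≤ 1 / n := by
  obtain ⟨hn, hl, hd, hs, hm, hσp, hα, hσ₀, hlam, d1, d2, m1, m2, s1, s2, σ1, σ2, α1, α2, i1, i2,
    e1, e2⟩ := h
  obtain ⟨M1, M2, L1⟩ := hL
  set x := Real.log (Real.log n) with hx
  set D := Real.log P.d with hD
  set y := Real.log n with hy
  have hx0 : 0 ≤ x := by linarith
  have hκ' : (300 : ℝ) ≤ κ := by exact_mod_cast hκ
  have hK0 : (0 : ℝ) ≤ K := Nat.cast_nonneg K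
  have hKx : 200 * K ≤ K * x := by
    rw [mul_comm]
    exact mul_le_mul_of_nonneg_left (by linarith) hK0
  have hκy : 300 * y ≤ κ * y := mul_le_mul_of_nonneg_right hκ' hl.le
  have hKq : 0 ≤ (q - 3) * ((K + 1) * x) := mul_nonneg (by linarith) (by positivity)
  have hylow : 60000 * ((K + 1) * x) ≤ y := by linarith
  have hy2 : (200 * K + 1000) * y ≤ y ^ 2 := by
    rw [pow_two]
    exact mul_le_mul_of_nonneg_right (by linarith) hl.le
  have hKy : 0 ≤ K * y := by positivity
  have n2 := log_le_ten (z := 2) (by norm_num) (by norm_num)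
  have n2' : 0 ≤ Real.log 2 := Real.log_nonneg (by norm_num)
  have n3 := log_le_ten (z := 3) (by norm_num) (by norm_num)
  have n4 := log_le_ten (z := 4) (by norm_num) (by norm_num)
  have n8 := log_le_ten (z := 8) (by norm_num) (by norm_num)
  have hn' : (0 : ℝ) < n := by exact_mod_cast hn
  have hn1 : (1 : ℝ) ≤ n := by exact_mod_cast hn
  have hny : y ^ 2 / 2 ≤ n := by
    have := Real.quadratic_le_exp_of_nonneg hl.le
    rw [hy, Real.exp_log hn', ← hy] at this
    linarith
  have hd2 : (2 : ℝ) ≤ P.d := by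
    refine le_of_log_le (by positivity) (by positivity) ?_
    linarith
  have hsd : (P.s : ℝ) / (P.d - 1) ≤ 2 * P.s / P.d := by
    rw [div_le_div_iff₀ (by linarith) (by linarith)]
    nlinarith [Nat.cast_nonneg (α := ℝ) P.s]
  have hsd0 : 0 ≤ (P.s : ℝ) / (P.d - 1) := div_nonneg (Nat.cast_nonneg _) (by linarith)
  have hsn : (n : ℝ) ≤ P.s := by
    refine le_of_log_le (by positivity) (by positivity) ?_
    linarith
  set Nc := ⌈y ^ 2⌉₊ with hNc
  have hN1 : y ^ 2 ≤ Nc := Nat.le_ceil _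
  have hN2 : (Nc : ℝ) ≤ y ^ 2 + 1 := (Nat.ceil_lt_add_one (by positivity)).le
  have t1 : (n : ℝ) ^ 2 * (P.d * (P.s / (P.d - 1)) ^ 2) ≤ 1 / (8 * n) := by
    have : (n : ℝ) ^ 2 * (P.d * (P.s / (P.d - 1)) ^ 2) ≤ n ^ 2 * (P.d * (2 * P.s / P.d) ^ 2) := by
      gcongr
    refine this.trans (le_of_log_le (by positivity) (by positivity) ?_)
    simp (disch := positivity) only [Real.log_mul, Real.log_div, Real.log_one, Real.log_pow,
      Nat.cast_ofNat]
    linarith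
  have t2 : (n : ℝ) * (P.d * (2 * Real.exp (-(y ^ 2 / 2)))) ≤ 1 / (8 * n) := by
    refine le_of_log_le (by positivity) (by positivity) ?_
    simp (disch := positivity) only [Real.log_mul, Real.log_div, Real.log_one, Real.log_exp]
    linarith
  have t3 : (n : ℝ) * (1 / 2) ^ P.s ≤ 1 / (8 * n) := by
    have h0 := one_sub_pow_le_exp (x := 1 / 2) (by norm_num) P.s
    rw [show (1 : ℝ) - 1 / 2 = 1 / 2 by norm_num] at h0
    refine (mul_le_mul_of_nonneg_left h0 hn'.le).trans
      (le_of_log_le (by positivity) (by positivity) ?_)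
    simp (disch := positivity) only [Real.log_mul, Real.log_div, Real.log_one, Real.log_exp]
    linarith
  have t4 : 2 * (2 ^ Nc * (1 - p₀ / 2) ^ n) ≤ 1 / (8 * n) := by
    have h0 := one_sub_pow_le_exp (x := p₀ / 2) (by linarith) n
    have h00 := one_sub_pow_le_exp (x := -1) (by norm_num) Nc
    rw [show (1 : ℝ) - -1 = 2 by norm_num] at h00
    refine (mul_le_mul_of_nonneg_left (mul_le_mul h00 h0 (pow_nonneg (by linarith) n)
      (by positivity)) two_pos.le).trans (le_of_log_le (by positivity) (by positivity) ?_)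
    simp (disch := positivity) only [Real.log_mul, Real.log_div, Real.log_one, Real.log_exp]
    linarith
  have t5 : (2 * (P.m * P.d) + n * (2 * P.m)) * (2 * Real.exp (-(y ^ 2 / 2))) ≤
      1 / (8 * (n : ℝ)) := by
    have h0 : (2 * (P.m * P.d) + n * (2 * P.m) : ℝ) ≤ 4 * (n * (P.m * P.d)) := by
      have i1 : 1 * (P.m * P.d : ℝ) ≤ n * (P.m * P.d) :=
        mul_le_mul_of_nonneg_right hn1 (by positivity)
      have i2 : (n * P.m : ℝ) * 1 ≤ n * P.m * P.d :=
        mul_le_mul_of_nonneg_left (by linarith) (by positivity)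
      linarith
    refine (mul_le_mul_of_nonneg_right h0 (by positivity)).trans
      (le_of_log_le (by positivity) (by positivity) ?_)
    simp (disch := positivity) only [Real.log_mul, Real.log_div, Real.log_one, Real.log_exp]
    linarith
  have t6 : ((n : ℝ) + 2) * (3 / 4) ^ P.m ≤ 1 / (8 * n) := by
    have h0 := one_sub_pow_le_exp (x := 1 / 4) (by norm_num) P.m
    rw [show (1 : ℝ) - 1 / 4 = 3 / 4 by norm_num] at h0
    refine (mul_le_mul (by linarith : (n : ℝ) + 2 ≤ 3 * n) h0 (by positivity)
      (by positivity)).trans (le_of_log_le (by positivity) (by positivity) ?_)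
    simp (disch := positivity) only [Real.log_mul, Real.log_div, Real.log_one, Real.log_exp]
    linarith
  have t7 : 2 * P.m * (3 / 4 : ℝ) ^ Nc ≤ 1 / (8 * n) := by
    have h0 := one_sub_pow_le_exp (x := 1 / 4) (by norm_num) Nc
    rw [show (1 : ℝ) - 1 / 4 = 3 / 4 by norm_num] at h0
    refine (mul_le_mul_of_nonneg_left h0 (by positivity)).trans
      (le_of_log_le (by positivity) (by positivity) ?_)
    simp (disch := positivity) only [Real.log_mul, Real.log_div, Real.log_one, Real.log_exp]
    linarith
  have e : (1 : ℝ) / n = 8 * (1 / (8 * n)) := by field_simp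
  have e0 : (0 : ℝ) ≤ 1 / (8 * n) := by positivity
  unfold failBound
  rw [e]
  linarith

open Filter in
lemma eventually_isLarge (q M : ℝ) (K : ℕ) (hM : 10 ≤ M) : ∀ᶠ n : ℕ in atTop, IsLarge q M K n := by
  have t1 : Tendsto (fun n : ℕ => Real.log n) atTop atTop :=
    Real.tendsto_log_atTop.comp tendsto_natCast_atTop_atTop
  have t2 : Tendsto (fun n : ℕ => Real.log (Real.log n)) atTop atTop :=
    Real.tendsto_log_atTop.comp t1
  have h3 := (Real.isLittleO_log_id_atTop.const_mul_left (1000 * (q * (20 * (K + 1))))).bound one_pos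
  filter_upwards [t2.eventually_ge_atTop (20 * M), t1.eventually h3, t1.eventually_ge_atTop 0]
    with n h1 h2 h0
  refine ⟨hM, h1, ?_⟩
  simp only [Real.norm_eq_abs, id, one_mul, abs_of_nonneg h0] at h2
  have := (le_abs_self _).trans h2
  linarith

open Filter in
lemma eventually_log_sq_le {a : ℝ} (ha : 0 < a) (b c : ℝ) :
    ∀ᶠ n : ℕ in atTop, b * Real.log n ^ 2 + c ≤ a * n := by
  have t1 : Tendsto (fun n : ℕ => (n : ℝ)) atTop atTop := tendsto_natCast_atTop_atTop
  have h1 := ((Real.isLittleO_pow_log_id_atTop (n := 2)).const_mul_left b).bound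
    (half_pos ha)
  filter_upwards [t1.eventually h1, t1.eventually_ge_atTop (2 * |c| / a), t1.eventually_ge_atTop 0]
    with n h2 h3 h0
  simp only [Real.norm_eq_abs, id, abs_of_nonneg h0] at h2
  rw [div_le_iff₀ ha] at h3
  linarith [(le_abs_self _).trans h2, le_abs_self c]

end AdamGD


/-! ### Choice of the constants and assembly. -/

namespace AdamGD

lemma adamSpeed_pos {β₁ β₂ : ℝ} (h12 : β₁ ^ 2 < β₂) (hβ₂ : β₂ < 1) : 0 < adamSpeed β₁ β₂ := by
  have h1 : 0 < β₂ - β₁ ^ 2 := by linarith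
  have h2 : 0 < 1 - β₂ := by linarith
  unfold adamSpeed
  positivity

lemma adamThr_pos {β₁ β₂ : ℝ} (hβ₁ : β₁ < 1) (hβ₂ : β₂ < 1) : 0 < adamThr β₁ β₂ := by
  have h1 : 0 < 1 - β₁ := by linarith
  have h2 : 0 < 1 - √β₂ := by
    have : √β₂ < 1 := by
      rw [Real.sqrt_lt' one_pos]
      linarith
    linarith
  unfold adamThr
  positivity

/-- Supplies the burn-in time of Adam, which depends only on the two averaging constants. -/
lemma exists_pow_le_hundredth {β₁ β₂ : ℝ} (h1 : 0 ≤ β₁) (h1' : β₁ < 1) (h2 : 0 ≤ β₂)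
    (h2' : β₂ < 1) : ∃ H : ℕ, 1 ≤ H ∧ β₁ ^ H ≤ 1 / 100 ∧ β₂ ^ H ≤ 1 / 100 := by
  have t1 := (tendsto_pow_atTop_nhds_zero_of_lt_one h1 h1').eventually_le_const
    (by norm_num : (0 : ℝ) < 1 / 100)
  have t2 := (tendsto_pow_atTop_nhds_zero_of_lt_one h2 h2').eventually_le_const
    (by norm_num : (0 : ℝ) < 1 / 100)
  exact ((Filter.eventually_ge_atTop 1).and (t1.and t2)).exists

/-- The sample size is large compared with all the constants of the problem. -/
structure IsLargeFor (q M C p₀ ε : ℝ) (K n : ℕ) : Prop where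
  pos : 0 < n
  log_pos : 0 < Real.log n
  large : IsLarge q M K n
  speed_le : C + 10 ≤ Real.log n / 10
  q_le : q ≤ n
  twelve_le : (12 : ℝ) ≤ n
  decay_le : 4 * (q + K * Real.log n) ≤ n
  label_le : 8 * Real.log n ^ 2 ≤ p₀ * n
  inv_le : 1 / (n : ℝ) ≤ ε

open Filter in
lemma eventually_isLargeFor (q M C p₀ ε : ℝ) (K : ℕ) (hM : 10 ≤ M) (hp₀ : 0 < p₀) (hε : 0 < ε) :
    ∀ᶠ n : ℕ in atTop, IsLargeFor q M C p₀ ε K n := by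
  have t0 : Tendsto (fun n : ℕ => (n : ℝ)) atTop atTop := tendsto_natCast_atTop_atTop
  have t1 : Tendsto (fun n : ℕ => Real.log n) atTop atTop := Real.tendsto_log_atTop.comp t0
  filter_upwards [eventually_gt_atTop 0, t1.eventually_ge_atTop 1, eventually_isLarge q M K hM,
    t1.eventually_ge_atTop (10 * (C + 10)), t0.eventually_ge_atTop q, t0.eventually_ge_atTop 12,
    eventually_log_sq_le one_pos (4 * K) (4 * q), eventually_log_sq_le hp₀ 8 0,
    t0.eventually_ge_atTop (1 / ε)] with n h1 h2 h3 h4 h5 h6 h7 h8 h9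
  refine ⟨h1, by linarith, h3, by linarith, h5, h6, ?_, by linarith, ?_⟩
  · have h10 : K * Real.log n ≤ K * Real.log n ^ 2 :=
      mul_le_mul_of_nonneg_left (le_self_pow₀ h2 two_ne_zero) (Nat.cast_nonneg K)
    linarith
  · rw [div_le_iff₀ hε] at h9
    rw [div_le_iff₀ (by linarith)]
    linarith

variable {P : Params} {q M C p₀ c ε η : ℝ} {κ K n : ℕ}

lemma LogParams.sparsity_lt (h : LogParams P q M κ K n) (hL : IsLarge q M K n) (hq : 3 ≤ q)
    (hκ : 300 ≤ κ) : P.s < P.d := by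
  obtain ⟨hn, hl, hd, hs, hm, hσp, hα, hσ₀, hlam, d1, d2, m1, m2, s1, s2, -⟩ := h
  obtain ⟨M1, M2, L1⟩ := hL
  have hκ' : (300 : ℝ) ≤ κ := by exact_mod_cast hκ
  have hκy : 300 * Real.log n ≤ κ * Real.log n := mul_le_mul_of_nonneg_right hκ' hl.le
  have hx : 0 ≤ Real.log (Real.log n) := by linarith
  have hKq : 0 ≤ (q - 3) * ((K + 1) * Real.log (Real.log n)) :=
    mul_nonneg (by linarith) (by positivity)
  have hKx : 0 ≤ K * Real.log (Real.log n) := mul_nonneg (Nat.cast_nonneg K) hx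
  have : (P.s : ℝ) < P.d := by
    refine lt_of_log_lt (by positivity) (by positivity) ?_
    linarith
  exact_mod_cast this

/-- The two conclusions about the output of the algorithms, for a typical training set. -/
lemma Params.Admissible.gdNumerics (h : P.Admissible q κ K c p₀ n) (hc : 1 ≤ c)
    (hcM : Real.log c ≤ M) (hL : IsLargeFor q M C p₀ ε K n) (hq : 3 ≤ q) (hκ : 100 * q ≤ κ)
    (hqM : Real.log q ≤ M) {T A b b' : ℕ} (hη : 0 < η)
    (hb : 2 * q * (K + A + 2) + q * K + A + 20 * K + 30 ≤ b) (h1 : IsPoly b b' n (1 / η))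
    (h2 : IsPoly (20 * K + 20) A n (T * η)) :
    GDNumerics q P.α P.lam η n P.m P.d P.s T (Real.log n * P.σp) (P.s * (P.σp / 100))
      (Real.log n * P.σ₀) (Real.log n * (P.σ₀ * √(P.s * (Real.log n * P.σp) ^ 2))) (P.σ₀ / 2)
      ((n : ℝ) ^ (-2 : ℝ)) n ((n : ℝ) ^ ((K : ℝ) + A + 2)) (3 * (P.s * (Real.log n * P.σp)))
      (P.s * P.σp ^ 2 / 10000) (2 * (P.m * P.d) * √(1 / (T * η))) := by
  have hκ' : 300 ≤ κ := by
    have : (300 : ℝ) ≤ κ := by linarith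
    exact_mod_cast this
  have lp := h.logParams hL.pos hL.log_pos (by linarith) hcM
  have sc := lp.scales (C := 0) hL.large hq hκ hqM le_rfl
    (by rw [mul_zero, add_zero, Real.log_one]; linarith [hL.large.M_ge])
  have hz := sc.horizon hη hb (by push_cast; exact le_rfl) h1 h2
  have h3 := lp.σ₀_pos
  have h4 := hL.log_pos
  exact sc.gdNumerics hz (by positivity) (lp.start hL.large hκ' hq) fun Y hY =>
    exp_rpow_lt_of_ge hq lp.lam_pos hL.twelve_le hL.q_le
      (by linarith [lp.lam_ge, hL.decay_le]) hY

/-- Features are overtaken after about `σ₀ / η` steps, by which time a response has grown to the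
order of `σ₀ E₁`. The initial phase is longer by the factor `4 log n`, long enough to bring every
weight of initial size up to `log n * σ₀` down. -/
lemma Params.Admissible.signNumerics (h : P.Admissible q κ K c p₀ n) (hc : 1 ≤ c)
    (hcM : Real.log c ≤ M) (hL : IsLargeFor q M C p₀ ε K n) (hq : 3 ≤ q) (hκ : 100 * q ≤ κ)
    (hqM : Real.log q ≤ M) {H : ℕ} {thr : ℝ} (hH1 : 1 ≤ H) (hH : Real.log H ≤ M) (hC : 0 < C)
    (hC1 : Real.log (1 + C) ≤ M) (hC5 : Real.log (1 + 5 * C) ≤ M) (hthr : 0 < thr)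
    (hthr1 : Real.log thr ≤ M) {T A b b' : ℕ} (hη : 0 < η)
    (hb : 2 * q * (K + A + 2) + q * K + A + 20 * K + 30 ≤ b) (h1 : IsPoly b b' n (1 / η))
    (h2 : IsPoly (20 * K + 20) A n (T * η)) :
    ∃ R, 0 < lipBound q P.lam P.m R (3 * (P.s * (Real.log n * P.σp))) ∧
      SignNumerics q P.α P.lam η n P.m P.d P.s T H ⌈4 * (Real.log n * P.σ₀) / η⌉₊
        ⌈P.σ₀ / η⌉₊ (Real.log n * P.σp) (P.s * (P.σp / 100)) (Real.log n * P.σ₀)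
        (Real.log n * P.σ₀ * (1 + 5 * C)) (P.σ₀ * √(P.s * P.σp ^ 2 / 10000) / 2)
        (P.σ₀ * √(P.s * P.σp ^ 2 / 10000) / 2) (P.lam * (Real.log n * P.σ₀ * (1 + 5 * C)))
        (thr * (lipBound q P.lam P.m R (3 * (P.s * (Real.log n * P.σp))) * (C * η)) / P.lam)
        (P.lam / (2 * q)) n R (3 * (P.s * (Real.log n * P.σp))) (P.s * P.σp ^ 2 / 10000)
        (thr * (lipBound q P.lam P.m R (3 * (P.s * (Real.log n * P.σp))) * (C * η))) C := by
  have hκ' : 300 ≤ κ := by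
    have : (300 : ℝ) ≤ κ := by linarith
    exact_mod_cast this
  have lp := h.logParams hL.pos hL.log_pos (by linarith) hcM
  have sc := lp.scales (C := C) hL.large hq hκ hqM hC.le hC5
  have hz := sc.horizon hη hb (by push_cast; exact le_rfl) h1 h2
  have hσ := lp.σ₀_pos
  have hl := hL.log_pos
  have hn := hL.pos
  obtain ⟨M1, M2, L1⟩ := hL.large
  set x := Real.log (Real.log n) with hx
  have hx0 : 0 ≤ x := by linarith
  have hKx : 0 ≤ K * x := mul_nonneg (Nat.cast_nonneg K) hx0
  have hMv : M ≤ 20 * ((K + 1) * x) := by linarith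
  have hv := sc.v_ge
  have hKq : 0 ≤ (q - 3) * ((K + 1) * x) := mul_nonneg (by linarith) (by positivity)
  have hηl : Real.log η ≤ -((A + 20 * K + 20) * Real.log n) := by
    have := hz.lip_le
    linarith [Real.log_nonneg hz.lip_one]
  have hAn : 0 ≤ A * Real.log n := by positivity
  have hKn : 0 ≤ K * Real.log n := by positivity
  have n2 := log_le_ten (z := 2) (by norm_num) (by norm_num)
  have n5 := log_le_ten (z := 5) (by norm_num) (by norm_num)
  have hHσ : (H + 1) * η ≤ P.σ₀ := by
    have hH' : (1 : ℝ) ≤ H := by exact_mod_cast hH1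
    refine (mul_le_mul_of_nonneg_right (by linarith : (H : ℝ) + 1 ≤ 2 * H) hη.le).trans
      (le_of_log_le (by positivity) (by positivity) ?_)
    simp (disch := positivity) only [Real.log_mul]
    linarith [lp.σ₀_ge, lp.dim_le]
  have hTσ : 5 * (Real.log n * P.σ₀) ≤ T * η := by
    have hT := hz.T_pos
    refine le_of_log_le (by positivity) (by positivity) ?_
    simp (disch := positivity) only [Real.log_mul]
    linarith [lp.σ₀_le, lp.dim_ge, hz.ge, sc.dim_ge, mul_pos (by linarith : 0 < q) hl]
  obtain ⟨g1, g2, g3, g4, g5, g6⟩ := adam_schedule hη hσ hC.le hL.speed_le hHσ hTσ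
  refine ⟨_, zero_lt_one.trans_le hz.lip_one, sc.signNumerics hz hH1 (hH.trans hMv) hC (hC1.trans hMv) hthr
    (hthr1.trans hMv) rfl rfl ?_ g5 ?_ g1 g2 g3 g4 fun Y hY => exp_rpow_lt_of_ge hq lp.lam_pos
      hL.twelve_le hL.q_le (by linarith [lp.lam_ge, hL.decay_le]) hY⟩
  · have : 0 ≤ Real.log (1 + 5 * C) := Real.log_nonneg (by linarith)
    rw [Real.log_mul (by positivity) (by positivity), Real.log_mul (by positivity) (by positivity)]
    linarith [lp.σ₀_ge]
  · have := Real.log_le_log hσ g6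
    rw [Real.log_mul (by positivity) (by positivity)] at this
    linarith [lp.σ₀_ge]

end AdamGD

theorem theorem1 (q : ℝ) (hq : 3 ≤ q) :
    ∃ κ : ℕ, ∀ (K : ℕ) (c p₀ β₁ β₂ : ℝ), 1 ≤ c → 0 < p₀ → 0 ≤ β₁ → β₁ < 1 → β₁ ^ 2 < β₂ → β₂ < 1 →
    ∃ a₀ : ℕ, ∀ A : ℕ, ∃ b₀ : ℕ, ∀ B : ℕ, ∀ ε : ℝ, 0 < ε →
    ∃ N : ℕ, ∀ n : ℕ, N ≤ n → ∀ P : Params, P.Admissible q κ K c p₀ n →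
    ∀ (T : ℕ) (η : ℝ), 0 < η → IsPoly b₀ B n (1 / η) → IsPoly a₀ A n (T * η) →
      1 - 1 / (n : ℝ) ≤ (P.trainLaw n).real {ω |
        let L : Weights P.m P.d → ℝ := loss q P.lam ω.1
        let W : ℕ → Weights P.m P.d := adamIter L β₁ β₂ η (WithLp.toLp 2 ω.2)
        ∀ t, IsBestIter T (fun t => norm1 (gradient L (W t))) t →
          norm1 (gradient L (W t)) ≤ 1 / (T * η) ∧
          trainError q ω.1 (W t) = 0 ∧
          1 / 2 - ε ≤ testError q P.law (W t)} ∧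
      1 - 1 / (n : ℝ) ≤ (P.trainLaw n).real {ω |
        let L : Weights P.m P.d → ℝ := loss q P.lam ω.1
        let W : ℕ → Weights P.m P.d := gdIter L η (WithLp.toLp 2 ω.2)
        ∀ t, IsBestIter T (fun t => ‖gradient L (W t)‖) t →
          ‖gradient L (W t)‖ ^ 2 ≤ 1 / (T * η) ∧
          trainError q ω.1 (W t) = 0 ∧
          testError q P.law (W t) ≤ ε} := by
  -- Degree `100 q` makes the dimension dominate the powers of `n` that occur. The horizon exponent
  -- puts `1 / (T η)` below every polynomially small quantity of the problem, and the step exponent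
  -- beats the Lipschitz constant of the gradient on the box.
  refine ⟨⌈100 * q⌉₊, fun K c p₀ β₁ β₂ hc hp₀ h0 hβ₁ h12 hβ₂ => ⟨20 * K + 20, fun A =>
    ⟨⌈2 * q * (K + A + 2) + q * K + A + 20 * K + 30⌉₊, fun B ε hε => ?_⟩⟩⟩
  have hβ₂0 : 0 ≤ β₂ := (sq_nonneg β₁).trans h12.le
  obtain ⟨H, hH, hH1, hH2⟩ := exists_pow_le_hundredth h0 hβ₁ hβ₂0 hβ₂
  set C := adamSpeed β₁ β₂ with hCdef
  have hC : 0 < C := adamSpeed_pos h12 hβ₂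
  have hthr := adamThr_pos hβ₁ hβ₂
  -- One number dominates the logarithms of all fixed constants, so the sample size only has to be
  -- large compared with it.
  obtain ⟨M, M0, M1, M2, M3, M4, M5, M6⟩ : ∃ M : ℝ, 10 ≤ M ∧ Real.log c ≤ M ∧ Real.log q ≤ M ∧
      Real.log H ≤ M ∧ Real.log (1 + C) ≤ M ∧ Real.log (1 + 5 * C) ≤ M ∧
      Real.log (adamThr β₁ β₂) ≤ M := by
    obtain ⟨M, hM⟩ := (Set.finite_range ![10, Real.log c, Real.log q, Real.log H,
      Real.log (1 + C), Real.log (1 + 5 * C), Real.log (adamThr β₁ β₂)]).bddAbove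
    exact ⟨M, hM ⟨0, rfl⟩, hM ⟨1, rfl⟩, hM ⟨2, rfl⟩, hM ⟨3, rfl⟩, hM ⟨4, rfl⟩, hM ⟨5, rfl⟩,
      hM ⟨6, rfl⟩⟩
  obtain ⟨N, hN⟩ := Filter.eventually_atTop.1
    (eventually_isLargeFor q M C p₀ (min ε (1 / 2)) K M0 hp₀ (lt_min hε one_half_pos))
  refine ⟨N, fun n hn P hP T η hη hb ha => ?_⟩
  have hL := hN n hn
  have hκ : 100 * q ≤ (⌈100 * q⌉₊ : ℕ) := Nat.le_ceil _
  have hκ' : 300 ≤ ⌈100 * q⌉₊ := by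
    have : (300 : ℝ) ≤ ⌈100 * q⌉₊ := by linarith
    exact_mod_cast this
  have lp := hP.logParams hL.pos hL.log_pos (by linarith) M1
  have hprob := hP.prob
  have hsd := lp.sparsity_lt hL.large hq hκ'
  have hfresh := lp.freshBound_le hL.large hκ' hq
  have hp1 : p₀ ≤ 1 := (hP.labels 1).trans measureReal_le_one
  have hm2 : Real.log n ^ 2 ≤ P.m := by
    refine le_trans (pow_le_pow_right₀ ?_ (by omega)) hP.width.1
    linarith [hL.speed_le]
  have hfail := lp.failBound_le hL.large hκ' hq hp1 hL.label_le hm2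
  have hgd := hP.gdNumerics hc M1 hL hq hκ M2 hη (Nat.le_ceil _) hb ha
  obtain ⟨R, hlip, hsign⟩ := hP.signNumerics hc M1 hL hq hκ M2 hH M3 hC M4 M5 hthr M6 hη
    (Nat.le_ceil _) hb ha
  have hε' := hL.inv_le
  have key : ∀ S : Set ((Fin n → DataPoint P.d) × (Idx P.m P.d → ℝ)), _ → 1 - 1 / (n : ℝ) ≤
      (P.trainLaw n).real S := fun S hS => (sub_le_sub_left hfail 1).trans
    (trainLaw_real_ge (k₀ := ⟨0, lp.d_pos⟩) hsd lp.s_pos lp.σp_pos lp.σ₀_pos hP.labels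
      hL.log_pos.le _ rfl hgd.Nm_pos hgd.Nm_le le_rfl le_rfl le_rfl hS)
  refine ⟨key _ fun S e w hg => ?_, key _ fun S e w hg => ?_⟩
  · simp only [Set.mem_ofPred_eq]
    intro t ht
    obtain ⟨r1, r2, r3⟩ := hg.adam_result hβ₁ h0 h12 hβ₂ hH1 hH2 hlip hsign ht
    refine ⟨r1, r2, ?_⟩
    have := hg.testError_ge hsd lp.σp_pos.le hL.log_pos.le r3 ⟨0, hL.pos⟩
    -- The test error of Adam is in fact at least `1 - 1 / n`; the sample size was chosen so that `1
    -- / n ≤ 1/2`.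
    linarith [min_le_right ε (1 / 2)]
  · simp only [Set.mem_ofPred_eq]
    intro t ht
    obtain ⟨r1, r2, r3⟩ := hg.gd_result hgd ht
    exact ⟨r1, r2, (hg.testError_le hsd lp.σp_pos.le hL.log_pos.le r3 ⟨0, hL.pos⟩).trans
      (hfresh.trans (hε'.trans (min_le_left _ _)))⟩
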